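/- **Setting.** Let $T,h_0\in(0,\infty)$, $H_T=[0,T]\times\mathbb R^d$, and let $\Lambda_1\subset\mathbb R^d\setminus\{0\}$ be finite. For $\lambda\in\Lambda_1$ let $q_\lambda\ge0$, $p_\lambda$, $c$, $f$ be real Borel functions of $(t,x)\in H_T$, and $g$ a real Borel function on $\mathbb R^d$. With $\delta_{h,\lambda}\varphi(x)=h^{-1}(\varphi(x+h\lambda)-\varphi(x))$ put $$L_h^0\varphi=\frac1h\sum_{\lambda\in\Lambda_1}q_\lambda\delta_{h,\lambda}\varphi+\sum_{\lambda\in\Lambda_1}p_\lambda\delta_{h,\lambda}\varphi,\qquad L_h\varphi=L_h^0\varphi-c\varphi ,$$ and for $h\in(0,h_0]$ let $u_h$ be the bounded solution (it exists and is unique under the assumptions below) of $$u(t,x)=g(x)+\int_0^t\big(L_hu(s,x)+f(s,x)\big)\,ds,\qquad (t,x)\in H_T. $$ Write $|D^k\varphi|^2=\sum_{|\alpha|=k}|D^\alpha\varphi|^2$ for derivatives in $x$, and $D_h^k$ for the $k$-th derivative in $h$ (one-sided at $h=h_0$). Let $\mathfrak B^m$ be the set of bounded Borel functions $\psi$ on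 $H_T$, continuous in $x$ for each $t$, whose generalized derivatives $D^\alpha\psi$ in $x$, $|\alpha|\le m$, are bounded on $H_T$, and set $\|\psi\|_m^2=\sup_{H_T}\sum_{|\alpha|\le m}|D^\alpha\psi|^2$ (essential supremum in $x$); the same notation is used for functions independent of $t$. Fix $\tau_\lambda\ge0$ ($\lambda\in\Lambda_1$), $\tau_0>0$, $\delta\in(0,1]$, $K\ge1$, $c_0>0$, an integer $m\ge0$ and constants $M_0,\dots,M_m$. Put $|\Lambda_1|^2=\sum_{\lambda\in\Lambda_1}|\lambda|^2$ and $\|\Lambda_1\|^2=\sum_{\lambda\in\Lambda_1}|\tau_\lambda\lambda|^2$. Let $\Lambda_2=\{\ell^1,\dots,\ell^d\}$ be a set of $d$ distinct labels not in $\Lambda_1$, and $\Lambda=\Lambda_1\cup\Lambda_2$. Put $T_{h,\lambda}\varphi(x)=\varphi(x+h\lambda)$ and $\bar\delta_{h,\lambda}=\tau_\lambda\delta_{h,\lambda}$ for $\lambda\in\Lambda_1$, $T_{h,\ell^i}=1$ and $\bar\delta_{h,\ell^i}=\tau_0D_i$; for $\lambda=(\lambda^1,\lambda^2)\in\Lambda^2$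 put $T_{h,\lambda}=T_{h,\lambda^1}T_{h,\lambda^2}$, $\bar\delta_{h,\lambda}=\bar\delta_{h,\lambda^1}\bar\delta_{h,\lambda^2}$. Further, for $\mu\in\Lambda\cup\Lambda^2$, let $$Q_{h,\mu}\varphi=\frac1h\sum_{\nu\in\Lambda_1}(\bar\delta_{h,\mu}q_\nu)\delta_{h,\nu}\varphi,\qquad L^0_{h,\mu}\varphi=Q_{h,\mu}\varphi+\sum_{\nu\in\Lambda_1}(\bar\delta_{h,\mu}p_\nu)\delta_{h,\nu}\varphi,$$ $$A_h(\varphi)=2\sum_{\lambda\in\Lambda}(\bar\delta_{h,\lambda}\varphi)\,L^0_{h,\lambda}T_{h,\lambda}\varphi,\qquad \mathcal Q_h(\varphi)=\sum_{\lambda\in\Lambda_1}\chi_{h,\lambda}(\delta_{h,\lambda}\varphi)^2,\qquad \chi_{h,\lambda}=q_\lambda+hp_\lambda .$$ Let $\mathfrak K$ be the set of linear operators $\mathcal K=\mathcal K(t)$ on the space of bounded Borel functions on $\mathbb R^d$ that preserve the cone of nonnegative functions and satisfy $\mathcal K1\le1$. **Assumptions.** 1. $p_\lambda,q_\lambda,c,f,g\in\mathfrak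 B^m$ for $\lambda\in\Lambda_1$, and $\sup_{H_T}\big(\sum_{\lambda\in\Lambda_1}(|D^kq_\lambda|^2+|D^kp_\lambda|^2)+|D^kc|^2\big)\le M_k^2$ for $k=0,\dots,m$. 2. $\chi_{h,\lambda}\ge0$ on $H_T$ for all $h\in(0,h_0]$, $\lambda\in\Lambda_1$. 3. $\sum_{\lambda\in\Lambda_1}\lambda q_\lambda=0$ on $H_T$. 4. $c\ge c_0$ on $H_T$. 5. $m\ge1$, and for every $h\in(0,h_0]$ there is $\mathcal K_h\in\mathfrak K$ such that, on $H_T$ and for all smooth $\varphi$ bounded together with all their derivatives, $$mA_h(\varphi)\le(1-\delta)\sum_{\lambda\in\Lambda}\mathcal Q_h(\bar\delta_{h,\lambda}\varphi)+K\mathcal Q_h(\varphi)+2(1-\delta)c\,\mathcal K_h\Big(\sum_{\lambda\in\Lambda}|\bar\delta_{h,\lambda}\varphi|^2\Big).$$ 6. $m\ge2$, and for every $h\in(0,h_0]$ and $n=1,\dots,m$ there is $\mathcal K_h=\mathcal K_{h,n}\in\mathfrak K$ such that, on $H_T$ and for all such $\varphi$, $$n\sum_{\nu\in\Lambda}A_h(\bar\delta_{h,\nu}\varphi)+n(n-1)\sum_{\lambda\in\Lambda^2}(\bar\delta_{h,\lambda}\varphi)Q_{h,\lambda}T_{h,\lambda}\varphi\le(1-\delta)\sum_{\lambda\in\Lambda^2}\mathcal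 Q_h(\bar\delta_{h,\lambda}\varphi)+K\sum_{\lambda\in\Lambda}\mathcal Q_h(\bar\delta_{h,\lambda}\varphi)$$ $$+\,2(1-\delta)c\,\mathcal K_h\Big(\sum_{\lambda\in\Lambda^2}|\bar\delta_{h,\lambda}\varphi|^2\Big)+K\mathcal K_h\Big(\sum_{\lambda\in\Lambda}|\bar\delta_{h,\lambda}\varphi|^2\Big).$$ **Theorem.** Let $k\ge1$ be odd, and let assumptions 1–6 hold with $m\ge3k+1$. Suppose that $\Lambda_1=-\Lambda_1$, $q_{-\lambda}=q_\lambda$ and $p_{-\lambda}=-p_\lambda$ on $H_T$ for all $\lambda\in\Lambda_1$. Then for every integer $r\ge0$ with $3k+r\le m-1$ the derivatives $D^rD_h^ku_h$ exist on $(0,h_0]\times H_T$, and $$\sup_{H_T}|D^rD_h^ku_h|\le N(\|f\|_m+\|g\|_m)\,h\qquad\text{for all }h\in(0,h_0],$$ where $N$ depends only on $m,\delta,c_0,\tau_0,K,|\Lambda_1|,\|\Lambda_1\|,M_0,\dots,M_m$. -/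

import Mathlib

open Set MeasureTheory
open scoped ContDiff

noncomputable section

namespace FDScheme

/-- The Euclidean space `ℝ^d`. -/
abbrev E (d : ℕ) := EuclideanSpace ℝ (Fin d)

/-! ## Derivatives in the space variable -/

/-- The classical partial derivative `D_i φ`. -/
def pderiv {d : ℕ} (i : Fin d) (φ : E d → ℝ) : E d → ℝ :=
  fun x => fderiv ℝ φ x (EuclideanSpace.single i 1)

/-- The classical derivative `D^α φ = D_1^{α_1} ⋯ D_d^{α_d} φ` for a multi-index `α`. -/
def mderiv {d : ℕ} (α : Fin d → ℕ) (φ : E d → ℝ) : E d → ℝ :=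
  (List.finRange d).foldr (fun i ψ => (pderiv i)^[α i] ψ) φ

/-- The multi-indices `α` with `|α| = k`. -/
def multiIndices (d k : ℕ) : Finset (Fin d → ℕ) := Finset.piAntidiag Finset.univ k

/-- `|D^k φ(x)|`, where `|D^k φ|² = ∑_{|α| = k} |D^α φ|²`, for `k` times differentiable `φ`. -/
def absD {d : ℕ} (k : ℕ) (φ : E d → ℝ) (x : E d) : ℝ :=
  Real.sqrt (∑ α ∈ multiIndices d k, (mderiv α φ x) ^ 2)

/-- `w` is the generalized derivative `D^α ψ` (in the sense of distributions). -/
def HasWeakDeriv {d : ℕ} (α : Fin d → ℕ) (ψ w : E d → ℝ) : Prop :=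
  LocallyIntegrable ψ volume ∧ LocallyIntegrable w volume ∧
    ∀ φ : E d → ℝ, ContDiff ℝ ∞ φ → HasCompactSupport φ →
      ∫ x, ψ x * mderiv α φ x = (-1 : ℝ) ^ (∑ i, α i) * ∫ x, w x * φ x

open Classical in
/-- A representative of the generalized derivative `D^α ψ`, unique up to a null set whenever it
exists as a locally integrable function. -/
def weakDeriv {d : ℕ} (α : Fin d → ℕ) (ψ : E d → ℝ) : E d → ℝ :=
  if h : ∃ w, HasWeakDeriv α ψ w then h.choose else 0

/-- `|D^k ψ|² = ∑_{|α| = k} |D^α ψ|²` with generalized derivatives (defined almost everywhere). -/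
def weakSq {d : ℕ} (k : ℕ) (ψ : E d → ℝ) (x : E d) : ℝ :=
  ∑ α ∈ multiIndices d k, (weakDeriv α ψ x) ^ 2

/-- The space `𝔅^m` of bounded Borel functions on `H_T = [0,T] × ℝ^d` which are continuous
in `x` and whose generalized derivatives in `x` up to order `m` are bounded on `H_T`. -/
structure MemB {d : ℕ} (m : ℕ) (T : ℝ) (ψ : ℝ → E d → ℝ) : Prop where
  measurable : Measurable (fun z : Icc (0 : ℝ) T × E d => ψ z.1 z.2)
  bounded : ∃ C : ℝ, ∀ t ∈ Icc 0 T, ∀ x, |ψ t x| ≤ C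
  continuous : ∀ t ∈ Icc 0 T, Continuous (ψ t)
  deriv_bounded : ∃ C : ℝ, ∀ t ∈ Icc 0 T, ∀ α : Fin d → ℕ, ∑ i, α i ≤ m →
    ∃ w, HasWeakDeriv α (ψ t) w ∧ ∀ᵐ x, |w x| ≤ C

/-- The norm `‖ψ‖_m`, where `‖ψ‖_m² = sup_{H_T} ∑_{|α| ≤ m} |D^α ψ|²`. Generalized derivatives
are functions of `x` up to null sets, so the supremum in `x` is the essential one. It is finite
for `ψ ∈ 𝔅^m`. -/
def normB {d : ℕ} (m : ℕ) (T : ℝ) (ψ : ℝ → E d → ℝ) : ℝ :=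
  Real.sqrt (⨆ t ∈ Icc (0 : ℝ) T,
    essSup (fun x => ENNReal.ofReal (∑ k ∈ Finset.range (m + 1), weakSq k (ψ t) x)) volume).toReal

/-! ## The finite difference equation -/

/-- The data of the scheme: the bound `h₀` for the mesh-sizes, the time horizon `T`, the finite
stencil `Λ₁`, the weights `τ_λ`, the coefficients `q_λ(t,x)`, `p_λ(t,x)`, `c(t,x)`, the free
term `f(t,x)` and the initial value `g(x)`. Only the values of `τ`, `q`, `p` at `λ ∈ Λ₁` and of
the functions of `t` at `t ∈ [0,T]` are relevant. -/
structure Scheme (d : ℕ) where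
  h₀ : ℝ
  T : ℝ
  Λ₁ : Finset (E d)
  τ : E d → ℝ
  q : E d → ℝ → E d → ℝ
  p : E d → ℝ → E d → ℝ
  c : ℝ → E d → ℝ
  f : ℝ → E d → ℝ
  g : E d → ℝ
  h₀_pos : 0 < h₀
  T_pos : 0 < T
  zero_notMem : (0 : E d) ∉ Λ₁
  τ_nonneg : ∀ l ∈ Λ₁, 0 ≤ τ l
  q_nonneg : ∀ l ∈ Λ₁, ∀ t ∈ Icc 0 T, ∀ x, 0 ≤ q l t x

/-- `δ_{h,λ} φ(x) = h⁻¹ (φ(x + hλ) - φ(x))`. -/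
def fd {d : ℕ} (h : ℝ) (l : E d) (φ : E d → ℝ) (x : E d) : ℝ :=
  h⁻¹ * (φ (x + h • l) - φ x)

/-- `h⁻¹ ∑_{λ ∈ Λ₁} a_λ(x) δ_{h,λ} φ(x)`. -/
def opQ {d : ℕ} (Λ₁ : Finset (E d)) (h : ℝ) (a : E d → E d → ℝ) (φ : E d → ℝ) (x : E d) : ℝ :=
  h⁻¹ * ∑ l ∈ Λ₁, a l x * fd h l φ x

/-- `h⁻¹ ∑_{λ ∈ Λ₁} a_λ(x) δ_{h,λ} φ(x) + ∑_{λ ∈ Λ₁} b_λ(x) δ_{h,λ} φ(x)`. -/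
def opL {d : ℕ} (Λ₁ : Finset (E d)) (h : ℝ) (a b : E d → E d → ℝ) (φ : E d → ℝ) (x : E d) : ℝ :=
  opQ Λ₁ h a φ x + ∑ l ∈ Λ₁, b l x * fd h l φ x

namespace Scheme

variable {d : ℕ} (S : Scheme d)

/-- `L_h φ(t,x) = L_h^0 φ(t,x) - c(t,x) φ(x)`. -/
def L (h t : ℝ) (φ : E d → ℝ) (x : E d) : ℝ :=
  opL S.Λ₁ h (fun l => S.q l t) (fun l => S.p l t) φ x - S.c t x * φ x

/-- `u` is a bounded solution on `H_T` of
`u(t,x) = g(x) + ∫_0^t (L_h u(s,x) + f(s,x)) ds`. -/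
structure IsBoundedSolution (h : ℝ) (u : ℝ → E d → ℝ) : Prop where
  bounded : ∃ C : ℝ, ∀ t ∈ Icc 0 S.T, ∀ x, |u t x| ≤ C
  integrable : ∀ t ∈ Icc 0 S.T, ∀ x,
    IntervalIntegrable (fun s => S.L h s (u s) x + S.f s x) volume 0 t
  equation : ∀ t ∈ Icc 0 S.T, ∀ x,
    u t x = S.g x + ∫ s in (0 : ℝ)..t, (S.L h s (u s) x + S.f s x)

/-- `|Λ₁|`, where `|Λ₁|² = ∑_{λ ∈ Λ₁} |λ|²`. -/
def size : ℝ := Real.sqrt (∑ l ∈ S.Λ₁, ‖l‖ ^ 2)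

/-- `‖Λ₁‖`, where `‖Λ₁‖² = ∑_{λ ∈ Λ₁} |τ_λ λ|²`. -/
def weightedSize : ℝ := Real.sqrt (∑ l ∈ S.Λ₁, ‖S.τ l • l‖ ^ 2)

/-- `χ_{h,λ} = q_λ + h p_λ`. -/
def χ (h : ℝ) (l : E d) (t : ℝ) (x : E d) : ℝ := S.q l t x + h * S.p l t x

/-! ## The extended index set `Λ = Λ₁ ∪ Λ₂`

The vectors `ℓ^1, …, ℓ^d` of `Λ₂` only label the coordinate derivatives; they are represented by
the right summand of `E d ⊕ Fin d`. -/

/-- The index set `Λ = Λ₁ ∪ Λ₂`. -/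
def Λ : Finset (E d ⊕ Fin d) := S.Λ₁.disjSum Finset.univ

/-- `T_{h,λ} φ(x) = φ(x + hλ)` for `λ ∈ Λ₁`, and the identity for `λ ∈ Λ₂`. -/
def shift (h : ℝ) : E d ⊕ Fin d → (E d → ℝ) → E d → ℝ
  | .inl l, φ => fun x => φ (x + h • l)
  | .inr _, φ => φ

/-- `\bar δ_{h,λ} = τ_λ h⁻¹ (T_{h,λ} - 1)` for `λ ∈ Λ₁`, and `\bar δ_{h,ℓ^i} = τ₀ D_i`. -/
def dbar (τ₀ h : ℝ) : E d ⊕ Fin d → (E d → ℝ) → E d → ℝ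
  | .inl l, φ => fun x => S.τ l * fd h l φ x
  | .inr i, φ => fun x => τ₀ * pderiv i φ x

/-- `A_h(φ) = 2 ∑_{λ ∈ Λ} (\bar δ_{h,λ} φ) L^0_{h,λ} T_{h,λ} φ`, where `L^0_{h,λ}` is `L^0_h` with
the coefficients `\bar δ_{h,λ} q_ν`, `\bar δ_{h,λ} p_ν` in place of `q_ν`, `p_ν`. -/
def A (τ₀ h t : ℝ) (φ : E d → ℝ) (x : E d) : ℝ :=
  2 * ∑ μ ∈ S.Λ, S.dbar τ₀ h μ φ x *
    opL S.Λ₁ h (fun l => S.dbar τ₀ h μ (S.q l t)) (fun l => S.dbar τ₀ h μ (S.p l t))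
      (shift h μ φ) x

/-- The quadratic form `𝒬_h(φ) = ∑_{λ ∈ Λ₁} χ_{h,λ} (δ_{h,λ} φ)²`. -/
def quad (h t : ℝ) (φ : E d → ℝ) (x : E d) : ℝ :=
  ∑ l ∈ S.Λ₁, S.χ h l t x * (fd h l φ x) ^ 2

/-- `∑_{λ ∈ Λ} |\bar δ_{h,λ} φ|²`. -/
def sq₁ (τ₀ h : ℝ) (φ : E d → ℝ) (x : E d) : ℝ :=
  ∑ μ ∈ S.Λ, (S.dbar τ₀ h μ φ x) ^ 2

/-- `∑_{λ ∈ Λ²} |\bar δ_{h,λ} φ|²`, where `\bar δ_{h,λ} = \bar δ_{h,λ¹} \bar δ_{h,λ²}`. -/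
def sq₂ (τ₀ h : ℝ) (φ : E d → ℝ) (x : E d) : ℝ :=
  ∑ μ ∈ S.Λ, ∑ ν ∈ S.Λ, (S.dbar τ₀ h μ (S.dbar τ₀ h ν φ) x) ^ 2

end Scheme

/-- Bounded Borel functions on `ℝ^d`. -/
def IsBoundedBorel {d : ℕ} (φ : E d → ℝ) : Prop :=
  Measurable φ ∧ ∃ C : ℝ, ∀ x, |φ x| ≤ C

/-- The class `𝔎` of linear operators on the space of bounded Borel functions that preserve
the cone of nonnegative functions and satisfy `𝒦 1 ≤ 1`. (They are bounded, with norm at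
most `1`.) The values of `𝒦` outside of the space of bounded Borel functions are irrelevant. -/
structure IsSubMarkov {d : ℕ} (𝒦 : (E d → ℝ) → E d → ℝ) : Prop where
  map : ∀ φ, IsBoundedBorel φ → IsBoundedBorel (𝒦 φ)
  add : ∀ φ ψ, IsBoundedBorel φ → IsBoundedBorel ψ → 𝒦 (φ + ψ) = 𝒦 φ + 𝒦 ψ
  smul : ∀ (a : ℝ) φ, IsBoundedBorel φ → 𝒦 (a • φ) = a • 𝒦 φ
  nonneg : ∀ φ, IsBoundedBorel φ → (∀ x, 0 ≤ φ x) → ∀ x, 0 ≤ 𝒦 φ x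
  one_le : ∀ x, 𝒦 (fun _ => 1) x ≤ 1

/-- Smooth functions on `ℝ^d` that are bounded together with all their derivatives. -/
def IsSmoothBounded {d : ℕ} (φ : E d → ℝ) : Prop :=
  ContDiff ℝ ∞ φ ∧ ∀ n : ℕ, ∃ C : ℝ, ∀ x, ‖iteratedFDeriv ℝ n φ x‖ ≤ C

namespace Scheme

variable {d : ℕ} (S : Scheme d)

/-! ## The assumptions -/

/-- The data belong to `𝔅^m`, and for `k = 0, …, m`
`sup_{H_T} (∑_{λ ∈ Λ₁} (|D^k q_λ|² + |D^k p_λ|²) + |D^k c|²) ≤ M_k²`. -/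
structure Regular (m : ℕ) (M : ℕ → ℝ) : Prop where
  q_mem : ∀ l ∈ S.Λ₁, MemB m S.T (S.q l)
  p_mem : ∀ l ∈ S.Λ₁, MemB m S.T (S.p l)
  c_mem : MemB m S.T S.c
  f_mem : MemB m S.T S.f
  g_mem : MemB m S.T (fun _ => S.g)
  bound : ∀ k ≤ m, ∀ t ∈ Icc 0 S.T, ∀ᵐ x,
    ∑ l ∈ S.Λ₁, (weakSq k (S.q l t) x + weakSq k (S.p l t) x) + weakSq k (S.c t) x ≤ M k ^ 2

/-- `χ_{h,λ} ≥ 0` on `H_T` for all `h ∈ (0,h₀]` and `λ ∈ Λ₁`. -/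
def ChiNonneg : Prop :=
  ∀ h ∈ Ioc 0 S.h₀, ∀ l ∈ S.Λ₁, ∀ t ∈ Icc 0 S.T, ∀ x, 0 ≤ S.χ h l t x

/-- `∑_{λ ∈ Λ₁} λ q_λ = 0` on `H_T`. -/
def Centered : Prop :=
  ∀ t ∈ Icc 0 S.T, ∀ x, ∑ l ∈ S.Λ₁, S.q l t x • l = 0

/-- `c ≥ c₀` on `H_T`. -/
def Killing (c₀ : ℝ) : Prop := ∀ t ∈ Icc 0 S.T, ∀ x, c₀ ≤ S.c t x

/-- For any `h ∈ (0,h₀]` there is `𝒦_h = 𝒦_h(t) ∈ 𝔎` such that on `H_T`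
`m A_h(φ) ≤ (1-δ) ∑_{λ ∈ Λ} 𝒬_h(\bar δ_{h,λ} φ) + K 𝒬_h(φ)
  + 2(1-δ) c 𝒦_h(∑_{λ ∈ Λ} |\bar δ_{h,λ} φ|²)`. -/
def FirstOrderCondition (m : ℕ) (δ τ₀ K : ℝ) : Prop :=
  1 ≤ m ∧ ∀ h ∈ Ioc 0 S.h₀, ∃ 𝒦 : ℝ → (E d → ℝ) → E d → ℝ,
    ∀ t ∈ Icc 0 S.T, IsSubMarkov (𝒦 t) ∧ ∀ φ, IsSmoothBounded φ → ∀ x,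
      m * S.A τ₀ h t φ x ≤
        (1 - δ) * ∑ μ ∈ S.Λ, S.quad h t (S.dbar τ₀ h μ φ) x
        + K * S.quad h t φ x
        + 2 * (1 - δ) * S.c t x * 𝒦 t (S.sq₁ τ₀ h φ) x

/-- For any `h ∈ (0,h₀]` and `n = 1, …, m` there is `𝒦_h = 𝒦_h(t) ∈ 𝔎` such that on `H_T`
`n ∑_{ν ∈ Λ} A_h(\bar δ_{h,ν} φ) + n(n-1) ∑_{λ ∈ Λ²} (\bar δ_{h,λ} φ) Q_{h,λ} T_{h,λ} φ
  ≤ (1-δ) ∑_{λ ∈ Λ²} 𝒬_h(\bar δ_{h,λ} φ) + K ∑_{λ ∈ Λ} 𝒬_h(\bar δ_{h,λ} φ)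
  + 2(1-δ) c 𝒦_h(∑_{λ ∈ Λ²} |\bar δ_{h,λ} φ|²) + K 𝒦_h(∑_{λ ∈ Λ} |\bar δ_{h,λ} φ|²)`,
where `Q_{h,λ} ψ = h⁻¹ ∑_{ν ∈ Λ₁} (\bar δ_{h,λ} q_ν) δ_{h,ν} ψ`. -/
def SecondOrderCondition (m : ℕ) (δ τ₀ K : ℝ) : Prop :=
  2 ≤ m ∧ ∀ h ∈ Ioc 0 S.h₀, ∀ n : ℕ, 1 ≤ n → n ≤ m → ∃ 𝒦 : ℝ → (E d → ℝ) → E d → ℝ,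
    ∀ t ∈ Icc 0 S.T, IsSubMarkov (𝒦 t) ∧ ∀ φ, IsSmoothBounded φ → ∀ x,
      n * ∑ ν ∈ S.Λ, S.A τ₀ h t (S.dbar τ₀ h ν φ) x
        + n * ((n : ℝ) - 1) * ∑ μ ∈ S.Λ, ∑ ν ∈ S.Λ,
            S.dbar τ₀ h μ (S.dbar τ₀ h ν φ) x *
              opQ S.Λ₁ h (fun l => S.dbar τ₀ h μ (S.dbar τ₀ h ν (S.q l t)))
                (shift h μ (shift h ν φ)) x ≤
        (1 - δ) * ∑ μ ∈ S.Λ, ∑ ν ∈ S.Λ, S.quad h t (S.dbar τ₀ h μ (S.dbar τ₀ h ν φ)) x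
        + K * ∑ μ ∈ S.Λ, S.quad h t (S.dbar τ₀ h μ φ) x
        + 2 * (1 - δ) * S.c t x * 𝒦 t (S.sq₂ τ₀ h φ) x
        + K * 𝒦 t (S.sq₁ τ₀ h φ) x

/-- The symmetry condition (S): `Λ₁ = -Λ₁` and `q_λ = q_{-λ}`. -/
def Symmetric : Prop :=
  (∀ l ∈ S.Λ₁, -l ∈ S.Λ₁) ∧ ∀ l ∈ S.Λ₁, ∀ t ∈ Icc 0 S.T, ∀ x, S.q (-l) t x = S.q l t x

/-- `p_{-λ} = -p_λ`. -/
def Antisymmetric : Prop :=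
  ∀ l ∈ S.Λ₁, ∀ t ∈ Icc 0 S.T, ∀ x, S.p (-l) t x = -S.p l t x

/-- `D_h^k u_h(t,x)` for `h ∈ (0,h₀]` (one-sided at `h = h₀`). -/
def Dh (k : ℕ) (u : ℝ → ℝ → E d → ℝ) (h t : ℝ) (x : E d) : ℝ :=
  iteratedDerivWithin k (fun η => u η t x) (Ioc 0 S.h₀) h

end Scheme

end FDScheme

end

/-! Because `∑ λ q_λ = 0`, the first-order Taylor term drops out of the singular part of `L_h`. The
operator then equals a sum of averages of `(1-θ) q_λ ∂_λ²φ(x+θhλ)` and `p_λ ∂_λφ(x+θhλ)` over `θ ∈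
[0,1]`, minus `cφ`, with the coefficients taken at `x` and no negative power of `h` left
(`opL_eq_segAvg`). Differentiating the equation `k` times in `h` shows that `V_k = D_h^k u_h` solves
the same equation. For `k ≥ 1` its initial value is zero, and its free term consists of averages of
`∂_λ^{k-j+2} V_j` and `∂_λ^{k-j+1} V_j` with `j < k` (`derivSystem_of_joint`). Since `k-j+2 ≤
3(k-j)`, an estimate of the solution by its data, uniform in `h`, bounds `D^r V_k` whenever `3k+r ≤
m` (`deriv_estimate`).

The factor `h` for odd `k` comes from parity. If `j` is odd, `V_j` is already `O(h)` by induction.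
If `j` is even, `k-j` is odd, so `q_λ ∂_λ^{k-j+2}` and `p_λ ∂_λ^{k-j+1}` change sign under `λ ↦ -λ`.
Their sums over the symmetric stencil vanish at `θ = 0`, and an integration by parts in `θ` leaves
`h` times an average with one more derivative (`sum_mul_segAvg_symm`). This extra derivative is the
reason for `3k+r ≤ m-1` (`sq_source_odd_le`, `deriv_estimate_odd`).

The uniform estimate (`apriori`) is Bernstein's method. One applies the words of length `n` in the
operators `\bar δ` to the equation, multiplies by the same words applied to the solution, and sums.
By the Leibniz rule, the terms still containing too many derivatives of the solution are those with
zero, one or two letters on the coefficients. Zero letters give `L_h^0` of the sum of squares minus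
a nonnegative quadratic form, minus the term with `c`; one and two letters give the expressions
controlled by assumptions 5 and 6 (`leibniz_term_le`, `energy_le`). A weighted sum over the orders
`0, …, n` makes the quadratic forms telescope, and a maximum principle based on `χ_{h,λ} ≥ 0` and `c
≥ c₀` finishes the argument (`apriori_step`).

Differentiability in `h` is obtained by treating `h` as another space variable. Translation by `hλ`
becomes the linear shear `(h,x) ↦ (h, x+hλ)`, and with `1/h` replaced by a smooth cut-off the
equation is a linear evolution equation with bounded coefficients, solved by Picard iteration
together with all derivatives (`exists_evolution_solution`).

These arguments need smooth data, so the data are mollified in `x`. The structural conditions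
survive: they are linear in the coefficients, and after replacing the operators `𝒦` by suprema they
are invariant under translation (`FirstEnergy.average`, `SecondEnergy.average`). The mollified joint
solutions converge uniformly with bounded derivatives of order `m`, so lower derivatives converge
too (`exists_evolution_limit`, `tendsto_ddList`). Uniqueness identifies the limit with the given
`u_h`. Throughout, norms are Euclidean sums over words, so that Cauchy–Schwarz produces no factor
depending on the dimension or on the number of elements of the stencil. -/

noncomputable section

namespace FDScheme

open Filter Topology

/-! ## Functions with bounded directional derivatives -/

section Calculus

variable {F G : Type*} [NormedAddCommGroup F] [NormedSpace ℝ F]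
  [NormedAddCommGroup G] [NormedSpace ℝ G]

/-- The directional derivative. -/
def dd (e : F) (φ : F → ℝ) : F → ℝ := fun z => fderiv ℝ φ z e

/-- `φ` is `N` times continuously differentiable and `φ` and its directional derivatives in at
most `N` directions of length at most one are bounded by `C`. -/
def BD : ℕ → ℝ → (F → ℝ) → Prop
  | 0, C, φ => Continuous φ ∧ ∀ x, |φ x| ≤ C
  | N + 1, C, φ => Differentiable ℝ φ ∧ (∀ x, |φ x| ≤ C) ∧ ∀ e : F, ‖e‖ ≤ 1 → BD N C (dd e φ)

theorem BD.bound {N : ℕ} {C : ℝ} {φ : F → ℝ} (h : BD N C φ) (x : F) : |φ x| ≤ C := by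
  cases N with
  | zero => exact h.2 x
  | succ N => exact h.2.1 x

theorem BD.nonneg {N : ℕ} {C : ℝ} {φ : F → ℝ} (h : BD N C φ) : 0 ≤ C :=
  (abs_nonneg _).trans (h.bound 0)

theorem BD.continuous {N : ℕ} {C : ℝ} {φ : F → ℝ} (h : BD N C φ) : Continuous φ := by
  cases N with
  | zero => exact h.1
  | succ N => exact h.1.continuous

theorem BD.mono {N : ℕ} {C C' : ℝ} {φ : F → ℝ} (h : BD N C φ) (hC : C ≤ C') : BD N C' φ := by
  induction N generalizing φ with
  | zero => exact ⟨h.1, fun x => (h.2 x).trans hC⟩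
  | succ N ih => exact ⟨h.1, fun x => (h.2.1 x).trans hC, fun e he => ih (h.2.2 e he)⟩

theorem BD.pred {N : ℕ} {C : ℝ} {φ : F → ℝ} (h : BD (N + 1) C φ) : BD N C φ := by
  induction N generalizing φ with
  | zero => exact ⟨h.1.continuous, h.2.1⟩
  | succ N ih => exact ⟨h.1, h.2.1, fun e he => ih (h.2.2 e he)⟩

theorem BD.of_le {N N' : ℕ} {C : ℝ} {φ : F → ℝ} (h : BD N C φ) (hN : N' ≤ N) : BD N' C φ := by
  induction N, hN using Nat.le_induction with
  | base => exact h
  | succ n hn ih => exact ih h.pred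

theorem dd_add {e : F} {φ ψ : F → ℝ} (hφ : Differentiable ℝ φ) (hψ : Differentiable ℝ ψ) :
    dd e (fun x => φ x + ψ x) = fun x => dd e φ x + dd e ψ x := by
  funext x
  simp only [dd]
  rw [fderiv_fun_add (hφ x) (hψ x)]; rfl

theorem dd_const_mul {e : F} {φ : F → ℝ} (a : ℝ) :
    dd e (fun x => a * φ x) = fun x => a * dd e φ x := by
  funext x
  simp only [dd]
  have h2 : (fun x => a * φ x) = a • φ := by ext; simp
  rw [h2, fderiv_const_smul_field]; simp

theorem dd_mul {e : F} {φ ψ : F → ℝ} (hφ : Differentiable ℝ φ) (hψ : Differentiable ℝ ψ) :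
    dd e (fun x => φ x * ψ x) = fun x => φ x * dd e ψ x + dd e φ x * ψ x := by
  funext x
  simp only [dd]
  rw [fderiv_fun_mul (hφ x) (hψ x)]; simp; ring

theorem dd_add_dir {e e' : F} {φ : F → ℝ} :
    dd (e + e') φ = fun x => dd e φ x + dd e' φ x := by
  funext x; simp [dd]

theorem dd_smul_dir {a : ℝ} {e : F} {φ : F → ℝ} : dd (a • e) φ = fun x => a * dd e φ x := by
  funext x; simp [dd]

theorem dd_zero_dir {φ : F → ℝ} : dd (0 : F) φ = fun _ => 0 := by
  funext x; simp [dd]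

theorem dd_sum {ι : Type*} (s : Finset ι) {e : F} {φ : ι → F → ℝ}
    (h : ∀ i ∈ s, Differentiable ℝ (φ i)) :
    dd e (fun x => ∑ i ∈ s, φ i x) = fun x => ∑ i ∈ s, dd e (φ i) x := by
  funext x
  simp only [dd]
  rw [fderiv_fun_sum (fun i hi => h i hi x)]; simp

theorem dd_const {e : F} (a : ℝ) : dd e (fun _ => a) = fun _ => 0 := by
  funext x; simp [dd]

theorem BD.const {N : ℕ} (a : ℝ) : BD N |a| (fun _ : F => a) := by
  induction N generalizing a with
  | zero => exact ⟨continuous_const, fun _ => le_rfl⟩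
  | succ N ih =>
    refine ⟨differentiable_const _, fun _ => le_rfl, fun e _ => ?_⟩
    rw [dd_const]
    exact (ih 0).mono (by simp)

theorem BD.add {N : ℕ} {C C' : ℝ} {φ ψ : F → ℝ} (h : BD N C φ) (h' : BD N C' ψ) :
    BD N (C + C') (fun x => φ x + ψ x) := by
  induction N generalizing φ ψ with
  | zero => exact ⟨h.1.add h'.1, fun x => (abs_add_le _ _).trans (add_le_add (h.2 x) (h'.2 x))⟩
  | succ N ih =>
    refine ⟨h.1.add h'.1, fun x => (abs_add_le _ _).trans (add_le_add (h.2.1 x) (h'.2.1 x)),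
      fun e he => ?_⟩
    rw [dd_add h.1 h'.1]
    exact ih (h.2.2 e he) (h'.2.2 e he)

theorem BD.const_mul {N : ℕ} {C : ℝ} {φ : F → ℝ} (h : BD N C φ) (a : ℝ) :
    BD N (|a| * C) (fun x => a * φ x) := by
  induction N generalizing φ with
  | zero =>
    refine ⟨continuous_const.mul h.1, fun x => ?_⟩
    rw [abs_mul]; exact mul_le_mul_of_nonneg_left (h.2 x) (abs_nonneg _)
  | succ N ih =>
    refine ⟨h.1.const_mul a, fun x => ?_, fun e he => ?_⟩
    · rw [abs_mul]; exact mul_le_mul_of_nonneg_left (h.2.1 x) (abs_nonneg _)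
    · rw [dd_const_mul]; exact ih (h.2.2 e he)

theorem BD.sub {N : ℕ} {C C' : ℝ} {φ ψ : F → ℝ} (h : BD N C φ) (h' : BD N C' ψ) :
    BD N (C + C') (fun x => φ x - ψ x) := by
  have := h.add (h'.const_mul (-1))
  simpa [sub_eq_add_neg] using this

theorem BD.sum {ι : Type*} {N : ℕ} (s : Finset ι) {C : ι → ℝ} {φ : ι → F → ℝ}
    (h : ∀ i ∈ s, BD N (C i) (φ i)) : BD N (∑ i ∈ s, C i) (fun x => ∑ i ∈ s, φ i x) := by
  classical
  induction s using Finset.induction_on with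
  | empty => simpa using BD.const (F := F) (N := N) 0
  | insert a s ha ih =>
    simp only [Finset.sum_insert ha]
    exact (h a (by simp)).add (ih fun i hi => h i (by simp [hi]))

theorem BD.mul {N : ℕ} {C C' : ℝ} {φ ψ : F → ℝ} (h : BD N C φ) (h' : BD N C' ψ) :
    BD N (2 ^ N * C * C') (fun x => φ x * ψ x) := by
  induction N generalizing φ ψ with
  | zero =>
    refine ⟨h.1.mul h'.1, fun x => ?_⟩
    rw [abs_mul]
    simpa using mul_le_mul (h.2 x) (h'.2 x) (abs_nonneg _) h.nonneg
  | succ N ih =>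
    have h0 := h.nonneg
    have h0' := h'.nonneg
    refine ⟨h.1.mul h'.1, fun x => ?_, fun e he => ?_⟩
    · rw [abs_mul]
      refine (mul_le_mul (h.2.1 x) (h'.2.1 x) (abs_nonneg _) h.nonneg).trans ?_
      have : (1 : ℝ) ≤ 2 ^ (N + 1) := one_le_pow₀ (by norm_num)
      rw [mul_assoc]
      exact le_mul_of_one_le_left (by positivity) this
    · rw [dd_mul h.1 h'.1]
      refine ((ih h.pred (h'.2.2 e he)).add (ih (h.2.2 e he) h'.pred)).mono (le_of_eq ?_)
      ring

theorem BD.dd {N : ℕ} {C : ℝ} {φ : F → ℝ} (h : BD (N + 1) C φ) (e : F) :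
    BD N (‖e‖ * C) (dd e φ) := by
  by_cases he : e = 0
  · subst he
    rw [dd_zero_dir]
    exact (BD.const 0).mono (by simp)
  · have hn : ‖e‖ ≠ 0 := norm_ne_zero_iff.mpr he
    have h1 : e = ‖e‖ • (‖e‖⁻¹ • e) := by rw [smul_smul, mul_inv_cancel₀ hn, one_smul]
    have h2 : ‖(‖e‖⁻¹ • e)‖ ≤ 1 := by rw [norm_smul, norm_inv, norm_norm, inv_mul_cancel₀ hn]
    have := (h.2.2 _ h2).const_mul ‖e‖
    rw [abs_norm, ← dd_smul_dir, ← h1] at this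
    exact this

theorem dd_comp_affine {A : G →L[ℝ] F} {v : F} {φ : F → ℝ} (h : Differentiable ℝ φ) (e : G) :
    dd e (fun z => φ (A z + v)) = fun z => dd (A e) φ (A z + v) := by
  funext z
  have h1 : HasFDerivAt (fun z => A z + v) A z := A.hasFDerivAt.add_const v
  have := ((h (A z + v)).hasFDerivAt.comp z h1).fderiv
  simp only [dd]
  rw [show (fun z => φ (A z + v)) = φ ∘ fun z => A z + v from rfl, this]
  rfl

/-- Every derivative costs one factor `R`, since `A` maps a unit direction to one of length at most
`R`. The assumption `1 ≤ R` lets the top power serve for the lower orders as well. Translations have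
`R = 1` and lose nothing. -/
theorem BD.comp_affine {N : ℕ} {C R : ℝ} {φ : F → ℝ} (h : BD N C φ) (A : G →L[ℝ] F) (v : F)
    (hA : ‖A‖ ≤ R) (hR : 1 ≤ R) : BD N (R ^ N * C) (fun z => φ (A z + v)) := by
  induction N generalizing φ C with
  | zero => exact ⟨h.1.comp (by fun_prop), fun x => by simpa using h.2 _⟩
  | succ N ih =>
    have h0 := h.nonneg
    refine ⟨h.1.comp (by fun_prop), fun x => (h.2.1 _).trans ?_, fun e he => ?_⟩
    · exact le_mul_of_one_le_left h0 (one_le_pow₀ hR)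
    · rw [dd_comp_affine h.1]
      have h1 : ‖A e‖ ≤ R := (A.le_opNorm_of_le he).trans (by simpa using hA)
      refine (ih ((h.dd (A e)).mono (mul_le_mul_of_nonneg_right h1 h0))).mono (le_of_eq ?_)
      ring

theorem BD.norm_fderiv_le {N : ℕ} {C : ℝ} {φ : F → ℝ} (h : BD (N + 1) C φ) (z : F) :
    ‖fderiv ℝ φ z‖ ≤ C := by
  refine ContinuousLinearMap.opNorm_le_bound _ h.nonneg fun e => ?_
  have := (h.dd e).bound z
  rw [mul_comm]
  simpa [FDScheme.dd] using this

theorem BD.abs_sub_le {N : ℕ} {C : ℝ} {φ : F → ℝ} (h : BD (N + 1) C φ) (x y : F) :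
    |φ y - φ x| ≤ C * ‖y - x‖ := by
  have := Convex.norm_image_sub_le_of_norm_fderiv_le (𝕜 := ℝ) (f := φ) (s := univ) (C := C)
    (fun z _ => h.1 z) (fun z _ => h.norm_fderiv_le z) convex_univ (mem_univ x) (mem_univ y)
  simpa using this

theorem BD.contDiff [FiniteDimensional ℝ F] {N : ℕ} {C : ℝ} {φ : F → ℝ} (h : BD N C φ) :
    ContDiff ℝ N φ := by
  induction N generalizing φ C with
  | zero => simpa using h.1
  | succ N ih =>
    rw [show ((N + 1 : ℕ) : WithTop ℕ∞) = (N : WithTop ℕ∞) + 1 by norm_cast,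
      contDiff_succ_iff_fderiv_apply]
    exact ⟨h.1, by simp, fun e => ih (h.dd e)⟩

/-- All derivatives are bounded. -/
def SB (φ : F → ℝ) : Prop := ∀ N, ∃ C, BD N C φ

theorem SB.differentiable {φ : F → ℝ} (h : SB φ) : Differentiable ℝ φ := (h 1).choose_spec.1

theorem SB.continuous {φ : F → ℝ} (h : SB φ) : Continuous φ := h.differentiable.continuous

theorem SB.const (a : ℝ) : SB (fun _ : F => a) := fun _ => ⟨_, BD.const a⟩

theorem SB.add {φ ψ : F → ℝ} (h : SB φ) (h' : SB ψ) : SB (fun x => φ x + ψ x) := fun N =>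
  ⟨_, (h N).choose_spec.add (h' N).choose_spec⟩

theorem SB.sub {φ ψ : F → ℝ} (h : SB φ) (h' : SB ψ) : SB (fun x => φ x - ψ x) := fun N =>
  ⟨_, (h N).choose_spec.sub (h' N).choose_spec⟩

theorem SB.mul {φ ψ : F → ℝ} (h : SB φ) (h' : SB ψ) : SB (fun x => φ x * ψ x) := fun N =>
  ⟨_, (h N).choose_spec.mul (h' N).choose_spec⟩

theorem SB.const_mul {φ : F → ℝ} (h : SB φ) (a : ℝ) : SB (fun x => a * φ x) := fun N =>
  ⟨_, (h N).choose_spec.const_mul a⟩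

theorem SB.sum {ι : Type*} (s : Finset ι) {φ : ι → F → ℝ} (h : ∀ i ∈ s, SB (φ i)) :
    SB (fun x => ∑ i ∈ s, φ i x) := by
  classical
  intro N
  choose! C hC using fun i hi => h i hi N
  exact ⟨_, BD.sum s hC⟩

theorem SB.dd {φ : F → ℝ} (h : SB φ) (e : F) : SB (dd e φ) := fun N =>
  ⟨_, (h (N + 1)).choose_spec.dd e⟩

theorem SB.iterate_dd {φ : F → ℝ} (h : SB φ) (e : F) (l : ℕ) : SB ((FDScheme.dd e)^[l] φ) := by
  induction l generalizing φ with
  | zero => exact h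
  | succ l ih => exact ih (h.dd e)

theorem SB.comp_affine {φ : F → ℝ} (h : SB φ) (A : G →L[ℝ] F) (v : F) :
    SB (fun z => φ (A z + v)) := fun N =>
  ⟨_, (h N).choose_spec.comp_affine A v (le_max_left _ _) (le_max_right _ 1)⟩

theorem SB.comp_linear {φ : F → ℝ} (h : SB φ) (A : G →L[ℝ] F) : SB (fun z => φ (A z)) := by
  simpa using h.comp_affine A 0

theorem SB.comp_add {φ : F → ℝ} (h : SB φ) (v : F) : SB (fun z => φ (z + v)) :=
  h.comp_affine (ContinuousLinearMap.id ℝ F) v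

theorem SB.contDiff [FiniteDimensional ℝ F] {φ : F → ℝ} (h : SB φ) : ContDiff ℝ ∞ φ :=
  contDiff_infty.mpr fun N => (h N).choose_spec.contDiff

theorem dd_comm [FiniteDimensional ℝ F] {φ : F → ℝ} (h : ContDiff ℝ 2 φ) (e e' : F) :
    dd e (dd e' φ) = dd e' (dd e φ) := by
  funext z
  have hs : IsSymmSndFDerivAt ℝ φ z := h.contDiffAt.isSymmSndFDerivAt (by simp)
  have hd : DifferentiableAt ℝ (fderiv ℝ φ) z :=
    (h.fderiv_right (m := 1) (by norm_num)).differentiable (by simp) z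
  have key : ∀ a b : F, dd a (dd b φ) z = fderiv ℝ (fderiv ℝ φ) z a b := by
    intro a b
    have : dd b φ = fun y => fderiv ℝ φ y b := rfl
    rw [this, dd, fderiv_clm_apply hd (differentiableAt_const b)]
    simp
  rw [key, key]
  exact hs e e'

theorem SB.dd_comm [FiniteDimensional ℝ F] {φ : F → ℝ} (h : SB φ) (e e' : F) :
    FDScheme.dd e (FDScheme.dd e' φ) = FDScheme.dd e' (FDScheme.dd e φ) :=
  FDScheme.dd_comm (h.contDiff.of_le (WithTop.coe_le_coe.mpr le_top)) e e'

/-- Evaluating on directions peels off one `dd` at a time, each at the cost of the length of its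
direction, so no dimensional constant appears. This is how `SB` functions become admissible test
functions in the assumptions. -/
theorem norm_iteratedFDeriv_le_of_BD [FiniteDimensional ℝ F] {N : ℕ} {C : ℝ} {φ : F → ℝ}
    (h : BD N C φ) (x : F) : ‖iteratedFDeriv ℝ N φ x‖ ≤ C := by
  refine ContinuousMultilinearMap.opNorm_le_bound h.nonneg fun v => ?_
  induction N generalizing φ C with
  | zero => simpa using h.bound x
  | succ N ih =>
    have h1 : iteratedFDeriv ℝ (N + 1) φ x v =
        iteratedFDeriv ℝ N (dd (v (Fin.last N)) φ) x (Fin.init v) := by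
      rw [iteratedFDeriv_succ_apply_right]
      have hc : ContDiffAt ℝ N (fderiv ℝ φ) x :=
        (h.contDiff.fderiv_right (m := N) (by norm_cast)).contDiffAt
      have := ((ContinuousLinearMap.apply ℝ ℝ (v (Fin.last N))).iteratedFDeriv_comp_left hc
        (i := N) le_rfl)
      have h2 : dd (v (Fin.last N)) φ =
          (ContinuousLinearMap.apply ℝ ℝ (v (Fin.last N))) ∘ fderiv ℝ φ := by
        funext y; simp [dd]
      rw [h2, this]
      simp
    rw [h1]
    refine (ih (h.dd (v (Fin.last N))) (Fin.init v)).trans (le_of_eq ?_)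
    rw [Fin.prod_univ_castSucc]
    simp [Fin.init]; ring

end Calculus

theorem SB.isSmoothBounded {d : ℕ} {φ : E d → ℝ} (h : SB φ) : IsSmoothBounded φ :=
  ⟨h.contDiff, fun n => ⟨_, fun x => norm_iteratedFDeriv_le_of_BD (h n).choose_spec x⟩⟩

/-! ## Integrals depending on a parameter -/

section Param

variable {F : Type*} [NormedAddCommGroup F] [NormedSpace ℝ F]
variable {Ω : Type*} [MeasurableSpace Ω] {μ : Measure Ω}

/-- The derivative is the limit of difference quotients with steps `1/(n+1)`, each of which is
measurable in the parameter. -/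
theorem aestronglyMeasurable_dd {ψ : Ω → F → ℝ} (hm : ∀ z, AEStronglyMeasurable (ψ · z) μ)
    (hd : ∀ᵐ y ∂μ, Differentiable ℝ (ψ y)) (e z : F) :
    AEStronglyMeasurable (fun y => dd e (ψ y) z) μ := by
  have hlim : Tendsto (fun n : ℕ => (1 / ((n : ℝ) + 1))) atTop (𝓝[≠] 0) := by
    refine tendsto_nhdsWithin_iff.mpr ⟨tendsto_one_div_add_atTop_nhds_zero_nat, ?_⟩
    exact Eventually.of_forall fun n => by
      simp only [mem_compl_iff, mem_singleton_iff]; positivity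
  refine aestronglyMeasurable_of_tendsto_ae (u := atTop)
    (f := fun (n : ℕ) y => (1 / ((n : ℝ) + 1))⁻¹ * (ψ y (z + (1 / ((n : ℝ) + 1)) • e) - ψ y z))
    (fun n => ((hm _).sub (hm _)).const_mul _) ?_
  filter_upwards [hd] with y hy
  have h0 : HasDerivAt (fun t : ℝ => ψ y (z + t • e)) (dd e (ψ y) z) 0 :=
    (hy z).hasFDerivAt.hasLineDerivAt e
  have := h0.tendsto_slope_zero.comp hlim
  simpa [dd, Function.comp_def] using this

theorem hasFDerivAt_integral_BD [FiniteDimensional ℝ F] {N : ℕ} {ψ : Ω → F → ℝ} {C : Ω → ℝ}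
    (hm : ∀ z, AEStronglyMeasurable (ψ · z) μ) (hC : Integrable C μ)
    (h : ∀ᵐ y ∂μ, BD (N + 1) (C y) (ψ y)) (z : F) :
    Integrable (fun y => fderiv ℝ (ψ y) z) μ ∧
    HasFDerivAt (fun z => ∫ y, ψ y z ∂μ) (∫ y, fderiv ℝ (ψ y) z ∂μ) z := by
  have hd : ∀ᵐ y ∂μ, Differentiable ℝ (ψ y) := h.mono fun y hy => hy.1
  have hm' : AEStronglyMeasurable (fun y => fderiv ℝ (ψ y) z) μ := by
    let b := Module.finBasis ℝ F
    -- In a basis the full derivative is a finite combination of directional ones, whose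
    -- measurability is already known.
    have : (fun y => fderiv ℝ (ψ y) z) = fun y => ∑ i, dd (b i) (ψ y) z •
        LinearMap.toContinuousLinearMap (b.coord i) := by
      funext y
      ext v
      conv_lhs => rw [← b.sum_repr v]
      rw [map_sum, sum_apply]
      refine Finset.sum_congr rfl fun i _ => ?_
      simp [dd, mul_comm]
    rw [this]
    exact Finset.aestronglyMeasurable_fun_sum _ fun i _ =>
      (aestronglyMeasurable_dd hm hd (b i) z).smul_const _
  refine ⟨Integrable.mono' hC hm' (h.mono fun y hy => hy.norm_fderiv_le z), ?_⟩
  refine hasFDerivAt_integral_of_dominated_of_fderiv_le (s := univ) (bound := C)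
    (F := fun z y => ψ y z) (F' := fun z y => fderiv ℝ (ψ y) z)
    univ_mem (Eventually.of_forall hm)
    (Integrable.mono' hC (hm z) (h.mono fun y hy => hy.bound z)) hm'
    (h.mono fun y hy x _ => hy.norm_fderiv_le x) hC
    (h.mono fun y hy x _ => (hy.1 x).hasFDerivAt)

theorem dd_integral [FiniteDimensional ℝ F] {N : ℕ} {ψ : Ω → F → ℝ} {C : Ω → ℝ}
    (hm : ∀ z, AEStronglyMeasurable (ψ · z) μ) (hC : Integrable C μ)
    (h : ∀ᵐ y ∂μ, BD (N + 1) (C y) (ψ y)) (e : F) :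
    dd e (fun z => ∫ y, ψ y z ∂μ) = fun z => ∫ y, dd e (ψ y) z ∂μ := by
  funext z
  obtain ⟨h1, h2⟩ := hasFDerivAt_integral_BD hm hC h z
  simp only [dd]
  rw [h2.fderiv, ContinuousLinearMap.integral_apply h1]

theorem BD.integral [FiniteDimensional ℝ F] {N : ℕ} {ψ : Ω → F → ℝ} {C : Ω → ℝ}
    (hm : ∀ z, AEStronglyMeasurable (ψ · z) μ) (hC : Integrable C μ)
    (h : ∀ᵐ y ∂μ, BD N (C y) (ψ y)) : BD N (∫ y, C y ∂μ) (fun z => ∫ y, ψ y z ∂μ) := by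
  have hb : ∀ z, |∫ y, ψ y z ∂μ| ≤ ∫ y, C y ∂μ := fun z => by
    rw [← Real.norm_eq_abs]
    exact norm_integral_le_of_norm_le hC (h.mono fun y hy => hy.bound z)
  induction N generalizing ψ with
  | zero =>
    refine ⟨?_, hb⟩
    exact continuous_of_dominated hm (fun z => h.mono fun y hy => hy.bound z) hC
      (h.mono fun y hy => hy.1)
  | succ N ih =>
    refine ⟨fun z => (hasFDerivAt_integral_BD hm hC h z).2.differentiableAt, hb, fun e he => ?_⟩
    rw [dd_integral hm hC h]
    have h' : ∀ᵐ y ∂μ, BD N (C y) (FDScheme.dd e (ψ y)) := h.mono fun y hy => hy.2.2 e he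
    exact ih (fun z => aestronglyMeasurable_dd hm (h.mono fun y hy => hy.1) e z) h'
      fun z => by
        rw [← Real.norm_eq_abs]
        exact norm_integral_le_of_norm_le hC (h'.mono fun y hy => hy.bound z)

end Param

/-! ## Uniform limits -/

section Limit

variable {F : Type*} [NormedAddCommGroup F] [NormedSpace ℝ F]

/-- An interpolation inequality of Landau type. -/
theorem abs_dd_le_of_BD {N : ℕ} {C η s : ℝ} {φ : F → ℝ} (h : BD (N + 2) C φ)
    (hη : ∀ z, |φ z| ≤ η) (hs : 0 < s) {e : F} (he : ‖e‖ ≤ 1) (z : F) :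
    |dd e φ z| ≤ 2 * η / s + C * s := by
  have hder : ∀ r, HasDerivAt (fun r : ℝ => φ (z + r • e)) (dd e φ (z + r • e)) r := by
    intro r
    have h1 : HasDerivAt (fun r : ℝ => z + r • e) e r := by
      simpa using ((hasDerivAt_id r).smul_const e).const_add z
    exact (h.1 _).hasFDerivAt.comp_hasDerivAt r h1
  -- Somewhere on the segment the derivative equals the slope, of size at most `2η/s`; moving back
  -- to `z` costs at most `C s` by the bound on second derivatives.
  obtain ⟨r, hr, hr'⟩ := exists_hasDerivAt_eq_slope (fun r : ℝ => φ (z + r • e))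
    (fun r => dd e φ (z + r • e)) hs (fun r _ => (hder r).continuousAt.continuousWithinAt)
    (fun r _ => hder r)
  simp only [zero_smul, add_zero, sub_zero] at hr'
  have h1 : |dd e φ (z + r • e)| ≤ 2 * η / s := by
    rw [hr', abs_div, abs_of_pos hs]
    gcongr
    have := hη (z + s • e)
    have := hη z
    calc _ ≤ |φ (z + s • e)| + |φ z| := abs_sub _ _
      _ ≤ _ := by linarith
  have h2 := (h.2.2 e he).abs_sub_le (z + r • e) z
  have h3 : ‖z - (z + r • e)‖ ≤ s := by
    simp only [sub_add_cancel_left, norm_neg, norm_smul, Real.norm_eq_abs, abs_of_pos hr.1]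
    calc r * ‖e‖ ≤ r * 1 := by gcongr; exact hr.1.le
      _ ≤ s := by linarith [hr.2]
  have h4 : |dd e φ z - dd e φ (z + r • e)| ≤ C * s :=
    h2.trans (mul_le_mul_of_nonneg_left h3 h.nonneg)
  have := abs_sub_abs_le_abs_sub (dd e φ z) (dd e φ (z + r • e))
  linarith

/-- The distance is measured by `η ^ 2` because the step `s = η` then balances the two terms of the
interpolation inequality. As `η` may vanish, the bound is proved for `s > η` and `s` is sent to `η`.
-/
theorem norm_fderiv_sub_le {N : ℕ} {C η : ℝ} {φ ψ : F → ℝ} (h : BD (N + 2) C φ)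
    (h' : BD (N + 2) C ψ) (hη0 : 0 ≤ η) (hη : ∀ z, |φ z - ψ z| ≤ η ^ 2) (z : F) :
    ‖fderiv ℝ φ z - fderiv ℝ ψ z‖ ≤ (2 + 2 * C) * η := by
  have h0 := h.nonneg
  have hsub := h.sub h'
  have key : ∀ s, η ≤ s → 0 < s → ‖fderiv ℝ φ z - fderiv ℝ ψ z‖ ≤ (2 + 2 * C) * s := by
    intro s hs hs0
    refine ContinuousLinearMap.opNorm_le_of_unit_norm (by positivity) fun e he => ?_
    have h1 := abs_dd_le_of_BD hsub hη hs0 he.le z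
    have h2 : dd e (fun x => φ x - ψ x) z = (fderiv ℝ φ z - fderiv ℝ ψ z) e := by
      simp only [dd]
      rw [fderiv_fun_sub (h.1 z) (h'.1 z)]
    rw [h2] at h1
    refine h1.trans ?_
    have : 2 * η ^ 2 / s ≤ 2 * s := by
      rw [div_le_iff₀ hs0]; nlinarith
    linarith
  have hlim : Tendsto (fun s => (2 + 2 * C) * s) (𝓝[>] η) (𝓝 ((2 + 2 * C) * η)) :=
    ((continuous_const.mul continuous_id).tendsto η).mono_left nhdsWithin_le_nhds
  refine ge_of_tendsto hlim ?_
  filter_upwards [self_mem_nhdsWithin] with s hs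
  exact key s (le_of_lt hs) (lt_of_le_of_lt hη0 hs)

/-- A common bound on second derivatives turns the uniform Cauchy property of the functions into
that of their gradients, by interpolation. -/
theorem tendstoUniformly_fderiv {N : ℕ} {C : ℝ} {φ : ℕ → F → ℝ} {φ' : F → ℝ}
    (h : ∀ n, BD (N + 2) C (φ n)) (hlim : TendstoUniformly φ φ' atTop) :
    Differentiable ℝ φ' ∧ TendstoUniformly (fun n => fderiv ℝ (φ n)) (fderiv ℝ φ') atTop := by
  have hC := (h 0).nonneg
  have hcau : UniformCauchySeqOn (fun n => fderiv ℝ (φ n)) atTop univ := by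
    rw [Metric.uniformCauchySeqOn_iff]
    intro ε hε
    set η := ε / (2 * (2 + 2 * C)) with hηdef
    have hη : 0 < η := by positivity
    have := (tendstoUniformlyOn_univ.mpr hlim).uniformCauchySeqOn
    rw [Metric.uniformCauchySeqOn_iff] at this
    obtain ⟨n0, hn0⟩ := this (η ^ 2) (by positivity)
    refine ⟨n0, fun m hm n hn x _ => ?_⟩
    rw [dist_eq_norm]
    have hb : ∀ z, |φ m z - φ n z| ≤ η ^ 2 := fun z => by
      have := hn0 m hm n hn z (mem_univ z)
      rw [Real.dist_eq] at this
      exact this.le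
    refine (norm_fderiv_sub_le (h m) (h n) hη.le hb x).trans_lt ?_
    rw [hηdef]
    have : (2 + 2 * C) * (ε / (2 * (2 + 2 * C))) = ε / 2 := by field_simp
    rw [this]; linarith
  have hex : ∀ z, ∃ L, Tendsto (fun n => fderiv ℝ (φ n) z) atTop (𝓝 L) := fun z =>
    cauchySeq_tendsto_of_complete (hcau.cauchySeq (mem_univ z))
  choose L hL using hex
  have hu : TendstoUniformly (fun n => fderiv ℝ (φ n)) L atTop :=
    tendstoUniformlyOn_univ.mp (hcau.tendstoUniformlyOn_of_tendsto fun z _ => hL z)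
  have hder := hasFDerivAt_of_tendstoUniformly hu (fun n x => ((h n).1 x).hasFDerivAt)
    (fun x => hlim.tendsto_at x)
  have : fderiv ℝ φ' = L := funext fun x => (hder x).fderiv
  rw [this]
  exact ⟨fun x => (hder x).differentiableAt, hu⟩

theorem tendstoUniformly_dd {N : ℕ} {C : ℝ} {φ : ℕ → F → ℝ} {φ' : F → ℝ}
    (h : ∀ n, BD (N + 2) C (φ n)) (hlim : TendstoUniformly φ φ' atTop) (e : F) :
    TendstoUniformly (fun n => dd e (φ n)) (dd e φ') atTop := by
  have h1 := (tendstoUniformly_fderiv h hlim).2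
  exact (ContinuousLinearMap.apply ℝ ℝ e).uniformContinuous.comp_tendstoUniformly h1

/-- One order is lost: bounds of order `N + 1` give uniform convergence of the derivatives only up
to order `N`. -/
theorem BD.of_tendstoUniformly {N : ℕ} {C : ℝ} {φ : ℕ → F → ℝ} {φ' : F → ℝ}
    (h : ∀ n, BD (N + 1) C (φ n)) (hlim : TendstoUniformly φ φ' atTop) : BD N C φ' := by
  have hb : ∀ x, |φ' x| ≤ C := fun x =>
    le_of_tendsto ((hlim.tendsto_at x).abs) (Eventually.of_forall fun n => (h n).bound x)
  induction N generalizing φ φ' with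
  | zero =>
    exact ⟨hlim.continuous (Frequently.of_forall fun n => (h n).continuous), hb⟩
  | succ N ih =>
    refine ⟨(tendstoUniformly_fderiv h hlim).1, hb, fun e he => ?_⟩
    have h1 := tendstoUniformly_dd h hlim e
    exact ih (fun n => (h n).2.2 e he) h1 fun x =>
      le_of_tendsto ((h1.tendsto_at x).abs)
        (Eventually.of_forall fun n => ((h n).2.2 e he).bound x)

/-- Iterated directional derivatives along a list of directions. -/
def ddList : List F → (F → ℝ) → F → ℝ
  | [], φ => φ
  | e :: es, φ => ddList es (dd e φ)

theorem tendsto_ddList (es : List F) {N : ℕ} {C : ℝ} {φ : ℕ → F → ℝ} {φ' : F → ℝ}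
    (h : ∀ n, BD N C (φ n)) (hlim : TendstoUniformly φ φ' atTop) (hN : es.length + 1 ≤ N) (z : F) :
    Tendsto (fun n => ddList es (φ n) z) atTop (𝓝 (ddList es φ' z)) := by
  induction es generalizing φ φ' N C with
  | nil => exact hlim.tendsto_at z
  | cons e es ih =>
    obtain ⟨N, rfl⟩ : ∃ N', N = N' + 2 := ⟨N - 2, by simp at hN; omega⟩
    exact ih (fun n => (h n).dd e) (tendstoUniformly_dd h hlim e) (by simp at hN; omega)

end Limit

/-! ## One-dimensional lemmas -/

theorem integral_exp_scaled (C t : ℝ) :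
    ∫ s in (0 : ℝ)..t, C * Real.exp (C * s) = Real.exp (C * t) - 1 := by
  have h : ∀ s ∈ uIcc 0 t, HasDerivAt (fun s => Real.exp (C * s)) (C * Real.exp (C * s)) s := by
    intro s _
    have := ((hasDerivAt_id s).const_mul C).exp
    simpa [mul_comm] using this
  rw [intervalIntegral.integral_eq_sub_of_hasDerivAt h
    (Continuous.intervalIntegrable (by fun_prop) _ _)]
  simp

theorem integral_pow_factorial (C t : ℝ) (n : ℕ) :
    ∫ s in (0 : ℝ)..t, C * ((C * s) ^ n / n.factorial) =
      (C * t) ^ (n + 1) / (n + 1).factorial := by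
  have h : ∀ s ∈ uIcc 0 t, HasDerivAt (fun s => (C * s) ^ (n + 1) / (n + 1).factorial)
      (C * ((C * s) ^ n / n.factorial)) s := by
    intro s _
    have := (((hasDerivAt_id s).const_mul C).pow (n + 1)).div_const ((n + 1).factorial : ℝ)
    convert! this using 1
    rw [Nat.factorial_succ]
    push_cast
    have : (n.factorial : ℝ) ≠ 0 := by positivity
    have : (n : ℝ) + 1 ≠ 0 := by positivity
    simp
    field_simp
  rw [intervalIntegral.integral_eq_sub_of_hasDerivAt h
    (Continuous.intervalIntegrable (by fun_prop) _ _)]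
  simp

/-- A Gronwall lemma for families of bounded functions, with no measurability required. -/
theorem gronwall_family {Z : Type*} {T C η B : ℝ} {u : ℝ → Z → ℝ}
    (hB : ∀ t ∈ Icc 0 T, ∀ z, |u t z| ≤ B)
    (h : ∀ b : ℝ → ℝ, Continuous b → (∀ s ∈ Icc 0 T, ∀ z, |u s z| ≤ b s) →
      ∀ t ∈ Icc 0 T, ∀ z, |u t z| ≤ η + ∫ s in (0 : ℝ)..t, C * b s)
    {t : ℝ} (ht : t ∈ Icc 0 T) (z : Z) : |u t z| ≤ η * Real.exp (C * t) := by
  -- Feeding a bound back into the hypothesis reproduces the exponential and turns the crude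
  -- constants into the remainder `(C t)ⁿ / n!`, which tends to zero.
  have key : ∀ n : ℕ, ∀ t ∈ Icc 0 T, ∀ z,
      |u t z| ≤ η * Real.exp (C * t) + B * ((C * t) ^ n / n.factorial) +
        |η| * ((C * t) ^ n / n.factorial) := by
    intro n
    induction n with
    | zero =>
      intro t ht z
      have := hB t ht z
      have h1 := h (fun _ => B) continuous_const hB
      simp only [pow_zero, Nat.factorial_zero, Nat.cast_one, div_one, mul_one]
      by_cases hη : 0 ≤ η
      · have : 0 ≤ η * Real.exp (C * t) := by positivity
        have := abs_nonneg η
        linarith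
      · have h0 := h1 0 ⟨le_rfl, ht.1.trans ht.2⟩ z
        simp only [intervalIntegral.integral_same, add_zero] at h0
        have := abs_nonneg (u 0 z)
        linarith
    | succ n ih =>
      intro t ht z
      have := h (fun s => η * Real.exp (C * s) + B * ((C * s) ^ n / n.factorial) +
        |η| * ((C * s) ^ n / n.factorial)) (by fun_prop) ih t ht z
      refine this.trans (le_of_eq ?_)
      have e1 : ∀ s, C * (η * Real.exp (C * s) + B * ((C * s) ^ n / n.factorial) +
          |η| * ((C * s) ^ n / n.factorial)) = η * (C * Real.exp (C * s)) +
          B * (C * ((C * s) ^ n / n.factorial)) + |η| * (C * ((C * s) ^ n / n.factorial)) := by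
        intro s; ring
      simp_rw [e1]
      rw [intervalIntegral.integral_add, intervalIntegral.integral_add]
      · rw [intervalIntegral.integral_const_mul η, intervalIntegral.integral_const_mul B,
          intervalIntegral.integral_const_mul |η|, integral_exp_scaled, integral_pow_factorial]
        ring
      all_goals exact Continuous.intervalIntegrable (by fun_prop) _ _
  have hlim : Tendsto (fun n : ℕ => η * Real.exp (C * t) + B * ((C * t) ^ n / n.factorial) +
      |η| * ((C * t) ^ n / n.factorial)) atTop
      (𝓝 (η * Real.exp (C * t) + B * 0 + |η| * 0)) := by
    have h0 := FloorSemiring.tendsto_pow_div_factorial_atTop (C * t)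
    exact (tendsto_const_nhds.add (h0.const_mul B)).add (h0.const_mul _)
  have := ge_of_tendsto' hlim fun n => key n t ht z
  simpa using this

/-- If `v t > b`, take the last time `r ≤ t` with `v r ≤ b`. On `(r, t]` the density is nonpositive,
hence `v t ≤ v r ≤ b`. Only integrability in time is used. -/
theorem primitive_le_of_nonpos {v G : ℝ → ℝ} {a b T : ℝ} (hG : IntervalIntegrable G volume 0 T)
    (hv : ∀ t ∈ Icc 0 T, v t = a + ∫ s in (0 : ℝ)..t, G s) (hab : a ≤ b)
    (hneg : ∀ s ∈ Icc 0 T, b < v s → G s ≤ 0) {t : ℝ} (ht : t ∈ Icc 0 T) : v t ≤ b := by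
  by_contra! hvt
  have hT : 0 ≤ T := ht.1.trans ht.2
  have hint : ∀ r ∈ Icc 0 T, ∀ s ∈ Icc 0 T, IntervalIntegrable G volume r s := fun r hr s hs =>
    hG.mono_set (by rw [uIcc_of_le hT]; exact uIcc_subset_Icc hr hs)
  have hcont : ContinuousOn v (Icc 0 T) := by
    have h1 : ContinuousOn (fun t => a + ∫ s in (0 : ℝ)..t, G s) (Icc 0 T) := by
      have := intervalIntegral.continuousOn_primitive_interval' hG (a := 0) (by simp)
      rw [uIcc_of_le hT] at this
      exact continuousOn_const.add this
    exact h1.congr hv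
  let A := Icc 0 t ∩ v ⁻¹' Iic b
  have hAc : IsClosed A :=
    (hcont.mono (Icc_subset_Icc_right ht.2)).preimage_isClosed_of_isClosed isClosed_Icc isClosed_Iic
  have h0 : (0 : ℝ) ∈ A := ⟨⟨le_rfl, ht.1⟩, by
    have := hv 0 ⟨le_rfl, hT⟩
    simp only [intervalIntegral.integral_same, add_zero] at this
    simpa [this] using hab⟩
  have hbdd : BddAbove A := ⟨t, fun s hs => hs.1.2⟩
  have hmem : sSup A ∈ A := hAc.csSup_mem ⟨0, h0⟩ hbdd
  set r := sSup A
  have hrT : r ∈ Icc 0 T := ⟨hmem.1.1, hmem.1.2.trans ht.2⟩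
  have hgt : ∀ s ∈ Ioc r t, G s ≤ 0 := by
    intro s hs
    have hs0 : s ∈ Icc 0 T := ⟨hmem.1.1.trans hs.1.le, hs.2.trans ht.2⟩
    refine hneg s hs0 ?_
    by_contra! hle
    exact absurd (le_csSup hbdd (show s ∈ A from ⟨⟨hs0.1, hs.2⟩, hle⟩)) (not_le.mpr hs.1)
  have hdiff : v t = v r + ∫ s in r..t, G s := by
    rw [hv t ht, hv r hrT, add_assoc, intervalIntegral.integral_add_adjacent_intervals
      (hint _ ⟨le_rfl, hT⟩ _ hrT) (hint _ hrT _ ht)]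
  have hle : ∫ s in r..t, G s ≤ 0 := by
    rw [intervalIntegral.integral_of_le hmem.1.2]
    exact setIntegral_nonpos measurableSet_Ioc hgt
  have : v r ≤ b := hmem.2
  linarith

/-- The density is merely integrable, so the chain rule is replaced by integration by parts for an
absolutely continuous function with itself. -/
theorem sq_primitive {w φ : ℝ → ℝ} {a T : ℝ} (hφ : IntervalIntegrable φ volume 0 T)
    (hw : ∀ t ∈ Icc 0 T, w t = a + ∫ s in (0 : ℝ)..t, φ s) {t : ℝ} (ht : t ∈ Icc 0 T) :
    w t ^ 2 = a ^ 2 + ∫ s in (0 : ℝ)..t, 2 * (w s * φ s) := by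
  have hφt : IntervalIntegrable φ volume 0 t := hφ.mono_set (by
    rw [uIcc_of_le (ht.1.trans ht.2)]; exact uIcc_subset_Icc ⟨le_rfl, ht.1.trans ht.2⟩ ht)
  set W : ℝ → ℝ := fun t => a + ∫ s in (0 : ℝ)..t, φ s with hW
  have hac : AbsolutelyContinuousOnInterval W 0 t := by
    have h1 := hφt.absolutelyContinuousOnInterval_intervalIntegral (c := 0) (by simp)
    have h2 : AbsolutelyContinuousOnInterval (fun _ : ℝ => a) 0 t :=
      (contDiffOn_const (n := 1)).absolutelyContinuousOnInterval
    exact h2.add h1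
  have h3 := hac.integral_deriv_mul_eq_sub hac
  have h4 : ∫ x in (0 : ℝ)..t, deriv W x * W x + W x * deriv W x =
      ∫ s in (0 : ℝ)..t, 2 * (w s * φ s) := by
    apply intervalIntegral.integral_congr_ae
    filter_upwards [hφt.ae_hasDerivAt_integral] with x hx hx'
    have hd : HasDerivAt W (φ x) x := (hx (uIoc_subset_uIcc hx') 0 (by simp)).const_add a
    rw [uIoc_of_le ht.1] at hx'
    rw [hd.deriv, hw x ⟨hx'.1.le, hx'.2.trans ht.2⟩]
    simp only [hW]
    ring
  rw [h4] at h3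
  rw [h3, hw t ht]
  simp [hW]
  ring

/-! ## Linear functional evolution equations -/

section Evolution

variable {F : Type*} [NormedAddCommGroup F] [NormedSpace ℝ F]

/-- Time dependent functions on `[0,T]`, measurable in time, all of whose space derivatives are
bounded. -/
structure TB (T : ℝ) (ψ : ℝ → F → ℝ) : Prop where
  meas : ∀ z, AEStronglyMeasurable (ψ · z) (volume.restrict (Icc 0 T))
  bd : ∀ N, ∃ C, ∀ t ∈ Icc 0 T, BD N C (ψ t)

variable {T : ℝ} {ψ χ : ℝ → F → ℝ}

theorem TB.sb (h : TB T ψ) {t : ℝ} (ht : t ∈ Icc 0 T) : SB (ψ t) := fun N =>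
  ⟨_, (h.bd N).choose_spec t ht⟩

theorem TB.of_sb {φ : F → ℝ} (h : SB φ) : TB T (fun _ => φ) :=
  ⟨fun _ => aestronglyMeasurable_const, fun N => ⟨_, fun _ _ => (h N).choose_spec⟩⟩

theorem TB.add (h : TB T ψ) (h' : TB T χ) : TB T (fun t z => ψ t z + χ t z) :=
  ⟨fun z => (h.meas z).add (h'.meas z), fun N =>
    ⟨_, fun t ht => ((h.bd N).choose_spec t ht).add ((h'.bd N).choose_spec t ht)⟩⟩

theorem TB.sub (h : TB T ψ) (h' : TB T χ) : TB T (fun t z => ψ t z - χ t z) :=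
  ⟨fun z => (h.meas z).sub (h'.meas z), fun N =>
    ⟨_, fun t ht => ((h.bd N).choose_spec t ht).sub ((h'.bd N).choose_spec t ht)⟩⟩

theorem TB.mul (h : TB T ψ) (h' : TB T χ) : TB T (fun t z => ψ t z * χ t z) :=
  ⟨fun z => (h.meas z).mul (h'.meas z), fun N =>
    ⟨_, fun t ht => ((h.bd N).choose_spec t ht).mul ((h'.bd N).choose_spec t ht)⟩⟩

theorem TB.const_mul (h : TB T ψ) (a : ℝ) : TB T (fun t z => a * ψ t z) :=
  (TB.of_sb (SB.const a)).mul h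

theorem TB.sum {ι : Type*} (s : Finset ι) {ψ : ι → ℝ → F → ℝ} (h : ∀ i ∈ s, TB T (ψ i)) :
    TB T (fun t z => ∑ i ∈ s, ψ i t z) := by
  classical
  refine ⟨fun z => Finset.aestronglyMeasurable_fun_sum _ fun i hi => (h i hi).meas z, fun N => ?_⟩
  choose! C hC using fun i hi => (h i hi).bd N
  exact ⟨_, fun t ht => BD.sum s fun i hi => hC i hi t ht⟩

theorem TB.comp_affine {G : Type*} [NormedAddCommGroup G] [NormedSpace ℝ G] (h : TB T ψ)
    (A : G →L[ℝ] F) (v : F) : TB T (fun t z => ψ t (A z + v)) :=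
  ⟨fun _ => h.meas _, fun N => ⟨_, fun t ht => ((h.bd N).choose_spec t ht).comp_affine A v
    (le_max_left _ _) (le_max_right _ 1)⟩⟩

theorem TB.comp_linear {G : Type*} [NormedAddCommGroup G] [NormedSpace ℝ G] (h : TB T ψ)
    (A : G →L[ℝ] F) : TB T (fun t z => ψ t (A z)) := by
  simpa using h.comp_affine A 0

theorem TB.comp_add (h : TB T ψ) (v : F) : TB T (fun t z => ψ t (z + v)) :=
  h.comp_affine (ContinuousLinearMap.id ℝ F) v

theorem TB.dd (h : TB T ψ) (e : F) : TB T (fun t => dd e (ψ t)) := by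
  refine ⟨fun z => aestronglyMeasurable_dd h.meas ?_ e z, fun N => ?_⟩
  · filter_upwards [ae_restrict_mem measurableSet_Icc] with t ht
    exact (h.sb ht).differentiable
  · exact ⟨_, fun t ht => ((h.bd (N + 1)).choose_spec t ht).dd e⟩

theorem TB.intervalIntegrable (h : TB T ψ) {t : ℝ} (ht : t ∈ Icc 0 T) (z : F) :
    IntervalIntegrable (ψ · z) volume 0 t := by
  obtain ⟨C, hC⟩ := h.bd 0
  rw [intervalIntegrable_iff_integrableOn_Icc_of_le ht.1]
  have hsub : Icc 0 t ⊆ Icc 0 T := Icc_subset_Icc_right ht.2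
  have : IntegrableOn (ψ · z) (Icc 0 T) := by
    refine Integrable.mono' (integrable_const C) (h.meas z) ?_
    filter_upwards [ae_restrict_mem measurableSet_Icc] with s hs
    exact (hC s hs).bound z
  exact this.mono_set hsub

theorem restrict_Ioc_le {t : ℝ} (ht : t ∈ Icc 0 T) :
    (volume : Measure ℝ).restrict (Ioc 0 t) ≤ volume.restrict (Icc 0 T) :=
  Measure.restrict_mono (Ioc_subset_Icc_self.trans (Icc_subset_Icc_right ht.2)) le_rfl

theorem BD.intervalIntegral [FiniteDimensional ℝ F] {N : ℕ} {C : ℝ → ℝ}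
    (hm : ∀ z, AEStronglyMeasurable (ψ · z) (volume.restrict (Icc 0 T))) (hc : Continuous C)
    (h : ∀ s ∈ Icc 0 T, BD N (C s) (ψ s)) {t : ℝ} (ht : t ∈ Icc 0 T) :
    BD N (∫ s in (0 : ℝ)..t, C s) (fun z => ∫ s in (0 : ℝ)..t, ψ s z) := by
  simp only [intervalIntegral.integral_of_le ht.1]
  refine BD.integral (fun z => (hm z).mono_measure (restrict_Ioc_le ht)) ?_ ?_
  · exact (hc.intervalIntegrable 0 t).1
  · filter_upwards [ae_restrict_mem measurableSet_Ioc] with s hs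
    exact h s ⟨hs.1.le, hs.2.trans ht.2⟩

theorem TB.dd_intervalIntegral [FiniteDimensional ℝ F] (h : TB T ψ) {t : ℝ} (ht : t ∈ Icc 0 T)
    (e : F) : FDScheme.dd e (fun z => ∫ s in (0 : ℝ)..t, ψ s z) =
      fun z => ∫ s in (0 : ℝ)..t, FDScheme.dd e (ψ s) z := by
  obtain ⟨C, hC⟩ := h.bd 1
  simp only [intervalIntegral.integral_of_le ht.1]
  refine dd_integral (N := 0) (C := fun _ => C)
    (fun z => (h.meas z).mono_measure (restrict_Ioc_le ht)) (integrable_const _) ?_ e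
  filter_upwards [ae_restrict_mem measurableSet_Ioc] with s hs
  exact hC s ⟨hs.1.le, hs.2.trans ht.2⟩

theorem aestronglyMeasurable_primitive {T : ℝ} {φ : ℝ → ℝ} (hφ : IntervalIntegrable φ volume 0 T)
    (hT : 0 ≤ T) :
    AEStronglyMeasurable (fun t => ∫ s in (0 : ℝ)..t, φ s) (volume.restrict (Icc 0 T)) := by
  have := intervalIntegral.continuousOn_primitive_interval' hφ (a := 0) (by simp)
  rw [uIcc_of_le hT] at this
  exact this.aestronglyMeasurable measurableSet_Icc

theorem TB.primitive [FiniteDimensional ℝ F] (h : TB T ψ) (hT : 0 ≤ T) :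
    TB T (fun t z => ∫ s in (0 : ℝ)..t, ψ s z) := by
  refine ⟨fun z => aestronglyMeasurable_primitive (h.intervalIntegrable ⟨hT, le_rfl⟩ z) hT,
    fun N => ?_⟩
  obtain ⟨C, hC⟩ := h.bd N
  refine ⟨T * C, fun t ht => ?_⟩
  have h1 := BD.intervalIntegral h.meas (C := fun _ => C) continuous_const hC ht
  refine h1.mono ?_
  simp only [intervalIntegral.integral_const, sub_zero, smul_eq_mul]
  exact mul_le_mul_of_nonneg_right ht.2 (hC t ht).nonneg

/-- A version of `BD.of_tendstoUniformly` which keeps the bound for the highest derivatives. -/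
theorem BD.of_tendstoUniformly_of_succ {N : ℕ} {C C' : ℝ} {φ : ℕ → F → ℝ} {φ' : F → ℝ}
    (h : ∀ n, BD (N + 1) C' (φ n)) (h' : ∀ n, BD N C (φ n))
    (hlim : TendstoUniformly φ φ' atTop) : BD N C φ' := by
  have hb : ∀ x, |φ' x| ≤ C := fun x =>
    le_of_tendsto ((hlim.tendsto_at x).abs) (Eventually.of_forall fun n => (h' n).bound x)
  induction N generalizing φ φ' with
  | zero =>
    exact ⟨hlim.continuous (Frequently.of_forall fun n => (h n).continuous), hb⟩
  | succ N ih =>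
    refine ⟨(tendstoUniformly_fderiv h hlim).1, hb, fun e he => ?_⟩
    have h1 := tendstoUniformly_dd h hlim e
    exact ih (fun n => (h n).2.2 e he) (fun n => (h' n).2.2 e he) h1 fun x =>
      le_of_tendsto ((h1.tendsto_at x).abs)
        (Eventually.of_forall fun n => ((h' n).2.2 e he).bound x)

variable {ι : Type*} (J : Finset ι) (a : ι → ℝ → F → ℝ) (A : ι → F →L[ℝ] F)

/-- The right-hand side of the evolution equation. -/
def evolRHS (f u : ℝ → F → ℝ) : ℝ → F → ℝ := fun s z => ∑ j ∈ J, a j s z * u s (A j z) + f s z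

/-- The Picard iterates of the evolution equation. -/
def picard (f : ℝ → F → ℝ) (g : F → ℝ) : ℕ → ℝ → F → ℝ
  | 0 => fun _ _ => 0
  | n + 1 => fun t z => g z + ∫ s in (0 : ℝ)..t, evolRHS J a A f (picard f g n) s z

variable {J a A}

theorem TB.evolRHS {f u : ℝ → F → ℝ} (ha : ∀ j ∈ J, TB T (a j)) (hf : TB T f) (hu : TB T u) :
    TB T (evolRHS J a A f u) :=
  (TB.sum J fun j hj => (ha j hj).mul (hu.comp_linear (A j))).add hf

theorem TB.picard [FiniteDimensional ℝ F] {f : ℝ → F → ℝ} {g : F → ℝ} (hT : 0 ≤ T)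
    (ha : ∀ j ∈ J, TB T (a j)) (hf : TB T f) (hg : SB g) (n : ℕ) : TB T (picard J a A f g n) := by
  induction n with
  | zero => exact TB.of_sb (SB.const 0)
  | succ n ih => exact (TB.of_sb hg).add ((TB.evolRHS ha hf ih).primitive hT)

theorem BD.evolRHS {f u : ℝ → F → ℝ} {N : ℕ} {Ca Cf R b s : ℝ} (hR : 1 ≤ R)
    (hA : ∀ j ∈ J, ‖A j‖ ≤ R) (ha : ∀ j ∈ J, BD N Ca (a j s)) (hf : BD N Cf (f s))
    (hu : BD N b (u s)) :
    BD N ((J.card * 2 ^ N * Ca * R ^ N) * b + Cf) (evolRHS J a A f u s) := by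
  refine ((BD.sum J fun j hj => (ha j hj).mul (hu.comp_affine (A j) 0 (hA j hj) hR)).add
    hf).mono (C' := (J.card * 2 ^ N * Ca * R ^ N) * b + Cf) (le_of_eq ?_) |> fun h => by
      simp only [add_zero] at h; exact h
  simp only [Finset.sum_const, nsmul_eq_mul]; ring

/-- The bound is reproduced by each Picard step: the exponential solves the scalar integral
equation, and `t * Cf ≤ T * Cf` absorbs the free term. -/
theorem BD.picard [FiniteDimensional ℝ F] {f : ℝ → F → ℝ} {g : F → ℝ} (hT : 0 ≤ T)
    (ha : ∀ j ∈ J, TB T (a j)) (hf : TB T f) (hg : SB g) {N : ℕ} {Ca Cf Cg R : ℝ} (hR : 1 ≤ R)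
    (hA : ∀ j ∈ J, ‖A j‖ ≤ R) (hCa : ∀ j ∈ J, ∀ t ∈ Icc 0 T, BD N Ca (a j t))
    (hCf : ∀ t ∈ Icc 0 T, BD N Cf (f t)) (hCg : BD N Cg g) (n : ℕ) {t : ℝ} (ht : t ∈ Icc 0 T) :
    BD N ((Cg + T * Cf) * Real.exp (J.card * 2 ^ N * Ca * R ^ N * t)) (picard J a A f g n t) := by
  have hf0 := (hCf 0 ⟨le_rfl, hT⟩).nonneg
  have hg0 := hCg.nonneg
  induction n generalizing t with
  | zero => exact (BD.const 0).mono (by rw [abs_zero]; positivity)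
  | succ n ih =>
    set C := (J.card * 2 ^ N * Ca * R ^ N : ℝ)
    have h1 := BD.intervalIntegral (TB.evolRHS ha hf (TB.picard hT ha hf hg n)).meas
      (C := fun s => C * ((Cg + T * Cf) * Real.exp (C * s)) + Cf) (by fun_prop)
      (fun s hs => BD.evolRHS hR hA (fun j hj => hCa j hj s hs) (hCf s hs) (ih hs)) ht
    refine (hCg.add h1).mono ?_
    have e1 : ∀ s, C * ((Cg + T * Cf) * Real.exp (C * s)) =
      (Cg + T * Cf) * (C * Real.exp (C * s)) := fun s => by ring
    rw [intervalIntegral.integral_add (Continuous.intervalIntegrable (by fun_prop) _ _)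
      (Continuous.intervalIntegrable (by fun_prop) _ _)]
    simp_rw [e1]
    rw [intervalIntegral.integral_const_mul, integral_exp_scaled]
    simp only [intervalIntegral.integral_const, sub_zero, smul_eq_mul]
    have : t * Cf ≤ T * Cf := mul_le_mul_of_nonneg_right ht.2 hf0
    linarith

theorem abs_picard_sub_le [FiniteDimensional ℝ F] {f : ℝ → F → ℝ} {g : F → ℝ} (hT : 0 ≤ T)
    (ha : ∀ j ∈ J, TB T (a j)) (hf : TB T f) (hg : SB g) {Ca B : ℝ}
    (hCa : ∀ j ∈ J, ∀ t ∈ Icc 0 T, ∀ z, |a j t z| ≤ Ca)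
    (hB : ∀ t ∈ Icc 0 T, ∀ z, |picard J a A f g 1 t z| ≤ B) (n : ℕ) {t : ℝ} (ht : t ∈ Icc 0 T)
    (z : F) : |picard J a A f g (n + 1) t z - picard J a A f g n t z| ≤
      B * ((J.card * Ca * t) ^ n / n.factorial) := by
  induction n generalizing t z with
  | zero => simpa [picard] using hB t ht z
  | succ n ih =>
    have hi : ∀ n, IntervalIntegrable (fun s => evolRHS J a A f (picard J a A f g n) s z)
        volume 0 t := fun n =>
      (TB.evolRHS ha hf (TB.picard hT ha hf hg n)).intervalIntegrable ht z
    have e : picard J a A f g (n + 1 + 1) t z - picard J a A f g (n + 1) t z =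
        ∫ s in (0 : ℝ)..t, (evolRHS J a A f (picard J a A f g (n + 1)) s z -
          evolRHS J a A f (picard J a A f g n) s z) := by
      rw [intervalIntegral.integral_sub (hi _) (hi _)]
      simp [picard]
    rw [e, ← Real.norm_eq_abs]
    set C := (J.card * Ca : ℝ)
    refine (intervalIntegral.norm_integral_le_of_norm_le ht.1
      (g := fun s => B * (C * ((C * s) ^ n / n.factorial))) ?_
      (Continuous.intervalIntegrable (by fun_prop) _ _)).trans (le_of_eq ?_)
    · refine Eventually.of_forall fun s hs => ?_
      have hs' : s ∈ Icc 0 T := ⟨hs.1.le, hs.2.trans ht.2⟩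
      have : evolRHS J a A f (picard J a A f g (n + 1)) s z -
          evolRHS J a A f (picard J a A f g n) s z = ∑ j ∈ J, a j s z *
            (picard J a A f g (n + 1) s (A j z) - picard J a A f g n s (A j z)) := by
        simp only [evolRHS, mul_sub, Finset.sum_sub_distrib]; ring
      rw [this, Real.norm_eq_abs]
      refine (Finset.abs_sum_le_sum_abs _ _).trans ?_
      calc _ ≤ ∑ j ∈ J, Ca * (B * ((C * s) ^ n / n.factorial)) := by
            refine Finset.sum_le_sum fun j hj => ?_
            rw [abs_mul]
            exact mul_le_mul (hCa j hj s hs' z) (ih hs' _) (abs_nonneg _)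
              ((abs_nonneg _).trans (hCa j hj s hs' z))
        _ = _ := by simp only [Finset.sum_const, nsmul_eq_mul]; ring
    · rw [intervalIntegral.integral_const_mul, integral_pow_factorial]

/-- The increments of the Picard iterates are bounded by `B (Ct)ⁿ/n!`, so they sum uniformly in
space. The last clause bounds the same solution at every order `N` by constants of order `N` only;
along mollified data these stay bounded at the order of regularity of the original data. -/
theorem exists_evolution_solution [FiniteDimensional ℝ F] {f : ℝ → F → ℝ} {g : F → ℝ}
    (hT : 0 ≤ T) (ha : ∀ j ∈ J, TB T (a j)) (hf : TB T f) (hg : SB g) :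
    ∃ u : ℝ → F → ℝ, TB T u ∧
      (∀ t ∈ Icc 0 T, ∀ z, u t z = g z + ∫ s in (0 : ℝ)..t, evolRHS J a A f u s z) ∧
      ∀ (N : ℕ) (Ca Cf Cg R : ℝ), 1 ≤ R → (∀ j ∈ J, ‖A j‖ ≤ R) →
        (∀ j ∈ J, ∀ t ∈ Icc 0 T, BD N Ca (a j t)) → (∀ t ∈ Icc 0 T, BD N Cf (f t)) → BD N Cg g →
        ∀ t ∈ Icc 0 T,
          BD N ((Cg + T * Cf) * Real.exp (J.card * 2 ^ N * Ca * R ^ N * t)) (u t) := by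
  classical
  have hTB := TB.picard (A := A) hT ha hf hg
  have h0T : (0 : ℝ) ∈ Icc 0 T := ⟨le_rfl, hT⟩
  obtain ⟨R, hR, hA⟩ : ∃ R : ℝ, 1 ≤ R ∧ ∀ j ∈ J, ‖A j‖ ≤ R :=
    ⟨1 + ∑ j ∈ J, ‖A j‖, by linarith [Finset.sum_nonneg fun j (_ : j ∈ J) => norm_nonneg (A j)],
      fun j hj => by
        have := Finset.single_le_sum (f := fun j => ‖A j‖) (fun j _ => norm_nonneg _) hj
        linarith⟩
  have hconst : ∀ N, ∃ C, ∀ j ∈ J, ∀ t ∈ Icc 0 T, BD N C (a j t) := by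
    intro N
    choose! C hC using fun j hj => (ha j hj).bd N
    refine ⟨∑ j ∈ J, |C j|, fun j hj t ht => (hC j hj t ht).mono ?_⟩
    exact (le_abs_self _).trans (Finset.single_le_sum (f := fun j => |C j|)
      (fun j _ => abs_nonneg _) hj)
  obtain ⟨Ca, hCa⟩ := hconst 0
  obtain ⟨B, hB⟩ := (hTB 1).bd 0
  have hstep := fun n t ht => abs_picard_sub_le (A := A) hT ha hf hg
    (fun j hj t ht z => (hCa j hj t ht).bound z) (fun t ht z => (hB t ht).bound z) n (t := t) ht
  have hB0 : 0 ≤ B := (hB 0 h0T).nonneg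
  have hunif : ∀ t ∈ Icc 0 T, TendstoUniformly (fun n => picard J a A f g n t)
      (fun z => ∑' n, (picard J a A f g (n + 1) t z - picard J a A f g n t z)) atTop := by
    intro t ht
    have hs : Summable fun n : ℕ => B * ((J.card * Ca * t) ^ n / n.factorial) :=
      (Real.summable_pow_div_factorial _).mul_left B
    have := tendstoUniformly_tsum_nat hs
      (f := fun n z => picard J a A f g (n + 1) t z - picard J a A f g n t z)
      fun n z => hstep n t ht z
    have e : (fun n => picard J a A f g n t) = fun N x => ∑ n ∈ Finset.range N,
        (picard J a A f g (n + 1) t x - picard J a A f g n t x) := by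
      funext n z
      rw [Finset.sum_range_sub (fun n => picard J a A f g n t z)]
      simp [picard]
    rw [e]
    exact this
  set u : ℝ → F → ℝ := fun t z =>
    ∑' n, (picard J a A f g (n + 1) t z - picard J a A f g n t z) with hu
  have hquant : ∀ (N : ℕ) (Ca Cf Cg R : ℝ), 1 ≤ R → (∀ j ∈ J, ‖A j‖ ≤ R) →
        (∀ j ∈ J, ∀ t ∈ Icc 0 T, BD N Ca (a j t)) → (∀ t ∈ Icc 0 T, BD N Cf (f t)) → BD N Cg g →
        ∀ t ∈ Icc 0 T,
          BD N ((Cg + T * Cf) * Real.exp (J.card * 2 ^ N * Ca * R ^ N * t)) (u t) := by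
    intro N Ca Cf Cg R hR hA hCa hCf hCg t ht
    obtain ⟨Ca', hCa'⟩ := hconst (N + 1)
    obtain ⟨Cf', hCf'⟩ := hf.bd (N + 1)
    obtain ⟨Cg', hCg'⟩ := hg (N + 1)
    -- The constants of order `N + 1` only guarantee that derivatives converge; the resulting bound
    -- uses those of order `N`.
    exact BD.of_tendstoUniformly_of_succ
      (fun n => BD.picard hT ha hf hg hR hA hCa' hCf' hCg' n ht)
      (fun n => BD.picard hT ha hf hg hR hA hCa hCf hCg n ht) (hunif t ht)
  have huTB : TB T u := by
    refine ⟨fun z => aestronglyMeasurable_of_tendsto_ae (u := atTop) (fun n => (hTB n).meas z) ?_,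
      fun N => ?_⟩
    · filter_upwards [ae_restrict_mem measurableSet_Icc] with t ht
      exact (hunif t ht).tendsto_at z
    · obtain ⟨Ca', hCa'⟩ := hconst N
      obtain ⟨Cf', hCf'⟩ := hf.bd N
      obtain ⟨Cg', hCg'⟩ := hg N
      have hCf0 := (hCf' 0 h0T).nonneg
      have hCg0 := hCg'.nonneg
      refine ⟨(Cg' + T * Cf') * Real.exp (J.card * 2 ^ N * |Ca'| * R ^ N * T), fun t ht =>
        (hquant N |Ca'| Cf' Cg' R hR hA (fun j hj t ht => (hCa' j hj t ht).mono (le_abs_self _))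
          hCf' hCg' t ht).mono ?_⟩
      gcongr
      exact ht.2
  refine ⟨u, huTB, fun t ht z => ?_, hquant⟩
  obtain ⟨Cf', hCf'⟩ := hf.bd 0
  obtain ⟨Cg', hCg'⟩ := hg 0
  have hCf0 := (hCf' 0 h0T).nonneg
  have hCg0 := hCg'.nonneg
  have hlim1 : Tendsto (fun n => picard J a A f g (n + 1) t z) atTop (𝓝 (u t z)) :=
    ((hunif t ht).tendsto_at z).comp (tendsto_add_atTop_nat 1)
  refine tendsto_nhds_unique hlim1 (tendsto_const_nhds.add ?_)
  set b : ℝ := (Cg' + T * Cf') * Real.exp (J.card * 2 ^ 0 * |Ca| * R ^ 0 * T)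
  refine intervalIntegral.tendsto_integral_filter_of_dominated_convergence
    (fun _ => J.card * 2 ^ 0 * |Ca| * R ^ 0 * b + Cf') ?_ ?_ (by simp) ?_
  · refine Eventually.of_forall fun n => ?_
    rw [uIoc_of_le ht.1]
    exact ((TB.evolRHS ha hf (hTB n)).meas z).mono_measure (restrict_Ioc_le ht)
  · refine Eventually.of_forall fun n => Eventually.of_forall fun s hs => ?_
    rw [uIoc_of_le ht.1] at hs
    have hs' : s ∈ Icc 0 T := ⟨hs.1.le, hs.2.trans ht.2⟩
    have h1 := BD.picard (A := A) hT ha hf hg (N := 0) hR hA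
      (fun j hj t ht => (hCa j hj t ht).mono (le_abs_self _)) hCf' hCg' n hs'
    have h2 := h1.mono (C' := b) (by
      simp only [b]
      gcongr
      exact hs'.2)
    exact (BD.evolRHS hR hA (fun j hj => (hCa j hj s hs').mono (le_abs_self _))
      (hCf' s hs') h2).bound z
  · refine Eventually.of_forall fun s hs => ?_
    rw [uIoc_of_le ht.1] at hs
    have hs' : s ∈ Icc 0 T := ⟨hs.1.le, hs.2.trans ht.2⟩
    exact (tendsto_finsetSum _ fun j _ => ((hunif s hs').tendsto_at _).const_mul _).add_const _

end Evolution

/-! ## Words -/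

/-- The words of length `n` over the alphabet `Λ`. -/
def words {β : Type*} (Λ : Finset β) : ℕ → Finset (List β)
  | 0 => {[]}
  | n + 1 => (Λ ×ˢ words Λ n).map ⟨fun z => z.1 :: z.2, fun a b h => by
      simp only [List.cons.injEq] at h; exact Prod.ext h.1 h.2⟩

theorem sum_words_zero {β M : Type*} [AddCommMonoid M] (Λ : Finset β) (f : List β → M) :
    ∑ w ∈ words Λ 0, f w = f [] := by simp [words]

theorem sum_words_succ {β M : Type*} [AddCommMonoid M] (Λ : Finset β) (n : ℕ) (f : List β → M) :
    ∑ w ∈ words Λ (n + 1), f w = ∑ μ ∈ Λ, ∑ w ∈ words Λ n, f (μ :: w) := by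
  simp [words, Finset.sum_product]
  rfl

theorem sum_words_add {β M : Type*} [AddCommMonoid M] (Λ : Finset β) (i j : ℕ) (f : List β → M) :
    ∑ w ∈ words Λ (i + j), f w = ∑ w ∈ words Λ i, ∑ w' ∈ words Λ j, f (w ++ w') := by
  induction i generalizing f with
  | zero => simp [sum_words_zero]
  | succ i ih =>
    rw [show i + 1 + j = (i + j) + 1 by ring, sum_words_succ, sum_words_succ]
    refine Finset.sum_congr rfl fun μ _ => ?_
    rw [ih]; simp

theorem mem_words {β : Type*} {Λ : Finset β} {n : ℕ} {w : List β} :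
    w ∈ words Λ n ↔ w.length = n ∧ ∀ μ ∈ w, μ ∈ Λ := by
  induction n generalizing w with
  | zero => cases w <;> simp [words]
  | succ n ih =>
    cases w with
    | nil => simp [words]
    | cons a w =>
      simp only [words, Finset.mem_map, Finset.mem_product, ih, Prod.exists]
      change (∃ b v, (b ∈ Λ ∧ v.length = n ∧ ∀ μ ∈ v, μ ∈ Λ) ∧ b :: v = a :: w) ↔ _
      constructor
      · rintro ⟨b, v, ⟨h1, h2, h3⟩, h4⟩
        simp only [List.cons.injEq] at h4
        obtain ⟨rfl, rfl⟩ := h4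
        exact ⟨by simp [h2], by simpa using ⟨h1, h3⟩⟩
      · rintro ⟨h1, h2⟩
        exact ⟨a, w, ⟨h2 a (by simp), by simpa using h1, fun μ hμ => h2 μ (by simp [hμ])⟩, rfl⟩

variable {d : ℕ}

theorem pderiv_eq_dd (i : Fin d) : pderiv (d := d) i = dd (EuclideanSpace.single i 1) := rfl

theorem dd_eq_sum_pderiv (κ : E d) (φ : E d → ℝ) (x : E d) :
    dd κ φ x = ∑ i, κ i * pderiv i φ x := by
  have : κ = ∑ i, κ i • EuclideanSpace.single i (1 : ℝ) := by
    ext j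
    simp [Finset.sum_apply, Pi.single_apply]
  simp only [dd]
  conv_lhs => rw [this]
  simp [pderiv]

theorem dd_sq_le (κ : E d) (φ : E d → ℝ) (x : E d) :
    dd κ φ x ^ 2 ≤ ‖κ‖ ^ 2 * ∑ i, pderiv i φ x ^ 2 := by
  rw [dd_eq_sum_pderiv, EuclideanSpace.real_norm_sq_eq]
  exact Finset.sum_mul_sq_le_sq_mul_sq _ _ _

theorem SB.fd {φ : E d → ℝ} (hφ : SB φ) (h : ℝ) (l : E d) : SB (fd h l φ) :=
  ((hφ.comp_add _).sub hφ).const_mul _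

theorem SB.pderiv {φ : E d → ℝ} (hφ : SB φ) (i : Fin d) : SB (pderiv i φ) := hφ.dd _

theorem dd_comp_add {φ : E d → ℝ} (hφ : SB φ) (e v : E d) :
    dd e (fun x => φ (x + v)) = fun x => dd e φ (x + v) :=
  dd_comp_affine (A := ContinuousLinearMap.id ℝ (E d)) (v := v) hφ.differentiable e

theorem dd_sub {φ ψ : E d → ℝ} (hφ : SB φ) (hψ : SB ψ) (e : E d) :
    dd e (fun x => φ x - ψ x) = fun x => dd e φ x - dd e ψ x := by
  funext x
  simp only [dd]
  rw [fderiv_fun_sub (hφ.differentiable x) (hψ.differentiable x)]; rfl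

theorem dd_fd {φ : E d → ℝ} (hφ : SB φ) (e : E d) (h : ℝ) (l : E d) :
    dd e (fd h l φ) = fd h l (dd e φ) := by
  have : fd h l φ = fun x => h⁻¹ * (φ (x + h • l) - φ x) := rfl
  rw [this, dd_const_mul, dd_sub (hφ.comp_add _) hφ, dd_comp_add hφ]
  rfl

/-! ### Difference and differential operators along words. -/

namespace Scheme

variable (S : Scheme d) (τ₀ h : ℝ)

/-- The translation vector of `T_{h,μ}`. -/
def shiftVec (h : ℝ) : E d ⊕ Fin d → E d
  | .inl l => h • l
  | .inr _ => 0

theorem shift_eq (μ : E d ⊕ Fin d) (φ : E d → ℝ) :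
    shift h μ φ = fun x => φ (x + shiftVec h μ) := by
  cases μ <;> simp [shift, shiftVec]

/-- The composition of the operators `\bar δ` along a word. -/
def wD : List (E d ⊕ Fin d) → (E d → ℝ) → E d → ℝ
  | [], φ => φ
  | μ :: w, φ => S.dbar τ₀ h μ (wD w φ)

/-- The total translation of a word. -/
def wshift (h : ℝ) : List (E d ⊕ Fin d) → E d
  | [] => 0
  | μ :: w => shiftVec h μ + wshift h w

/-- `∑_{w ∈ Λⁿ} |\bar δ_w φ|²`. -/
def sq (n : ℕ) (φ : E d → ℝ) (x : E d) : ℝ := ∑ w ∈ words S.Λ n, (S.wD τ₀ h w φ x) ^ 2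

variable {S τ₀ h}

theorem sq_nonneg (n : ℕ) (φ : E d → ℝ) (x : E d) : 0 ≤ S.sq τ₀ h n φ x :=
  Finset.sum_nonneg fun _ _ => _root_.sq_nonneg _

theorem sb_dbar {φ : E d → ℝ} (hφ : SB φ) (μ : E d ⊕ Fin d) : SB (S.dbar τ₀ h μ φ) := by
  cases μ with
  | inl l => exact (hφ.fd h l).const_mul _
  | inr i => exact (hφ.pderiv i).const_mul _

theorem sb_wD {φ : E d → ℝ} (hφ : SB φ) (w : List (E d ⊕ Fin d)) : SB (S.wD τ₀ h w φ) := by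
  induction w with
  | nil => exact hφ
  | cons μ w ih => exact sb_dbar ih μ

theorem dbar_add {φ ψ : E d → ℝ} (hφ : SB φ) (hψ : SB ψ) (μ : E d ⊕ Fin d) :
    S.dbar τ₀ h μ (fun x => φ x + ψ x) = fun x => S.dbar τ₀ h μ φ x + S.dbar τ₀ h μ ψ x := by
  funext x
  cases μ with
  | inl l => simp only [dbar, fd]; ring
  | inr i => simp only [dbar, pderiv_eq_dd, dd_add hφ.differentiable hψ.differentiable]; ring

theorem dbar_const_mul {φ : E d → ℝ} (a : ℝ) (μ : E d ⊕ Fin d) :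
    S.dbar τ₀ h μ (fun x => a * φ x) = fun x => a * S.dbar τ₀ h μ φ x := by
  funext x
  cases μ with
  | inl l => simp only [dbar, fd]; ring
  | inr i => simp only [dbar, pderiv_eq_dd, dd_const_mul]; ring

theorem dbar_comp_add {φ : E d → ℝ} (hφ : SB φ) (v : E d) (μ : E d ⊕ Fin d) :
    S.dbar τ₀ h μ (fun x => φ (x + v)) = fun x => S.dbar τ₀ h μ φ (x + v) := by
  funext x
  cases μ with
  | inl l => simp only [dbar, fd, add_right_comm]
  | inr i => simp only [dbar, pderiv_eq_dd, dd_comp_add hφ]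

/-- Difference quotients and derivatives obey the same product rule once the second factor is
translated by `shiftVec`, which is zero for derivatives. Both kinds of letters can therefore be
treated together. -/
theorem dbar_mul {φ ψ : E d → ℝ} (hφ : SB φ) (hψ : SB ψ) (μ : E d ⊕ Fin d) :
    S.dbar τ₀ h μ (fun x => φ x * ψ x) =
      fun x => φ x * S.dbar τ₀ h μ ψ x + S.dbar τ₀ h μ φ x * ψ (x + shiftVec h μ) := by
  funext x
  cases μ with
  | inl l => simp only [dbar, fd, shiftVec]; ring
  | inr i =>
    simp only [dbar, pderiv_eq_dd, dd_mul hφ.differentiable hψ.differentiable, shiftVec, add_zero]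
    ring

theorem dbar_dd {φ : E d → ℝ} (hφ : SB φ) (e : E d) (μ : E d ⊕ Fin d) :
    S.dbar τ₀ h μ (dd e φ) = dd e (S.dbar τ₀ h μ φ) := by
  cases μ with
  | inl l =>
    have : S.dbar τ₀ h (.inl l) φ = fun x => S.τ l * fd h l φ x := rfl
    rw [this, dd_const_mul, dd_fd hφ]; rfl
  | inr i =>
    have : S.dbar τ₀ h (.inr i) φ = fun x => τ₀ * pderiv i φ x := rfl
    rw [this, dd_const_mul, pderiv_eq_dd, hφ.dd_comm]; rfl

theorem dbar_comm {φ : E d → ℝ} (hφ : SB φ) (μ ν : E d ⊕ Fin d) :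
    S.dbar τ₀ h μ (S.dbar τ₀ h ν φ) = S.dbar τ₀ h ν (S.dbar τ₀ h μ φ) := by
  cases ν with
  | inr i =>
    have e : ∀ ψ : E d → ℝ, S.dbar τ₀ h (.inr i) ψ =
        fun x => τ₀ * dd (EuclideanSpace.single i 1) ψ x := fun _ => rfl
    rw [e, e, dbar_const_mul, dbar_dd hφ]
  | inl l =>
    have e : ∀ ψ : E d → ℝ, S.dbar τ₀ h (.inl l) ψ =
        fun x => (S.τ l * h⁻¹) * (ψ (x + h • l) + (-1) * ψ x) := fun ψ => by
      funext x; simp only [dbar, fd]; ring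
    rw [e, e, dbar_const_mul, dbar_add (hφ.comp_add _) (hφ.const_mul _), dbar_comp_add hφ,
      dbar_const_mul]

theorem wD_append (w w' : List (E d ⊕ Fin d)) (φ : E d → ℝ) :
    S.wD τ₀ h (w ++ w') φ = S.wD τ₀ h w (S.wD τ₀ h w' φ) := by
  induction w with
  | nil => rfl
  | cons μ w ih => simp [wD, ih]

theorem dbar_wD {φ : E d → ℝ} (hφ : SB φ) (μ : E d ⊕ Fin d) (w : List (E d ⊕ Fin d)) :
    S.dbar τ₀ h μ (S.wD τ₀ h w φ) = S.wD τ₀ h w (S.dbar τ₀ h μ φ) := by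
  induction w with
  | nil => rfl
  | cons ν w ih =>
    simp only [wD]
    rw [dbar_comm (sb_wD hφ w), ih]

theorem wD_add {φ ψ : E d → ℝ} (hφ : SB φ) (hψ : SB ψ) (w : List (E d ⊕ Fin d)) :
    S.wD τ₀ h w (fun x => φ x + ψ x) = fun x => S.wD τ₀ h w φ x + S.wD τ₀ h w ψ x := by
  induction w with
  | nil => rfl
  | cons μ w ih =>
    simp only [wD]
    rw [ih, dbar_add (sb_wD hφ w) (sb_wD hψ w)]

theorem wD_const_mul {φ : E d → ℝ} (a : ℝ) (w : List (E d ⊕ Fin d)) :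
    S.wD τ₀ h w (fun x => a * φ x) = fun x => a * S.wD τ₀ h w φ x := by
  induction w with
  | nil => rfl
  | cons μ w ih => simp only [wD]; rw [ih, dbar_const_mul]

theorem wD_zero (w : List (E d ⊕ Fin d)) : S.wD τ₀ h w (fun _ => 0) = fun _ => 0 := by
  have := wD_const_mul (S := S) (τ₀ := τ₀) (h := h) (φ := fun _ => 0) 0 w
  simpa using this

theorem wD_sum {ι : Type*} (s : Finset ι) {φ : ι → E d → ℝ} (hφ : ∀ i ∈ s, SB (φ i))
    (w : List (E d ⊕ Fin d)) :
    S.wD τ₀ h w (fun x => ∑ i ∈ s, φ i x) = fun x => ∑ i ∈ s, S.wD τ₀ h w (φ i) x := by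
  classical
  induction s using Finset.induction_on with
  | empty => simp [wD_zero]
  | insert a s ha ih =>
    simp only [Finset.sum_insert ha]
    have h2 : ∀ i ∈ s, SB (φ i) := fun i hi => hφ i (by simp [hi])
    rw [wD_add (hφ a (by simp)) (SB.sum s h2), ih h2]

theorem wD_dd {φ : E d → ℝ} (hφ : SB φ) (e : E d) (w : List (E d ⊕ Fin d)) :
    S.wD τ₀ h w (dd e φ) = dd e (S.wD τ₀ h w φ) := by
  induction w with
  | nil => rfl
  | cons μ w ih => simp only [wD]; rw [ih, dbar_dd (sb_wD hφ w)]

theorem wD_iterate_dd {φ : E d → ℝ} (hφ : SB φ) (e : E d) (l : ℕ) (w : List (E d ⊕ Fin d)) :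
    S.wD τ₀ h w ((dd e)^[l] φ) = (dd e)^[l] (S.wD τ₀ h w φ) := by
  induction l generalizing φ with
  | zero => rfl
  | succ l ih => simp only [Function.iterate_succ_apply]; rw [ih (hφ.dd e), wD_dd hφ]

theorem sq_succ {φ : E d → ℝ} (hφ : SB φ) (n : ℕ) (x : E d) :
    S.sq τ₀ h (n + 1) φ x = ∑ μ ∈ S.Λ, S.sq τ₀ h n (S.dbar τ₀ h μ φ) x := by
  simp only [sq, sum_words_succ]
  refine Finset.sum_congr rfl fun μ _ => Finset.sum_congr rfl fun w _ => ?_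
  rw [wD, dbar_wD hφ]

/-! ## The Leibniz rule -/

variable (S τ₀ h) in
/-- The terms of the Leibniz rule. -/
def leibnizTerm (i k : ℕ) (w a ψ : E d → ℝ) (x : E d) : ℝ :=
  ∑ ν ∈ words S.Λ k, ∑ l ∈ words S.Λ i, S.wD τ₀ h l (S.wD τ₀ h ν w) x *
    (S.wD τ₀ h l a x * S.wD τ₀ h ν ψ (x + wshift h l))

theorem sum_leibnizTerm {w ψ : E d → ℝ} (hw : SB w) (hψ : SB ψ) (i k : ℕ) (a : E d → ℝ)
    (x : E d) :
    ∑ μ ∈ S.Λ, S.leibnizTerm τ₀ h i k (S.dbar τ₀ h μ w) a (S.dbar τ₀ h μ ψ) x =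
      S.leibnizTerm τ₀ h i (k + 1) w a ψ x := by
  simp only [leibnizTerm, sum_words_succ]
  refine Finset.sum_congr rfl fun μ _ => Finset.sum_congr rfl fun ν _ => ?_
  simp only [wD, dbar_wD hw, dbar_wD hψ]

/-- The statement starts with `i` letters already on `a` so that induction on `n` closes. A new
letter falls either on `ψ`, which replaces `w` and `ψ` by their `\bar δ_μ`, or on `a`, which raises
`i`; Pascal's rule recombines the two. Summing over all words, with the commuting operators tested
against the same words on `w`, makes the order of the letters irrelevant. -/
theorem leibniz_aux {w a ψ : E d → ℝ} (hw : SB w) (ha : SB a) (hψ : SB ψ) (i n : ℕ) (x : E d) :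
    ∑ l ∈ words S.Λ i, ∑ ρ ∈ words S.Λ n, S.wD τ₀ h ρ (S.wD τ₀ h l w) x *
      S.wD τ₀ h ρ (fun y => S.wD τ₀ h l a y * ψ (y + wshift h l)) x =
    ∑ jk ∈ Finset.HasAntidiagonal.antidiagonal n, (n.choose jk.1 : ℝ) *
      S.leibnizTerm τ₀ h (i + jk.1) jk.2 w a ψ x := by
  induction n generalizing i w ψ with
  | zero => simp [sum_words_zero, leibnizTerm, wD]
  | succ n ih =>
    rw [Finset.sum_antidiagonal_choose_succ_mul
      (fun j k => S.leibnizTerm τ₀ h (i + j) k w a ψ x)]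
    have e2 : ∑ jk ∈ Finset.HasAntidiagonal.antidiagonal n, (n.choose jk.2 : ℝ) *
        S.leibnizTerm τ₀ h (i + (jk.1 + 1)) jk.2 w a ψ x =
        ∑ jk ∈ Finset.HasAntidiagonal.antidiagonal n, (n.choose jk.1 : ℝ) *
        S.leibnizTerm τ₀ h (i + 1 + jk.1) jk.2 w a ψ x := by
      refine Finset.sum_congr rfl fun jk hjk => ?_
      rw [Finset.HasAntidiagonal.mem_antidiagonal] at hjk
      rw [← Nat.choose_symm_of_eq_add hjk.symm, show i + (jk.1 + 1) = i + 1 + jk.1 by ring]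
    have e1 : ∑ jk ∈ Finset.HasAntidiagonal.antidiagonal n, (n.choose jk.1 : ℝ) *
        S.leibnizTerm τ₀ h (i + jk.1) (jk.2 + 1) w a ψ x =
        ∑ μ ∈ S.Λ, ∑ jk ∈ Finset.HasAntidiagonal.antidiagonal n, (n.choose jk.1 : ℝ) *
          S.leibnizTerm τ₀ h (i + jk.1) jk.2 (S.dbar τ₀ h μ w) a (S.dbar τ₀ h μ ψ) x := by
      rw [Finset.sum_comm]
      refine Finset.sum_congr rfl fun jk _ => ?_
      rw [← Finset.mul_sum, sum_leibnizTerm hw hψ]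
    rw [e1, e2, ← ih hw hψ (i + 1)]
    simp only [← ih (sb_dbar hw _) (sb_dbar hψ _) i]
    rw [sum_words_succ, ← Finset.sum_add_distrib]
    simp only [sum_words_succ]
    rw [Finset.sum_comm]
    refine Finset.sum_congr rfl fun μ _ => ?_
    rw [← Finset.sum_add_distrib]
    refine Finset.sum_congr rfl fun l _ => ?_
    rw [← Finset.sum_add_distrib]
    refine Finset.sum_congr rfl fun ρ _ => ?_
    have hs1 : SB (fun y => S.wD τ₀ h l a y) := sb_wD ha l
    have hs2 : SB (fun y => ψ (y + wshift h l)) := hψ.comp_add _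
    have hs3 : SB (fun y => S.dbar τ₀ h μ ψ (y + wshift h l)) := (sb_dbar hψ μ).comp_add _
    have hs4 : SB (fun y => S.dbar τ₀ h μ (S.wD τ₀ h l a) y) := sb_dbar hs1 μ
    -- The two possible destinations of the letter `μ`: the factor `ψ`, or `a`, in which case `ψ`
    -- picks up the extra translation by `shiftVec h μ`.
    have e3 : S.wD τ₀ h (μ :: ρ) (fun y => S.wD τ₀ h l a y * ψ (y + wshift h l)) x =
        S.wD τ₀ h ρ (fun y => S.wD τ₀ h l a y * S.dbar τ₀ h μ ψ (y + wshift h l)) x +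
        S.wD τ₀ h ρ (fun y => S.wD τ₀ h (μ :: l) a y * ψ (y + wshift h (μ :: l))) x := by
      rw [wD, dbar_wD (hs1.mul hs2), dbar_mul hs1 hs2, dbar_comp_add hψ]
      have e4 : (fun y => S.wD τ₀ h (μ :: l) a y * ψ (y + wshift h (μ :: l))) =
          fun x => S.dbar τ₀ h μ (fun y => S.wD τ₀ h l a y) x *
            ψ (x + shiftVec h μ + wshift h l) := by
        funext y
        simp only [wD, wshift, add_assoc]
      rw [e4, wD_add (hs1.mul hs3) (hs4.mul ((hψ.comp_add _).comp_add (shiftVec h μ)))]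
    rw [e3, ← dbar_wD hw μ l, wD, ← dbar_wD (sb_wD hw l), mul_add]
    congr 1
    simp only [wD]
    rw [dbar_wD (sb_wD hw l)]

theorem leibniz {w a ψ : E d → ℝ} (hw : SB w) (ha : SB a) (hψ : SB ψ) (n : ℕ) (x : E d) :
    ∑ ρ ∈ words S.Λ n, S.wD τ₀ h ρ w x * S.wD τ₀ h ρ (fun y => a y * ψ y) x =
    ∑ jk ∈ Finset.HasAntidiagonal.antidiagonal n, (n.choose jk.1 : ℝ) *
      S.leibnizTerm τ₀ h jk.1 jk.2 w a ψ x := by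
  have := leibniz_aux (S := S) (τ₀ := τ₀) (h := h) hw ha hψ 0 n x
  simpa [sum_words_zero, wD, wshift] using this

end Scheme

/-! ## Cauchy–Schwarz inequalities -/

/-- Cauchy–Schwarz is applied twice, first in `k` and then in the pair `(ν, l)`, which keeps the
cardinalities of all three index sets out of the bound. -/
theorem abs_sum_mul_sum_le {ι ι' κ : Type*} (P : Finset ι) (Q : Finset ι') (R : Finset κ)
    (X : ι → ι' → ℝ) (a : κ → ι' → ℝ) (Y : κ → ι' → ι → ℝ) {X0 A B : ℝ}
    (hX0 : 0 ≤ X0) (hA0 : 0 ≤ A) (hB0 : 0 ≤ B)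
    (hX : ∑ ν ∈ P, ∑ l ∈ Q, X ν l ^ 2 ≤ X0 ^ 2) (ha : ∑ l ∈ Q, ∑ k ∈ R, a k l ^ 2 ≤ A ^ 2)
    (hY : ∀ l ∈ Q, ∑ ν ∈ P, ∑ k ∈ R, Y k l ν ^ 2 ≤ B ^ 2) :
    |∑ ν ∈ P, ∑ l ∈ Q, X ν l * ∑ k ∈ R, a k l * Y k l ν| ≤ X0 * (A * B) := by
  have h1 : ∑ ν ∈ P, ∑ l ∈ Q, (∑ k ∈ R, a k l * Y k l ν) ^ 2 ≤ (A * B) ^ 2 := by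
    calc _ ≤ ∑ ν ∈ P, ∑ l ∈ Q, (∑ k ∈ R, a k l ^ 2) * ∑ k ∈ R, Y k l ν ^ 2 :=
          Finset.sum_le_sum fun ν _ => Finset.sum_le_sum fun l _ =>
            Finset.sum_mul_sq_le_sq_mul_sq _ _ _
      _ = ∑ l ∈ Q, (∑ k ∈ R, a k l ^ 2) * ∑ ν ∈ P, ∑ k ∈ R, Y k l ν ^ 2 := by
          rw [Finset.sum_comm]; simp only [Finset.mul_sum]
      _ ≤ ∑ l ∈ Q, (∑ k ∈ R, a k l ^ 2) * B ^ 2 :=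
          Finset.sum_le_sum fun l hl => mul_le_mul_of_nonneg_left (hY l hl)
            (Finset.sum_nonneg fun _ _ => sq_nonneg _)
      _ ≤ A ^ 2 * B ^ 2 := by
          rw [← Finset.sum_mul]; exact mul_le_mul_of_nonneg_right ha (sq_nonneg _)
      _ = _ := by ring
  refine abs_le_of_sq_le_sq ?_ (by positivity)
  rw [← Finset.sum_product']
  refine (Finset.sum_mul_sq_le_sq_mul_sq _ _ _).trans ?_
  rw [Finset.sum_product' P Q (fun ν l => X ν l ^ 2),
    Finset.sum_product' P Q (fun ν l => (∑ k ∈ R, a k l * Y k l ν) ^ 2), mul_pow]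
  exact mul_le_mul hX h1 (Finset.sum_nonneg fun _ _ => Finset.sum_nonneg fun _ _ => sq_nonneg _)
    (sq_nonneg _)

/-- The closing step of the duality arguments below: a sum of squares is estimated by pairing the
vector with itself. -/
theorem le_of_sq_le_mul_sqrt {s B : ℝ} (hB : 0 ≤ B) (h : s ≤ √s * B) : s ≤ B ^ 2 := by
  by_cases hs : s ≤ 0
  · exact hs.trans (sq_nonneg _)
  · push Not at hs
    have h1 : 0 < √s := Real.sqrt_pos.mpr hs
    have h2 : √s * √s = s := Real.mul_self_sqrt hs.le
    have : √s ≤ B := by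
      by_contra! hc
      nlinarith
    nlinarith

/-! ## Averages along segments -/

/-- `∫_0^1 w(θ) ∂_κ^l φ(x + θhκ) dθ`. -/
def segAvg (h : ℝ) (w : ℝ → ℝ) (l : ℕ) (κ : E d) (φ : E d → ℝ) (x : E d) : ℝ :=
  ∫ θ in (0 : ℝ)..1, w θ * ((dd κ)^[l] φ) (x + (θ * h) • κ)

theorem tb_segment {w : ℝ → ℝ} (hw : Continuous w) {φ : E d → ℝ} (hφ : SB φ) (h : ℝ) (κ : E d) :
    TB 1 (fun θ x => w θ * φ (x + (θ * h) • κ)) := by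
  refine ⟨fun z => (Continuous.aestronglyMeasurable ?_), fun N => ?_⟩
  · exact hw.mul (hφ.continuous.comp (by fun_prop))
  · obtain ⟨C, hC⟩ := hφ N
    obtain ⟨b, hb⟩ := isCompact_Icc.exists_bound_of_continuousOn (s := Icc (0 : ℝ) 1)
      hw.continuousOn
    refine ⟨b * C, fun θ hθ => ?_⟩
    have h1 := (hC.comp_affine (ContinuousLinearMap.id ℝ (E d)) ((θ * h) • κ) (R := 1)
      ContinuousLinearMap.norm_id_le le_rfl).const_mul (w θ)
    refine h1.mono ?_
    rw [one_pow, one_mul]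
    exact mul_le_mul_of_nonneg_right (hb θ hθ) hC.nonneg

theorem SB.segAvg {w : ℝ → ℝ} (hw : Continuous w) {φ : E d → ℝ} (hφ : SB φ) (h : ℝ) (l : ℕ)
    (κ : E d) : SB (segAvg h w l κ φ) :=
  ((tb_segment hw (hφ.iterate_dd κ l) h κ).primitive zero_le_one).sb
    (show (1 : ℝ) ∈ Icc 0 1 by simp)

theorem segAvg_comp_add {w : ℝ → ℝ} {φ : E d → ℝ} (h : ℝ) (l : ℕ) (κ v x : E d) :
    segAvg h w l κ φ (x + v) =
      ∫ θ in (0 : ℝ)..1, w θ * ((dd κ)^[l] φ) (x + (θ * h) • κ + v) := by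
  simp only [segAvg, add_right_comm]

theorem dd_segAvg {w : ℝ → ℝ} (hw : Continuous w) {φ : E d → ℝ} (hφ : SB φ) (h : ℝ) (l : ℕ)
    (κ e : E d) : dd e (segAvg h w l κ φ) = segAvg h w l κ (dd e φ) := by
  have h1 := (tb_segment hw (hφ.iterate_dd κ l) h κ).dd_intervalIntegral
    (show (1 : ℝ) ∈ Icc 0 1 by simp) e
  have h2 : segAvg h w l κ φ =
      fun x => ∫ θ in (0 : ℝ)..1, w θ * ((dd κ)^[l] φ) (x + (θ * h) • κ) := rfl
  have h3 : dd e ((dd κ)^[l] φ) = (dd κ)^[l] (dd e φ) := by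
    clear h1 h2
    induction l generalizing φ with
    | zero => rfl
    | succ l ih => simp only [Function.iterate_succ_apply]; rw [ih (hφ.dd κ), hφ.dd_comm]
  rw [h2, h1]
  funext x
  simp only [segAvg]
  congr 1
  funext θ
  rw [dd_const_mul, dd_comp_add (hφ.iterate_dd κ l), h3]

theorem continuous_segment {φ : E d → ℝ} (hφ : SB φ) {w : ℝ → ℝ} (hw : Continuous w) (h : ℝ)
    (κ x : E d) : Continuous fun θ : ℝ => w θ * φ (x + (θ * h) • κ) :=
  hw.mul (hφ.continuous.comp (by fun_prop))

theorem segAvg_add {w : ℝ → ℝ} (hw : Continuous w) {φ ψ : E d → ℝ} (hφ : SB φ) (hψ : SB ψ)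
    (h : ℝ) (l : ℕ) (κ : E d) :
    segAvg h w l κ (fun x => φ x + ψ x) = fun x => segAvg h w l κ φ x + segAvg h w l κ ψ x := by
  funext x
  have h3 : (dd κ)^[l] (fun x => φ x + ψ x) =
      fun x => ((dd κ)^[l] φ) x + ((dd κ)^[l] ψ) x := by
    induction l generalizing φ ψ with
    | zero => rfl
    | succ l ih =>
      simp only [Function.iterate_succ_apply]
      rw [dd_add hφ.differentiable hψ.differentiable, ih (hφ.dd κ) (hψ.dd κ)]
  simp only [segAvg]
  rw [h3, ← intervalIntegral.integral_add
    ((continuous_segment (hφ.iterate_dd κ l) hw h κ x).intervalIntegrable _ _)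
    ((continuous_segment (hψ.iterate_dd κ l) hw h κ x).intervalIntegrable _ _)]
  simp only [mul_add]

theorem segAvg_const_mul {w : ℝ → ℝ} {φ : E d → ℝ} (h : ℝ) (l : ℕ) (κ : E d) (a : ℝ) :
    segAvg h w l κ (fun x => a * φ x) = fun x => a * segAvg h w l κ φ x := by
  funext x
  have h3 : (dd κ)^[l] (fun x => a * φ x) = fun x => a * ((dd κ)^[l] φ) x := by
    induction l generalizing φ with
    | zero => rfl
    | succ l ih => simp only [Function.iterate_succ_apply]; rw [dd_const_mul, ih]
  simp only [segAvg]
  rw [h3, ← intervalIntegral.integral_const_mul]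
  congr 1; funext θ; ring

theorem segAvg_comp_add' {w : ℝ → ℝ} {φ : E d → ℝ} (hφ : SB φ) (h : ℝ) (l : ℕ) (κ v : E d) :
    segAvg h w l κ (fun x => φ (x + v)) = fun x => segAvg h w l κ φ (x + v) := by
  have h3 : (dd κ)^[l] (fun x => φ (x + v)) = fun x => ((dd κ)^[l] φ) (x + v) := by
    induction l generalizing φ with
    | zero => rfl
    | succ l ih =>
      simp only [Function.iterate_succ_apply]; rw [dd_comp_add hφ, ih (hφ.dd κ)]
  funext x
  rw [segAvg_comp_add]
  simp only [segAvg, h3]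

/-- `δ_{h,κ}` as an average of first derivatives. -/
theorem fd_eq_segAvg {φ : E d → ℝ} (hφ : SB φ) {h : ℝ} (hh : h ≠ 0) (κ x : E d) :
    fd h κ φ x = segAvg h (fun _ => 1) 1 κ φ x := by
  have hd : ∀ θ ∈ uIcc (0 : ℝ) 1, HasDerivAt (fun θ : ℝ => h⁻¹ * φ (x + (θ * h) • κ))
      (1 * ((dd κ)^[1] φ) (x + (θ * h) • κ)) θ := by
    intro θ _
    have h1 : HasDerivAt (fun θ : ℝ => x + (θ * h) • κ) (h • κ) θ := by
      have := (((hasDerivAt_id θ).mul_const h).smul_const κ).const_add x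
      simpa using this
    have h2 := ((hφ.differentiable _).hasFDerivAt.comp_hasDerivAt θ h1).const_mul h⁻¹
    convert! h2 using 1
    simp [dd, hh]
  have := intervalIntegral.integral_eq_sub_of_hasDerivAt hd
    ((continuous_segment (hφ.iterate_dd κ 1) continuous_const h κ x).intervalIntegrable _ _)
  simp only [segAvg]
  rw [this]
  simp only [fd]
  simp
  ring

/-- The second order Taylor remainder as an average of second derivatives. -/
theorem fd_sub_dd_eq_segAvg {φ : E d → ℝ} (hφ : SB φ) {h : ℝ} (hh : h ≠ 0) (κ x : E d) :
    h⁻¹ * fd h κ φ x = segAvg h (fun θ => 1 - θ) 2 κ φ x + h⁻¹ * dd κ φ x := by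
  have hd : ∀ θ ∈ uIcc (0 : ℝ) 1,
      HasDerivAt (fun θ : ℝ => h⁻¹ * ((1 - θ) * dd κ φ (x + (θ * h) • κ)))
      ((1 - θ) * ((dd κ)^[2] φ) (x + (θ * h) • κ) -
        h⁻¹ * (1 * ((dd κ)^[1] φ) (x + (θ * h) • κ))) θ := by
    intro θ _
    have h1 : HasDerivAt (fun θ : ℝ => x + (θ * h) • κ) (h • κ) θ := by
      have := (((hasDerivAt_id θ).mul_const h).smul_const κ).const_add x
      simpa using this
    have h2 := ((hφ.dd κ).differentiable _).hasFDerivAt.comp_hasDerivAt θ h1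
    have h3 := ((((hasDerivAt_id θ).const_sub 1).mul h2)).const_mul h⁻¹
    convert! h3 using 1
    simp [dd]
    field_simp
    ring
  have c1 := (continuous_segment (hφ.iterate_dd κ 2) (w := fun θ => 1 - θ) (by fun_prop)
    h κ x).intervalIntegrable (μ := volume) 0 1
  have c2 := ((continuous_segment (hφ.iterate_dd κ 1) (w := fun _ => 1) continuous_const
    h κ x).const_mul h⁻¹).intervalIntegrable (μ := volume) 0 1
  have := intervalIntegral.integral_eq_sub_of_hasDerivAt hd (c1.sub c2)
  rw [intervalIntegral.integral_sub c1 c2, intervalIntegral.integral_const_mul] at this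
  rw [fd_eq_segAvg hφ hh]
  simp only [segAvg]
  simp at this ⊢
  linarith

/-- Minkowski's inequality in Euclidean form: the vector of averages is paired with itself, the sum
is moved under the integral, and Cauchy–Schwarz is applied for each `θ`. The number of components
does not enter. -/
theorem segAvg_sq_le {ι : Type*} (s : Finset ι) {φ : ι → E d → ℝ} (hφ : ∀ i ∈ s, SB (φ i))
    {w : ℝ → ℝ} (hw : Continuous w) (hw1 : ∀ θ ∈ Icc (0 : ℝ) 1, |w θ| ≤ 1) {B : ℝ} (hB : 0 ≤ B)
    {κ : E d} {l : ℕ} (h : ℝ) (hb : ∀ y, ∑ i ∈ s, ((dd κ)^[l] (φ i) y) ^ 2 ≤ B ^ 2) (x : E d) :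
    ∑ i ∈ s, segAvg h w l κ (φ i) x ^ 2 ≤ B ^ 2 := by
  set c : ι → ℝ := fun i => segAvg h w l κ (φ i) x with hc
  refine le_of_sq_le_mul_sqrt hB ?_
  have hcont : ∀ i ∈ s, Continuous fun θ : ℝ => w θ * ((dd κ)^[l] (φ i)) (x + (θ * h) • κ) :=
    fun i hi => continuous_segment ((hφ i hi).iterate_dd κ l) hw h κ x
  have e : ∑ i ∈ s, c i ^ 2 = ∫ θ in (0 : ℝ)..1,
      ∑ i ∈ s, c i * (w θ * ((dd κ)^[l] (φ i)) (x + (θ * h) • κ)) := by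
    rw [intervalIntegral.integral_finsetSum fun i hi =>
      ((hcont i hi).const_mul (c i)).intervalIntegrable _ _]
    refine Finset.sum_congr rfl fun i _ => ?_
    rw [intervalIntegral.integral_const_mul, sq]
    rfl
  rw [e]
  refine (le_abs_self _).trans ?_
  rw [← Real.norm_eq_abs]
  have hle : ∀ θ ∈ Ioc (0 : ℝ) 1,
      ‖∑ i ∈ s, c i * (w θ * ((dd κ)^[l] (φ i)) (x + (θ * h) • κ))‖ ≤ √(∑ i ∈ s, c i ^ 2) * B := by
    intro θ hθ
    rw [Real.norm_eq_abs]
    refine abs_le_of_sq_le_sq ?_ (by positivity)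
    refine (Finset.sum_mul_sq_le_sq_mul_sq _ _ _).trans ?_
    rw [mul_pow, Real.sq_sqrt (Finset.sum_nonneg fun _ _ => sq_nonneg _)]
    refine mul_le_mul_of_nonneg_left ?_ (Finset.sum_nonneg fun _ _ => sq_nonneg _)
    refine le_trans (Finset.sum_le_sum fun i _ => ?_) (hb (x + (θ * h) • κ))
    rw [mul_pow]
    have : w θ ^ 2 ≤ 1 := by
      have := hw1 θ ⟨hθ.1.le, hθ.2⟩
      rw [← sq_abs]; nlinarith [abs_nonneg (w θ)]
    exact mul_le_of_le_one_left (sq_nonneg _) this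
  have := intervalIntegral.norm_integral_le_of_norm_le_const (a := 0) (b := 1)
    (C := √(∑ i ∈ s, c i ^ 2) * B) (f := fun θ =>
      ∑ i ∈ s, c i * (w θ * ((dd κ)^[l] (φ i)) (x + (θ * h) • κ)))
    (by rw [uIoc_of_le zero_le_one]; exact hle)
  rw [← e] at this ⊢
  simpa using this

/-! ### Averages along segments in the norms given by words. -/

namespace Scheme

variable {S : Scheme d} {τ₀ h : ℝ}

theorem dbar_segAvg {w : ℝ → ℝ} (hw : Continuous w) {φ : E d → ℝ} (hφ : SB φ) (η : ℝ) (l : ℕ)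
    (κ : E d) (μ : E d ⊕ Fin d) :
    S.dbar τ₀ h μ (segAvg η w l κ φ) = segAvg η w l κ (S.dbar τ₀ h μ φ) := by
  cases μ with
  | inr i =>
    have e : ∀ ψ : E d → ℝ, S.dbar τ₀ h (.inr i) ψ =
        fun x => τ₀ * dd (EuclideanSpace.single i 1) ψ x := fun _ => rfl
    rw [e, e, segAvg_const_mul, dd_segAvg hw hφ]
  | inl l' =>
    have e : ∀ ψ : E d → ℝ, S.dbar τ₀ h (.inl l') ψ =
        fun x => (S.τ l' * h⁻¹) * (ψ (x + h • l') + (-1) * ψ x) := fun ψ => by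
      funext x; simp only [dbar, fd]; ring
    rw [e, e, segAvg_const_mul, segAvg_add hw (hφ.comp_add _) (hφ.const_mul _),
      segAvg_const_mul, segAvg_comp_add' hφ]

theorem wD_segAvg {w : ℝ → ℝ} (hw : Continuous w) {φ : E d → ℝ} (hφ : SB φ) (η : ℝ) (l : ℕ)
    (κ : E d) (v : List (E d ⊕ Fin d)) :
    S.wD τ₀ h v (segAvg η w l κ φ) = segAvg η w l κ (S.wD τ₀ h v φ) := by
  induction v with
  | nil => rfl
  | cons μ v ih => simp only [wD]; rw [ih, dbar_segAvg hw (sb_wD hφ v)]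

/-- The letters from `Λ₂` alone dominate the gradient; this is the role of `τ₀ > 0`. -/
theorem sum_pderiv_sq_le (hτ : 0 < τ₀) (φ : E d → ℝ) (x : E d) :
    ∑ i, pderiv i φ x ^ 2 ≤ τ₀⁻¹ ^ 2 * ∑ μ ∈ S.Λ, S.dbar τ₀ h μ φ x ^ 2 := by
  have e : ∑ i, pderiv i φ x ^ 2 = τ₀⁻¹ ^ 2 * ∑ i : Fin d, S.dbar τ₀ h (.inr i) φ x ^ 2 := by
    rw [Finset.mul_sum]
    refine Finset.sum_congr rfl fun i _ => ?_
    simp only [dbar]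
    field_simp
  rw [e]
  refine mul_le_mul_of_nonneg_left ?_ (by positivity)
  rw [Λ, Finset.sum_disjSum]
  have : 0 ≤ ∑ l ∈ S.Λ₁, S.dbar τ₀ h (.inl l) φ x ^ 2 :=
    Finset.sum_nonneg fun _ _ => _root_.sq_nonneg _
  linarith

/-- Each `∂_κ` is traded for one more letter of the word at the price `‖κ‖/τ₀`. -/
theorem sum_iterate_dd_sq_le (hτ : 0 < τ₀) {φ : E d → ℝ} (hφ : SB φ) (κ : E d) (n l : ℕ)
    (y : E d) : ∑ ν ∈ words S.Λ n, ((dd κ)^[l] (S.wD τ₀ h ν φ) y) ^ 2 ≤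
      (‖κ‖ ^ 2 * τ₀⁻¹ ^ 2) ^ l * S.sq τ₀ h (n + l) φ y := by
  induction l generalizing n with
  | zero => simp [sq]
  | succ l ih =>
    have h1 : ∑ ν ∈ words S.Λ n, ((dd κ)^[l + 1] (S.wD τ₀ h ν φ) y) ^ 2 ≤
        ∑ ν ∈ words S.Λ n, ‖κ‖ ^ 2 * (τ₀⁻¹ ^ 2 *
          ∑ μ ∈ S.Λ, ((dd κ)^[l] (S.wD τ₀ h (μ :: ν) φ) y) ^ 2) := by
      refine Finset.sum_le_sum fun ν _ => ?_
      rw [Function.iterate_succ_apply']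
      refine (dd_sq_le κ _ y).trans (mul_le_mul_of_nonneg_left ?_ (by positivity))
      refine (sum_pderiv_sq_le (S := S) (h := h) hτ _ y).trans (le_of_eq ?_)
      congr 1
      refine Finset.sum_congr rfl fun μ _ => ?_
      have e1 := wD_iterate_dd (S := S) (τ₀ := τ₀) (h := h) (sb_wD (S := S) (τ₀ := τ₀) (h := h)
        hφ ν) κ l [μ]
      simp only [wD] at e1 ⊢
      rw [e1]
    refine h1.trans ?_
    rw [← Finset.mul_sum, ← Finset.mul_sum, Finset.sum_comm]
    have h2 := ih (n + 1)
    rw [sum_words_succ, show n + 1 + l = n + (l + 1) by ring] at h2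
    calc _ = (‖κ‖ ^ 2 * τ₀⁻¹ ^ 2) *
          (∑ μ ∈ S.Λ, ∑ ν ∈ words S.Λ n, ((dd κ)^[l] (S.wD τ₀ h (μ :: ν) φ) y) ^ 2) := by ring
      _ ≤ (‖κ‖ ^ 2 * τ₀⁻¹ ^ 2) * ((‖κ‖ ^ 2 * τ₀⁻¹ ^ 2) ^ l * S.sq τ₀ h (n + (l + 1)) φ y) :=
          mul_le_mul_of_nonneg_left h2 (by positivity)
      _ = _ := by ring

theorem sq_segAvg_le (hτ : 0 < τ₀) {φ : E d → ℝ} (hφ : SB φ) {w : ℝ → ℝ} (hw : Continuous w)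
    (hw1 : ∀ θ ∈ Icc (0 : ℝ) 1, |w θ| ≤ 1) {B : ℝ} (hB : 0 ≤ B) (η : ℝ) (κ : E d) (n l : ℕ)
    (hb : ∀ y, S.sq τ₀ h (n + l) φ y ≤ B ^ 2) (x : E d) :
    S.sq τ₀ h n (segAvg η w l κ φ) x ≤ ((‖κ‖ * τ₀⁻¹) ^ l * B) ^ 2 := by
  simp only [sq, wD_segAvg hw hφ]
  refine segAvg_sq_le _ (fun ν _ => sb_wD hφ ν) hw hw1 (by positivity) η (fun y => ?_) x
  refine (sum_iterate_dd_sq_le hτ hφ κ n l y).trans ?_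
  calc _ ≤ (‖κ‖ ^ 2 * τ₀⁻¹ ^ 2) ^ l * B ^ 2 :=
        mul_le_mul_of_nonneg_left (hb y) (by positivity)
    _ = _ := by rw [← mul_pow, ← pow_mul, mul_pow _ B, ← pow_mul, mul_comm l 2]

end Scheme

namespace Scheme

variable {S : Scheme d} {τ₀ h : ℝ}

/-! ## Consequences of the Leibniz rule -/

theorem sq_add (j k : ℕ) (w : E d → ℝ) (x : E d) :
    ∑ ν ∈ words S.Λ k, ∑ l ∈ words S.Λ j, S.wD τ₀ h l (S.wD τ₀ h ν w) x ^ 2 =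
      S.sq τ₀ h (j + k) w x := by
  rw [sq, sum_words_add, Finset.sum_comm]
  simp only [wD_append]

/-- The coefficient bound is for the sum over the whole family, as is the bound for the functions.
One Cauchy–Schwarz over family and words together therefore suffices, and the size of the stencil
does not appear. -/
theorem abs_sum_leibnizTerm_le {κ : Type*} (R : Finset κ) {j k : ℕ} {v : E d → ℝ}
    {a ψ : κ → E d → ℝ} {A B : ℝ} (hA0 : 0 ≤ A) (hB0 : 0 ≤ B) (x : E d)
    (hA : ∑ i ∈ R, S.sq τ₀ h j (a i) x ≤ A ^ 2)
    (hB : ∀ y, ∑ i ∈ R, S.sq τ₀ h k (ψ i) y ≤ B ^ 2) :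
    |∑ i ∈ R, S.leibnizTerm τ₀ h j k v (a i) (ψ i) x| ≤ √(S.sq τ₀ h (j + k) v x) * (A * B) := by
  have e : ∑ i ∈ R, S.leibnizTerm τ₀ h j k v (a i) (ψ i) x =
      ∑ ν ∈ words S.Λ k, ∑ l ∈ words S.Λ j, S.wD τ₀ h l (S.wD τ₀ h ν v) x *
        ∑ i ∈ R, S.wD τ₀ h l (a i) x * S.wD τ₀ h ν (ψ i) (x + wshift h l) := by
    simp only [leibnizTerm]
    rw [Finset.sum_comm]
    refine Finset.sum_congr rfl fun ν _ => ?_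
    rw [Finset.sum_comm]
    simp only [Finset.mul_sum]
  rw [e]
  refine abs_sum_mul_sum_le (words S.Λ k) (words S.Λ j) R
    (fun ν l => S.wD τ₀ h l (S.wD τ₀ h ν v) x) (fun i l => S.wD τ₀ h l (a i) x)
    (fun i l ν => S.wD τ₀ h ν (ψ i) (x + wshift h l)) (Real.sqrt_nonneg _) hA0 hB0 ?_ ?_ ?_
  · rw [sq_add, Real.sq_sqrt (sq_nonneg _ _ _)]
  · rw [Finset.sum_comm]; exact hA
  · intro l _
    rw [Finset.sum_comm]
    exact hB _

theorem sum_antidiagonal_choose (n : ℕ) :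
    ∑ jk ∈ Finset.HasAntidiagonal.antidiagonal n, (n.choose jk.1 : ℝ) = 2 ^ n := by
  rw [Finset.Nat.sum_antidiagonal_eq_sum_range_succ_mk]
  have := Nat.sum_range_choose n
  exact_mod_cast this

/-- The sum of products is tested against itself, so that the Leibniz rule applies with `w = F`; the
binomial coefficients add up to `2 ^ n`. -/
theorem sq_sum_mul_le {κ : Type*} (R : Finset κ) {n : ℕ} {a ψ : κ → E d → ℝ}
    (ha : ∀ i ∈ R, SB (a i)) (hψ : ∀ i ∈ R, SB (ψ i)) {A B : ℝ} (hA0 : 0 ≤ A) (hB0 : 0 ≤ B)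
    (x : E d) (hA : ∀ j ≤ n, ∑ i ∈ R, S.sq τ₀ h j (a i) x ≤ A ^ 2)
    (hB : ∀ k ≤ n, ∀ y, ∑ i ∈ R, S.sq τ₀ h k (ψ i) y ≤ B ^ 2) :
    S.sq τ₀ h n (fun y => ∑ i ∈ R, a i y * ψ i y) x ≤ (2 ^ n * (A * B)) ^ 2 := by
  set F : E d → ℝ := fun y => ∑ i ∈ R, a i y * ψ i y with hF
  have hFs : SB F := SB.sum R fun i hi => (ha i hi).mul (hψ i hi)
  refine le_of_sq_le_mul_sqrt (by positivity) ?_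
  have e : S.sq τ₀ h n F x = ∑ jk ∈ Finset.HasAntidiagonal.antidiagonal n, (n.choose jk.1 : ℝ) *
      ∑ i ∈ R, S.leibnizTerm τ₀ h jk.1 jk.2 F (a i) (ψ i) x := by
    simp only [Finset.mul_sum]
    rw [Finset.sum_comm]
    have : ∀ i ∈ R, ∑ jk ∈ Finset.HasAntidiagonal.antidiagonal n, (n.choose jk.1 : ℝ) *
        S.leibnizTerm τ₀ h jk.1 jk.2 F (a i) (ψ i) x = ∑ ρ ∈ words S.Λ n,
        S.wD τ₀ h ρ F x * S.wD τ₀ h ρ (fun y => a i y * ψ i y) x := fun i hi =>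
      (leibniz hFs (ha i hi) (hψ i hi) n x).symm
    rw [Finset.sum_congr rfl this, Finset.sum_comm, sq]
    refine Finset.sum_congr rfl fun ρ _ => ?_
    rw [← Finset.mul_sum, pow_two]
    congr 1
    rw [hF, wD_sum R fun i hi => (ha i hi).mul (hψ i hi)]
  conv_lhs => rw [e]
  calc _ ≤ ∑ jk ∈ Finset.HasAntidiagonal.antidiagonal n, (n.choose jk.1 : ℝ) *
        (√(S.sq τ₀ h n F x) * (A * B)) := by
        refine Finset.sum_le_sum fun jk hjk => mul_le_mul_of_nonneg_left ?_ (by positivity)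
        rw [Finset.HasAntidiagonal.mem_antidiagonal] at hjk
        refine (le_abs_self _).trans ?_
        have := abs_sum_leibnizTerm_le (S := S) (τ₀ := τ₀) (h := h) R (v := F) hA0 hB0 x
          (hA jk.1 (by omega)) (hB jk.2 (by omega))
        rwa [hjk] at this
    _ = _ := by rw [← Finset.sum_mul, sum_antidiagonal_choose]; ring

/-! ## The operator `L_h` as an average of derivatives -/

/-- After a Taylor expansion the only singular contribution is `h⁻¹` times the derivative along `∑
a_l l`, which is zero. What remains is bounded by second derivatives uniformly in `h`. -/
theorem opQ_eq_segAvg (hh : h ≠ 0) {Λ₁ : Finset (E d)} {a : E d → E d → ℝ} {φ : E d → ℝ}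
    (hφ : SB φ) (x : E d) (ha : ∑ l ∈ Λ₁, a l x • l = 0) :
    opQ Λ₁ h a φ x = ∑ l ∈ Λ₁, a l x * segAvg h (fun θ => 1 - θ) 2 l φ x := by
  have h0 : ∑ l ∈ Λ₁, a l x * dd l φ x = 0 := by
    have : fderiv ℝ φ x (∑ l ∈ Λ₁, a l x • l) = 0 := by rw [ha]; simp
    rw [map_sum] at this
    simpa [dd] using this
  have h1 : ∀ l, h⁻¹ * (a l x * fd h l φ x) =
      a l x * segAvg h (fun θ => 1 - θ) 2 l φ x + h⁻¹ * (a l x * dd l φ x) := fun l => by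
    have := fd_sub_dd_eq_segAvg hφ hh l x
    calc _ = a l x * (h⁻¹ * fd h l φ x) := by ring
      _ = _ := by rw [this]; ring
  rw [opQ, Finset.mul_sum]
  simp only [h1]
  rw [Finset.sum_add_distrib, ← Finset.mul_sum, h0, mul_zero, add_zero]

theorem opL_eq_segAvg (hh : h ≠ 0) {Λ₁ : Finset (E d)} {a b : E d → E d → ℝ} {φ : E d → ℝ}
    (hφ : SB φ) (x : E d) (ha : ∑ l ∈ Λ₁, a l x • l = 0) :
    opL Λ₁ h a b φ x = ∑ l ∈ Λ₁, a l x * segAvg h (fun θ => 1 - θ) 2 l φ x +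
      ∑ l ∈ Λ₁, b l x * segAvg h (fun _ => 1) 1 l φ x := by
  rw [opL, opQ_eq_segAvg hh hφ x ha]
  simp only [fd_eq_segAvg hφ hh]

/-- Centering is a linear relation with constant vectors, hence inherited by the differentiated
coefficients. Thus `Q_{h,μ}` and its second-order analogue are nonsingular too. -/
theorem wD_centered {Λ₁ : Finset (E d)} {a : E d → E d → ℝ} (hs : ∀ l ∈ Λ₁, SB (a l))
    (ha : ∀ x, ∑ l ∈ Λ₁, a l x • l = 0) (w : List (E d ⊕ Fin d)) (x : E d) :
    ∑ l ∈ Λ₁, S.wD τ₀ h w (a l) x • l = 0 := by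
  ext i
  have h1 : (fun x => ∑ l ∈ Λ₁, l i * a l x) = fun _ => 0 := by
    funext y
    have := congrArg (fun v : E d => v i) (ha y)
    simpa [mul_comm] using this
  have h2 := wD_sum (S := S) (τ₀ := τ₀) (h := h) Λ₁ (φ := fun l x => l i * a l x)
    (fun l hl => (hs l hl).const_mul _) w
  rw [h1, wD_zero] at h2
  have h3 := congrFun h2 x
  simp only [wD_const_mul] at h3
  simp only [WithLp.ofLp_sum, WithLp.ofLp_smul, Finset.sum_apply, Pi.smul_apply, smul_eq_mul]
  rw [show (0 : E d).ofLp i = 0 from rfl]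
  simpa [mul_comm] using h3.symm

/-- The discrete carré du champ identity. It is the source of the quadratic form `𝒬_h`, with weights
`χ = q + hp`. -/
theorem two_mul_opL (hh : h ≠ 0) {Λ₁ : Finset (E d)} (a b : E d → E d → ℝ) (φ : E d → ℝ)
    (x : E d) : 2 * (φ x * opL Λ₁ h a b φ x) = opL Λ₁ h a b (fun y => φ y ^ 2) x -
      ∑ l ∈ Λ₁, (a l x + h * b l x) * fd h l φ x ^ 2 := by
  simp only [opL, opQ, Finset.mul_sum, mul_add]
  rw [← Finset.sum_add_distrib, ← Finset.sum_add_distrib, ← Finset.sum_sub_distrib]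
  refine Finset.sum_congr rfl fun l _ => ?_
  simp only [fd]
  field_simp
  ring

theorem opL_sum {ι : Type*} (s : Finset ι) {Λ₁ : Finset (E d)} (a b : E d → E d → ℝ)
    (φ : ι → E d → ℝ) (x : E d) :
    opL Λ₁ h a b (fun y => ∑ i ∈ s, φ i y) x = ∑ i ∈ s, opL Λ₁ h a b (φ i) x := by
  have hfd : ∀ l, fd h l (fun y => ∑ i ∈ s, φ i y) x = ∑ i ∈ s, fd h l (φ i) x := fun l => by
    simp only [fd, Finset.mul_sum, ← Finset.sum_sub_distrib]
  simp only [opL, opQ, hfd, Finset.sum_add_distrib, Finset.mul_sum]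
  congr 1 <;> rw [Finset.sum_comm]

theorem opL_const_mul {Λ₁ : Finset (E d)} (a b : E d → E d → ℝ) (r : ℝ)
    (φ : E d → ℝ) (x : E d) :
    opL Λ₁ h a b (fun y => r * φ y) x = r * opL Λ₁ h a b φ x := by
  simp only [opL, opQ, fd, Finset.mul_sum, mul_add]
  congr 1 <;> exact Finset.sum_congr rfl fun l _ => by ring

/-! ## Energy conditions for families of functions -/

variable (S τ₀ h)

/-- The first order condition for finite families of functions. -/
def FirstEnergy (δ K t : ℝ) : Prop :=
  ∀ (ι : Type) (s : Finset ι) (φ : ι → E d → ℝ), (∀ i ∈ s, SB (φ i)) → ∀ C₁ : ℝ,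
    (∀ y, ∑ i ∈ s, S.sq₁ τ₀ h (φ i) y ≤ C₁) → ∀ x,
    ∑ i ∈ s, S.A τ₀ h t (φ i) x ≤
      (1 - δ) * ∑ i ∈ s, ∑ μ ∈ S.Λ, S.quad h t (S.dbar τ₀ h μ (φ i)) x
        + K * ∑ i ∈ s, S.quad h t (φ i) x + 2 * (1 - δ) * S.c t x * C₁

/-- The second order condition for finite families of functions. -/
def SecondEnergy (δ K t : ℝ) (n : ℕ) : Prop :=
  ∀ (ι : Type) (s : Finset ι) (φ : ι → E d → ℝ), (∀ i ∈ s, SB (φ i)) → ∀ C₁ C₂ : ℝ,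
    (∀ y, ∑ i ∈ s, S.sq₁ τ₀ h (φ i) y ≤ C₁) → (∀ y, ∑ i ∈ s, S.sq₂ τ₀ h (φ i) y ≤ C₂) → ∀ x,
    ∑ i ∈ s, (n * ∑ ν ∈ S.Λ, S.A τ₀ h t (S.dbar τ₀ h ν (φ i)) x
        + n * ((n : ℝ) - 1) * ∑ μ ∈ S.Λ, ∑ ν ∈ S.Λ,
            S.dbar τ₀ h μ (S.dbar τ₀ h ν (φ i)) x *
              opQ S.Λ₁ h (fun l => S.dbar τ₀ h μ (S.dbar τ₀ h ν (S.q l t)))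
                (shift h μ (shift h ν (φ i))) x) ≤
      (1 - δ) * ∑ i ∈ s, ∑ μ ∈ S.Λ, ∑ ν ∈ S.Λ,
          S.quad h t (S.dbar τ₀ h μ (S.dbar τ₀ h ν (φ i))) x
        + K * ∑ i ∈ s, ∑ μ ∈ S.Λ, S.quad h t (S.dbar τ₀ h μ (φ i)) x
        + 2 * (1 - δ) * S.c t x * C₂ + K * C₁

/-- `∑_{w ∈ Λⁿ} 𝒬_h(\bar δ_w φ)`. -/
def quadSum (t : ℝ) (n : ℕ) (φ : E d → ℝ) (x : E d) : ℝ :=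
  ∑ w ∈ words S.Λ n, S.quad h t (S.wD τ₀ h w φ) x

/-- The leading terms in the differentiated equation. -/
def mainTerm (t : ℝ) (n : ℕ) (w : E d → ℝ) (x : E d) (jk : ℕ × ℕ) : ℝ :=
  if jk.1 = 0 then opL S.Λ₁ h (fun l => S.q l t) (fun l => S.p l t) (S.sq τ₀ h n w) x -
      S.quadSum τ₀ h t n w x - 2 * S.c t x * S.sq τ₀ h n w x
  else if jk.1 = 1 then n * ∑ ν ∈ words S.Λ jk.2, S.A τ₀ h t (S.wD τ₀ h ν w) x
  else if jk.1 = 2 then n * ((n : ℝ) - 1) * ∑ i ∈ words S.Λ jk.2, ∑ μ ∈ S.Λ, ∑ ν ∈ S.Λ,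
            S.dbar τ₀ h μ (S.dbar τ₀ h ν (S.wD τ₀ h i w)) x *
              opQ S.Λ₁ h (fun l => S.dbar τ₀ h μ (S.dbar τ₀ h ν (S.q l t)))
                (shift h μ (shift h ν (S.wD τ₀ h i w))) x
  else 0

variable {S τ₀ h}

/-- One factor `‖κ‖ ^ 2` is summed to `size ^ 2` and the other powers are bounded by `‖κ‖ ≤ size`.
For `l = 0` there would be no factor to sum, and the cardinality of the stencil would appear. -/
theorem sum_size_le (l : ℕ) (hl : 1 ≤ l) {r B : ℝ} (hr : 0 ≤ r) :
    ∑ κ ∈ S.Λ₁, ((‖κ‖ * r) ^ l * B) ^ 2 ≤ ((S.size * r) ^ l * B) ^ 2 := by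
  have hs : S.size ^ 2 = ∑ κ ∈ S.Λ₁, ‖κ‖ ^ 2 :=
    Real.sq_sqrt (Finset.sum_nonneg fun _ _ => _root_.sq_nonneg _)
  have hs0 : 0 ≤ S.size := Real.sqrt_nonneg _
  obtain ⟨l, rfl⟩ : ∃ l', l = l' + 1 := ⟨l - 1, by omega⟩
  have h1 : ∀ κ ∈ S.Λ₁, ((‖κ‖ * r) ^ (l + 1) * B) ^ 2 ≤
      ‖κ‖ ^ 2 * (r ^ 2 * ((S.size * r) ^ l * B) ^ 2) := by
    intro κ hκ
    have : ‖κ‖ ≤ S.size := by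
      refine abs_le_of_sq_le_sq' ?_ hs0 |>.2
      rw [hs]
      exact Finset.single_le_sum (f := fun κ : E d => ‖κ‖ ^ 2)
        (fun _ _ => _root_.sq_nonneg _) hκ
    calc _ = ‖κ‖ ^ 2 * (r ^ 2 * (((‖κ‖ * r) ^ l) ^ 2 * B ^ 2)) := by ring
      _ ≤ ‖κ‖ ^ 2 * (r ^ 2 * (((S.size * r) ^ l) ^ 2 * B ^ 2)) := by gcongr
      _ = _ := by ring
  refine (Finset.sum_le_sum h1).trans (le_of_eq ?_)
  rw [← Finset.sum_mul, ← hs]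
  ring

theorem shift_shift_eq (μ ν : E d ⊕ Fin d) (φ : E d → ℝ) :
    shift h μ (shift h ν φ) = fun x => φ (x + wshift h [μ, ν]) := by
  rw [shift_eq, shift_eq]
  funext x
  simp [wshift, add_assoc]

/-- Smoothness of the coefficients at time `t`. -/
structure SmoothAt (S : Scheme d) (t : ℝ) : Prop where
  q : ∀ l ∈ S.Λ₁, SB (S.q l t)
  p : ∀ l ∈ S.Λ₁, SB (S.p l t)
  c : SB (S.c t)
  centered : ∀ x, ∑ l ∈ S.Λ₁, S.q l t x • l = 0

variable {t : ℝ}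

/-- With no letter on the coefficients, the carré du champ identity applies to each differentiated
function separately and the squares add up under the linear operator. -/
theorem leibniz_zero_eq (hS : SmoothAt S t) (hh : h ≠ 0) {w : E d → ℝ} (hw : SB w) (n : ℕ)
    (x : E d) :
    2 * (∑ l ∈ S.Λ₁, S.leibnizTerm τ₀ h 0 n w (S.q l t) (segAvg h (fun θ => 1 - θ) 2 l w) x +
      ∑ l ∈ S.Λ₁, S.leibnizTerm τ₀ h 0 n w (S.p l t) (segAvg h (fun _ => 1) 1 l w) x -
      S.leibnizTerm τ₀ h 0 n w (S.c t) w x) = S.mainTerm τ₀ h t n w x (0, n) := by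
  have e : S.mainTerm τ₀ h t n w x (0, n) =
      opL S.Λ₁ h (fun l => S.q l t) (fun l => S.p l t) (S.sq τ₀ h n w) x -
      S.quadSum τ₀ h t n w x - 2 * S.c t x * S.sq τ₀ h n w x := by simp [mainTerm]
  have e1 : S.sq τ₀ h n w = fun y => ∑ ν ∈ words S.Λ n, (fun y => S.wD τ₀ h ν w y ^ 2) y := rfl
  rw [e, e1, opL_sum]
  simp only [quadSum, quad, χ, leibnizTerm, sum_words_zero, wD, wshift, add_zero, mul_sub, mul_add,
    Finset.mul_sum]
  rw [← Finset.sum_sub_distrib, ← Finset.sum_sub_distrib, Finset.sum_comm (s := S.Λ₁),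
    Finset.sum_comm (s := S.Λ₁), ← Finset.sum_add_distrib, ← Finset.sum_sub_distrib]
  refine Finset.sum_congr rfl fun ν _ => ?_
  have h1 := two_mul_opL hh (Λ₁ := S.Λ₁) (fun l => S.q l t) (fun l => S.p l t) (S.wD τ₀ h ν w) x
  rw [opL_eq_segAvg hh (sb_wD hw ν) x (hS.centered x)] at h1
  rw [← h1]
  simp only [wD_segAvg (w := fun θ => 1 - θ) (by fun_prop) hw,
    wD_segAvg (w := fun _ => 1) (by fun_prop) hw, mul_add, Finset.mul_sum]
  ring

/-- A single letter on `q` or `p` produces exactly the form `A_h` of assumptions 5 and 6, the shift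
in `T_{h,λ}` being the translation in the product rule. The term with `c` is of lower order and is
left to the remainder. -/
theorem leibniz_one_eq (hS : SmoothAt S t) (hh : h ≠ 0) {w : E d → ℝ} (hw : SB w) (k : ℕ)
    (x : E d) :
    2 * (∑ l ∈ S.Λ₁, S.leibnizTerm τ₀ h 1 k w (S.q l t) (segAvg h (fun θ => 1 - θ) 2 l w) x +
      ∑ l ∈ S.Λ₁, S.leibnizTerm τ₀ h 1 k w (S.p l t) (segAvg h (fun _ => 1) 1 l w) x) =
      ∑ ν ∈ words S.Λ k, S.A τ₀ h t (S.wD τ₀ h ν w) x := by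
  simp only [leibnizTerm, A]
  rw [← Finset.mul_sum]
  congr 1
  rw [Finset.sum_comm (s := S.Λ₁), Finset.sum_comm (s := S.Λ₁), ← Finset.sum_add_distrib]
  refine Finset.sum_congr rfl fun ν _ => ?_
  rw [Finset.sum_comm (s := S.Λ₁), Finset.sum_comm (s := S.Λ₁), ← Finset.sum_add_distrib,
    sum_words_succ]
  refine Finset.sum_congr rfl fun μ _ => ?_
  have hc := wD_centered (S := S) (τ₀ := τ₀) (h := h) hS.q hS.centered [μ] x
  simp only [wD] at hc
  have hν := sb_wD (S := S) (τ₀ := τ₀) (h := h) hw ν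
  rw [sum_words_zero, shift_eq, opL_eq_segAvg hh (hν.comp_add _) x hc, mul_add]
  simp only [wD_segAvg (w := fun θ => 1 - θ) (by fun_prop) hw,
    wD_segAvg (w := fun _ => 1) (by fun_prop) hw, Finset.mul_sum, segAvg_comp_add' hν,
    wD, wshift, add_zero]

/-- Two letters on `q` give the second expression in assumption 6; the corresponding terms with `p`
and `c` are of lower order. -/
theorem leibniz_two_eq (hS : SmoothAt S t) (hh : h ≠ 0) {w : E d → ℝ} (hw : SB w) (k : ℕ)
    (x : E d) :
    ∑ l ∈ S.Λ₁, S.leibnizTerm τ₀ h 2 k w (S.q l t) (segAvg h (fun θ => 1 - θ) 2 l w) x =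
      ∑ i ∈ words S.Λ k, ∑ μ ∈ S.Λ, ∑ ν ∈ S.Λ,
            S.dbar τ₀ h μ (S.dbar τ₀ h ν (S.wD τ₀ h i w)) x *
              opQ S.Λ₁ h (fun l => S.dbar τ₀ h μ (S.dbar τ₀ h ν (S.q l t)))
                (shift h μ (shift h ν (S.wD τ₀ h i w))) x := by
  simp only [leibnizTerm]
  rw [Finset.sum_comm (s := S.Λ₁)]
  refine Finset.sum_congr rfl fun ν _ => ?_
  rw [Finset.sum_comm (s := S.Λ₁), sum_words_succ]
  refine Finset.sum_congr rfl fun μ _ => ?_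
  rw [sum_words_succ]
  refine Finset.sum_congr rfl fun μ' _ => ?_
  have hc := wD_centered (S := S) (τ₀ := τ₀) (h := h) hS.q hS.centered [μ, μ'] x
  simp only [wD] at hc
  have hν := sb_wD (S := S) (τ₀ := τ₀) (h := h) hw ν
  rw [sum_words_zero, shift_shift_eq, opQ_eq_segAvg hh (hν.comp_add _) x hc]
  simp only [wD_segAvg (w := fun θ => 1 - θ) (by fun_prop) hw, Finset.mul_sum,
    segAvg_comp_add' hν, wD]

/-- With `j` of the `n` letters on the coefficients, the terms with `q`, `p`, `c` involve
derivatives of `w` of orders `n-j+2`, `n-j+1`, `n-j`. These are below `n` once `j ≥ 3`, `j ≥ 2`, `j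
≥ 1` respectively, and are then controlled by `B₁`. What is left for `j ≤ 2` is `mainTerm`. -/
theorem leibniz_term_le (hτ : 0 < τ₀) (hS : SmoothAt S t) (hh : h ≠ 0) {A B₁ : ℝ} (hA0 : 0 ≤ A)
    (hB0 : 0 ≤ B₁) {n : ℕ} {w : E d → ℝ} (hw : SB w) (x : E d)
    (hA : ∀ j ≤ n, ∑ l ∈ S.Λ₁, (S.sq τ₀ h j (S.q l t) x + S.sq τ₀ h j (S.p l t) x) +
      S.sq τ₀ h j (S.c t) x ≤ A ^ 2)
    (hB : ∀ j < n, ∀ y, S.sq τ₀ h j w y ≤ B₁ ^ 2) {j k : ℕ} (hjk : j + k = n) :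
    2 * ((n.choose j : ℝ) *
      (∑ l ∈ S.Λ₁, S.leibnizTerm τ₀ h j k w (S.q l t) (segAvg h (fun θ => 1 - θ) 2 l w) x +
      ∑ l ∈ S.Λ₁, S.leibnizTerm τ₀ h j k w (S.p l t) (segAvg h (fun _ => 1) 1 l w) x -
      S.leibnizTerm τ₀ h j k w (S.c t) w x)) ≤ S.mainTerm τ₀ h t n w x (j, k) +
      (n.choose j : ℝ) * (2 * (A + A * (S.size * τ₀⁻¹) + A * (S.size * τ₀⁻¹) ^ 2) *
        (√(S.sq τ₀ h n w x) * B₁)) := by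
  have hτ' : 0 ≤ τ₀⁻¹ := by positivity
  have hs0 : 0 ≤ S.size := Real.sqrt_nonneg _
  have hq0 : ∀ j ≤ n, ∑ l ∈ S.Λ₁, S.sq τ₀ h j (S.q l t) x ≤ A ^ 2 := fun j hj => by
    have := hA j hj
    have h1 := sq_nonneg (S := S) (τ₀ := τ₀) (h := h) j (S.c t) x
    have h2 : 0 ≤ ∑ l ∈ S.Λ₁, S.sq τ₀ h j (S.p l t) x := Finset.sum_nonneg fun _ _ => sq_nonneg _ _ _
    rw [Finset.sum_add_distrib] at this
    linarith
  have hp0 : ∀ j ≤ n, ∑ l ∈ S.Λ₁, S.sq τ₀ h j (S.p l t) x ≤ A ^ 2 := fun j hj => by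
    have := hA j hj
    have h1 := sq_nonneg (S := S) (τ₀ := τ₀) (h := h) j (S.c t) x
    have h2 : 0 ≤ ∑ l ∈ S.Λ₁, S.sq τ₀ h j (S.q l t) x := Finset.sum_nonneg fun _ _ => sq_nonneg _ _ _
    rw [Finset.sum_add_distrib] at this
    linarith
  have hc0 : ∀ j ≤ n, S.sq τ₀ h j (S.c t) x ≤ A ^ 2 := fun j hj => by
    have := hA j hj
    have h1 : 0 ≤ ∑ l ∈ S.Λ₁, (S.sq τ₀ h j (S.q l t) x + S.sq τ₀ h j (S.p l t) x) :=
      Finset.sum_nonneg fun _ _ => add_nonneg (sq_nonneg _ _ _) (sq_nonneg _ _ _)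
    linarith
  have hX := Real.sqrt_nonneg (S.sq τ₀ h n w x)
  have bc : 1 ≤ j → |S.leibnizTerm τ₀ h j k w (S.c t) w x| ≤
      √(S.sq τ₀ h n w x) * (A * B₁) := fun hj => by
    have := abs_sum_leibnizTerm_le (S := S) (τ₀ := τ₀) (h := h) (Finset.univ : Finset Unit)
      (j := j) (k := k) (v := w) (a := fun _ => S.c t) (ψ := fun _ => w) hA0 hB0 x
      (by simpa using hc0 j (by omega)) (fun y => by simpa using hB k (by omega) y)
    rw [hjk] at this
    simpa using this
  have bp : 2 ≤ j → |∑ l ∈ S.Λ₁, S.leibnizTerm τ₀ h j k w (S.p l t)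
      (segAvg h (fun _ => 1) 1 l w) x| ≤
      √(S.sq τ₀ h n w x) * (A * ((S.size * τ₀⁻¹) ^ 1 * B₁)) := fun hj => by
    have := abs_sum_leibnizTerm_le (S := S) (τ₀ := τ₀) (h := h) S.Λ₁
      (j := j) (k := k) (v := w) (a := fun l => S.p l t) (B := (S.size * τ₀⁻¹) ^ 1 * B₁)
      (ψ := fun l => segAvg h (fun _ => 1) 1 l w) hA0 (by positivity) x
      (hp0 j (by omega)) (fun y => le_trans (Finset.sum_le_sum fun l _ =>
        sq_segAvg_le hτ hw continuous_const (by simp) hB0 h l k 1 (hB (k + 1) (by omega)) y)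
        (sum_size_le 1 le_rfl hτ'))
    rwa [hjk] at this
  have bq : 3 ≤ j → |∑ l ∈ S.Λ₁, S.leibnizTerm τ₀ h j k w (S.q l t)
      (segAvg h (fun θ => 1 - θ) 2 l w) x| ≤
      √(S.sq τ₀ h n w x) * (A * ((S.size * τ₀⁻¹) ^ 2 * B₁)) := fun hj => by
    have := abs_sum_leibnizTerm_le (S := S) (τ₀ := τ₀) (h := h) S.Λ₁
      (j := j) (k := k) (v := w) (a := fun l => S.q l t) (B := (S.size * τ₀⁻¹) ^ 2 * B₁)
      (ψ := fun l => segAvg h (fun θ => 1 - θ) 2 l w) hA0 (by positivity) x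
      (hq0 j (by omega)) (fun y => le_trans (Finset.sum_le_sum fun l _ =>
        sq_segAvg_le hτ hw (by fun_prop) (fun θ hθ => by
          rw [abs_of_nonneg (by linarith [hθ.2])]; linarith [hθ.1]) hB0 h l k 2
          (hB (k + 2) (by omega)) y)
        (sum_size_le 2 one_le_two hτ'))
    rwa [hjk] at this
  set Tq := ∑ l ∈ S.Λ₁, S.leibnizTerm τ₀ h j k w (S.q l t) (segAvg h (fun θ => 1 - θ) 2 l w) x
    with hTq
  set Tp := ∑ l ∈ S.Λ₁, S.leibnizTerm τ₀ h j k w (S.p l t) (segAvg h (fun _ => 1) 1 l w) x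
    with hTp
  set Tc := S.leibnizTerm τ₀ h j k w (S.c t) w x with hTc
  set X := √(S.sq τ₀ h n w x)
  have hn : (0 : ℝ) ≤ n.choose j := by positivity
  have hr1 : 0 ≤ X * B₁ * A := by positivity
  have hr2 : 0 ≤ X * B₁ * A * (S.size * τ₀⁻¹) := by positivity
  have hr3 : 0 ≤ X * B₁ * A * (S.size * τ₀⁻¹) ^ 2 := by positivity
  by_cases j0 : j = 0
  · subst j0
    obtain rfl : k = n := by omega
    have := leibniz_zero_eq (τ₀ := τ₀) hS hh hw k x
    rw [Nat.choose_zero_right, Nat.cast_one, one_mul, one_mul, this]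
    have : 0 ≤ 2 * (A + A * (S.size * τ₀⁻¹) + A * (S.size * τ₀⁻¹) ^ 2) * (X * B₁) := by positivity
    linarith
  by_cases j1 : j = 1
  · subst j1
    have h1 := leibniz_one_eq (τ₀ := τ₀) hS hh hw k x
    have h2 := neg_le_of_abs_le (bc le_rfl)
    have e : S.mainTerm τ₀ h t n w x (1, k) =
        n * ∑ ν ∈ words S.Λ k, S.A τ₀ h t (S.wD τ₀ h ν w) x := by simp [mainTerm]
    rw [e, ← h1, Nat.choose_one_right, ← hTq, ← hTp]
    rw [Nat.choose_one_right] at hn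
    have h3 : (n : ℝ) * (-Tc) ≤ n * (X * B₁ * A) :=
      mul_le_mul_of_nonneg_left (by linarith) hn
    have h4 := mul_nonneg hn hr2
    have h5 := mul_nonneg hn hr3
    nlinarith
  by_cases j2 : j = 2
  · subst j2
    have h1 := leibniz_two_eq (τ₀ := τ₀) hS hh hw k x
    have h2 := neg_le_of_abs_le (bc (by norm_num))
    have h2' := le_of_abs_le (bp le_rfl)
    have e : S.mainTerm τ₀ h t n w x (2, k) = n * ((n : ℝ) - 1) * Tq := by
      simp only [mainTerm]; simp [← h1, hTq]
    -- The factor 2 from the derivative of the square meets the binomial coefficient, which explains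
    -- `n(n-1)` in assumption 6.
    have e2 : (2 : ℝ) * n.choose 2 = n * ((n : ℝ) - 1) := by
      rw [Nat.cast_choose_two]; ring
    rw [e, ← e2]
    have h3 := mul_le_mul_of_nonneg_left h2 hn
    have h4 := mul_le_mul_of_nonneg_left h2' hn
    have h5 := mul_nonneg hn hr3
    nlinarith
  · have e : S.mainTerm τ₀ h t n w x (j, k) = 0 := by simp [mainTerm, j0, j1, j2]
    have h2 := neg_le_of_abs_le (bc (by omega))
    have h2' := le_of_abs_le (bp (by omega))
    have h2'' := le_of_abs_le (bq (by omega))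
    rw [e, zero_add]
    have h3 : Tq + Tp - Tc ≤ (A + A * (S.size * τ₀⁻¹) + A * (S.size * τ₀⁻¹) ^ 2) * (X * B₁) := by
      linarith
    have h4 := mul_le_mul_of_nonneg_left h3 hn
    linarith

end Scheme

/-! ### The energy inequality for words of length `n`. -/

namespace Scheme

variable {S : Scheme d} {τ₀ h : ℝ} {t : ℝ}

theorem sb_L (hS : SmoothAt S t) {w : E d → ℝ} (hw : SB w) : SB (S.L h t w) := by
  have h1 : S.L h t w = fun x => (h⁻¹ * ∑ l ∈ S.Λ₁, S.q l t x * fd h l w x +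
      ∑ l ∈ S.Λ₁, S.p l t x * fd h l w x) - S.c t x * w x := rfl
  rw [h1]
  exact (((SB.sum _ fun l hl => (hS.q l hl).mul (hw.fd h l)).const_mul _).add
    (SB.sum _ fun l hl => (hS.p l hl).mul (hw.fd h l))).sub (hS.c.mul hw)

theorem sum_wD_L_eq (hS : SmoothAt S t) (hh : h ≠ 0) {w : E d → ℝ} (hw : SB w) (n : ℕ)
    (x : E d) :
    ∑ ρ ∈ words S.Λ n, S.wD τ₀ h ρ w x * S.wD τ₀ h ρ (S.L h t w) x =
    ∑ jk ∈ Finset.HasAntidiagonal.antidiagonal n, (n.choose jk.1 : ℝ) *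
      (∑ l ∈ S.Λ₁, S.leibnizTerm τ₀ h jk.1 jk.2 w (S.q l t) (segAvg h (fun θ => 1 - θ) 2 l w) x +
      ∑ l ∈ S.Λ₁, S.leibnizTerm τ₀ h jk.1 jk.2 w (S.p l t) (segAvg h (fun _ => 1) 1 l w) x -
      S.leibnizTerm τ₀ h jk.1 jk.2 w (S.c t) w x) := by
  have s2 : ∀ l, SB (segAvg h (fun θ => 1 - θ) 2 l w) := fun l => hw.segAvg (by fun_prop) h 2 l
  have s1 : ∀ l, SB (segAvg h (fun _ => 1) 1 l w) := fun l => hw.segAvg continuous_const h 1 l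
  have hL : S.L h t w = fun x => (∑ l ∈ S.Λ₁, S.q l t x * segAvg h (fun θ => 1 - θ) 2 l w x +
      ∑ l ∈ S.Λ₁, S.p l t x * segAvg h (fun _ => 1) 1 l w x) + (-1) * (S.c t x * w x) := by
    funext x
    rw [L, opL_eq_segAvg hh hw x (hS.centered x)]
    ring
  have sq' : ∀ l ∈ S.Λ₁, SB (fun x => S.q l t x * segAvg h (fun θ => 1 - θ) 2 l w x) :=
    fun l hl => (hS.q l hl).mul (s2 l)
  have sp' : ∀ l ∈ S.Λ₁, SB (fun x => S.p l t x * segAvg h (fun _ => 1) 1 l w x) :=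
    fun l hl => (hS.p l hl).mul (s1 l)
  have hc' := hS.c.mul hw
  have e : ∀ ρ, S.wD τ₀ h ρ (S.L h t w) x =
      (∑ l ∈ S.Λ₁, S.wD τ₀ h ρ (fun x => S.q l t x * segAvg h (fun θ => 1 - θ) 2 l w x) x +
      ∑ l ∈ S.Λ₁, S.wD τ₀ h ρ (fun x => S.p l t x * segAvg h (fun _ => 1) 1 l w x) x) +
      (-1) * S.wD τ₀ h ρ (fun x => S.c t x * w x) x := by
    intro ρ
    rw [hL, wD_add ((SB.sum _ sq').add (SB.sum _ sp')) (hc'.const_mul _),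
      wD_add (SB.sum _ sq') (SB.sum _ sp'), wD_sum _ sq', wD_sum _ sp', wD_const_mul]
  simp only [e, mul_add, Finset.sum_add_distrib, mul_sub, Finset.sum_sub_distrib]
  congr 1
  · congr 1
    · simp only [Finset.mul_sum]
      rw [Finset.sum_comm, Finset.sum_comm (t := S.Λ₁)]
      refine Finset.sum_congr rfl fun l hl => ?_
      exact leibniz hw (hS.q l hl) (s2 l) n x
    · simp only [Finset.mul_sum]
      rw [Finset.sum_comm, Finset.sum_comm (t := S.Λ₁)]
      refine Finset.sum_congr rfl fun l hl => ?_
      exact leibniz hw (hS.p l hl) (s1 l) n x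
  · rw [← leibniz hw hS.c hw n x]
    simp only [← Finset.sum_neg_distrib]
    refine Finset.sum_congr rfl fun l hl => ?_
    ring

/-- For `n = 1` the first order condition is applied to `w` itself. For `n ≥ 2` the second order
condition is applied to the family of all `\bar δ_ν w` with words `ν` of length `n - 2`, which
restores the sums over words of length `n`. -/
theorem sum_mainTerm_le {δ K : ℝ} (hK : 0 ≤ K) {n : ℕ} {w : E d → ℝ}
    (hw : SB w) (x : E d)
    (h1 : S.FirstEnergy τ₀ h δ K t) (h2 : 2 ≤ n → S.SecondEnergy τ₀ h δ K t n) {B₁ Z : ℝ}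
    (hB : ∀ j < n, ∀ y, S.sq τ₀ h j w y ≤ B₁ ^ 2) (hZ : ∀ y, S.sq τ₀ h n w y ≤ Z)
    (hδ : δ ≤ 1) (hc : 0 ≤ S.c t x) (hq : 0 ≤ S.quadSum τ₀ h t n w x) :
    ∑ jk ∈ Finset.HasAntidiagonal.antidiagonal n, S.mainTerm τ₀ h t n w x jk ≤
      opL S.Λ₁ h (fun l => S.q l t) (fun l => S.p l t) (S.sq τ₀ h n w) x -
      δ * S.quadSum τ₀ h t n w x +
      K * (if n = 0 then 0 else S.quadSum τ₀ h t (n - 1) w x) - 2 * S.c t x * S.sq τ₀ h n w x +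
      2 * (1 - δ) * S.c t x * Z + K * B₁ ^ 2 := by
  have hm0 : ∀ k, S.mainTerm τ₀ h t n w x (0, k) =
      opL S.Λ₁ h (fun l => S.q l t) (fun l => S.p l t) (S.sq τ₀ h n w) x -
      S.quadSum τ₀ h t n w x - 2 * S.c t x * S.sq τ₀ h n w x := fun k => by simp [mainTerm]
  have hZ0 : 0 ≤ Z := (sq_nonneg _ _ _).trans (hZ x)
  have hKB : 0 ≤ K * B₁ ^ 2 := by positivity
  match n, h2, hB, hZ, hq, hm0 with
  | 0, h2, hB, hZ, hq, hm0 =>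
    rw [Finset.Nat.sum_antidiagonal_eq_sum_range_succ_mk, Finset.sum_range_one, hm0]
    simp only [if_true]
    have : 0 ≤ 2 * (1 - δ) * S.c t x * Z := by
      have : 0 ≤ 1 - δ := by linarith
      positivity
    have : δ * S.quadSum τ₀ h t 0 w x ≤ S.quadSum τ₀ h t 0 w x := by nlinarith
    linarith
  | 1, h2, hB, hZ, hq, hm0 =>
    have hm1 : S.mainTerm τ₀ h t 1 w x (1, 0) = S.A τ₀ h t w x := by
      simp [mainTerm, sum_words_zero, wD]
    rw [Finset.Nat.sum_antidiagonal_eq_sum_range_succ_mk, Finset.sum_range_succ,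
      Finset.sum_range_one, hm0, show 1 - 1 = 0 from rfl, hm1]
    have := h1 Unit Finset.univ (fun _ => w) (fun _ _ => hw) Z (fun y => by
      refine le_trans (le_of_eq ?_) (hZ y)
      simp [sq₁, sq, sum_words_succ, sum_words_zero, wD]) x
    simp only [Finset.univ_unique, Finset.sum_const, Finset.card_singleton, one_smul] at this
    have e2 : ∑ μ ∈ S.Λ, S.quad h t (S.dbar τ₀ h μ w) x = S.quadSum τ₀ h t 1 w x := by
      simp [quadSum, sum_words_succ, sum_words_zero, wD]
    have e3 : S.quad h t w x = S.quadSum τ₀ h t 0 w x := by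
      simp [quadSum, sum_words_zero, wD]
    rw [e2, e3] at this
    simp only [one_ne_zero, if_false]
    linarith
  | n + 2, h2, hB, hZ, hq, hm0 =>
    rw [Finset.Nat.sum_antidiagonal_succ, Finset.Nat.sum_antidiagonal_succ, hm0]
    have e0 : ∑ jk ∈ Finset.HasAntidiagonal.antidiagonal n,
        S.mainTerm τ₀ h t (n + 2) w x (jk.1 + 1 + 1, jk.2) =
        S.mainTerm τ₀ h t (n + 2) w x (2, n) := by
      rw [Finset.sum_eq_single (0, n)]
      · rintro ⟨j, k⟩ hjk hne
        have : j ≠ 0 := by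
          rintro rfl
          rw [Finset.HasAntidiagonal.mem_antidiagonal] at hjk
          simp at hjk
          exact hne (by rw [hjk])
        simp [mainTerm, this]
      · intro hne
        exact absurd (Finset.HasAntidiagonal.mem_antidiagonal.mpr (by simp)) hne
    rw [e0]
    have hE := h2 (by omega) (List (E d ⊕ Fin d)) (words S.Λ n) (fun ν => S.wD τ₀ h ν w)
      (fun ν _ => sb_wD hw ν) (B₁ ^ 2) Z (fun y => by
        refine le_trans (le_of_eq ?_) (hB (n + 1) (by omega) y)
        simp only [sq, sum_words_succ, sq₁, wD]
        rw [Finset.sum_comm]) (fun y => by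
        refine le_trans (le_of_eq ?_) (hZ y)
        simp only [sq, sum_words_succ, sq₂, wD]
        rw [Finset.sum_comm]
        exact Finset.sum_congr rfl fun _ _ => Finset.sum_comm) x
    have e1 : S.mainTerm τ₀ h t (n + 2) w x (0 + 1, n + 1) + S.mainTerm τ₀ h t (n + 2) w x (2, n) =
      ∑ i ∈ words S.Λ n, (((n + 2 : ℕ) : ℝ) * ∑ ν ∈ S.Λ, S.A τ₀ h t (S.dbar τ₀ h ν (S.wD τ₀ h i w)) x
        + ((n + 2 : ℕ) : ℝ) * (((n + 2 : ℕ) : ℝ) - 1) * ∑ μ ∈ S.Λ, ∑ ν ∈ S.Λ,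
            S.dbar τ₀ h μ (S.dbar τ₀ h ν (S.wD τ₀ h i w)) x *
              opQ S.Λ₁ h (fun l => S.dbar τ₀ h μ (S.dbar τ₀ h ν (S.q l t)))
                (shift h μ (shift h ν (S.wD τ₀ h i w))) x) := by
      simp only [mainTerm, sum_words_succ]
      rw [Finset.sum_add_distrib, ← Finset.mul_sum, ← Finset.mul_sum, Finset.sum_comm]
      simp [wD]
    have e2 : ∑ i ∈ words S.Λ n, ∑ μ ∈ S.Λ, ∑ ν ∈ S.Λ,
          S.quad h t (S.dbar τ₀ h μ (S.dbar τ₀ h ν (S.wD τ₀ h i w))) x =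
        S.quadSum τ₀ h t (n + 2) w x := by
      simp only [quadSum, sum_words_succ, wD]
      rw [Finset.sum_comm]
      exact Finset.sum_congr rfl fun _ _ => Finset.sum_comm
    have e3 : ∑ i ∈ words S.Λ n, ∑ μ ∈ S.Λ, S.quad h t (S.dbar τ₀ h μ (S.wD τ₀ h i w)) x =
        S.quadSum τ₀ h t (n + 1) w x := by
      simp only [quadSum, sum_words_succ, wD]
      rw [Finset.sum_comm]
    rw [e2, e3, ← e1] at hE
    simp only [Nat.add_eq_zero_iff, OfNat.ofNat_ne_zero, and_false, if_false,
      show n + 2 - 1 = n + 1 by omega]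
    linarith

theorem quad_nonneg (hχ : ∀ l ∈ S.Λ₁, ∀ x, 0 ≤ S.χ h l t x) (φ : E d → ℝ) (x : E d) :
    0 ≤ S.quad h t φ x :=
  Finset.sum_nonneg fun l hl => mul_nonneg (hχ l hl x) (_root_.sq_nonneg _)

/-- The differentiated energy inequality. -/
theorem energy_le {δ K : ℝ} (hK : 0 ≤ K) (hδ : δ ≤ 1) (hτ : 0 < τ₀) (hS : SmoothAt S t)
    (hh : h ≠ 0)
    (hχ : ∀ l ∈ S.Λ₁, ∀ x, 0 ≤ S.χ h l t x) (hc : ∀ x, 0 ≤ S.c t x) {n : ℕ}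
    {w F : E d → ℝ} (hw : SB w) (hF : SB F) (x : E d)
    (h1 : S.FirstEnergy τ₀ h δ K t) (h2 : 2 ≤ n → S.SecondEnergy τ₀ h δ K t n) {A B B₁ Z : ℝ}
    (hA0 : 0 ≤ A) (hB10 : 0 ≤ B₁) (hB0 : 0 ≤ B)
    (hA : ∀ j ≤ n, ∑ l ∈ S.Λ₁, (S.sq τ₀ h j (S.q l t) x + S.sq τ₀ h j (S.p l t) x) +
      S.sq τ₀ h j (S.c t) x ≤ A ^ 2)
    (hB1 : ∀ j < n, ∀ y, S.sq τ₀ h j w y ≤ B₁ ^ 2) (hZ : ∀ y, S.sq τ₀ h n w y ≤ Z)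
    (hB : S.sq τ₀ h n F x ≤ B ^ 2) :
    ∑ ρ ∈ words S.Λ n, 2 * (S.wD τ₀ h ρ w x * S.wD τ₀ h ρ (fun y => S.L h t w y + F y) x) ≤
      opL S.Λ₁ h (fun l => S.q l t) (fun l => S.p l t) (S.sq τ₀ h n w) x -
      δ * S.quadSum τ₀ h t n w x +
      K * (if n = 0 then 0 else S.quadSum τ₀ h t (n - 1) w x) - 2 * S.c t x * S.sq τ₀ h n w x +
      2 * (1 - δ) * S.c t x * Z + K * B₁ ^ 2 +
      √(S.sq τ₀ h n w x) *
        (2 ^ n * (2 * (A + A * (S.size * τ₀⁻¹) + A * (S.size * τ₀⁻¹) ^ 2)) * B₁ + 2 * B) := by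
  have hm := sum_mainTerm_le (τ₀ := τ₀) (h := h) hK hw x h1 h2 hB1 hZ hδ (hc x)
    (Finset.sum_nonneg fun _ _ => quad_nonneg hχ _ _)
  have e1 : ∑ ρ ∈ words S.Λ n,
      2 * (S.wD τ₀ h ρ w x * S.wD τ₀ h ρ (fun y => S.L h t w y + F y) x) =
      2 * ∑ ρ ∈ words S.Λ n, S.wD τ₀ h ρ w x * S.wD τ₀ h ρ (S.L h t w) x +
      2 * ∑ ρ ∈ words S.Λ n, S.wD τ₀ h ρ w x * S.wD τ₀ h ρ F x := by
    rw [Finset.mul_sum, Finset.mul_sum, ← Finset.sum_add_distrib]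
    refine Finset.sum_congr rfl fun ρ _ => ?_
    rw [wD_add (sb_L hS hw) hF]
    ring
  have hFle : ∑ ρ ∈ words S.Λ n, S.wD τ₀ h ρ w x * S.wD τ₀ h ρ F x ≤
      √(S.sq τ₀ h n w x) * B := by
    refine (Real.sum_mul_le_sqrt_mul_sqrt _ _ _).trans ?_
    refine mul_le_mul_of_nonneg_left ?_ (Real.sqrt_nonneg _)
    exact Real.sqrt_le_iff.mpr ⟨hB0, hB⟩
  have hL : 2 * ∑ ρ ∈ words S.Λ n, S.wD τ₀ h ρ w x * S.wD τ₀ h ρ (S.L h t w) x ≤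
      ∑ jk ∈ Finset.HasAntidiagonal.antidiagonal n, S.mainTerm τ₀ h t n w x jk +
      2 ^ n * (2 * (A + A * (S.size * τ₀⁻¹) + A * (S.size * τ₀⁻¹) ^ 2) *
        (√(S.sq τ₀ h n w x) * B₁)) := by
    rw [sum_wD_L_eq hS hh hw, Finset.mul_sum, ← sum_antidiagonal_choose, Finset.sum_mul,
      ← Finset.sum_add_distrib]
    refine Finset.sum_le_sum fun jk hjk => ?_
    exact leibniz_term_le hτ hS hh hA0 hB10 hw x hA hB1
      (Finset.HasAntidiagonal.mem_antidiagonal.mp hjk)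
  rw [e1]
  linarith

end Scheme

/-! ## Maximum principle -/

/-- The supremum `W` over all times and points need not be attained. If `W > b₀`, then wherever `V`
is within `η` of `W` the drift is at most `a η - γ ≤ 0`, so `V` can never enter this layer from
below. Hence `V ≤ W - η` everywhere, contradicting the choice of `W`. -/
theorem max_principle {Z : Type*} {T b₀ : ℝ} {V G : ℝ → Z → ℝ} {V₀ : Z → ℝ}
    (hG : ∀ z, IntervalIntegrable (G · z) volume 0 T)
    (hV : ∀ t ∈ Icc 0 T, ∀ z, V t z = V₀ z + ∫ s in (0 : ℝ)..t, G s z)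
    (h0 : ∀ z, V₀ z ≤ b₀) (hbdd : ∃ C, ∀ t ∈ Icc 0 T, ∀ z, V t z ≤ C)
    (h : ∀ W, (∀ t ∈ Icc 0 T, ∀ z, V t z ≤ W) → b₀ < W →
      ∃ γ > 0, ∃ a ≥ 0, ∀ t ∈ Icc 0 T, ∀ z, G t z ≤ a * (W - V t z) - γ)
    {t : ℝ} (ht : t ∈ Icc 0 T) (z : Z) : V t z ≤ b₀ := by
  by_contra! hlt
  obtain ⟨C, hC⟩ := hbdd
  set A : Set ℝ := {r | ∃ t ∈ Icc 0 T, ∃ z, r = V t z} with hA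
  have hAb : BddAbove A := ⟨C, by rintro r ⟨t, ht, z, rfl⟩; exact hC t ht z⟩
  have hAn : A.Nonempty := ⟨_, t, ht, z, rfl⟩
  set W := sSup A with hW
  have hle : ∀ t ∈ Icc 0 T, ∀ z, V t z ≤ W := fun t ht z => le_csSup hAb ⟨t, ht, z, rfl⟩
  have hbW : b₀ < W := hlt.trans_le (hle t ht z)
  obtain ⟨γ, hγ, a, ha, hGle⟩ := h W hle hbW
  set η := min (γ / (a + 1)) (W - b₀) with hη
  have hη0 : 0 < η := lt_min (by positivity) (by linarith)
  have key : ∀ t ∈ Icc 0 T, ∀ z, V t z ≤ W - η := by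
    intro t ht z
    refine primitive_le_of_nonpos (v := fun t => V t z) (hG z) (fun t ht => hV t ht z)
      ((h0 z).trans ?_) (fun s hs hlt => ?_) ht
    · linarith [min_le_right (γ / (a + 1)) (W - b₀)]
    · have h1 := hGle s hs z
      have h2 : a * (W - V s z) ≤ a * η := mul_le_mul_of_nonneg_left (by linarith) ha
      have h3 : a * η ≤ a * (γ / (a + 1)) := mul_le_mul_of_nonneg_left (min_le_left _ _) ha
      have h4 : a * (γ / (a + 1)) ≤ γ := by
        rw [mul_div_assoc', div_le_iff₀ (by positivity)]; nlinarith
      linarith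
  have : W ≤ W - η := csSup_le hAn (by rintro r ⟨t, ht, z, rfl⟩; exact key t ht z)
  linarith

/-! ### Smooth data and the uniform a priori estimate. -/

namespace Scheme

variable {S : Scheme d} {τ₀ h : ℝ}

theorem tb_dbar {T : ℝ} {ψ : ℝ → E d → ℝ} (hψ : TB T ψ) (μ : E d ⊕ Fin d) :
    TB T (fun t => S.dbar τ₀ h μ (ψ t)) := by
  cases μ with
  | inl l => exact (((hψ.comp_add (h • l)).sub hψ).const_mul h⁻¹).const_mul (S.τ l)
  | inr i => exact (hψ.dd _).const_mul τ₀

theorem tb_wD {T : ℝ} {ψ : ℝ → E d → ℝ} (hψ : TB T ψ) (w : List (E d ⊕ Fin d)) :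
    TB T (fun t => S.wD τ₀ h w (ψ t)) := by
  induction w with
  | nil => exact hψ
  | cons μ w ih => exact tb_dbar ih μ

theorem dbar_intervalIntegral {T t : ℝ} {ψ : ℝ → E d → ℝ} (hψ : TB T ψ) (ht : t ∈ Icc 0 T)
    (μ : E d ⊕ Fin d) :
    S.dbar τ₀ h μ (fun x => ∫ s in (0 : ℝ)..t, ψ s x) =
      fun x => ∫ s in (0 : ℝ)..t, S.dbar τ₀ h μ (ψ s) x := by
  funext x
  cases μ with
  | inl l =>
    simp only [dbar, fd]
    rw [intervalIntegral.integral_const_mul, intervalIntegral.integral_const_mul,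
      intervalIntegral.integral_sub (hψ.intervalIntegrable ht _) (hψ.intervalIntegrable ht _)]
  | inr i =>
    simp only [dbar, pderiv_eq_dd]
    rw [intervalIntegral.integral_const_mul, hψ.dd_intervalIntegral ht]

theorem wD_intervalIntegral {T t : ℝ} {ψ : ℝ → E d → ℝ} (hψ : TB T ψ) (ht : t ∈ Icc 0 T)
    (w : List (E d ⊕ Fin d)) :
    S.wD τ₀ h w (fun x => ∫ s in (0 : ℝ)..t, ψ s x) =
      fun x => ∫ s in (0 : ℝ)..t, S.wD τ₀ h w (ψ s) x := by
  induction w with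
  | nil => rfl
  | cons μ w ih => simp only [wD]; rw [ih, dbar_intervalIntegral (tb_wD hψ w) ht]

variable (S τ₀) in
/-- Smooth data satisfying the assumptions in a form which is stable under mollification. -/
structure SmoothData (δ K c₀ A : ℝ) (m : ℕ) : Prop where
  q_tb : ∀ l ∈ S.Λ₁, TB S.T (S.q l)
  p_tb : ∀ l ∈ S.Λ₁, TB S.T (S.p l)
  c_tb : TB S.T S.c
  chi : S.ChiNonneg
  centered : S.Centered
  killing : S.Killing c₀
  first : ∀ h ∈ Ioc 0 S.h₀, ∀ t ∈ Icc 0 S.T, S.FirstEnergy τ₀ h δ K t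
  second : ∀ h ∈ Ioc 0 S.h₀, ∀ t ∈ Icc 0 S.T, ∀ n, 2 ≤ n → n ≤ m → S.SecondEnergy τ₀ h δ K t n
  bound : ∀ h ∈ Ioc 0 S.h₀, ∀ t ∈ Icc 0 S.T, ∀ j ≤ m, ∀ x,
    ∑ l ∈ S.Λ₁, (S.sq τ₀ h j (S.q l t) x + S.sq τ₀ h j (S.p l t) x) +
      S.sq τ₀ h j (S.c t) x ≤ A ^ 2

theorem SmoothData.smoothAt {δ K c₀ A : ℝ} {m : ℕ} (hS : S.SmoothData τ₀ δ K c₀ A m) {t : ℝ}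
    (ht : t ∈ Icc 0 S.T) : SmoothAt S t :=
  ⟨fun l hl => (hS.q_tb l hl).sb ht, fun l hl => (hS.p_tb l hl).sb ht, hS.c_tb.sb ht,
    hS.centered t ht⟩

theorem tb_L (hq : ∀ l ∈ S.Λ₁, TB S.T (S.q l)) (hp : ∀ l ∈ S.Λ₁, TB S.T (S.p l))
    (hc : TB S.T S.c) {v : ℝ → E d → ℝ} (hv : TB S.T v) : TB S.T (fun t => S.L h t (v t)) := by
  have hfd : ∀ l, TB S.T (fun t => fd h l (v t)) := fun l =>
    ((hv.comp_add (h • l)).sub hv).const_mul h⁻¹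
  exact (((TB.sum _ fun l hl => (hq l hl).mul (hfd l)).const_mul _).add
    (TB.sum _ fun l hl => (hp l hl).mul (hfd l))).sub (hc.mul hv)

/-- Nonnegative `χ` means that `L_h^0` is an average of increments with nonnegative weights, so its
value vanishes as `V x` approaches the upper bound `W`. The factor `h⁻²` is harmless: it enters only
the constant `a` of `max_principle`, not the final bound. -/
theorem opL_le_of_le (hh : 0 < h) {Λ₁ : Finset (E d)} {a b : E d → E d → ℝ} {V : E d → ℝ} {x : E d}
    {W C : ℝ} (hχ : ∀ l ∈ Λ₁, 0 ≤ a l x + h * b l x)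
    (hC : ∑ l ∈ Λ₁, (a l x + h * b l x) ≤ C) (hV : ∀ y, V y ≤ W) :
    opL Λ₁ h a b V x ≤ h⁻¹ ^ 2 * C * (W - V x) := by
  have e : opL Λ₁ h a b V x =
      ∑ l ∈ Λ₁, h⁻¹ ^ 2 * ((a l x + h * b l x) * (V (x + h • l) - V x)) := by
    simp only [opL, opQ, Finset.mul_sum, fd]
    rw [← Finset.sum_add_distrib]
    refine Finset.sum_congr rfl fun l _ => ?_
    field_simp
  rw [e, ← Finset.mul_sum, mul_assoc]
  refine mul_le_mul_of_nonneg_left ?_ (by positivity)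
  calc _ ≤ ∑ l ∈ Λ₁, (a l x + h * b l x) * (W - V x) :=
        Finset.sum_le_sum fun l hl => mul_le_mul_of_nonneg_left (by linarith [hV (x + h • l)])
          (hχ l hl)
    _ = (∑ l ∈ Λ₁, (a l x + h * b l x)) * (W - V x) := by rw [Finset.sum_mul]
    _ ≤ _ := mul_le_mul_of_nonneg_right hC (by linarith [hV x])

/-- The ratio `K/δ` of the weights is chosen so that the term `K q_{j-1}` from level `j` cancels
exactly against `-δ q_{j-1}` from level `j - 1`; only `-δ q_n` remains. -/
theorem sum_quadSum_le {n : ℕ} {δ K : ℝ} (hδ : 0 < δ) (q : ℕ → ℝ)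
    (hq : 0 ≤ q n) :
    ∑ j ∈ Finset.range (n + 1), (K / δ) ^ (n - j) *
      (-(δ * q j) + K * (if j = 0 then 0 else q (j - 1))) ≤ 0 := by
  have : ∀ n, ∑ j ∈ Finset.range (n + 1), (K / δ) ^ (n - j) *
      (-(δ * q j) + K * (if j = 0 then 0 else q (j - 1))) = -(δ * q n) := by
    intro n
    induction n with
    | zero => simp
    | succ n ih =>
      rw [Finset.sum_range_succ]
      have e : ∑ j ∈ Finset.range (n + 1), (K / δ) ^ (n + 1 - j) *
          (-(δ * q j) + K * (if j = 0 then 0 else q (j - 1))) = (K / δ) *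
          ∑ j ∈ Finset.range (n + 1), (K / δ) ^ (n - j) *
          (-(δ * q j) + K * (if j = 0 then 0 else q (j - 1))) := by
        rw [Finset.mul_sum]
        refine Finset.sum_congr rfl fun j hj => ?_
        rw [Finset.mem_range] at hj
        rw [show n + 1 - j = (n - j) + 1 by omega, pow_succ]
        ring
      rw [e, ih]
      simp
      field_simp
      ring
  rw [this]
  have := mul_nonneg hδ.le hq
  linarith

end Scheme

namespace Scheme

variable {S : Scheme d} {τ₀ h : ℝ}

theorem sq_evolution {v : ℝ → E d → ℝ} {v₀ : E d → ℝ} (hv : TB S.T v) (hv₀ : SB v₀)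
    {ψ : ℝ → E d → ℝ} (hψ : TB S.T ψ)
    (heq : ∀ t ∈ Icc 0 S.T, ∀ x, v t x = v₀ x + ∫ s in (0 : ℝ)..t, ψ s x) (n : ℕ) {t : ℝ}
    (ht : t ∈ Icc 0 S.T) (x : E d) :
    S.sq τ₀ h n (v t) x = S.sq τ₀ h n v₀ x + ∫ s in (0 : ℝ)..t,
      ∑ ρ ∈ words S.Λ n, 2 * (S.wD τ₀ h ρ (v s) x * S.wD τ₀ h ρ (ψ s) x) := by
  have hT : S.T ∈ Icc 0 S.T := ⟨S.T_pos.le, le_rfl⟩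
  have e : ∀ ρ, ∀ t ∈ Icc 0 S.T, S.wD τ₀ h ρ (v t) x =
      S.wD τ₀ h ρ v₀ x + ∫ s in (0 : ℝ)..t, S.wD τ₀ h ρ (ψ s) x := by
    intro ρ t ht
    rw [show v t = fun x => v₀ x + ∫ s in (0 : ℝ)..t, ψ s x from funext (heq t ht),
      wD_add hv₀ ((hψ.primitive S.T_pos.le).sb ht), wD_intervalIntegral hψ ht]
  rw [intervalIntegral.integral_finsetSum fun ρ _ =>
    (((tb_wD hv ρ).mul (tb_wD hψ ρ)).const_mul 2).intervalIntegrable ht x]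
  simp only [sq]
  rw [← Finset.sum_add_distrib]
  refine Finset.sum_congr rfl fun ρ _ => ?_
  exact sq_primitive ((tb_wD hψ ρ).intervalIntegrable hT x) (e ρ) ht

theorem tb_sq {v : ℝ → E d → ℝ} {T : ℝ} (hv : TB T v) (n : ℕ) :
    TB T (fun t => S.sq τ₀ h n (v t)) := by
  have : (fun t => S.sq τ₀ h n (v t)) =
      fun t x => ∑ w ∈ words S.Λ n, S.wD τ₀ h w (v t) x * S.wD τ₀ h w (v t) x := by
    funext t x
    simp [sq, pow_two]
  rw [this]
  exact TB.sum _ fun w _ => (tb_wD hv w).mul (tb_wD hv w)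

theorem sq_zero_eq (φ : E d → ℝ) (x : E d) : S.sq τ₀ h 0 φ x = φ x ^ 2 := by
  simp [sq, sum_words_zero, wD]

-- Bernstein's argument for the function `V = ∑ r^{n-j} |\bar δ^j v|²` with `r = K/δ`. The quadratic
-- forms telescope away and the lower levels are already bounded by `B²`. At level `n` the bound `Z
-- = W` turns the terms with `c` into `2c(W - V) - 2δcW`. The negative part `-2δc₀W` outweighs all
-- lower-order terms as soon as `W > (YB)²`. The constant `Y` is fixed before the dimension, the
-- scheme and `h`.
set_option maxHeartbeats 1000000 in
theorem apriori_step {n : ℕ} {δ K c₀ A size : ℝ} (hδ : δ ∈ Ioc (0 : ℝ) 1)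
    (hc₀ : 0 < c₀) (hτ : 0 < τ₀) (hK : 1 ≤ K) (hA : 0 ≤ A) :
    ∃ Y : ℝ, 1 ≤ Y ∧ ∀ {d : ℕ} (S : Scheme d) {m : ℕ}, S.size = size →
      S.SmoothData τ₀ δ K c₀ A m → n ≤ m → ∀ h ∈ Ioc 0 S.h₀, ∀ (v F : ℝ → E d → ℝ) (v₀ : E d → ℝ)
      (B : ℝ), TB S.T v → TB S.T F → SB v₀ → 0 ≤ B →
      (∀ t ∈ Icc 0 S.T, ∀ x, v t x = v₀ x + ∫ s in (0 : ℝ)..t, (S.L h s (v s) x + F s x)) →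
      (∀ j ≤ n, ∀ t ∈ Icc 0 S.T, ∀ x, S.sq τ₀ h j (F t) x ≤ B ^ 2) →
      (∀ j ≤ n, ∀ x, S.sq τ₀ h j v₀ x ≤ B ^ 2) →
      (∀ j < n, ∀ t ∈ Icc 0 S.T, ∀ x, S.sq τ₀ h j (v t) x ≤ B ^ 2) →
      ∀ t ∈ Icc 0 S.T, ∀ x, S.sq τ₀ h n (v t) x ≤ (Y * B) ^ 2 := by
  obtain ⟨hδ0, hδ1⟩ := hδ
  set r := K / δ with hr
  have hr1 : 1 ≤ r := by rw [hr, le_div_iff₀ hδ0]; linarith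
  have hr0 : 0 ≤ r := by linarith
  set σ := ∑ j ∈ Finset.range (n + 1), r ^ (n - j) with hσ
  have hσ0 : 0 ≤ σ := by positivity
  have hσ1 : 1 ≤ σ := by
    rw [hσ, Finset.sum_range_succ, Nat.sub_self, pow_zero]
    have : 0 ≤ ∑ j ∈ Finset.range n, r ^ (n - j) := by positivity
    linarith
  set P := |2 * (A + A * (size * τ₀⁻¹) + A * (size * τ₀⁻¹) ^ 2)| with hP
  set R₂ := 2 ^ n * P + 2 with hR₂
  have hR₂0 : 0 ≤ R₂ := by positivity
  set R₁ := σ * (2 * A + K + R₂) with hR₁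
  have hR₁0 : 0 ≤ R₁ := by positivity
  -- The factor `σ` makes `(Y B) ^ 2` dominate the weighted initial value, the other factor makes
  -- the dissipation `2δc₀W` exceed `R₁ B² + R₂ √W B`.
  set Y := (1 + (R₁ + R₂) / (2 * δ * c₀)) * σ with hY
  have hY1' : 1 ≤ 1 + (R₁ + R₂) / (2 * δ * c₀) := by
    have : 0 ≤ (R₁ + R₂) / (2 * δ * c₀) := by positivity
    linarith
  have hYσ : σ ≤ Y ^ 2 := by
    have : σ ≤ Y := by rw [hY]; nlinarith
    nlinarith
  have hY1 : 1 + (R₁ + R₂) / (2 * δ * c₀) ≤ Y := by rw [hY]; nlinarith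
  have hPle : ∀ j ≤ n, ∀ B : ℝ, 0 ≤ B →
      2 ^ j * (2 * (A + A * (size * τ₀⁻¹) + A * (size * τ₀⁻¹) ^ 2)) * B + 2 * B ≤ R₂ * B := by
    intro j hj B hB
    have : (2 : ℝ) ^ j * (2 * (A + A * (size * τ₀⁻¹) + A * (size * τ₀⁻¹) ^ 2)) ≤ 2 ^ n * P := by
      calc _ ≤ 2 ^ j * P := mul_le_mul_of_nonneg_left (le_abs_self _) (by positivity)
        _ ≤ 2 ^ n * P := by
          refine mul_le_mul_of_nonneg_right (pow_le_pow_right₀ (by norm_num) hj) (abs_nonneg _)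
    have := mul_le_mul_of_nonneg_right this hB
    rw [hR₂, add_mul]
    linarith
  clear_value P σ R₂ Y r
  refine ⟨Y, by linarith, ?_⟩
  intro d S m hsize hS hnm h hh v F v₀ B hv hF hv₀ hB heq hFB hv₀B hvB
  have hh0 : 0 < h := hh.1
  set ψ : ℝ → E d → ℝ := fun s x => S.L h s (v s) x + F s x with hψdef
  have hψ : TB S.T ψ := (tb_L hS.q_tb hS.p_tb hS.c_tb hv).add hF
  set V : ℝ → E d → ℝ := fun t x => ∑ j ∈ Finset.range (n + 1), r ^ (n - j) *
    S.sq τ₀ h j (v t) x with hVdef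
  set G : ℝ → E d → ℝ := fun s x => ∑ j ∈ Finset.range (n + 1), r ^ (n - j) *
    ∑ ρ ∈ words S.Λ j, 2 * (S.wD τ₀ h ρ (v s) x * S.wD τ₀ h ρ (ψ s) x) with hGdef
  have hG : TB S.T G := TB.sum _ fun j _ => (TB.sum _ fun ρ _ =>
    ((tb_wD hv ρ).mul (tb_wD hψ ρ)).const_mul 2).const_mul _
  have hVtb : TB S.T V := TB.sum _ fun j _ => (tb_sq hv j).const_mul _
  have hT : S.T ∈ Icc 0 S.T := ⟨S.T_pos.le, le_rfl⟩
  have hsq_le_V : ∀ t x, S.sq τ₀ h n (v t) x ≤ V t x := by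
    intro t x
    simp only [hVdef]
    rw [Finset.sum_range_succ, Nat.sub_self, pow_zero, one_mul]
    have : 0 ≤ ∑ j ∈ Finset.range n, r ^ (n - j) * S.sq τ₀ h j (v t) x :=
      Finset.sum_nonneg fun j _ => mul_nonneg (by positivity) (sq_nonneg _ _ _)
    linarith
  have hVeq : ∀ t ∈ Icc 0 S.T, ∀ x, V t x = (∑ j ∈ Finset.range (n + 1), r ^ (n - j) *
      S.sq τ₀ h j v₀ x) + ∫ s in (0 : ℝ)..t, G s x := by
    intro t ht x
    simp only [hVdef, hGdef]
    rw [intervalIntegral.integral_finsetSum fun j _ => ((TB.sum _ fun ρ _ =>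
      ((tb_wD hv ρ).mul (tb_wD hψ ρ)).const_mul 2).const_mul _).intervalIntegrable ht x,
      ← Finset.sum_add_distrib]
    refine Finset.sum_congr rfl fun j _ => ?_
    rw [intervalIntegral.integral_const_mul, sq_evolution hv hv₀ hψ heq j ht x, mul_add]
  have hcA : ∀ t ∈ Icc 0 S.T, ∀ x, S.c t x ≤ A := by
    intro t ht x
    have h1 := hS.bound h hh t ht 0 (Nat.zero_le _) x
    rw [sq_zero_eq] at h1
    have h2 : 0 ≤ ∑ l ∈ S.Λ₁, (S.sq τ₀ h 0 (S.q l t) x + S.sq τ₀ h 0 (S.p l t) x) :=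
      Finset.sum_nonneg fun _ _ => add_nonneg (sq_nonneg _ _ _) (sq_nonneg _ _ _)
    exact (abs_le_of_sq_le_sq' (by linarith) hA).2
  have hc0 : ∀ t ∈ Icc 0 S.T, ∀ x, 0 ≤ S.c t x := fun t ht x => hc₀.le.trans (hS.killing t ht x)
  obtain ⟨Cχ, hCχ⟩ := (TB.sum S.Λ₁ fun l hl => (hS.q_tb l hl).add
    ((hS.p_tb l hl).const_mul h)).bd 0
  have hCχ' : ∀ t ∈ Icc 0 S.T, ∀ x, ∑ l ∈ S.Λ₁, (S.q l t x + h * S.p l t x) ≤ Cχ :=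
    fun t ht x => (le_abs_self _).trans ((hCχ t ht).bound x)
  have hmain : ∀ t ∈ Icc 0 S.T, ∀ x, V t x ≤ (Y * B) ^ 2 := by
    intro t ht x
    refine max_principle (fun x => hG.intervalIntegrable hT x) hVeq (fun x => ?_) ?_ ?_ ht x
    · calc _ ≤ ∑ j ∈ Finset.range (n + 1), r ^ (n - j) * B ^ 2 := by
            refine Finset.sum_le_sum fun j hj => ?_
            exact mul_le_mul_of_nonneg_left (hv₀B j (by simpa [Nat.lt_succ_iff] using hj) x)
              (by positivity)
        _ = σ * B ^ 2 := by rw [hσ, Finset.sum_mul]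
        _ ≤ Y ^ 2 * B ^ 2 := by gcongr
        _ = _ := by ring
    · obtain ⟨C, hC⟩ := hVtb.bd 0
      exact ⟨C, fun t ht x => (le_abs_self _).trans ((hC t ht).bound x)⟩
    intro W hW hbW
    have hW0 : 0 < W := lt_of_le_of_lt (by positivity) hbW
    have hsW : Y * B < √W := Real.lt_sqrt_of_sq_lt hbW
    have hsW2 : √W * √W = W := Real.mul_self_sqrt hW0.le
    have hsW0 : 0 < √W := Real.sqrt_pos.mpr hW0
    have hBW : B ≤ √W := by nlinarith
    -- The gap `γ` is the dissipation minus the lower-order terms. The slope `a` collects the bound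
    -- for `L_h^0` near the supremum and `2A` from the terms with `c ≤ A`.
    refine ⟨2 * δ * c₀ * W - R₁ * B ^ 2 - R₂ * (√W * B), ?_, h⁻¹ ^ 2 * |Cχ| + 2 * A, by positivity,
      ?_⟩
    · have h1 : R₁ * B ^ 2 ≤ R₁ * (√W * B) := by
        refine mul_le_mul_of_nonneg_left ?_ hR₁0
        nlinarith
      have h2 : (R₁ + R₂) * B < 2 * δ * c₀ * √W := by
        have h3 : (1 + (R₁ + R₂) / (2 * δ * c₀)) * B < √W :=
          (mul_le_mul_of_nonneg_right hY1 hB).trans_lt hsW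
        have h4 : 2 * δ * c₀ * ((1 + (R₁ + R₂) / (2 * δ * c₀)) * B) < 2 * δ * c₀ * √W :=
          mul_lt_mul_of_pos_left h3 (by positivity)
        have h5 : 2 * δ * c₀ * ((1 + (R₁ + R₂) / (2 * δ * c₀)) * B) =
            2 * δ * c₀ * B + (R₁ + R₂) * B := by field_simp
        have : 0 ≤ 2 * δ * c₀ * B := by positivity
        linarith
      have h6 := mul_lt_mul_of_pos_right h2 hsW0
      rw [mul_assoc (2 * δ * c₀), hsW2, mul_right_comm, mul_assoc, add_mul] at h6
      linarith
    intro t ht x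
    have hSt := hS.smoothAt ht
    have hvt := hv.sb ht
    have hFt := hF.sb ht
    have hχ : ∀ l ∈ S.Λ₁, ∀ x, 0 ≤ S.χ h l t x := fun l hl x => hS.chi h hh l hl t ht x
    have hsqW : ∀ y, S.sq τ₀ h n (v t) y ≤ W := fun y => (hsq_le_V t y).trans (hW t ht y)
    have hbound : ∀ j ≤ n, ∑ l ∈ S.Λ₁, (S.sq τ₀ h j (S.q l t) x + S.sq τ₀ h j (S.p l t) x) +
        S.sq τ₀ h j (S.c t) x ≤ A ^ 2 := fun j hj => hS.bound h hh t ht j (hj.trans hnm) x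
    set cc := S.c t x
    have hcc0 : 0 ≤ cc := hc0 t ht x
    have hccA : cc ≤ A := hcA t ht x
    set qs : ℕ → ℝ := fun j => S.quadSum τ₀ h t j (v t) x with hqs
    set Ls : ℕ → ℝ := fun j =>
      opL S.Λ₁ h (fun l => S.q l t) (fun l => S.p l t) (S.sq τ₀ h j (v t)) x with hLs
    have hen : ∀ j ≤ n, ∀ Z, (∀ y, S.sq τ₀ h j (v t) y ≤ Z) →
        ∑ ρ ∈ words S.Λ j, 2 * (S.wD τ₀ h ρ (v t) x * S.wD τ₀ h ρ (ψ t) x) ≤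
        Ls j - δ * qs j + K * (if j = 0 then 0 else qs (j - 1)) - 2 * cc * S.sq τ₀ h j (v t) x +
        2 * (1 - δ) * cc * Z + K * B ^ 2 + √Z * (R₂ * B) := by
      intro j hj Z hZ
      refine (energy_le (by linarith) hδ1 hτ hSt hh0.ne' hχ (hc0 t ht) hvt hFt x
        (hS.first h hh t ht) (fun h2 => hS.second h hh t ht j h2 (hj.trans hnm)) hA hB hB
        (fun i hi => hbound i (hi.trans hj)) (fun i hi y => hvB i (by omega) t ht y) hZ
        (hFB j hj t ht x)).trans ?_
      rw [hsize]
      have h1 := mul_le_mul_of_nonneg_left (hPle j hj B hB) (Real.sqrt_nonneg (S.sq τ₀ h j (v t) x))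
      have h2 : √(S.sq τ₀ h j (v t) x) * (R₂ * B) ≤ √Z * (R₂ * B) :=
        mul_le_mul_of_nonneg_right (Real.sqrt_le_sqrt (hZ x)) (by positivity)
      have h3 := h1.trans h2
      linarith
    have hj1 : ∀ j ∈ Finset.range (n + 1), r ^ (n - j) *
        ∑ ρ ∈ words S.Λ j, 2 * (S.wD τ₀ h ρ (v t) x * S.wD τ₀ h ρ (ψ t) x) ≤
        r ^ (n - j) * Ls j + r ^ (n - j) *
        (-(δ * qs j) + K * (if j = 0 then 0 else qs (j - 1))) -
        2 * cc * (r ^ (n - j) * S.sq τ₀ h j (v t) x) + r ^ (n - j) * ((2 * A + K + R₂) * B ^ 2) +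
        (if j = n then 2 * (1 - δ) * cc * W + R₂ * (√W * B) else 0) := by
      intro j hj
      have hjn : j ≤ n := by simpa [Nat.lt_succ_iff] using hj
      have hrp : 0 ≤ r ^ (n - j) := by positivity
      -- Only the top level needs the unknown supremum `W`; the lower ones use the known bound `B ^
      -- 2`.
      rcases hjn.eq_or_lt with rfl | hlt
      · have h1 := hen j le_rfl W hsqW
        simp only [Nat.sub_self, pow_zero, one_mul, if_true]
        have : 0 ≤ (2 * A + R₂) * B ^ 2 := by positivity
        linarith
      · have h1 := mul_le_mul_of_nonneg_left (hen j hjn (B ^ 2) (hvB j hlt t ht)) hrp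
        rw [if_neg hlt.ne]
        rw [Real.sqrt_sq hB] at h1
        have h2 : 2 * (1 - δ) * cc * B ^ 2 ≤ 2 * A * B ^ 2 := by
          refine mul_le_mul_of_nonneg_right ?_ (by positivity)
          nlinarith
        have h3 := mul_le_mul_of_nonneg_left h2 hrp
        nlinarith
    have hLsum : ∑ j ∈ Finset.range (n + 1), r ^ (n - j) * Ls j =
        opL S.Λ₁ h (fun l => S.q l t) (fun l => S.p l t) (V t) x := by
      simp only [hLs, hVdef]
      rw [opL_sum]
      simp only [opL_const_mul]
    have hLV := opL_le_of_le (a := fun l => S.q l t) (b := fun l => S.p l t) hh0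
      (V := V t) (W := W) (x := x) (fun l hl => hχ l hl x) (hCχ' t ht x) (hW t ht)
    have hquad := sum_quadSum_le (n := n) (K := K) hδ0 qs
      (Finset.sum_nonneg fun _ _ => quad_nonneg hχ _ _)
    rw [← hr] at hquad
    have hsum := Finset.sum_le_sum hj1
    rw [Finset.sum_add_distrib, Finset.sum_add_distrib, Finset.sum_sub_distrib,
      Finset.sum_add_distrib, hLsum, ← Finset.mul_sum, ← Finset.sum_mul,
      Finset.sum_ite_eq' (Finset.range (n + 1)) n] at hsum
    simp only [Finset.mem_range, Nat.lt_succ_self, if_true] at hsum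
    rw [← hσ] at hsum
    have hVle := hW t ht x
    have hGx : G t x = ∑ j ∈ Finset.range (n + 1), r ^ (n - j) *
        ∑ ρ ∈ words S.Λ j, 2 * (S.wD τ₀ h ρ (v t) x * S.wD τ₀ h ρ (ψ t) x) := rfl
    rw [← hGx] at hsum
    have hVx : V t x = ∑ j ∈ Finset.range (n + 1), r ^ (n - j) * S.sq τ₀ h j (v t) x := rfl
    rw [← hVx] at hsum
    have h5 : h⁻¹ ^ 2 * Cχ * (W - V t x) ≤ h⁻¹ ^ 2 * |Cχ| * (W - V t x) := by
      refine mul_le_mul_of_nonneg_right ?_ (by linarith)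
      exact mul_le_mul_of_nonneg_left (le_abs_self _) (by positivity)
    have h6 : 2 * cc * (W - V t x) ≤ 2 * A * (W - V t x) :=
      mul_le_mul_of_nonneg_right (by linarith) (by linarith)
    have h7 : 2 * δ * c₀ * W ≤ 2 * δ * cc * W := by
      have : c₀ ≤ cc := hS.killing t ht x
      gcongr
    have h8 : σ * ((2 * A + K + R₂) * B ^ 2) = R₁ * B ^ 2 := by rw [hR₁]; ring
    linarith
  intro t ht x
  exact (hsq_le_V t x).trans (hmain t ht x)

/-- The a priori estimate, uniform in the mesh-size, the dimension and the stencil. -/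
theorem apriori (n : ℕ) {δ K c₀ A size : ℝ} (hδ : δ ∈ Ioc (0 : ℝ) 1)
    (hc₀ : 0 < c₀) (hτ : 0 < τ₀) (hK : 1 ≤ K) (hA : 0 ≤ A) :
    ∃ Y : ℝ, 1 ≤ Y ∧ ∀ {d : ℕ} (S : Scheme d) {m : ℕ}, S.size = size →
      S.SmoothData τ₀ δ K c₀ A m → n ≤ m → ∀ h ∈ Ioc 0 S.h₀, ∀ (v F : ℝ → E d → ℝ) (v₀ : E d → ℝ)
      (B : ℝ), TB S.T v → TB S.T F → SB v₀ → 0 ≤ B →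
      (∀ t ∈ Icc 0 S.T, ∀ x, v t x = v₀ x + ∫ s in (0 : ℝ)..t, (S.L h s (v s) x + F s x)) →
      (∀ j ≤ n, ∀ t ∈ Icc 0 S.T, ∀ x, S.sq τ₀ h j (F t) x ≤ B ^ 2) →
      (∀ j ≤ n, ∀ x, S.sq τ₀ h j v₀ x ≤ B ^ 2) →
      ∀ j ≤ n, ∀ t ∈ Icc 0 S.T, ∀ x, S.sq τ₀ h j (v t) x ≤ (Y * B) ^ 2 := by
  induction n with
  | zero =>
    obtain ⟨Y, hY1, hY⟩ := apriori_step (n := 0) (size := size) hδ hc₀ hτ hK hA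
    refine ⟨Y, hY1, fun S m hs hS hm h hh v F v₀ B hv hF hv₀ hB heq hFB hvB j hj => ?_⟩
    obtain rfl : j = 0 := by omega
    exact hY S hs hS hm h hh v F v₀ B hv hF hv₀ hB heq hFB hvB (fun j hj => absurd hj (by omega))
  | succ n ih =>
    obtain ⟨Y₁, hY₁1, hY₁⟩ := ih
    obtain ⟨Y, hY1, hY⟩ := apriori_step (n := n + 1) (size := size) hδ hc₀ hτ hK hA
    -- The new level treats `Y₁ * B`, which bounds all previous levels and the data, as its `B`.
    refine ⟨Y * Y₁, by nlinarith, fun S m hs hS hm h hh v F v₀ B hv hF hv₀ hB heq hFB hvB => ?_⟩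
    have h1 := hY₁ S hs hS (by omega) h hh v F v₀ B hv hF hv₀ hB heq
      (fun j hj => hFB j (by omega)) (fun j hj => hvB j (by omega))
    have hBB : B ^ 2 ≤ (Y₁ * B) ^ 2 := by
      have : B ≤ Y₁ * B := by nlinarith
      gcongr
    have h2 := hY S hs hS hm h hh v F v₀ (Y₁ * B) hv hF hv₀ (by positivity) heq
      (fun j hj t ht x => (hFB j hj t ht x).trans hBB) (fun j hj x => (hvB j hj x).trans hBB)
      (fun j hj => h1 j (by omega))
    intro j hj t ht x
    rcases hj.eq_or_lt with rfl | hlt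
    · exact (h2 t ht x).trans (le_of_eq (by ring))
    · refine (h1 j (by omega) t ht x).trans ?_
      have : Y₁ * B ≤ Y * Y₁ * B := by
        have : 0 ≤ Y₁ * B := by positivity
        nlinarith
      gcongr

end Scheme

theorem TB.congr {F : Type*} [NormedAddCommGroup F] [NormedSpace ℝ F] {T : ℝ} {ψ χ : ℝ → F → ℝ}
    (h : TB T ψ) (e : ∀ t ∈ Icc 0 T, χ t = ψ t) : TB T χ := by
  refine ⟨fun z => (h.meas z).congr ?_, fun N => ⟨(h.bd N).choose, fun t ht => ?_⟩⟩
  · filter_upwards [ae_restrict_mem measurableSet_Icc] with t ht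
    rw [e t ht]
  · rw [e t ht]
    exact (h.bd N).choose_spec t ht

/-- Integration by parts in an average along a segment. -/
theorem segAvg_eq_add {φ : E d → ℝ} (hφ : SB φ) {w : ℝ → ℝ} (hw : Continuous w) (h : ℝ) (l : ℕ)
    (κ x : E d) :
    segAvg h w l κ φ x = (∫ θ in (0 : ℝ)..1, w θ) * ((dd κ)^[l] φ) x +
      h * segAvg h (fun s => ∫ θ in s..1, w θ) (l + 1) κ φ x := by
  set W : ℝ → ℝ := fun s => ∫ θ in s..1, w θ with hW
  set ψ := (dd κ)^[l] φ with hψ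
  have hψs : SB ψ := hφ.iterate_dd κ l
  have hWd : ∀ s, HasDerivAt W (-w s) s := fun s =>
    intervalIntegral.integral_hasDerivAt_left (hw.intervalIntegrable _ _)
      (hw.stronglyMeasurableAtFilter _ _) hw.continuousAt
  have hWc : Continuous W := continuous_iff_continuousAt.mpr fun s => (hWd s).continuousAt
  have hψd : ∀ θ, HasDerivAt (fun θ : ℝ => ψ (x + (θ * h) • κ)) (h * dd κ ψ (x + (θ * h) • κ)) θ := by
    intro θ
    have h1 : HasDerivAt (fun θ : ℝ => x + (θ * h) • κ) (h • κ) θ := by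
      have := (((hasDerivAt_id θ).mul_const h).smul_const κ).const_add x
      simpa using this
    have h2 := (hψs.differentiable (x + (θ * h) • κ)).hasFDerivAt.comp_hasDerivAt θ h1
    rw [map_smul] at h2
    exact h2
  have h3 : ∀ θ ∈ uIcc (0 : ℝ) 1, HasDerivAt (fun θ : ℝ => W θ * ψ (x + (θ * h) • κ))
      (-(w θ * ψ (x + (θ * h) • κ)) + h * (W θ * dd κ ψ (x + (θ * h) • κ))) θ := by
    intro θ _
    refine ((hWd θ).mul (hψd θ)).congr_deriv ?_
    ring
  have c1 := (continuous_segment hψs hw h κ x)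
  have c1n : Continuous fun θ : ℝ => -(w θ * ψ (x + (θ * h) • κ)) := c1.neg
  have c2 := (continuous_segment (hψs.dd κ) hWc h κ x)
  have h4 := intervalIntegral.integral_eq_sub_of_hasDerivAt h3
    ((c1n.add (c2.const_mul h)).intervalIntegrable _ _)
  rw [intervalIntegral.integral_add (c1n.intervalIntegrable _ _)
    ((c2.const_mul h).intervalIntegrable _ _), intervalIntegral.integral_neg,
    intervalIntegral.integral_const_mul] at h4
  have h5 : W 1 = 0 := by simp [hW]
  have h6 : segAvg h W (l + 1) κ φ x =
      ∫ θ in (0 : ℝ)..1, W θ * dd κ ψ (x + (θ * h) • κ) := by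
    simp only [segAvg, Function.iterate_succ_apply', hψ]
  have h7 : segAvg h w l κ φ x = ∫ θ in (0 : ℝ)..1, w θ * ψ (x + (θ * h) • κ) := rfl
  rw [h6, h7]
  simp only [h5, zero_mul, zero_smul, add_zero] at h4
  have h8 : W 0 = ∫ θ in (0 : ℝ)..1, w θ := rfl
  rw [← h8]
  linarith

theorem iterate_dd_neg {φ : E d → ℝ} (κ : E d) (l : ℕ) :
    (dd (-κ))^[l] φ = fun x => (-1) ^ l * ((dd κ)^[l] φ) x := by
  induction l with
  | zero => simp
  | succ l ih =>
    simp only [Function.iterate_succ_apply']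
    rw [ih, dd_const_mul, ← neg_one_smul ℝ κ, dd_smul_dir]
    funext x
    ring

theorem sum_symm_eq_zero {Λ₁ : Finset (E d)} (hΛ : ∀ l ∈ Λ₁, -l ∈ Λ₁) {r : E d → ℝ}
    (hr : ∀ l ∈ Λ₁, r (-l) = -r l) : ∑ l ∈ Λ₁, r l = 0 := by
  have : ∑ l ∈ Λ₁, r l = ∑ l ∈ Λ₁, -r l := by
    refine Finset.sum_nbij' (fun l => -l) (fun l => -l) hΛ hΛ (by simp) (by simp) ?_
    intro l hl
    rw [hr l hl, neg_neg]
  rw [Finset.sum_neg_distrib] at this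
  linarith

/-- Integration by parts in `θ` separates the value at `θ = 0`, whose sum over the stencil is odd
under `κ ↦ -κ` and vanishes. The rest carries the factor `h`, one more derivative, and the tail of
the weight as its new weight. -/
theorem sum_mul_segAvg_symm {Λ₁ : Finset (E d)} (hΛ : ∀ l ∈ Λ₁, -l ∈ Λ₁) {a : E d → ℝ} {l : ℕ}
    (ha : ∀ κ ∈ Λ₁, a (-κ) = (-1) ^ (l + 1) * a κ) {φ : E d → ℝ} (hφ : SB φ) {w : ℝ → ℝ}
    (hw : Continuous w) (h : ℝ) (x : E d) :
    ∑ κ ∈ Λ₁, a κ * segAvg h w l κ φ x =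
      h * ∑ κ ∈ Λ₁, a κ * segAvg h (fun s => ∫ θ in s..1, w θ) (l + 1) κ φ x := by
  have h0 : ∑ κ ∈ Λ₁, a κ * ((dd κ)^[l] φ) x = 0 := by
    refine sum_symm_eq_zero hΛ fun κ hκ => ?_
    rw [ha κ hκ, iterate_dd_neg]
    have : ((-1 : ℝ) ^ l) * (-1) ^ l = 1 := by rw [← mul_pow]; simp
    rw [pow_succ]
    linear_combination (-(a κ * ((dd κ)^[l] φ) x)) * this
  simp only [fun κ => segAvg_eq_add hφ hw h l κ x, mul_add, Finset.sum_add_distrib]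
  rw [Finset.mul_sum]
  have h1 : ∑ κ ∈ Λ₁, a κ * ((∫ θ in (0 : ℝ)..1, w θ) * ((dd κ)^[l] φ) x) =
      (∫ θ in (0 : ℝ)..1, w θ) * ∑ κ ∈ Λ₁, a κ * ((dd κ)^[l] φ) x := by
    rw [Finset.mul_sum]
    exact Finset.sum_congr rfl fun _ _ => by ring
  rw [h1, h0, mul_zero, zero_add]
  exact Finset.sum_congr rfl fun _ _ => by ring

theorem abs_integral_tail_le {w : ℝ → ℝ}
    (hw1 : ∀ θ ∈ Icc (0 : ℝ) 1, |w θ| ≤ 1) {s : ℝ} (hs : s ∈ Icc (0 : ℝ) 1) :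
    |∫ θ in s..1, w θ| ≤ 1 := by
  have := intervalIntegral.norm_integral_le_of_norm_le_const (a := s) (b := 1) (f := w) (C := 1)
    (fun θ hθ => by
      rw [uIoc_of_le hs.2] at hθ
      exact hw1 θ ⟨hs.1.trans hθ.1.le, hθ.2⟩)
  rw [Real.norm_eq_abs] at this
  refine this.trans ?_
  rw [one_mul, abs_of_nonneg (by linarith [hs.2])]
  linarith [hs.1]

theorem continuous_integral_tail {w : ℝ → ℝ} (hw : Continuous w) :
    Continuous fun s => ∫ θ in s..1, w θ :=
  continuous_iff_continuousAt.mpr fun _ => (intervalIntegral.integral_hasDerivAt_left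
    (hw.intervalIntegrable _ _) (hw.stronglyMeasurableAtFilter _ _) hw.continuousAt).continuousAt

/-! ### The equations for the derivatives in the mesh-size and their free terms. -/

namespace Scheme

variable {S : Scheme d} {τ₀ h : ℝ}

/-- The triangle inequality for the Euclidean norm indexed by words. -/
theorem sq_add_le {n : ℕ} {φ ψ : E d → ℝ} (hφ : SB φ) (hψ : SB ψ) {a b : ℝ} (ha : 0 ≤ a)
    (hb : 0 ≤ b) {x : E d} (h1 : S.sq τ₀ h n φ x ≤ a ^ 2) (h2 : S.sq τ₀ h n ψ x ≤ b ^ 2) :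
    S.sq τ₀ h n (fun y => φ y + ψ y) x ≤ (a + b) ^ 2 := by
  have h3 := Real.sum_mul_le_sqrt_mul_sqrt (words S.Λ n) (fun w => S.wD τ₀ h w φ x)
    (fun w => S.wD τ₀ h w ψ x)
  have h4 : √(∑ w ∈ words S.Λ n, S.wD τ₀ h w φ x ^ 2) ≤ a := Real.sqrt_le_iff.mpr ⟨ha, h1⟩
  have h5 : √(∑ w ∈ words S.Λ n, S.wD τ₀ h w ψ x ^ 2) ≤ b := Real.sqrt_le_iff.mpr ⟨hb, h2⟩
  have h6 := mul_le_mul h4 h5 (Real.sqrt_nonneg _) ha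
  have e : S.sq τ₀ h n (fun y => φ y + ψ y) x = S.sq τ₀ h n φ x + S.sq τ₀ h n ψ x +
      2 * ∑ w ∈ words S.Λ n, S.wD τ₀ h w φ x * S.wD τ₀ h w ψ x := by
    simp only [sq, Finset.mul_sum]
    rw [← Finset.sum_add_distrib, ← Finset.sum_add_distrib]
    refine Finset.sum_congr rfl fun w _ => ?_
    rw [wD_add hφ hψ]
    ring
  rw [e]
  linarith [h3.trans h6]

theorem sq_const_mul (n : ℕ) (φ : E d → ℝ) (a : ℝ) (x : E d) :
    S.sq τ₀ h n (fun y => a * φ y) x = a ^ 2 * S.sq τ₀ h n φ x := by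
  simp only [sq, wD_const_mul, mul_pow, Finset.mul_sum]

theorem sq_zero_fun (n : ℕ) (x : E d) : S.sq τ₀ h n (fun _ => 0) x = 0 := by
  simp [sq, wD_zero]

theorem sq_sum_le {ι : Type*} {n : ℕ} (s : Finset ι) {φ : ι → E d → ℝ} (hφ : ∀ i ∈ s, SB (φ i))
    {a : ι → ℝ} (ha : ∀ i ∈ s, 0 ≤ a i) {x : E d}
    (h1 : ∀ i ∈ s, S.sq τ₀ h n (φ i) x ≤ a i ^ 2) :
    S.sq τ₀ h n (fun y => ∑ i ∈ s, φ i y) x ≤ (∑ i ∈ s, a i) ^ 2 := by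
  classical
  induction s using Finset.induction_on with
  | empty => simp [sq_zero_fun]
  | insert i s hi ih =>
    simp only [Finset.sum_insert hi]
    exact sq_add_le (hφ i (by simp)) (SB.sum s fun j hj => hφ j (by simp [hj])) (ha i (by simp))
      (Finset.sum_nonneg fun j hj => ha j (by simp [hj])) (h1 i (by simp))
      (ih (fun j hj => hφ j (by simp [hj])) (fun j hj => ha j (by simp [hj]))
        fun j hj => h1 j (by simp [hj]))

theorem sq_sum_mul_segAvg_le (hτ : 0 < τ₀) {a : E d → E d → ℝ} (ha : ∀ κ ∈ S.Λ₁, SB (a κ))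
    {φ : E d → ℝ} (hφ : SB φ) {w : ℝ → ℝ} (hw : Continuous w)
    (hw1 : ∀ θ ∈ Icc (0 : ℝ) 1, |w θ| ≤ 1) {A B : ℝ} (hA0 : 0 ≤ A) (hB : 0 ≤ B) (η : ℝ)
    {n l : ℕ} (hl : 1 ≤ l) (x : E d) (hA : ∀ j ≤ n, ∑ κ ∈ S.Λ₁, S.sq τ₀ h j (a κ) x ≤ A ^ 2)
    (hb : ∀ k ≤ n, ∀ y, S.sq τ₀ h (k + l) φ y ≤ B ^ 2) :
    S.sq τ₀ h n (fun y => ∑ κ ∈ S.Λ₁, a κ y * segAvg η w l κ φ y) x ≤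
      (2 ^ n * (A * ((S.size * τ₀⁻¹) ^ l * B))) ^ 2 := by
  have hs0 : 0 ≤ S.size := Real.sqrt_nonneg _
  refine sq_sum_mul_le _ ha (fun κ _ => hφ.segAvg hw η l κ) hA0 (by positivity) x hA ?_
  intro k hk y
  exact (Finset.sum_le_sum fun κ _ => sq_segAvg_le hτ hφ hw hw1 hB η κ k l (hb k hk) y).trans
    (sum_size_le l hl (inv_nonneg.mpr hτ.le))

variable (S h) in
/-- The free term in the equation for the `k`-th derivative in `h`. -/
def source (V : ℕ → ℝ → E d → ℝ) (k : ℕ) (s : ℝ) (x : E d) : ℝ :=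
  (if k = 0 then S.f s x else 0) + ∑ j ∈ Finset.range k, (k.choose j : ℝ) *
    (∑ κ ∈ S.Λ₁, S.q κ s x * segAvg h (fun θ => (1 - θ) * θ ^ (k - j)) (k - j + 2) κ (V j s) x +
      ∑ κ ∈ S.Λ₁, S.p κ s x * segAvg h (fun θ => θ ^ (k - j)) (k - j + 1) κ (V j s) x)

variable (S h) in
/-- The system of equations for the derivatives in `h`. -/
structure DerivSystem (V : ℕ → ℝ → E d → ℝ) : Prop where
  tb : ∀ k, TB S.T (V k)
  source_tb : ∀ k, TB S.T (S.source h V k)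
  equation : ∀ k, ∀ t ∈ Icc 0 S.T, ∀ x, V k t x = (if k = 0 then S.g x else 0) +
    ∫ s in (0 : ℝ)..t, (S.L h s (V k s) x + S.source h V k s x)

/-- The constant in the estimate of the free term. -/
def sourceConst (A σ : ℝ) (n k : ℕ) : ℝ :=
  1 + ∑ j ∈ Finset.range k, (k.choose j : ℝ) * (2 * (2 ^ n * (A * σ ^ (k + 3))))

theorem sourceConst_ge_one {A σ : ℝ} (hA : 0 ≤ A) (hσ : 0 ≤ σ) (n k : ℕ) :
    1 ≤ sourceConst A σ n k := by
  have : 0 ≤ ∑ j ∈ Finset.range k, (k.choose j : ℝ) * (2 * (2 ^ n * (A * σ ^ (k + 3)))) := by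
    positivity
  rw [sourceConst]
  linarith

theorem continuous_weight_q (i : ℕ) : Continuous fun θ : ℝ => (1 - θ) * θ ^ i := by fun_prop

theorem continuous_weight_p (i : ℕ) : Continuous fun θ : ℝ => θ ^ i := by fun_prop

theorem abs_weight_p_le (i : ℕ) : ∀ θ ∈ Icc (0 : ℝ) 1, |θ ^ i| ≤ 1 := fun θ hθ => by
  rw [abs_of_nonneg (pow_nonneg hθ.1 i)]
  exact pow_le_one₀ hθ.1 hθ.2

theorem abs_weight_q_le (i : ℕ) : ∀ θ ∈ Icc (0 : ℝ) 1, |(1 - θ) * θ ^ i| ≤ 1 := fun θ hθ => by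
  rw [abs_mul]
  have h1 : |1 - θ| ≤ 1 := by rw [abs_of_nonneg (by linarith [hθ.2])]; linarith [hθ.1]
  exact mul_le_one₀ h1 (abs_nonneg _) (abs_weight_p_le i θ hθ)

section Estimates

variable {δ K c₀ A : ℝ} {m : ℕ} {t : ℝ}

theorem SmoothData.sum_q_le (hS : S.SmoothData τ₀ δ K c₀ A m) (hh : h ∈ Ioc 0 S.h₀)
    (ht : t ∈ Icc 0 S.T) (x : E d) {j : ℕ} (hj : j ≤ m) :
    ∑ κ ∈ S.Λ₁, S.sq τ₀ h j (S.q κ t) x ≤ A ^ 2 := by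
  have h1 := hS.bound h hh t ht j hj x
  rw [Finset.sum_add_distrib] at h1
  have h2 : 0 ≤ ∑ κ ∈ S.Λ₁, S.sq τ₀ h j (S.p κ t) x := Finset.sum_nonneg fun _ _ => sq_nonneg _ _ _
  linarith [sq_nonneg (S := S) (τ₀ := τ₀) (h := h) j (S.c t) x]

theorem SmoothData.sum_p_le (hS : S.SmoothData τ₀ δ K c₀ A m) (hh : h ∈ Ioc 0 S.h₀)
    (ht : t ∈ Icc 0 S.T) (x : E d) {j : ℕ} (hj : j ≤ m) :
    ∑ κ ∈ S.Λ₁, S.sq τ₀ h j (S.p κ t) x ≤ A ^ 2 := by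
  have h1 := hS.bound h hh t ht j hj x
  rw [Finset.sum_add_distrib] at h1
  have h2 : 0 ≤ ∑ κ ∈ S.Λ₁, S.sq τ₀ h j (S.q κ t) x := Finset.sum_nonneg fun _ _ => sq_nonneg _ _ _
  linarith [sq_nonneg (S := S) (τ₀ := τ₀) (h := h) j (S.c t) x]

variable {V : ℕ → ℝ → E d → ℝ} {σ B : ℝ}

/-- The free term needs `V_j` up to order `n + (k-j) + 2`, and `3j + n + (k-j) + 2 ≤ 3k + n` because
`j < k`. This is the reason for three space derivatives per derivative in `h`. -/
theorem sq_source_le (hτ : 0 < τ₀) (hA : 0 ≤ A) (hS : S.SmoothData τ₀ δ K c₀ A m)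
    (hV : ∀ k, TB S.T (V k)) (hh : h ∈ Ioc 0 S.h₀)
    (hσ : S.size * τ₀⁻¹ ≤ σ) (hσ1 : 1 ≤ σ) (hB : 0 ≤ B) {n k : ℕ} (hnk : 3 * k + n ≤ m)
    (ht : t ∈ Icc 0 S.T) (hfs : SB (S.f t)) (hf : k = 0 → ∀ x, S.sq τ₀ h n (S.f t) x ≤ B ^ 2)
    (hj : ∀ j < k, ∀ i, 3 * j + i ≤ m → ∀ x, S.sq τ₀ h i (V j t) x ≤ B ^ 2) (x : E d) :
    S.sq τ₀ h n (S.source h V k t) x ≤ (sourceConst A σ n k * B) ^ 2 := by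
  have hs0 : 0 ≤ S.size * τ₀⁻¹ := mul_nonneg (Real.sqrt_nonneg _) (inv_nonneg.mpr hτ.le)
  have hσ0 : 0 ≤ σ := by linarith
  rw [sourceConst, add_mul, one_mul, Finset.sum_mul]
  have hq := fun κ (hκ : κ ∈ S.Λ₁) => (hS.smoothAt ht).q κ hκ
  have hp := fun κ (hκ : κ ∈ S.Λ₁) => (hS.smoothAt ht).p κ hκ
  have sbq : ∀ i l j, SB (fun x => ∑ κ ∈ S.Λ₁, S.q κ t x *
      segAvg h (fun θ => (1 - θ) * θ ^ i) l κ (V j t) x) := fun i l j =>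
    SB.sum _ fun κ hκ => (hq κ hκ).mul (((hV j).sb ht).segAvg (continuous_weight_q i) h l κ)
  have sbp : ∀ i l j, SB (fun x => ∑ κ ∈ S.Λ₁, S.p κ t x *
      segAvg h (fun θ => θ ^ i) l κ (V j t) x) := fun i l j =>
    SB.sum _ fun κ hκ => (hp κ hκ).mul (((hV j).sb ht).segAvg (continuous_weight_p i) h l κ)
  -- The exponent `k + 3` also covers the additional derivative that occurs in the estimate for odd
  -- `k`.
  have hpow : ∀ l ≤ k + 3, (S.size * τ₀⁻¹) ^ l ≤ σ ^ (k + 3) := fun l hl =>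
    (pow_le_pow_left₀ hs0 hσ l).trans (pow_le_pow_right₀ hσ1 hl)
  have hmono : ∀ l ≤ k + 3, (2 ^ n * (A * ((S.size * τ₀⁻¹) ^ l * B))) ^ 2 ≤
      (2 ^ n * (A * σ ^ (k + 3)) * B) ^ 2 := by
    intro l hl
    have := hpow l hl
    refine pow_le_pow_left₀ (by positivity) ?_ 2
    calc 2 ^ n * (A * ((S.size * τ₀⁻¹) ^ l * B)) ≤ 2 ^ n * (A * (σ ^ (k + 3) * B)) := by gcongr
      _ = _ := by ring
  refine sq_add_le (φ := fun y => if k = 0 then S.f t y else 0)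
    (ψ := fun x => ∑ j ∈ Finset.range k, (k.choose j : ℝ) *
    (∑ κ ∈ S.Λ₁, S.q κ t x * segAvg h (fun θ => (1 - θ) * θ ^ (k - j)) (k - j + 2) κ (V j t) x +
      ∑ κ ∈ S.Λ₁, S.p κ t x * segAvg h (fun θ => θ ^ (k - j)) (k - j + 1) κ (V j t) x))
    (by split_ifs; exacts [hfs, SB.const 0])
    (SB.sum _ fun j _ => ((sbq _ _ _).add (sbp _ _ _)).const_mul _) hB (by positivity) ?_ ?_
  · split_ifs with hk0
    · exact hf hk0 x
    · rw [sq_zero_fun]; positivity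
  refine sq_sum_le _ (fun j _ => ((sbq _ _ _).add (sbp _ _ _)).const_mul _)
    (fun j _ => by positivity) fun j hjk => ?_
  rw [Finset.mem_range] at hjk
  rw [sq_const_mul, mul_assoc, mul_pow]
  refine mul_le_mul_of_nonneg_left ?_ (by positivity)
  rw [mul_assoc, two_mul]
  refine sq_add_le (sbq _ _ _) (sbp _ _ _) (by positivity) (by positivity) ?_ ?_
  · refine (sq_sum_mul_segAvg_le hτ hq ((hV j).sb ht) (continuous_weight_q _) (abs_weight_q_le _)
      hA hB h (by omega) x (fun i hi => hS.sum_q_le hh ht x (by omega))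
      (fun i hi y => hj j hjk _ (by omega) y)).trans (hmono _ (by omega))
  · refine (sq_sum_mul_segAvg_le hτ hp ((hV j).sb ht) (continuous_weight_p _) (abs_weight_p_le _)
      hA hB h (by omega) x (fun i hi => hS.sum_p_le hh ht x (by omega))
      (fun i hi y => hj j hjk _ (by omega) y)).trans (hmono _ (by omega))

/-- For odd `k` the free term gains a factor `h`. -/
theorem sq_source_odd_le (hτ : 0 < τ₀) (hA : 0 ≤ A) (hS : S.SmoothData τ₀ δ K c₀ A m)
    (hsym : S.Symmetric) (hanti : S.Antisymmetric)
    (hV : ∀ k, TB S.T (V k)) (hh : h ∈ Ioc 0 S.h₀)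
    (hσ : S.size * τ₀⁻¹ ≤ σ) (hσ1 : 1 ≤ σ) (hB : 0 ≤ B) {n k : ℕ} (hk : Odd k)
    (hnk : 3 * k + n + 1 ≤ m) (ht : t ∈ Icc 0 S.T)
    (hj : ∀ j < k, ∀ i, 3 * j + i ≤ m → ∀ x, S.sq τ₀ h i (V j t) x ≤ B ^ 2)
    (hj' : ∀ j < k, Odd j → ∀ i, 3 * j + i + 1 ≤ m → ∀ x, S.sq τ₀ h i (V j t) x ≤ (B * h) ^ 2)
    (x : E d) :
    S.sq τ₀ h n (S.source h V k t) x ≤ (sourceConst A σ n k * (B * h)) ^ 2 := by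
  have hh0 : 0 < h := hh.1
  have hs0 : 0 ≤ S.size * τ₀⁻¹ := mul_nonneg (Real.sqrt_nonneg _) (inv_nonneg.mpr hτ.le)
  have hσ0 : 0 ≤ σ := by linarith
  have hk0 : k ≠ 0 := by rintro rfl; simp at hk
  have hq := fun κ (hκ : κ ∈ S.Λ₁) => (hS.smoothAt ht).q κ hκ
  have hp := fun κ (hκ : κ ∈ S.Λ₁) => (hS.smoothAt ht).p κ hκ
  have sbq : ∀ i l j, SB (fun x => ∑ κ ∈ S.Λ₁, S.q κ t x *
      segAvg h (fun θ => (1 - θ) * θ ^ i) l κ (V j t) x) := fun i l j =>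
    SB.sum _ fun κ hκ => (hq κ hκ).mul (((hV j).sb ht).segAvg (continuous_weight_q i) h l κ)
  have sbp : ∀ i l j, SB (fun x => ∑ κ ∈ S.Λ₁, S.p κ t x *
      segAvg h (fun θ => θ ^ i) l κ (V j t) x) := fun i l j =>
    SB.sum _ fun κ hκ => (hp κ hκ).mul (((hV j).sb ht).segAvg (continuous_weight_p i) h l κ)
  have hpow : ∀ l ≤ k + 3, (S.size * τ₀⁻¹) ^ l ≤ σ ^ (k + 3) := fun l hl =>
    (pow_le_pow_left₀ hs0 hσ l).trans (pow_le_pow_right₀ hσ1 hl)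
  have hmono : ∀ l ≤ k + 3, ∀ b, 0 ≤ b → (2 ^ n * (A * ((S.size * τ₀⁻¹) ^ l * b))) ^ 2 ≤
      (2 ^ n * (A * σ ^ (k + 3)) * b) ^ 2 := by
    intro l hl b hb
    have := hpow l hl
    refine pow_le_pow_left₀ (by positivity) ?_ 2
    calc 2 ^ n * (A * ((S.size * τ₀⁻¹) ^ l * b)) ≤ 2 ^ n * (A * (σ ^ (k + 3) * b)) := by gcongr
      _ = _ := by ring
  have hBh : 0 ≤ B * h := by positivity
  have e : S.source h V k t = fun x => ∑ j ∈ Finset.range k, (k.choose j : ℝ) *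
      (∑ κ ∈ S.Λ₁, S.q κ t x * segAvg h (fun θ => (1 - θ) * θ ^ (k - j)) (k - j + 2) κ (V j t) x +
        ∑ κ ∈ S.Λ₁, S.p κ t x * segAvg h (fun θ => θ ^ (k - j)) (k - j + 1) κ (V j t) x) := by
    funext x
    simp [source, hk0]
  rw [e]
  have hc : ∑ j ∈ Finset.range k, (k.choose j : ℝ) * (2 * (2 ^ n * (A * σ ^ (k + 3)))) * (B * h) ≤
      sourceConst A σ n k * (B * h) := by
    rw [← Finset.sum_mul]
    refine mul_le_mul_of_nonneg_right ?_ hBh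
    rw [sourceConst]
    linarith
  refine le_trans ?_ (pow_le_pow_left₀ (by positivity) hc 2)
  refine sq_sum_le _ (fun j _ => ((sbq _ _ _).add (sbp _ _ _)).const_mul _)
    (fun j _ => by positivity) fun j hjk => ?_
  rw [Finset.mem_range] at hjk
  rw [sq_const_mul, mul_assoc, mul_pow]
  refine mul_le_mul_of_nonneg_left ?_ (by positivity)
  rw [mul_assoc, two_mul]
  refine sq_add_le (sbq _ _ _) (sbp _ _ _) (by positivity) (by positivity) ?_ ?_
  -- For even `j` the order `k-j+2` is odd while `q` is even in `κ`, so the leading part cancels.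
  -- The factor `h` is bought with one derivative, paid for by the `+ 1` in `hnk`.
  · rcases Nat.even_or_odd j with hje | hjo
    · have hpar : ∀ y, ∀ κ ∈ S.Λ₁, S.q (-κ) t y = (-1) ^ (k - j + 2 + 1) * S.q κ t y := by
        intro y κ hκ
        have : Even (k - j + 2 + 1) := by
          have : Odd (k - j) := Nat.Odd.sub_even hjk.le hk hje
          grind
        rw [this.neg_one_pow, one_mul, hsym.2 κ hκ t ht]
      have e1 : (fun y => ∑ κ ∈ S.Λ₁, S.q κ t y *
          segAvg h (fun θ => (1 - θ) * θ ^ (k - j)) (k - j + 2) κ (V j t) y) =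
          fun y => h * ∑ κ ∈ S.Λ₁, S.q κ t y * segAvg h
            (fun s => ∫ θ in s..1, (1 - θ) * θ ^ (k - j)) (k - j + 2 + 1) κ (V j t) y := by
        funext y
        exact sum_mul_segAvg_symm hsym.1 (a := fun κ => S.q κ t y) (hpar y) ((hV j).sb ht)
          (continuous_weight_q _) h y
      rw [e1, sq_const_mul]
      have h1 := (sq_sum_mul_segAvg_le hτ hq ((hV j).sb ht)
        (continuous_integral_tail (continuous_weight_q (k - j)))
        (fun s hs => abs_integral_tail_le (abs_weight_q_le _) hs)
        hA hB h (l := k - j + 2 + 1) (n := n) (by omega) x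
        (fun i hi => hS.sum_q_le hh ht x (by omega))
        (fun i hi y => hj j hjk _ (by omega) y)).trans (hmono _ (by omega) B hB)
      calc _ ≤ h ^ 2 * (2 ^ n * (A * σ ^ (k + 3)) * B) ^ 2 :=
            mul_le_mul_of_nonneg_left h1 (by positivity)
        _ = _ := by ring
    -- For odd `j` no cancellation is needed: `V_j` is itself of order `h`.
    · refine (sq_sum_mul_segAvg_le hτ hq ((hV j).sb ht) (continuous_weight_q _) (abs_weight_q_le _)
        hA hBh h (by omega) x (fun i hi => hS.sum_q_le hh ht x (by omega))
        (fun i hi y => hj' j hjk hjo _ (by omega) y)).trans (hmono _ (by omega) _ hBh)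
  · rcases Nat.even_or_odd j with hje | hjo
    -- Here the order `k-j+1` is even and the sign comes from `p` being odd in `κ`.
    · have hpar : ∀ y, ∀ κ ∈ S.Λ₁, S.p (-κ) t y = (-1) ^ (k - j + 1 + 1) * S.p κ t y := by
        intro y κ hκ
        have : Odd (k - j + 1 + 1) := by
          have : Odd (k - j) := Nat.Odd.sub_even hjk.le hk hje
          grind
        rw [this.neg_one_pow, neg_one_mul, hanti κ hκ t ht]
      have e1 : (fun y => ∑ κ ∈ S.Λ₁, S.p κ t y *
          segAvg h (fun θ => θ ^ (k - j)) (k - j + 1) κ (V j t) y) =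
          fun y => h * ∑ κ ∈ S.Λ₁, S.p κ t y * segAvg h
            (fun s => ∫ θ in s..1, θ ^ (k - j)) (k - j + 1 + 1) κ (V j t) y := by
        funext y
        exact sum_mul_segAvg_symm hsym.1 (a := fun κ => S.p κ t y) (hpar y) ((hV j).sb ht)
          (continuous_weight_p _) h y
      rw [e1, sq_const_mul]
      have h1 := (sq_sum_mul_segAvg_le hτ hp ((hV j).sb ht)
        (continuous_integral_tail (continuous_weight_p (k - j)))
        (fun s hs => abs_integral_tail_le (abs_weight_p_le _) hs)
        hA hB h (l := k - j + 1 + 1) (n := n) (by omega) x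
        (fun i hi => hS.sum_p_le hh ht x (by omega))
        (fun i hi y => hj j hjk _ (by omega) y)).trans (hmono _ (by omega) B hB)
      calc _ ≤ h ^ 2 * (2 ^ n * (A * σ ^ (k + 3)) * B) ^ 2 :=
            mul_le_mul_of_nonneg_left h1 (by positivity)
        _ = _ := by ring
    · refine (sq_sum_mul_segAvg_le hτ hp ((hV j).sb ht) (continuous_weight_p _) (abs_weight_p_le _)
        hA hBh h (by omega) x (fun i hi => hS.sum_p_le hh ht x (by omega))
        (fun i hi y => hj' j hjk hjo _ (by omega) y)).trans (hmono _ (by omega) _ hBh)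

end Estimates

end Scheme

/-! ### Estimates of the derivatives in the mesh-size, by induction on their order. -/

namespace Scheme

variable {τ₀ : ℝ}

theorem sourceConst_le_sum {A σ : ℝ} (hA : 0 ≤ A) (hσ : 0 ≤ σ) {n m : ℕ} (hn : n ≤ m) (k : ℕ) :
    sourceConst A σ n k ≤ ∑ i ∈ Finset.range (m + 1), sourceConst A σ i k :=
  Finset.single_le_sum (f := fun i => sourceConst A σ i k)
    (fun i _ => zero_le_one.trans (sourceConst_ge_one hA hσ i k))
    (Finset.mem_range.mpr (by omega))

/-- The estimate of the derivatives in `h`. -/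
theorem deriv_estimate (m : ℕ) {δ K c₀ A size : ℝ} (hδ : δ ∈ Ioc (0 : ℝ) 1)
    (hc₀ : 0 < c₀) (hτ : 0 < τ₀) (hK : 1 ≤ K) (hA : 0 ≤ A) (k : ℕ) :
    ∃ N : ℝ, 1 ≤ N ∧ ∀ {d : ℕ} (S : Scheme d), S.size = size →
      S.SmoothData τ₀ δ K c₀ A m → TB S.T S.f → SB S.g → ∀ h ∈ Ioc 0 S.h₀,
      ∀ (V : ℕ → ℝ → E d → ℝ) (B : ℝ), S.DerivSystem h V → 0 ≤ B →
      (∀ j ≤ m, ∀ t ∈ Icc 0 S.T, ∀ x, S.sq τ₀ h j (S.f t) x ≤ B ^ 2) →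
      (∀ j ≤ m, ∀ x, S.sq τ₀ h j S.g x ≤ B ^ 2) →
      ∀ j ≤ k, ∀ i, 3 * j + i ≤ m → ∀ t ∈ Icc 0 S.T, ∀ x, S.sq τ₀ h i (V j t) x ≤ (N * B) ^ 2 := by
  set σ := max 1 (size * τ₀⁻¹) with hσdef
  have hσ1 : 1 ≤ σ := le_max_left _ _
  have hσ : size * τ₀⁻¹ ≤ σ := le_max_right _ _
  -- One order in `h` at a time: a constant for all smaller orders yields one for order `k`, so the
  -- outer induction only has to combine them.
  have step : ∀ k : ℕ, ∀ N₀ : ℝ, 1 ≤ N₀ → ∃ N : ℝ, N₀ ≤ N ∧ ∀ {d : ℕ} (S : Scheme d),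
      S.size = size →
      S.SmoothData τ₀ δ K c₀ A m → TB S.T S.f → SB S.g → ∀ h ∈ Ioc 0 S.h₀,
      ∀ (V : ℕ → ℝ → E d → ℝ) (B : ℝ), S.DerivSystem h V → 0 ≤ B →
      (∀ j ≤ m, ∀ t ∈ Icc 0 S.T, ∀ x, S.sq τ₀ h j (S.f t) x ≤ B ^ 2) →
      (∀ j ≤ m, ∀ x, S.sq τ₀ h j S.g x ≤ B ^ 2) →
      (∀ j < k, ∀ i, 3 * j + i ≤ m → ∀ t ∈ Icc 0 S.T, ∀ x,
        S.sq τ₀ h i (V j t) x ≤ (N₀ * B) ^ 2) →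
      ∀ i, 3 * k + i ≤ m → ∀ t ∈ Icc 0 S.T, ∀ x, S.sq τ₀ h i (V k t) x ≤ (N * B) ^ 2 := by
    intro k N₀ hN₀
    -- After `k` derivatives in `h` there remain `m - 3k` space derivatives for which the free term
    -- is controlled.
    obtain ⟨Y, hY1, hY⟩ := apriori (m - 3 * k) (size := size) hδ hc₀ hτ hK hA
    set C := ∑ i ∈ Finset.range (m + 1), sourceConst A σ i k with hC
    have hCi : ∀ i ≤ m, sourceConst A σ i k ≤ C := fun i hi =>
      sourceConst_le_sum hA (by linarith) hi k
    have hC1 : 1 ≤ C := (sourceConst_ge_one hA (by linarith) 0 k).trans (hCi 0 (Nat.zero_le m))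
    refine ⟨Y * (C * N₀), by nlinarith [mul_nonneg (sub_nonneg.mpr hY1) (sub_nonneg.mpr hC1)], ?_⟩
    intro d S hs hS hf hg h hh V B hV hB hfB hgB hj i hi t ht x
    have hBN : B ≤ N₀ * B := le_mul_of_one_le_left hB hN₀
    have hBC : B ≤ C * (N₀ * B) := hBN.trans (le_mul_of_one_le_left (by linarith) hC1)
    have h1 := hY S hs hS (by omega) h hh (V k) (S.source h V k)
      (fun x => if k = 0 then S.g x else 0) (C * (N₀ * B)) (hV.tb k) (hV.source_tb k)
      (by split_ifs; exacts [hg, SB.const 0]) (by linarith) (hV.equation k) (by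
        intro j hjn t ht x
        refine (sq_source_le hτ hA hS hV.tb hh (by rw [hs]; exact hσ) hσ1 (by linarith)
          (B := N₀ * B) (n := j) (k := k) (by omega) ht (hf.sb ht)
          (fun _ y => (hfB j (by omega) t ht y).trans (pow_le_pow_left₀ hB hBN 2))
          (fun j' hj' i' hi' y => hj j' hj' i' hi' t ht y) x).trans ?_
        have := hCi j (by omega)
        have h0 := sourceConst_ge_one hA (show 0 ≤ σ by linarith) j k
        refine pow_le_pow_left₀ (mul_nonneg (by linarith) (by linarith)) ?_ 2
        exact mul_le_mul_of_nonneg_right this (by linarith)) (by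
        intro j hjn x
        split_ifs
        · exact (hgB j (by omega) x).trans (pow_le_pow_left₀ hB hBC 2)
        · rw [sq_zero_fun]; positivity) i (by omega) t ht x
    refine h1.trans (le_of_eq ?_)
    ring
  induction k with
  | zero =>
    obtain ⟨N, hN, h1⟩ := step 0 1 le_rfl
    refine ⟨N, hN, fun S hs hS hf hg h hh V B hV hB hfB hgB j hj i hi => ?_⟩
    obtain rfl : j = 0 := by omega
    exact h1 S hs hS hf hg h hh V B hV hB hfB hgB (fun j hj => absurd hj (by omega)) i hi
  | succ k ih =>
    obtain ⟨N₀, hN₀, h0⟩ := ih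
    obtain ⟨N, hN, h1⟩ := step (k + 1) N₀ hN₀
    refine ⟨N, hN₀.trans hN, fun S hs hS hf hg h hh V B hV hB hfB hgB j hj i hi => ?_⟩
    have h2 := h0 S hs hS hf hg h hh V B hV hB hfB hgB
    rcases hj.eq_or_lt with rfl | hlt
    · exact h1 S hs hS hf hg h hh V B hV hB hfB hgB (fun j hj => h2 j (by omega)) i hi
    · intro t ht x
      refine (h2 j (by omega) i hi t ht x).trans (pow_le_pow_left₀ (by positivity) ?_ 2)
      exact mul_le_mul_of_nonneg_right hN hB

/-- The estimate of the derivatives of odd order in `h`. -/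
theorem deriv_estimate_odd (m : ℕ) {δ K c₀ A size : ℝ} (hδ : δ ∈ Ioc (0 : ℝ) 1)
    (hc₀ : 0 < c₀) (hτ : 0 < τ₀) (hK : 1 ≤ K) (hA : 0 ≤ A) (k : ℕ) :
    ∃ N : ℝ, 1 ≤ N ∧ ∀ {d : ℕ} (S : Scheme d), S.size = size →
      S.SmoothData τ₀ δ K c₀ A m → S.Symmetric → S.Antisymmetric →
      TB S.T S.f → SB S.g → ∀ h ∈ Ioc 0 S.h₀,
      ∀ (V : ℕ → ℝ → E d → ℝ) (B : ℝ), S.DerivSystem h V → 0 ≤ B →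
      (∀ j ≤ m, ∀ t ∈ Icc 0 S.T, ∀ x, S.sq τ₀ h j (S.f t) x ≤ B ^ 2) →
      (∀ j ≤ m, ∀ x, S.sq τ₀ h j S.g x ≤ B ^ 2) →
      ∀ j ≤ k, Odd j → ∀ i, 3 * j + i + 1 ≤ m → ∀ t ∈ Icc 0 S.T, ∀ x,
        S.sq τ₀ h i (V j t) x ≤ (N * (B * h)) ^ 2 := by
  set σ := max 1 (size * τ₀⁻¹) with hσdef
  have hσ1 : 1 ≤ σ := le_max_left _ _
  have hσ : size * τ₀⁻¹ ≤ σ := le_max_right _ _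
  induction k with
  | zero =>
    refine ⟨1, le_rfl, fun S hs hS _ _ hf hg h hh V B hV hB hfB hgB j hj hjo => ?_⟩
    obtain rfl : j = 0 := by omega
    simp at hjo
  | succ k ih =>
    obtain ⟨N₀, hN₀, h0⟩ := ih
    obtain ⟨N₁, hN₁, h1⟩ := deriv_estimate m (size := size) hδ hc₀ hτ hK hA k
    -- One order less than in `deriv_estimate`, because the cancellation over the stencil consumes a
    -- derivative.
    obtain ⟨Y, hY1, hY⟩ := apriori (m - 3 * (k + 1) - 1) (size := size) hδ hc₀ hτ hK hA
    set C := ∑ i ∈ Finset.range (m + 1), sourceConst A σ i (k + 1) with hC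
    have hCi : ∀ i ≤ m, sourceConst A σ i (k + 1) ≤ C := fun i hi =>
      sourceConst_le_sum hA (by linarith) hi (k + 1)
    have hC1 : 1 ≤ C := (sourceConst_ge_one hA (by linarith) 0 (k + 1)).trans (hCi 0 (Nat.zero_le m))
    -- A common constant for the `O(h)` bounds of the odd orders and the plain bounds of all lower
    -- orders.
    set N₂ := N₀ + N₁ with hN₂
    have hN₂1 : 1 ≤ N₂ := by linarith
    have hle : N₂ ≤ Y * (C * N₂) := by
      have : N₂ ≤ C * N₂ := le_mul_of_one_le_left (by linarith) hC1
      exact this.trans (le_mul_of_one_le_left (by linarith) hY1)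
    refine ⟨Y * (C * N₂), by linarith, ?_⟩
    intro d S hs hS hsym hanti hf hg h hh V B hV hB hfB hgB j hj hjo
    have hh0 : 0 < h := hh.1
    have h2 := h0 S hs hS hsym hanti hf hg h hh V B hV hB hfB hgB
    have h3 := h1 S hs hS hf hg h hh V B hV hB hfB hgB
    have hNB : 0 ≤ N₂ * B := by positivity
    rcases hj.eq_or_lt with rfl | hlt
    · intro i hi t ht x
      have h4 := hY S hs hS (by omega) h hh (V (k + 1)) (S.source h V (k + 1)) (fun x => 0)
        (C * (N₂ * B * h)) (hV.tb _) (hV.source_tb _) (SB.const 0) (by positivity)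
        (fun t ht x => by simpa using hV.equation (k + 1) t ht x) (by
          intro j hjn t ht x
          refine (sq_source_odd_le hτ hA hS hsym hanti hV.tb hh (by rw [hs]; exact hσ) hσ1 hNB hjo
            (n := j) (by omega) ht (fun j' hj' i' hi' y => ?_) (fun j' hj' hjo' i' hi' y => ?_)
            x).trans ?_
          · refine (h3 j' (by omega) i' hi' t ht y).trans (pow_le_pow_left₀ (by positivity) ?_ 2)
            exact mul_le_mul_of_nonneg_right (by linarith) hB
          · refine (h2 j' (by omega) hjo' i' hi' t ht y).trans
              (pow_le_pow_left₀ (by positivity) ?_ 2)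
            rw [mul_assoc]
            exact mul_le_mul_of_nonneg_right (by linarith) (by positivity)
          have := hCi j (by omega)
          have h0 := sourceConst_ge_one hA (show 0 ≤ σ by linarith) j (k + 1)
          refine pow_le_pow_left₀ (mul_nonneg (by linarith) (by positivity)) ?_ 2
          exact mul_le_mul_of_nonneg_right this (by positivity)) (by
          intro j _ x
          rw [sq_zero_fun]; positivity) i (by omega) t ht x
      refine h4.trans (le_of_eq ?_)
      ring
    · intro i hi t ht x
      refine (h2 j (by omega) hjo i hi t ht x).trans (pow_le_pow_left₀ (by positivity) ?_ 2)
      exact mul_le_mul_of_nonneg_right (by linarith) (by positivity)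

end Scheme

/-! ### Criteria for bounded derivatives, a cut-off of `1/h`, and iterated directional derivatives.
-/

section Criteria

variable {F : Type*} [NormedAddCommGroup F] [NormedSpace ℝ F]

theorem BD_of_norm_iteratedFDeriv_le {N : ℕ} {C : ℝ} {φ : F → ℝ} (hφ : ContDiff ℝ ∞ φ)
    (h : ∀ i ≤ N, ∀ x, ‖iteratedFDeriv ℝ i φ x‖ ≤ C) : BD N C φ := by
  have h0 : ∀ x, |φ x| ≤ C := fun x => by simpa using h 0 (Nat.zero_le _) x
  have hd : Differentiable ℝ φ := hφ.differentiable (by simp)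
  induction N generalizing φ with
  | zero => exact ⟨hφ.continuous, h0⟩
  | succ N ih =>
    refine ⟨hd, h0, fun e he => ?_⟩
    have e1 : dd e φ = (ContinuousLinearMap.apply ℝ ℝ e) ∘ fderiv ℝ φ := by
      funext y; simp [dd]
    have hf : ContDiff ℝ ∞ (fderiv ℝ φ) := hφ.fderiv_right (by simp)
    have hdd : ContDiff ℝ ∞ (dd e φ) := by
      rw [e1]
      exact (ContinuousLinearMap.apply ℝ ℝ e).contDiff.comp hf
    have hb : ∀ i ≤ N, ∀ x, ‖iteratedFDeriv ℝ i (dd e φ) x‖ ≤ C := by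
      intro i hi x
      rw [e1]
      refine ((ContinuousLinearMap.apply ℝ ℝ e).norm_iteratedFDeriv_comp_left hf.contDiffAt
        (n := i) (by exact_mod_cast le_top)).trans ?_
      rw [norm_iteratedFDeriv_fderiv]
      have hn : ‖ContinuousLinearMap.apply ℝ ℝ e‖ ≤ 1 :=
        ContinuousLinearMap.opNorm_le_bound _ zero_le_one fun L => by
          rw [ContinuousLinearMap.apply_apply, one_mul]
          exact (L.le_opNorm e).trans (mul_le_of_le_one_right (norm_nonneg _) he)
      calc _ ≤ 1 * ‖iteratedFDeriv ℝ (i + 1) φ x‖ := by gcongr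
        _ ≤ C := by rw [one_mul]; exact h _ (by omega) x
    exact ih hdd hb (fun x => by simpa using hb 0 (Nat.zero_le _) x) (hdd.differentiable (by simp))

theorem SB_of_hasCompactSupport {φ : F → ℝ} (hφ : ContDiff ℝ ∞ φ) (hc : HasCompactSupport φ) :
    SB φ := by
  intro N
  have h1 : ∀ i : ℕ, ∃ C, ∀ x, ‖iteratedFDeriv ℝ i φ x‖ ≤ C := fun i => by
    have h2 : Continuous (iteratedFDeriv ℝ i φ) :=
      hφ.continuous_iteratedFDeriv (by exact_mod_cast le_top)
    exact (hc.iteratedFDeriv i).exists_bound_of_continuous h2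
  choose C hC using h1
  refine ⟨∑ i ∈ Finset.range (N + 1), |C i|, BD_of_norm_iteratedFDeriv_le hφ fun i hi x => ?_⟩
  exact (hC i x).trans ((le_abs_self _).trans (Finset.single_le_sum (f := fun i => |C i|)
    (fun _ _ => abs_nonneg _) (Finset.mem_range.mpr (by omega))))

/-- A bump equal to one on `[a, b]` and vanishing to the left of `a/2` keeps `h⁻¹` away from its
singularity, so the product is smooth with compact support. -/
theorem exists_cutoff {a b : ℝ} (ha : 0 < a) (hab : a < b) :
    ∃ β : ℝ → ℝ, SB β ∧ ∀ h ∈ Icc a b, β h = h⁻¹ := by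
  let χ : ContDiffBump ((a + b) / 2 : ℝ) :=
    ⟨(b - a) / 2, (b - a) / 2 + a / 2, by linarith, by linarith⟩
  refine ⟨fun h => χ h * h⁻¹, SB_of_hasCompactSupport ?_ ?_, fun h hh => ?_⟩
  · rw [contDiff_iff_contDiffAt]
    intro h
    by_cases h0 : 0 < h
    · exact χ.contDiff.contDiffAt.mul (contDiffAt_inv ℝ h0.ne')
    · have : (fun h => χ h * h⁻¹) =ᶠ[𝓝 h] fun _ => 0 := by
        have : h < a / 2 := by linarith
        filter_upwards [Iio_mem_nhds this] with y hy
        rw [mem_Iio] at hy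
        rw [χ.zero_of_le_dist, zero_mul]
        rw [Real.dist_eq, abs_sub_comm]
        refine le_trans ?_ (le_abs_self _)
        change (b - a) / 2 + a / 2 ≤ _
        linarith
      exact contDiffAt_const.congr_of_eventuallyEq this
  · exact χ.hasCompactSupport.mul_right
  · dsimp only
    rw [χ.one_of_mem_closedBall, one_mul]
    rw [Metric.mem_closedBall, Real.dist_eq, abs_le]
    change -((b - a) / 2) ≤ _ ∧ _ ≤ (b - a) / 2
    constructor <;> linarith [hh.1, hh.2]

theorem iterate_dd_congr {O : Set F} (hO : IsOpen O) {φ ψ : F → ℝ} (h : EqOn φ ψ O) (e : F)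
    (k : ℕ) : EqOn ((dd e)^[k] φ) ((dd e)^[k] ψ) O := by
  induction k with
  | zero => exact h
  | succ k ih =>
    intro z hz
    simp only [Function.iterate_succ_apply', dd]
    rw [Filter.EventuallyEq.fderiv_eq (ih.eventuallyEq_of_mem (hO.mem_nhds hz))]

theorem iterate_dd_add {φ ψ : F → ℝ} (hφ : SB φ) (hψ : SB ψ) (e : F) (k : ℕ) :
    (dd e)^[k] (fun z => φ z + ψ z) = fun z => ((dd e)^[k] φ) z + ((dd e)^[k] ψ) z := by
  induction k with
  | zero => rfl
  | succ k ih =>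
    simp only [Function.iterate_succ_apply']
    rw [ih, dd_add (hφ.iterate_dd e k).differentiable (hψ.iterate_dd e k).differentiable]

theorem iterate_dd_sum {ι : Type*} (s : Finset ι) {φ : ι → F → ℝ} (hφ : ∀ i ∈ s, SB (φ i)) (e : F)
    (k : ℕ) : (dd e)^[k] (fun z => ∑ i ∈ s, φ i z) = fun z => ∑ i ∈ s, ((dd e)^[k] (φ i)) z := by
  induction k with
  | zero => rfl
  | succ k ih =>
    simp only [Function.iterate_succ_apply']
    rw [ih, dd_sum s fun i hi => ((hφ i hi).iterate_dd e k).differentiable]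

theorem iterate_dd_const_mul {φ : F → ℝ} (a : ℝ) (e : F) (k : ℕ) :
    (dd e)^[k] (fun z => a * φ z) = fun z => a * ((dd e)^[k] φ) z := by
  induction k with
  | zero => rfl
  | succ k ih =>
    simp only [Function.iterate_succ_apply']
    rw [ih, dd_const_mul]

theorem TB.iterate_dd {T : ℝ} {ψ : ℝ → F → ℝ} (h : TB T ψ) (e : F) (k : ℕ) :
    TB T (fun t => (FDScheme.dd e)^[k] (ψ t)) := by
  induction k with
  | zero => exact h
  | succ k ih => simp only [Function.iterate_succ_apply']; exact ih.dd e

theorem TB.iterate_dd_intervalIntegral [FiniteDimensional ℝ F] {T t : ℝ} {ψ : ℝ → F → ℝ}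
    (h : TB T ψ) (ht : t ∈ Icc 0 T) (e : F) (k : ℕ) :
    (FDScheme.dd e)^[k] (fun z => ∫ s in (0 : ℝ)..t, ψ s z) =
      fun z => ∫ s in (0 : ℝ)..t, ((FDScheme.dd e)^[k] (ψ s)) z := by
  induction k with
  | zero => rfl
  | succ k ih =>
    simp only [Function.iterate_succ_apply']
    rw [ih, (h.iterate_dd e k).dd_intervalIntegral ht]

end Criteria

/-! ## The mesh-size as an additional variable -/

/-- The unit vector in the direction of the mesh-size. -/
def eh : ℝ × E d := (1, 0)

/-- The shear `(h, x) ↦ (h, x + hκ)`. -/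
def shear (κ : E d) : ℝ × E d →L[ℝ] ℝ × E d :=
  (ContinuousLinearMap.fst ℝ ℝ (E d)).prod
    (ContinuousLinearMap.snd ℝ ℝ (E d) + (ContinuousLinearMap.fst ℝ ℝ (E d)).smulRight κ)

theorem shear_apply (κ : E d) (z : ℝ × E d) : shear κ z = (z.1, z.2 + z.1 • κ) := rfl

theorem norm_shear_le (κ : E d) : ‖shear κ‖ ≤ 1 + ‖κ‖ := by
  refine ContinuousLinearMap.opNorm_le_bound _ (by positivity) fun z => ?_
  have h1 : ‖z.1‖ ≤ ‖z‖ := norm_fst_le z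
  have h2 : ‖z.2‖ ≤ ‖z‖ := norm_snd_le z
  rw [shear_apply, Prod.norm_def, max_le_iff]
  have h3 : 0 ≤ ‖κ‖ * ‖z‖ := by positivity
  constructor
  · change ‖z.1‖ ≤ _
    linarith
  · dsimp only
    refine (norm_add_le _ _).trans ?_
    rw [norm_smul]
    nlinarith [norm_nonneg κ]

theorem shear_eh (κ : E d) : shear κ eh = eh + (0, κ) := by
  rw [shear_apply, eh]; simp

/-- `∫_0^1 w(θ) ∂_κ^l φ(h, x + θhκ) dθ`. -/
def shearAvg (w : ℝ → ℝ) (l : ℕ) (κ : E d) (φ : ℝ × E d → ℝ) (z : ℝ × E d) : ℝ :=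
  ∫ θ in (0 : ℝ)..1, w θ * ((dd ((0, κ) : ℝ × E d))^[l] φ) (shear (θ • κ) z)

theorem tb_shear {w : ℝ → ℝ} (hw : Continuous w) {φ : ℝ × E d → ℝ} (hφ : SB φ) (κ : E d) :
    TB 1 (fun θ z => w θ * φ (shear (θ • κ) z)) := by
  refine ⟨fun z => (Continuous.aestronglyMeasurable ?_), fun N => ?_⟩
  · simp only [shear_apply]
    exact hw.mul (hφ.continuous.comp (by fun_prop))
  · obtain ⟨C, hC⟩ := hφ N
    obtain ⟨b, hb⟩ := isCompact_Icc.exists_bound_of_continuousOn (s := Icc (0 : ℝ) 1)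
      hw.continuousOn
    refine ⟨b * ((1 + ‖κ‖) ^ N * C), fun θ hθ => ?_⟩
    have hn : ‖shear (θ • κ)‖ ≤ 1 + ‖κ‖ := by
      refine (norm_shear_le _).trans ?_
      rw [norm_smul, Real.norm_of_nonneg hθ.1]
      have := mul_le_of_le_one_left (norm_nonneg κ) hθ.2
      linarith
    have h1 := (hC.comp_affine (shear (θ • κ)) 0 hn (by linarith [norm_nonneg κ])).const_mul (w θ)
    simp only [add_zero] at h1
    refine h1.mono ?_
    have := hC.nonneg
    exact mul_le_mul_of_nonneg_right (hb θ hθ) (by positivity)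

theorem SB.shearAvg {w : ℝ → ℝ} (hw : Continuous w) {φ : ℝ × E d → ℝ} (hφ : SB φ) (l : ℕ)
    (κ : E d) : SB (shearAvg w l κ φ) :=
  ((tb_shear hw (hφ.iterate_dd (0, κ) l) κ).primitive zero_le_one).sb
    (show (1 : ℝ) ∈ Icc 0 1 by simp)

theorem iterate_dd_comm {F : Type*} [NormedAddCommGroup F] [NormedSpace ℝ F]
    [FiniteDimensional ℝ F] {φ : F → ℝ} (hφ : SB φ) (e e' : F) (l : ℕ) :
    dd e ((dd e')^[l] φ) = (dd e')^[l] (dd e φ) := by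
  induction l generalizing φ with
  | zero => rfl
  | succ l ih => simp only [Function.iterate_succ_apply]; rw [ih (hφ.dd e'), hφ.dd_comm]

/-- The shear by `θκ` maps the `h`-direction to itself plus `θκ`. Hence a derivative in `h` either
falls on `φ` or becomes `θ ∂_κ`, which multiplies the weight by `θ` and raises the order by one. -/
theorem dd_shearAvg {w : ℝ → ℝ} (hw : Continuous w) {φ : ℝ × E d → ℝ} (hφ : SB φ) (l : ℕ)
    (κ : E d) : dd eh (shearAvg w l κ φ) = fun z => shearAvg w l κ (dd eh φ) z +
      shearAvg (fun θ => w θ * θ) (l + 1) κ φ z := by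
  have h1 := (tb_shear hw (hφ.iterate_dd (0, κ) l) κ).dd_intervalIntegral
    (show (1 : ℝ) ∈ Icc 0 1 by simp) eh
  have h2 : shearAvg w l κ φ =
      fun z => ∫ θ in (0 : ℝ)..1, w θ * ((dd ((0, κ) : ℝ × E d))^[l] φ) (shear (θ • κ) z) := rfl
  rw [h2, h1]
  funext z
  simp only [shearAvg]
  have hw' : Continuous fun θ => w θ * θ := hw.mul continuous_id
  have i1 := (tb_shear hw ((hφ.dd eh).iterate_dd (0, κ) l) κ).intervalIntegrable
    (show (1 : ℝ) ∈ Icc 0 1 by simp) z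
  have i2 := (tb_shear hw' (hφ.iterate_dd (0, κ) (l + 1)) κ).intervalIntegrable
    (show (1 : ℝ) ∈ Icc 0 1 by simp) z
  rw [← intervalIntegral.integral_add i1 i2]
  congr 1
  funext θ
  set ψ := (dd ((0, κ) : ℝ × E d))^[l] φ with hψ
  have hψs : SB ψ := hφ.iterate_dd _ l
  rw [dd_const_mul]
  have h3 := dd_comp_affine (A := shear (θ • κ)) (v := 0) hψs.differentiable eh
  simp only [add_zero] at h3
  rw [h3, shear_eh, dd_add_dir, show ((0 : ℝ), θ • κ) = θ • ((0 : ℝ), κ) by simp, dd_smul_dir,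
    hψ, iterate_dd_comm hφ, Function.iterate_succ_apply']
  ring

/-- Iterating the previous rule gives a binomial formula, and this is where the weights `θ^{k-j}`
and the orders in `source` come from. -/
theorem iterate_dd_shearAvg {w : ℝ → ℝ} (hw : Continuous w) {φ : ℝ × E d → ℝ} (hφ : SB φ) (l : ℕ)
    (κ : E d) (k : ℕ) : (dd eh)^[k] (shearAvg w l κ φ) = fun z =>
      ∑ ij ∈ Finset.HasAntidiagonal.antidiagonal k, (k.choose ij.1 : ℝ) *
        shearAvg (fun θ => w θ * θ ^ ij.2) (l + ij.2) κ ((dd eh)^[ij.1] φ) z := by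
  have hwi : ∀ i : ℕ, Continuous fun θ => w θ * θ ^ i := fun i => hw.mul (continuous_pow i)
  induction k with
  | zero =>
    funext z
    rw [Finset.Nat.sum_antidiagonal_eq_sum_range_succ_mk, Finset.sum_range_one]
    simp
  | succ k ih =>
    rw [Function.iterate_succ_apply', ih, dd_sum _ fun ij _ =>
      (((hφ.iterate_dd eh ij.1).shearAvg (hwi ij.2) _ κ).const_mul _).differentiable]
    funext z
    have e1 : ∀ ij : ℕ × ℕ, dd eh (fun z => (k.choose ij.1 : ℝ) *
        shearAvg (fun θ => w θ * θ ^ ij.2) (l + ij.2) κ ((dd eh)^[ij.1] φ) z) z =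
        (k.choose ij.1 : ℝ) *
          shearAvg (fun θ => w θ * θ ^ (ij.2 + 1)) (l + (ij.2 + 1)) κ ((dd eh)^[ij.1] φ) z +
        (k.choose ij.1 : ℝ) *
          shearAvg (fun θ => w θ * θ ^ ij.2) (l + ij.2) κ ((dd eh)^[ij.1 + 1] φ) z := by
      intro ij
      rw [dd_const_mul, dd_shearAvg (hwi ij.2) (hφ.iterate_dd eh ij.1),
        Function.iterate_succ_apply']
      simp only [pow_succ, mul_assoc, add_assoc]
      ring
    simp only [e1, Finset.sum_add_distrib]
    rw [Finset.sum_antidiagonal_choose_succ_mul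
      (fun i j => shearAvg (fun θ => w θ * θ ^ j) (l + j) κ ((dd eh)^[i] φ) z)]
    congr 1
    refine Finset.sum_congr rfl fun ij hij => ?_
    rw [Finset.HasAntidiagonal.mem_antidiagonal] at hij
    rw [← hij, Nat.choose_symm_add]

/-- Derivatives in `x` of slices. -/
theorem iterate_dd_slice {φ : ℝ × E d → ℝ} (hφ : SB φ) (κ : E d) (l : ℕ) (h : ℝ) :
    (dd κ)^[l] (fun x => φ (h, x)) = fun x => ((dd ((0, κ) : ℝ × E d))^[l] φ) (h, x) := by
  induction l generalizing φ with
  | zero => rfl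
  | succ l ih =>
    simp only [Function.iterate_succ_apply]
    have h1 := dd_comp_affine (A := ContinuousLinearMap.inr ℝ ℝ (E d)) (v := (h, 0))
      hφ.differentiable κ
    simp only [ContinuousLinearMap.inr_apply, Prod.mk_add_mk, zero_add, add_zero] at h1
    rw [h1, ih (hφ.dd _)]

theorem shearAvg_slice {w : ℝ → ℝ} {φ : ℝ × E d → ℝ} (hφ : SB φ) (l : ℕ) (κ : E d) (h : ℝ)
    (x : E d) : shearAvg w l κ φ (h, x) = segAvg h w l κ (fun y => φ (h, y)) x := by
  simp only [shearAvg, segAvg, iterate_dd_slice hφ, shear_apply, smul_smul, mul_comm]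

theorem SB.slice {φ : ℝ × E d → ℝ} (hφ : SB φ) (h : ℝ) : SB (fun x => φ (h, x)) := by
  have := hφ.comp_affine (ContinuousLinearMap.inr ℝ ℝ (E d)) (h, 0)
  simpa using this

theorem TB.slice {T : ℝ} {ψ : ℝ → ℝ × E d → ℝ} (hψ : TB T ψ) (h : ℝ) :
    TB T (fun t x => ψ t (h, x)) := by
  have := hψ.comp_affine (ContinuousLinearMap.inr ℝ ℝ (E d)) (h, 0)
  simpa using this

theorem TB.comp_snd {T : ℝ} {ψ : ℝ → E d → ℝ} (hψ : TB T ψ) :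
    TB T (fun t (z : ℝ × E d) => ψ t z.2) :=
  hψ.comp_linear (ContinuousLinearMap.snd ℝ ℝ (E d))

theorem SB.comp_snd {φ : E d → ℝ} (hφ : SB φ) : SB (fun z : ℝ × E d => φ z.2) :=
  hφ.comp_linear (ContinuousLinearMap.snd ℝ ℝ (E d))

theorem SB.comp_fst {φ : ℝ → ℝ} (hφ : SB φ) : SB (fun z : ℝ × E d => φ z.1) :=
  hφ.comp_linear (ContinuousLinearMap.fst ℝ ℝ (E d))

theorem dd_eh_comp_snd {φ : E d → ℝ} (hφ : SB φ) :
    dd eh (fun z : ℝ × E d => φ z.2) = fun _ => 0 := by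
  have h1 := dd_comp_affine (A := ContinuousLinearMap.snd ℝ ℝ (E d)) (v := 0)
    hφ.differentiable (eh : ℝ × E d)
  simp only [ContinuousLinearMap.coe_snd', add_zero] at h1
  rw [h1]
  simp [eh, dd]

theorem iterate_dd_eh_comp_snd {φ : E d → ℝ} (hφ : SB φ) (k : ℕ) :
    (dd eh)^[k] (fun z : ℝ × E d => φ z.2) = fun z => if k = 0 then φ z.2 else 0 := by
  cases k with
  | zero => simp
  | succ k =>
    rw [Function.iterate_succ_apply, dd_eh_comp_snd hφ]
    simp only [Nat.add_eq_zero_iff, one_ne_zero, and_false, if_false]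
    induction k with
    | zero => rfl
    | succ k ih => rw [Function.iterate_succ_apply, dd_const, ih]

theorem iterate_dd_eh_mul {a : E d → ℝ} (ha : SB a) {φ : ℝ × E d → ℝ} (hφ : SB φ) (k : ℕ) :
    (dd eh)^[k] (fun z => a z.2 * φ z) = fun z => a z.2 * ((dd eh)^[k] φ) z := by
  induction k with
  | zero => rfl
  | succ k ih =>
    simp only [Function.iterate_succ_apply']
    rw [ih, dd_mul ha.comp_snd.differentiable (hφ.iterate_dd eh k).differentiable,
      dd_eh_comp_snd ha]
    simp

namespace Scheme

variable (S : Scheme d)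

/-- The coefficients of the equation with the mesh-size as an additional variable; `β` is a
smooth cut-off of `h⁻¹`. -/
def jointCoef (β : ℝ → ℝ) : Option (E d) → ℝ → ℝ × E d → ℝ
  | none => fun s z => (-1) * ∑ l ∈ S.Λ₁, (β z.1 * (β z.1 * S.q l s z.2) + β z.1 * S.p l s z.2) -
      S.c s z.2
  | some l => fun s z => β z.1 * (β z.1 * S.q l s z.2) + β z.1 * S.p l s z.2

/-- The shears of the equation with the mesh-size as an additional variable. -/
def jointShear : Option (E d) → (ℝ × E d →L[ℝ] ℝ × E d)
  | none => ContinuousLinearMap.id ℝ _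
  | some l => shear l

/-- The right-hand side of the equation with the mesh-size as an additional variable. -/
def jointRHS (β : ℝ → ℝ) (u : ℝ → ℝ × E d → ℝ) : ℝ → ℝ × E d → ℝ :=
  evolRHS (Finset.insertNone S.Λ₁) (S.jointCoef β) jointShear (fun s z => S.f s z.2) u

variable {S} {β : ℝ → ℝ}

theorem tb_jointCoef (hβ : SB β) (hq : ∀ l ∈ S.Λ₁, TB S.T (S.q l))
    (hp : ∀ l ∈ S.Λ₁, TB S.T (S.p l)) (hc : TB S.T S.c) :
    ∀ o ∈ Finset.insertNone S.Λ₁, TB S.T (S.jointCoef β o) := by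
  have hβ' : TB S.T (fun _ (z : ℝ × E d) => β z.1) := TB.of_sb hβ.comp_fst
  have h1 : ∀ l ∈ S.Λ₁, TB S.T (S.jointCoef β (some l)) := fun l hl =>
    (hβ'.mul (hβ'.mul (hq l hl).comp_snd)).add (hβ'.mul (hp l hl).comp_snd)
  intro o ho
  cases o with
  | none => exact ((TB.sum S.Λ₁ h1).const_mul (-1)).sub hc.comp_snd
  | some l => exact h1 l (by simpa using ho)

/-- On a slice where the cut-off equals `1/h`, the coefficient of each shifted value is `h⁻² q + h⁻¹
p` and the diagonal coefficient collects their negatives and `-c`; this is `L_h` with its difference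
quotients expanded. -/
theorem jointRHS_eq (u : ℝ → ℝ × E d → ℝ) (s : ℝ) {h : ℝ} (hβh : β h = h⁻¹)
    (x : E d) : S.jointRHS β u s (h, x) = S.L h s (fun y => u s (h, y)) x + S.f s x := by
  simp only [jointRHS, evolRHS, Finset.sum_insertNone, jointCoef, jointShear, shear_apply, hβh,
    ContinuousLinearMap.id_apply, L, opL, opQ, fd, Finset.mul_sum]
  have : ∀ l, (h⁻¹ * (h⁻¹ * S.q l s x) + h⁻¹ * S.p l s x) * u s (h, x + h • l) =
      (h⁻¹ * (S.q l s x * (h⁻¹ * (u s (h, x + h • l) - u s (h, x)))) +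
      S.p l s x * (h⁻¹ * (u s (h, x + h • l) - u s (h, x)))) -
      (-1 * (h⁻¹ * (h⁻¹ * S.q l s x) + h⁻¹ * S.p l s x)) * u s (h, x) := fun l => by ring
  simp only [this, Finset.sum_sub_distrib, Finset.sum_add_distrib, ← Finset.sum_mul]
  ring

/-- The solution of the joint equation gives the derivatives in `h`. -/
theorem derivSystem_of_joint (hβ : SB β) (hq : ∀ l ∈ S.Λ₁, TB S.T (S.q l))
    (hp : ∀ l ∈ S.Λ₁, TB S.T (S.p l)) (hc : TB S.T S.c) (hf : TB S.T S.f) (hg : SB S.g)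
    (hcen : S.Centered) {a b : ℝ} (ha : 0 < a) (hab : ∀ h ∈ Ioo a b, β h = h⁻¹)
    {U : ℝ → ℝ × E d → ℝ} (hU : TB S.T U)
    (heq : ∀ t ∈ Icc 0 S.T, ∀ z, U t z = S.g z.2 + ∫ s in (0 : ℝ)..t, S.jointRHS β U s z)
    {h : ℝ} (hh : h ∈ Ioo a b) :
    S.DerivSystem h (fun k t x => ((dd eh)^[k] (U t)) (h, x)) := by
  have hh0 : 0 < h := ha.trans hh.1
  set V : ℕ → ℝ → E d → ℝ := fun k t x => ((dd eh)^[k] (U t)) (h, x) with hV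
  have hR : TB S.T (S.jointRHS β U) := TB.evolRHS (tb_jointCoef hβ hq hp hc) hf.comp_snd hU
  have hVt : ∀ k, TB S.T (V k) := fun k => (hU.iterate_dd eh k).slice h
  have key : ∀ k, ∀ s ∈ Icc 0 S.T, ∀ x, ((dd eh)^[k] (S.jointRHS β U s)) (h, x) =
      S.L h s (V k s) x + S.source h V k s x := by
    intro k s hs x
    have hUs := hU.sb hs
    have hO : IsOpen {z : ℝ × E d | z.1 ∈ Ioo a b} := isOpen_Ioo.preimage continuous_fst
    -- On the open slab where `β = 1/h` the right-hand side has a form without inverse powers of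
    -- `h`. An identity on an open set may be differentiated there any number of times.
    have e1 : EqOn (S.jointRHS β U s) (fun z => (∑ l ∈ S.Λ₁, S.q l s z.2 *
        shearAvg (fun θ => 1 - θ) 2 l (U s) z + ∑ l ∈ S.Λ₁, S.p l s z.2 *
        shearAvg (fun _ => 1) 1 l (U s) z) + ((-1) * (S.c s z.2 * U s z) + S.f s z.2))
        {z : ℝ × E d | z.1 ∈ Ioo a b} := by
      rintro ⟨η, y⟩ hη
      have hη' : η ∈ Ioo a b := hη
      have hη0 : η ≠ 0 := (ha.trans hη'.1).ne'
      rw [jointRHS_eq U s (hab η hη'), L, opL_eq_segAvg hη0 (hUs.slice η) y (hcen s hs y)]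
      simp only [shearAvg_slice hUs]
      ring
    have s2 : ∀ l ∈ S.Λ₁, SB (fun z : ℝ × E d => S.q l s z.2 *
        shearAvg (fun θ => 1 - θ) 2 l (U s) z) := fun l hl =>
      ((hq l hl).sb hs).comp_snd.mul (hUs.shearAvg (by fun_prop) 2 l)
    have s1 : ∀ l ∈ S.Λ₁, SB (fun z : ℝ × E d => S.p l s z.2 *
        shearAvg (fun _ => 1) 1 l (U s) z) := fun l hl =>
      ((hp l hl).sb hs).comp_snd.mul (hUs.shearAvg continuous_const 1 l)
    have s0 : SB (fun z : ℝ × E d => S.c s z.2 * U s z) := (hc.sb hs).comp_snd.mul hUs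
    rw [iterate_dd_congr hO e1 eh k (show (h, x) ∈ {z : ℝ × E d | z.1 ∈ Ioo a b} from hh),
      iterate_dd_add ((SB.sum _ s2).add (SB.sum _ s1))
        ((s0.const_mul (-1)).add (hf.sb hs).comp_snd),
      iterate_dd_add (SB.sum _ s2) (SB.sum _ s1),
      iterate_dd_add (s0.const_mul (-1)) (hf.sb hs).comp_snd, iterate_dd_sum _ s2,
      iterate_dd_sum _ s1, iterate_dd_const_mul, iterate_dd_eh_comp_snd (hf.sb hs),
      iterate_dd_eh_mul (hc.sb hs) hUs]
    dsimp only
    -- The term of the binomial formula in which all `k` derivatives fall on `U` rebuilds `L_h V_k`;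
    -- the others form the free term.
    have e2 : ∀ l ∈ S.Λ₁, ((dd eh)^[k] fun z : ℝ × E d => S.q l s z.2 *
        shearAvg (fun θ => 1 - θ) 2 l (U s) z) (h, x) =
        ∑ j ∈ Finset.range k, (k.choose j : ℝ) * (S.q l s x *
          segAvg h (fun θ => (1 - θ) * θ ^ (k - j)) (k - j + 2) l (V j s) x) +
        S.q l s x * segAvg h (fun θ => 1 - θ) 2 l (V k s) x := by
      intro l hl
      rw [iterate_dd_eh_mul ((hq l hl).sb hs) (hUs.shearAvg (by fun_prop) 2 l),
        iterate_dd_shearAvg (by fun_prop) hUs]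
      dsimp only
      rw [Finset.Nat.sum_antidiagonal_eq_sum_range_succ_mk, Finset.sum_range_succ, mul_add,
        Finset.mul_sum]
      simp only [shearAvg_slice (hUs.iterate_dd eh _), Nat.sub_self, pow_zero, mul_one,
        Nat.choose_self, Nat.cast_one, one_mul, add_zero, hV]
      congr 1
      refine Finset.sum_congr rfl fun j _ => ?_
      rw [add_comm 2]
      ring
    have e3 : ∀ l ∈ S.Λ₁, ((dd eh)^[k] fun z : ℝ × E d => S.p l s z.2 *
        shearAvg (fun _ => 1) 1 l (U s) z) (h, x) =
        ∑ j ∈ Finset.range k, (k.choose j : ℝ) * (S.p l s x *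
          segAvg h (fun θ => θ ^ (k - j)) (k - j + 1) l (V j s) x) +
        S.p l s x * segAvg h (fun _ => 1) 1 l (V k s) x := by
      intro l hl
      rw [iterate_dd_eh_mul ((hp l hl).sb hs) (hUs.shearAvg continuous_const 1 l),
        iterate_dd_shearAvg continuous_const hUs]
      dsimp only
      rw [Finset.Nat.sum_antidiagonal_eq_sum_range_succ_mk, Finset.sum_range_succ, mul_add,
        Finset.mul_sum]
      simp only [shearAvg_slice (hUs.iterate_dd eh _), Nat.sub_self, pow_zero, mul_one,
        Nat.choose_self, Nat.cast_one, one_mul, add_zero, hV]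
      congr 1
      refine Finset.sum_congr rfl fun j _ => ?_
      rw [add_comm 1]
      ring
    rw [Finset.sum_congr rfl e2, Finset.sum_congr rfl e3, L,
      opL_eq_segAvg hh0.ne' ((hVt k).sb hs) x (hcen s hs x), source, Finset.sum_add_distrib,
      Finset.sum_add_distrib, Finset.sum_comm, Finset.sum_comm (s := S.Λ₁)]
    simp only [mul_add, Finset.mul_sum, Finset.sum_add_distrib]
    simp only [hV]
    ring
  refine ⟨hVt, fun k => ?_, fun k t ht x => ?_⟩
  -- Regularity of the free term is read off as a difference of two regular functions.
  · refine (((hR.iterate_dd eh k).slice h).sub (tb_L (h := h) hq hp hc (hVt k))).congr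
      fun s hs => ?_
    funext x
    rw [key k s hs x]
    ring
  · have e0 : U t = fun z => S.g z.2 + ∫ s in (0 : ℝ)..t, S.jointRHS β U s z := funext (heq t ht)
    have e1 : V k t x = ((dd eh)^[k] (U t)) (h, x) := rfl
    rw [e1, e0, iterate_dd_add hg.comp_snd ((hR.primitive S.T_pos.le).sb ht),
      iterate_dd_eh_comp_snd hg, hR.iterate_dd_intervalIntegral ht]
    dsimp only
    congr 1
    refine intervalIntegral.integral_congr fun s hs => ?_
    rw [uIcc_of_le ht.1] at hs
    exact key k s ⟨hs.1, hs.2.trans ht.2⟩ x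

end Scheme

/-! ## Multi-indices and words -/

/-- The standard basis vectors. -/
def bvec (i : Fin d) : E d := EuclideanSpace.single i 1

/-- The derivative along a word in the coordinate directions. -/
def pword (v : List (Fin d)) (φ : E d → ℝ) : E d → ℝ := ddList (v.map bvec) φ

theorem pword_cons (i : Fin d) (v : List (Fin d)) (φ : E d → ℝ) :
    pword (i :: v) φ = pword v (pderiv i φ) := rfl

theorem ddList_append {F : Type*} [NormedAddCommGroup F] [NormedSpace ℝ F] (l l' : List F)
    (φ : F → ℝ) : ddList (l ++ l') φ = ddList l' (ddList l φ) := by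
  induction l generalizing φ with
  | nil => rfl
  | cons e l ih => exact ih _

theorem dd_ddList {F : Type*} [NormedAddCommGroup F] [NormedSpace ℝ F] [FiniteDimensional ℝ F]
    {φ : F → ℝ} (hφ : SB φ) (e : F) (l : List F) : dd e (ddList l φ) = ddList l (dd e φ) := by
  induction l generalizing φ with
  | nil => rfl
  | cons e' l ih => simp only [ddList]; rw [ih (hφ.dd e'), hφ.dd_comm]

theorem pword_perm {φ : E d → ℝ} (hφ : SB φ) {v v' : List (Fin d)} (h : v.Perm v') :
    pword v φ = pword v' φ := by
  induction h generalizing φ with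
  | nil => rfl
  | cons i _ ih => rw [pword_cons, pword_cons, ih (hφ.pderiv i)]
  | swap i j l =>
    simp only [pword_cons, pderiv_eq_dd]
    rw [hφ.dd_comm]
  | trans _ _ ih ih' => rw [ih hφ, ih' hφ]

/-- The word of a multi-index. -/
def mword (α : Fin d → ℕ) : List (Fin d) → List (Fin d)
  | [] => []
  | i :: L => mword α L ++ List.replicate (α i) i

theorem ddList_replicate {F : Type*} [NormedAddCommGroup F] [NormedSpace ℝ F] (e : F) (n : ℕ)
    (φ : F → ℝ) : ddList (List.replicate n e) φ = (dd e)^[n] φ := by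
  induction n generalizing φ with
  | zero => rfl
  | succ n ih => rw [List.replicate_succ, Function.iterate_succ_apply]; exact ih _

theorem mderiv_eq_pword (α : Fin d → ℕ) (φ : E d → ℝ) :
    mderiv α φ = pword (mword α (List.finRange d)) φ := by
  rw [mderiv]
  generalize List.finRange d = L
  induction L with
  | nil => rfl
  | cons i L ih =>
    rw [List.foldr_cons, ih, mword, pword, pword, List.map_append, ddList_append,
      List.map_replicate, ddList_replicate]
    rfl

theorem count_mword (α : Fin d → ℕ) (i : Fin d) : (mword α (List.finRange d)).count i = α i := by
  have h : ∀ L : List (Fin d), L.Nodup → (mword α L).count i = if i ∈ L then α i else 0 := by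
    intro L hL
    induction L with
    | nil => simp [mword]
    | cons j L ih =>
      rw [List.nodup_cons] at hL
      rw [mword, List.count_append, ih hL.2, List.count_replicate]
      by_cases hij : i = j
      · subst hij
        simp [hL.1]
      · simp [hij, Ne.symm hij]
  rw [h _ (List.nodup_finRange d)]
  simp

theorem length_mword (α : Fin d → ℕ) : (mword α (List.finRange d)).length = ∑ i, α i := by
  have := Multiset.sum_count_eq_card (s := Finset.univ)
    (m := ((mword α (List.finRange d) : List (Fin d)) : Multiset (Fin d))) (by simp)
  simp only [Multiset.coe_count, count_mword, Multiset.coe_card] at this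
  exact this.symm

theorem mem_multiIndices {k : ℕ} {α : Fin d → ℕ} : α ∈ multiIndices d k ↔ ∑ i, α i = k := by
  rw [multiIndices, Finset.mem_piAntidiag]
  simp

/-- Distinct multi-indices have distinct canonical words, so the left side is a partial sum of the
right one. -/
theorem sum_mderiv_sq_le (k : ℕ) (φ : E d → ℝ) (x : E d) :
    ∑ α ∈ multiIndices d k, mderiv α φ x ^ 2 ≤
      ∑ v ∈ words (Finset.univ : Finset (Fin d)) k, pword v φ x ^ 2 := by
  classical
  have hinj : Set.InjOn (fun α : Fin d → ℕ => mword α (List.finRange d)) (multiIndices d k) := by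
    intro α _ α' _ h
    funext i
    rw [← count_mword α i, ← count_mword α' i]
    exact congrArg (List.count i) h
  calc _ = ∑ v ∈ (multiIndices d k).image fun α => mword α (List.finRange d), pword v φ x ^ 2 := by
        rw [Finset.sum_image hinj]
        exact Finset.sum_congr rfl fun α _ => by rw [mderiv_eq_pword]
    _ ≤ _ := by
        refine Finset.sum_le_sum_of_subset_of_nonneg ?_ fun _ _ _ => sq_nonneg _
        intro v hv
        obtain ⟨α, hα, rfl⟩ := Finset.mem_image.mp hv
        rw [mem_words, length_mword]
        exact ⟨mem_multiIndices.mp hα, fun _ _ => Finset.mem_univ _⟩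

/-- The words with the same letter counts are permutations of one canonical word, at most `k!` in
number, and give the same derivative. The factor is independent of `d`. -/
theorem sum_pword_sq_le (k : ℕ) {φ : E d → ℝ} (hφ : SB φ) (x : E d) :
    ∑ v ∈ words (Finset.univ : Finset (Fin d)) k, pword v φ x ^ 2 ≤
      k.factorial * ∑ α ∈ multiIndices d k, mderiv α φ x ^ 2 := by
  classical
  have hmap : ∀ v ∈ words (Finset.univ : Finset (Fin d)) k,
      (fun i => v.count i) ∈ multiIndices d k := by
    intro v hv
    rw [mem_words] at hv
    rw [mem_multiIndices]
    have := Multiset.sum_count_eq_card (s := Finset.univ) (m := ((v : List (Fin d)) :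
      Multiset (Fin d))) (by simp)
    simpa [hv.1] using this
  rw [← Finset.sum_fiberwise_of_maps_to hmap, Finset.mul_sum]
  refine Finset.sum_le_sum fun α hα => ?_
  have hperm : ∀ v : List (Fin d), (fun i => v.count i) = α →
      v.Perm (mword α (List.finRange d)) := by
    intro v hv
    rw [List.perm_iff_count]
    intro i
    rw [count_mword, ← hv]
  have h1 : ∀ v ∈ (words (Finset.univ : Finset (Fin d)) k).filter
      (fun v => (fun i => v.count i) = α), pword v φ x ^ 2 = mderiv α φ x ^ 2 := by
    intro v hv
    rw [Finset.mem_filter] at hv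
    rw [mderiv_eq_pword, pword_perm hφ (hperm v hv.2)]
  rw [Finset.sum_congr rfl h1, Finset.sum_const, nsmul_eq_mul]
  refine mul_le_mul_of_nonneg_right ?_ (sq_nonneg _)
  have h2 : ((words (Finset.univ : Finset (Fin d)) k).filter
      (fun v => (fun i => v.count i) = α)) ⊆
      (mword α (List.finRange d)).permutations.toFinset := by
    intro v hv
    rw [Finset.mem_filter] at hv
    rw [List.mem_toFinset, List.mem_permutations]
    exact hperm v hv.2
  have h3 := (Finset.card_le_card h2).trans (List.toFinset_card_le _)
  rw [List.length_permutations, length_mword, mem_multiIndices.mp hα] at h3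
  exact_mod_cast h3

/-- A unit direction is a combination of coordinate directions with square-summable coefficients, so
Cauchy–Schwarz lowers the order by one with the same constant. -/
theorem BD_of_sum_pword_sq_le {N : ℕ} {C : ℝ} (hC : 0 ≤ C) {φ : E d → ℝ} (hφ : SB φ)
    (h : ∀ k ≤ N, ∀ x, ∑ v ∈ words (Finset.univ : Finset (Fin d)) k, pword v φ x ^ 2 ≤ C ^ 2) :
    BD N C φ := by
  have h0 : ∀ x, |φ x| ≤ C := fun x => by
    have := h 0 (Nat.zero_le _) x
    rw [sum_words_zero] at this
    exact abs_le_of_sq_le_sq this hC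
  induction N generalizing φ with
  | zero => exact ⟨hφ.continuous, h0⟩
  | succ N ih =>
    have h1 : ∀ e : E d, ‖e‖ ≤ 1 → ∀ k ≤ N, ∀ x,
        ∑ v ∈ words (Finset.univ : Finset (Fin d)) k, pword v (dd e φ) x ^ 2 ≤ C ^ 2 := by
      intro e he k hk x
      refine le_trans ?_ (h (k + 1) (by omega) x)
      rw [sum_words_succ, Finset.sum_comm]
      refine Finset.sum_le_sum fun v _ => ?_
      have e1 : pword v (dd e φ) = dd e (pword v φ) := (dd_ddList hφ e _).symm
      rw [e1]
      refine (dd_sq_le e _ x).trans ?_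
      have e2 : ∀ i, pword (i :: v) φ x = pderiv i (pword v φ) x := fun i => by
        rw [pword_cons, pderiv_eq_dd, pword, pword, dd_ddList hφ]
      simp only [e2]
      refine mul_le_of_le_one_left (Finset.sum_nonneg fun _ _ => sq_nonneg _) ?_
      exact pow_le_one₀ (norm_nonneg _) he
    refine ⟨hφ.differentiable, h0, fun e he => ih (hφ.dd e) (h1 e he) fun x => ?_⟩
    have := h1 e he 0 (Nat.zero_le _) x
    rw [sum_words_zero] at this
    exact abs_le_of_sq_le_sq this hC

/-! ### Comparison of words in `Λ` with words in the coordinate directions. -/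

namespace Scheme

variable {S : Scheme d} {τ₀ h : ℝ}

theorem sum_pword_sq_le_sq (hτ : 0 < τ₀) {φ : E d → ℝ} (hφ : SB φ) (r : ℕ) (x : E d) :
    ∑ v ∈ words (Finset.univ : Finset (Fin d)) r, pword v φ x ^ 2 ≤
      (τ₀⁻¹ ^ r) ^ 2 * S.sq τ₀ h r φ x := by
  induction r generalizing φ with
  | zero => simp [sum_words_zero, sq_zero_eq, pword, ddList]
  | succ r ih =>
    rw [sum_words_succ]
    have h1 : ∀ i, ∑ v ∈ words (Finset.univ : Finset (Fin d)) r, pword (i :: v) φ x ^ 2 ≤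
        (τ₀⁻¹ ^ (r + 1)) ^ 2 * S.sq τ₀ h r (S.dbar τ₀ h (.inr i) φ) x := by
      intro i
      have e1 : S.dbar τ₀ h (.inr i) φ = fun x => τ₀ * pderiv i φ x := rfl
      rw [e1, sq_const_mul]
      refine (ih (hφ.pderiv i)).trans (le_of_eq ?_)
      have e2 : (τ₀⁻¹ ^ (r + 1)) ^ 2 * (τ₀ ^ 2 * S.sq τ₀ h r (pderiv i φ) x) =
          (τ₀⁻¹ ^ r) ^ 2 * (τ₀⁻¹ * τ₀) ^ 2 * S.sq τ₀ h r (pderiv i φ) x := by ring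
      rw [e2, inv_mul_cancel₀ hτ.ne', one_pow, mul_one]
    refine (Finset.sum_le_sum fun i _ => h1 i).trans ?_
    rw [← Finset.mul_sum]
    refine mul_le_mul_of_nonneg_left ?_ (by positivity)
    rw [sq_succ hφ, Λ, Finset.sum_disjSum]
    have : 0 ≤ ∑ l ∈ S.Λ₁, S.sq τ₀ h r (S.dbar τ₀ h (.inl l) φ) x :=
      Finset.sum_nonneg fun _ _ => sq_nonneg _ _ _
    linarith

/-- A difference quotient along `l` is an average of `∂_l`, hence bounded by the gradient times
`‖l‖`. Summing the weights `‖τ_l l‖²` gives a constant free of `h`. -/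
theorem sum_dbar_sq_le {ι : Type*} (s : Finset ι) {ψ : ι → E d → ℝ} (hψ : ∀ i ∈ s, SB (ψ i))
    (hh : h ≠ 0) {B : ℝ} (hB : 0 ≤ B)
    (hb : ∀ y, ∑ i ∈ s, ∑ a, pderiv a (ψ i) y ^ 2 ≤ B ^ 2) (x : E d) :
    ∑ i ∈ s, ∑ μ ∈ S.Λ, S.dbar τ₀ h μ (ψ i) x ^ 2 ≤ (S.weightedSize ^ 2 + τ₀ ^ 2) * B ^ 2 := by
  have hws : S.weightedSize ^ 2 = ∑ l ∈ S.Λ₁, ‖S.τ l • l‖ ^ 2 :=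
    Real.sq_sqrt (Finset.sum_nonneg fun _ _ => _root_.sq_nonneg _)
  rw [Finset.sum_comm, Λ, Finset.sum_disjSum, add_mul, hws, Finset.sum_mul]
  refine add_le_add (Finset.sum_le_sum fun l _ => ?_) ?_
  · have h1 := segAvg_sq_le s hψ (w := fun _ => 1) continuous_const (by simp)
      (B := ‖l‖ * B) (κ := l) (l := 1) (by positivity) h (fun y => by
        calc _ ≤ ∑ i ∈ s, ‖l‖ ^ 2 * ∑ a, pderiv a (ψ i) y ^ 2 :=
              Finset.sum_le_sum fun i _ => dd_sq_le l (ψ i) y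
          _ = ‖l‖ ^ 2 * ∑ i ∈ s, ∑ a, pderiv a (ψ i) y ^ 2 := by rw [Finset.mul_sum]
          _ ≤ ‖l‖ ^ 2 * B ^ 2 := mul_le_mul_of_nonneg_left (hb y) (by positivity)
          _ = _ := by ring) x
    have e1 : ∀ i ∈ s, S.dbar τ₀ h (.inl l) (ψ i) x ^ 2 =
        S.τ l ^ 2 * segAvg h (fun _ => 1) 1 l (ψ i) x ^ 2 := by
      intro i hi
      simp only [dbar]
      rw [fd_eq_segAvg (hψ i hi) hh, mul_pow]
    rw [Finset.sum_congr rfl e1, ← Finset.mul_sum, norm_smul, mul_pow, Real.norm_eq_abs, sq_abs]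
    calc _ ≤ S.τ l ^ 2 * (‖l‖ * B) ^ 2 := mul_le_mul_of_nonneg_left h1 (_root_.sq_nonneg _)
      _ = _ := by ring
  · have e1 : ∑ a, ∑ i ∈ s, S.dbar τ₀ h (.inr a) (ψ i) x ^ 2 =
        τ₀ ^ 2 * ∑ i ∈ s, ∑ a, pderiv a (ψ i) x ^ 2 := by
      rw [Finset.sum_comm, Finset.mul_sum]
      refine Finset.sum_congr rfl fun i _ => ?_
      rw [Finset.mul_sum]
      exact Finset.sum_congr rfl fun a _ => by simp only [dbar, mul_pow]
    rw [e1]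
    exact mul_le_mul_of_nonneg_left (hb x) (_root_.sq_nonneg _)

/-- Letters are exchanged one by one. The statement is for families because each exchange enlarges
the index set, either by a coordinate direction or by a word. -/
theorem sum_sq_le_of_pword {n : ℕ} (hh : h ≠ 0) :
    ∀ {ι : Type} (s : Finset ι) (ψ : ι → E d → ℝ), (∀ i ∈ s, SB (ψ i)) → ∀ B : ℝ,
    (∀ y, ∑ i ∈ s, ∑ v ∈ words (Finset.univ : Finset (Fin d)) n, pword v (ψ i) y ^ 2 ≤ B) →
    ∀ x, ∑ i ∈ s, S.sq τ₀ h n (ψ i) x ≤ (S.weightedSize ^ 2 + τ₀ ^ 2) ^ n * B := by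
  induction n with
  | zero =>
    intro ι s ψ hψ B hb x
    simpa [sq_zero_eq, sum_words_zero, pword, ddList] using hb x
  | succ n ih =>
    intro ι s ψ hψ B hb x
    have hB0 : 0 ≤ B := le_trans (Finset.sum_nonneg fun _ _ =>
      Finset.sum_nonneg fun _ _ => _root_.sq_nonneg _) (hb 0)
    have h1 : ∀ y, ∑ z ∈ s ×ˢ (Finset.univ : Finset (Fin d)), S.sq τ₀ h n (pderiv z.2 (ψ z.1)) y ≤
        (S.weightedSize ^ 2 + τ₀ ^ 2) ^ n * B := by
      refine ih (s ×ˢ Finset.univ) (fun z => pderiv z.2 (ψ z.1))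
        (fun z hz => (hψ z.1 (Finset.mem_product.mp hz).1).pderiv _) B fun y => ?_
      rw [Finset.sum_product]
      refine le_trans (le_of_eq ?_) (hb y)
      refine Finset.sum_congr rfl fun i _ => ?_
      rw [sum_words_succ]
      rfl
    have h2 := sum_dbar_sq_le (S := S) (τ₀ := τ₀) (s ×ˢ words S.Λ n)
      (ψ := fun z => S.wD τ₀ h z.2 (ψ z.1))
      (fun z hz => sb_wD (hψ z.1 (Finset.mem_product.mp hz).1) z.2) hh
      (Real.sqrt_nonneg ((S.weightedSize ^ 2 + τ₀ ^ 2) ^ n * B)) (fun y => by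
        rw [Real.sq_sqrt (by positivity)]
        refine le_trans (le_of_eq ?_) (h1 y)
        rw [Finset.sum_product, Finset.sum_product]
        refine Finset.sum_congr rfl fun i hi => ?_
        rw [Finset.sum_comm]
        refine Finset.sum_congr rfl fun a _ => ?_
        rw [sq]
        refine Finset.sum_congr rfl fun w _ => ?_
        rw [pderiv_eq_dd, wD_dd (hψ i hi)]) x
    rw [Real.sq_sqrt (by positivity)] at h2
    refine le_trans (le_of_eq ?_) (h2.trans (le_of_eq (by ring)))
    rw [Finset.sum_product]
    refine Finset.sum_congr rfl fun i _ => ?_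
    rw [sq, sum_words_succ, Finset.sum_comm]
    rfl

end Scheme

/-! ## Mollification -/

/-- The convolution of `φ` with the measure `ν`. -/
def moll (ν : Measure (E d)) (φ : E d → ℝ) (x : E d) : ℝ := ∫ y, φ (x - y) ∂ν

section Prob

variable {ν : Measure (E d)} [IsProbabilityMeasure ν]

theorem BD.comp_sub {N : ℕ} {C : ℝ} {φ : E d → ℝ} (h : BD N C φ) (y : E d) :
    BD N C (fun x => φ (x - y)) := by
  have := h.comp_affine (ContinuousLinearMap.id ℝ (E d)) (-y) (R := 1)
    ContinuousLinearMap.norm_id_le le_rfl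
  simpa [sub_eq_add_neg] using this

theorem dd_comp_sub {φ : E d → ℝ} (h : Differentiable ℝ φ) (e y : E d) :
    dd e (fun x => φ (x - y)) = fun x => dd e φ (x - y) := by
  have := dd_comp_affine (A := ContinuousLinearMap.id ℝ (E d)) (v := -y) h e
  simpa [sub_eq_add_neg] using this

theorem BD.integrable {C : ℝ} {φ : E d → ℝ} (h : BD 0 C φ) (x : E d) :
    Integrable (fun y => φ (x - y)) ν :=
  Integrable.mono' (integrable_const C) (h.1.comp (by fun_prop)).aestronglyMeasurable
    (Eventually.of_forall fun y => h.2 _)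

theorem dd_moll {N : ℕ} {C : ℝ} {φ : E d → ℝ} (h : BD (N + 1) C φ) (e : E d) :
    dd e (moll ν φ) = moll ν (dd e φ) := by
  have := dd_integral (μ := ν) (ψ := fun y x => φ (x - y)) (C := fun _ => C) (N := N)
    (fun x => (h.continuous.comp (by fun_prop : Continuous fun y => x - y)).aestronglyMeasurable)
    (integrable_const C) (Eventually.of_forall fun y => h.comp_sub y) e
  refine this.trans ?_
  funext x
  simp only [moll, dd_comp_sub h.1]

theorem abs_moll_sub_le {φ : E d → ℝ} {r η : ℝ} (hν : ∀ᵐ y ∂ν, ‖y‖ ≤ r) {x : E d}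
    (hi : Integrable (fun y => φ (x - y)) ν) (h : ∀ y, ‖y‖ ≤ r → |φ (x - y) - φ x| ≤ η) :
    |moll ν φ x - φ x| ≤ η := by
  have e : moll ν φ x - φ x = ∫ y, (φ (x - y) - φ x) ∂ν := by
    rw [integral_sub hi (integrable_const _)]
    simp [moll]
  rw [e, ← Real.norm_eq_abs]
  refine (norm_integral_le_of_norm_le (integrable_const η) (hν.mono fun y hy => h y hy)).trans ?_
  simp

/-- Jensen's inequality for a family of functions. -/
theorem sum_moll_sq_le {ι : Type*} (s : Finset ι) {F : ι → E d → ℝ} {B : ℝ} (hB : 0 ≤ B) {x : E d}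
    (hi : ∀ i ∈ s, Integrable (fun y => F i (x - y)) ν)
    (h : ∀ᵐ y ∂ν, ∑ i ∈ s, F i (x - y) ^ 2 ≤ B ^ 2) : ∑ i ∈ s, moll ν (F i) x ^ 2 ≤ B ^ 2 := by
  refine le_of_sq_le_mul_sqrt hB ?_
  have e : ∑ i ∈ s, moll ν (F i) x ^ 2 = ∫ y, ∑ i ∈ s, moll ν (F i) x * F i (x - y) ∂ν := by
    rw [integral_finsetSum _ fun i hi' => (hi i hi').const_mul _]
    refine Finset.sum_congr rfl fun i _ => ?_
    rw [integral_const_mul, sq]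
    rfl
  have hle := norm_integral_le_of_norm_le (μ := ν)
    (f := fun y => ∑ i ∈ s, moll ν (F i) x * F i (x - y))
    (g := fun _ => √(∑ i ∈ s, moll ν (F i) x ^ 2) * B) (integrable_const _)
    (h.mono fun y hy => by
      rw [Real.norm_eq_abs]
      refine abs_le_of_sq_le_sq ?_ (by positivity)
      refine (Finset.sum_mul_sq_le_sq_mul_sq _ _ _).trans ?_
      rw [mul_pow, Real.sq_sqrt (Finset.sum_nonneg fun _ _ => sq_nonneg _)]
      exact mul_le_mul_of_nonneg_left hy (Finset.sum_nonneg fun _ _ => sq_nonneg _))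
  rw [← e, Real.norm_eq_abs] at hle
  refine (le_abs_self _).trans (hle.trans (le_of_eq ?_))
  simp

end Prob

section Kernel

/-- The probability measure with the density `b`. -/
def bumpMeasure (b : ContDiffBump (0 : E d)) : Measure (E d) :=
  volume.withDensity fun y => ENNReal.ofReal (b.normed volume y)

variable (b : ContDiffBump (0 : E d))

theorem integral_bumpMeasure (F : E d → ℝ) :
    ∫ y, F y ∂(bumpMeasure b) = ∫ y, b.normed volume y * F y := by
  rw [bumpMeasure, integral_withDensity_eq_integral_toReal_smul
    b.continuous_normed.measurable.ennreal_ofReal (by simp)]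
  refine integral_congr_ae (Eventually.of_forall fun y => ?_)
  simp [ENNReal.toReal_ofReal (b.nonneg_normed y)]

instance : IsProbabilityMeasure (bumpMeasure b) := ⟨by
  rw [bumpMeasure, withDensity_apply _ MeasurableSet.univ, Measure.restrict_univ,
    ← ofReal_integral_eq_lintegral_ofReal b.integrable_normed
      (Eventually.of_forall b.nonneg_normed), b.integral_normed, ENNReal.ofReal_one]⟩

theorem ae_norm_le_bumpMeasure : ∀ᵐ y ∂(bumpMeasure b), ‖y‖ ≤ b.rOut := by
  rw [bumpMeasure, ae_withDensity_iff b.continuous_normed.measurable.ennreal_ofReal]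
  refine Eventually.of_forall fun y hy => ?_
  by_contra! h
  apply hy
  have : y ∉ Function.support (b.normed volume) := by
    rw [b.support_normed_eq, mem_ball_zero_iff]
    exact not_lt.mpr h.le
  rw [Function.notMem_support.mp this, ENNReal.ofReal_zero]

theorem bumpMeasure_absolutelyContinuous : bumpMeasure b ≪ volume :=
  withDensity_absolutelyContinuous _ _

/-- The convolution of functions. -/
def conv (ρ φ : E d → ℝ) (x : E d) : ℝ := ∫ z, φ z * ρ (x - z)

theorem conv_eq_integral (ρ φ : E d → ℝ) (x : E d) : conv ρ φ x = ∫ y, ρ y * φ (x - y) := by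
  rw [conv, ← integral_sub_left_eq_self (fun z => φ z * ρ (x - z)) volume x]
  refine integral_congr_ae (Eventually.of_forall fun y => ?_)
  simp [mul_comm]

theorem moll_eq_conv (φ : E d → ℝ) : moll (bumpMeasure b) φ = conv (b.normed volume) φ := by
  funext x
  rw [moll, integral_bumpMeasure, conv_eq_integral]

variable {b}

theorem hasCompactSupport_dd {ρ : E d → ℝ} (hc : HasCompactSupport ρ) (e : E d) :
    HasCompactSupport (dd e ρ) := by
  have : dd e ρ = (fun L : E d →L[ℝ] ℝ => L e) ∘ fderiv ℝ ρ := rfl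
  rw [this]
  exact (hc.fderiv ℝ).comp_left rfl

theorem contDiff_dd {ρ : E d → ℝ} (h : ContDiff ℝ ∞ ρ) (e : E d) : ContDiff ℝ ∞ (dd e ρ) := by
  have : dd e ρ = (ContinuousLinearMap.apply ℝ ℝ e) ∘ fderiv ℝ ρ := by
    funext y; simp [dd]
  rw [this]
  exact (ContinuousLinearMap.apply ℝ ℝ e).contDiff.comp (h.fderiv_right (by simp))

theorem tsupport_dd_subset {ρ : E d → ℝ} (e : E d) : tsupport (dd e ρ) ⊆ tsupport ρ := by
  have : dd e ρ = (fun L : E d →L[ℝ] ℝ => L e) ∘ fderiv ℝ ρ := rfl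
  rw [this]
  exact (tsupport_comp_subset rfl _).trans (tsupport_fderiv_subset ℝ)

theorem hasFDerivAt_conv {ρ φ : E d → ℝ} (hρ : ContDiff ℝ ∞ ρ) (hc : HasCompactSupport ρ)
    (hφ : LocallyIntegrable φ volume) (x : E d) :
    DifferentiableAt ℝ (conv ρ φ) x ∧ ∀ e, dd e (conv ρ φ) x = conv (dd e ρ) φ x := by
  have h := hc.hasFDerivAt_convolution_right (ContinuousLinearMap.mul ℝ ℝ) (μ := volume) hφ
    (hρ.of_le (by exact_mod_cast le_top)) x
  have e0 : (convolution φ ρ (ContinuousLinearMap.mul ℝ ℝ) volume) = conv ρ φ := rfl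
  rw [e0] at h
  refine ⟨h.differentiableAt, fun e => ?_⟩
  rw [dd, h.fderiv]
  rw [convolution_precompR_apply (L := ContinuousLinearMap.mul ℝ ℝ) hφ (hc.fderiv ℝ)
    (hρ.continuous_fderiv (by simp)) x e]
  rfl

theorem dd_conv {ρ φ : E d → ℝ} (hρ : ContDiff ℝ ∞ ρ) (hc : HasCompactSupport ρ)
    (hφ : LocallyIntegrable φ volume) (e : E d) : dd e (conv ρ φ) = conv (dd e ρ) φ :=
  funext fun x => (hasFDerivAt_conv hρ hc hφ x).2 e

theorem ddList_conv {ρ φ : E d → ℝ} (hρ : ContDiff ℝ ∞ ρ) (hc : HasCompactSupport ρ)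
    (hφ : LocallyIntegrable φ volume) (l : List (E d)) :
    ddList l (conv ρ φ) = conv (ddList l ρ) φ := by
  induction l generalizing ρ with
  | nil => rfl
  | cons e l ih =>
    simp only [ddList]
    rw [dd_conv hρ hc hφ, ih (contDiff_dd hρ e) (hasCompactSupport_dd hc e)]

theorem ddList_reflect {ρ : E d → ℝ} (hρ : ContDiff ℝ ∞ ρ) (x : E d) (l : List (E d)) :
    ddList l (fun z => ρ (x - z)) = fun z => (-1) ^ l.length * ddList l ρ (x - z) := by
  have hmul : ∀ (l : List (E d)) (a : ℝ) (φ : E d → ℝ),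
      ddList l (fun z => a * φ z) = fun z => a * ddList l φ z := by
    intro l a
    induction l with
    | nil => intro φ; rfl
    | cons e l ih => intro φ; simp only [ddList]; rw [dd_const_mul, ih]
  induction l generalizing ρ with
  | nil => simp [ddList]
  | cons e l ih =>
    have h1 : dd e (fun z => ρ (x - z)) = fun z => (-1) * dd e ρ (x - z) := by
      have := dd_comp_affine (A := -ContinuousLinearMap.id ℝ (E d)) (v := x)
        (hρ.differentiable (by simp)) e
      simp only [neg_apply, ContinuousLinearMap.id_apply, neg_add_eq_sub]
        at this
      rw [this]
      funext z
      simp [dd]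
    simp only [ddList]
    rw [h1, hmul, ih (contDiff_dd hρ e), List.length_cons]
    funext z
    ring

/-- All derivatives fall on the kernel, and their supports stay in the fixed compact set `Kc`.
Nothing but boundedness and local integrability is required of `φ`. -/
theorem BD.conv {N : ℕ} {C C₀ : ℝ} {ρ φ : E d → ℝ} {Kc : Set (E d)} (hKc : IsCompact Kc)
    (hρ : ContDiff ℝ ∞ ρ) (hs : tsupport ρ ⊆ Kc) (hρb : BD N C ρ)
    (hφ : LocallyIntegrable φ volume) (hb : ∀ x, |φ x| ≤ C₀) :
    BD N (C * C₀ * (volume Kc).toReal) (conv ρ φ) := by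
  have hc0 : 0 ≤ C₀ := (abs_nonneg _).trans (hb 0)
  have key : ∀ {ρ : E d → ℝ}, tsupport ρ ⊆ Kc → (∀ x, |ρ x| ≤ C) → ∀ x,
      |FDScheme.conv ρ φ x| ≤ C * C₀ * (volume Kc).toReal := by
    intro ρ hs hρb x
    rw [conv_eq_integral, ← setIntegral_eq_integral_of_forall_compl_eq_zero (s := Kc),
      ← Real.norm_eq_abs]
    · refine norm_setIntegral_le_of_norm_le_const hKc.measure_lt_top fun y _ => ?_
      rw [norm_mul]
      exact mul_le_mul (hρb y) (hb _) (norm_nonneg _) ((abs_nonneg _).trans (hρb 0))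
    · intro y hy
      have : ρ y = 0 := image_eq_zero_of_notMem_tsupport fun h => hy (hs h)
      rw [this, zero_mul]
  have hcs : ∀ {ρ : E d → ℝ}, tsupport ρ ⊆ Kc → HasCompactSupport ρ := fun h =>
    hKc.of_isClosed_subset (isClosed_tsupport _) h
  induction N generalizing ρ with
  | zero =>
    refine ⟨?_, key hs hρb.bound⟩
    exact continuous_iff_continuousAt.mpr fun x =>
      (hasFDerivAt_conv hρ (hcs hs) hφ x).1.continuousAt
  | succ N ih =>
    refine ⟨fun x => (hasFDerivAt_conv hρ (hcs hs) hφ x).1, key hs hρb.bound, fun e he => ?_⟩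
    rw [dd_conv hρ (hcs hs) hφ]
    exact ih (contDiff_dd hρ e) ((tsupport_dd_subset e).trans hs) (hρb.2.2 e he)

/-- Generalized derivatives of a function become derivatives of its mollification. -/
theorem mderiv_moll (b : ContDiffBump (0 : E d)) {α : Fin d → ℕ} {φ w : E d → ℝ}
    (hw : HasWeakDeriv α φ w) :
    mderiv α (moll (bumpMeasure b) φ) = moll (bumpMeasure b) w := by
  have hρ : ContDiff ℝ ∞ (b.normed volume) := b.contDiff_normed
  have hc : HasCompactSupport (b.normed volume) := b.hasCompactSupport_normed
  obtain ⟨h1, h2, h3⟩ := hw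
  rw [moll_eq_conv, moll_eq_conv, mderiv_eq_pword, pword, ddList_conv hρ hc h1]
  funext x
  set l := (mword α (List.finRange d)).map bvec with hl
  have hlen : l.length = ∑ i, α i := by rw [hl, List.length_map, length_mword]
  -- The test function in the definition of the generalized derivative is the reflected kernel. Its
  -- derivatives carry the sign `(-1)^{|α|}`, which cancels the sign in that definition.
  have hη : ContDiff ℝ ∞ (fun z => b.normed volume (x - z)) := hρ.comp (by fun_prop)
  have hηc : HasCompactSupport (fun z => b.normed volume (x - z)) :=
    hc.comp_homeomorph (Homeomorph.subLeft x)
  have h4 := h3 _ hη hηc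
  rw [mderiv_eq_pword, pword, ← hl, ddList_reflect hρ, hlen] at h4
  have e1 : ∫ z, φ z * ((-1) ^ (∑ i, α i) * ddList l (b.normed volume) (x - z)) =
      (-1) ^ (∑ i, α i) * conv (ddList l (b.normed volume)) φ x := by
    rw [conv, ← integral_const_mul]
    refine integral_congr_ae (Eventually.of_forall fun z => ?_)
    ring
  rw [e1] at h4
  exact mul_left_cancel₀ (pow_ne_zero _ (by norm_num)) h4

/-! ## Measurability in time -/

/-- Joint measurability is only given on `[0,T]`, so time is first projected onto this interval; the
projection is the identity where it matters. -/
theorem aestronglyMeasurable_moll {T : ℝ} (hT : 0 ≤ T) {ψ : ℝ → E d → ℝ}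
    (hψ : Measurable (fun z : Icc (0 : ℝ) T × E d => ψ z.1 z.2)) (ν : Measure (E d)) [SFinite ν]
    (x : E d) : AEStronglyMeasurable (fun t => moll ν (ψ t) x) (volume.restrict (Icc 0 T)) := by
  have h1 : Measurable (fun z : ℝ × E d => ψ (projIcc 0 T hT z.1) (x - z.2)) :=
    hψ.comp (f := fun z : ℝ × E d => (projIcc 0 T hT z.1, x - z.2))
      (((continuous_projIcc.comp continuous_fst).measurable).prodMk
        (measurable_const.sub measurable_snd))
  have h2 : StronglyMeasurable (fun t => ∫ y, ψ (projIcc 0 T hT t) (x - y) ∂ν) :=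
    h1.stronglyMeasurable.integral_prod_right'
  refine h2.aestronglyMeasurable.congr ?_
  filter_upwards [ae_restrict_mem measurableSet_Icc] with t ht
  rw [projIcc_of_mem hT ht]
  rfl

/-- Mollification of bounded functions which are continuous in `x`. -/
theorem tb_moll (b : ContDiffBump (0 : E d)) {T C : ℝ} (hT : 0 ≤ T) {ψ : ℝ → E d → ℝ}
    (hψ : Measurable (fun z : Icc (0 : ℝ) T × E d => ψ z.1 z.2))
    (hc : ∀ t ∈ Icc 0 T, Continuous (ψ t)) (hb : ∀ t ∈ Icc 0 T, ∀ x, |ψ t x| ≤ C) :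
    TB T (fun t => moll (bumpMeasure b) (ψ t)) := by
  refine ⟨fun x => aestronglyMeasurable_moll hT hψ _ x, fun N => ?_⟩
  obtain ⟨C', hC'⟩ := SB_of_hasCompactSupport b.contDiff_normed
    (b.hasCompactSupport_normed (μ := volume)) N
  refine ⟨C' * C * (volume (tsupport (b.normed (volume : Measure (E d))))).toReal,
    fun t ht => ?_⟩
  rw [moll_eq_conv]
  exact BD.conv (b.hasCompactSupport_normed (μ := volume)) b.contDiff_normed subset_rfl hC'
    (hc t ht).locallyIntegrable (hb t ht)

end Kernel

/-! ## Averages of the coefficients -/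

/-- `F` is integrable with integral `a`. -/
def HasAvg (ν : Measure (E d)) (F : E d → ℝ) (a : ℝ) : Prop := Integrable F ν ∧ ∫ y, F y ∂ν = a

section HasAvg

variable {ν : Measure (E d)} {F G : E d → ℝ} {a b : ℝ}

theorem HasAvg.add (h : HasAvg ν F a) (h' : HasAvg ν G b) :
    HasAvg ν (fun y => F y + G y) (a + b) :=
  ⟨h.1.add h'.1, by rw [integral_add h.1 h'.1, h.2, h'.2]⟩

theorem HasAvg.sub (h : HasAvg ν F a) (h' : HasAvg ν G b) :
    HasAvg ν (fun y => F y - G y) (a - b) :=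
  ⟨h.1.sub h'.1, by rw [integral_sub h.1 h'.1, h.2, h'.2]⟩

theorem HasAvg.const_mul (h : HasAvg ν F a) (c : ℝ) : HasAvg ν (fun y => c * F y) (c * a) :=
  ⟨h.1.const_mul c, by rw [integral_const_mul, h.2]⟩

theorem HasAvg.mul_const (h : HasAvg ν F a) (c : ℝ) : HasAvg ν (fun y => F y * c) (a * c) :=
  ⟨h.1.mul_const c, by rw [integral_mul_const, h.2]⟩

theorem HasAvg.sum {ι : Type*} (s : Finset ι) {F : ι → E d → ℝ} {a : ι → ℝ}
    (h : ∀ i ∈ s, HasAvg ν (F i) (a i)) : HasAvg ν (fun y => ∑ i ∈ s, F i y) (∑ i ∈ s, a i) :=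
  ⟨integrable_finsetSum _ fun i hi => (h i hi).1, by
    rw [integral_finsetSum _ fun i hi => (h i hi).1]
    exact Finset.sum_congr rfl fun i hi => (h i hi).2⟩

theorem HasAvg.const [IsProbabilityMeasure ν] (c : ℝ) : HasAvg ν (fun _ => c) c :=
  ⟨integrable_const c, by simp⟩

theorem HasAvg.le (h : HasAvg ν F a) (h' : HasAvg ν G b) (hle : ∀ y, F y ≤ G y) : a ≤ b := by
  rw [← h.2, ← h'.2]
  exact integral_mono h.1 h'.1 hle

theorem hasAvg_moll [IsProbabilityMeasure ν] {N : ℕ} {C : ℝ} {φ : E d → ℝ} (h : BD N C φ)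
    (x : E d) : HasAvg ν (fun y => φ (x - y)) (moll ν φ x) :=
  ⟨(h.of_le (Nat.zero_le N)).integrable x, rfl⟩

end HasAvg

namespace Scheme

variable (S : Scheme d)

/-- The scheme with averaged data. -/
def average (ν : Measure (E d)) : Scheme d where
  h₀ := S.h₀
  T := S.T
  Λ₁ := S.Λ₁
  τ := S.τ
  q := fun l t => moll ν (S.q l t)
  p := fun l t => moll ν (S.p l t)
  c := fun t => moll ν (S.c t)
  f := fun t => moll ν (S.f t)
  g := moll ν S.g
  h₀_pos := S.h₀_pos
  T_pos := S.T_pos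
  zero_notMem := S.zero_notMem
  τ_nonneg := S.τ_nonneg
  q_nonneg := fun l hl t ht _ => integral_nonneg fun _ => S.q_nonneg l hl t ht _

variable {S} {τ₀ h t : ℝ} {ν : Measure (E d)}

theorem average_dbar (μ : E d ⊕ Fin d) (φ : E d → ℝ) :
    (S.average ν).dbar τ₀ h μ φ = S.dbar τ₀ h μ φ := by
  cases μ <;> rfl

variable [IsProbabilityMeasure ν]

theorem BD.dbar {N : ℕ} {C : ℝ} {φ : E d → ℝ} (h' : BD (N + 1) C φ) (μ : E d ⊕ Fin d) :
    ∃ C', BD N C' (S.dbar τ₀ h μ φ) := by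
  cases μ with
  | inl l =>
    have h1 := h'.pred.comp_affine (ContinuousLinearMap.id ℝ (E d)) (h • l) (R := 1)
      ContinuousLinearMap.norm_id_le le_rfl
    exact ⟨_, ((h1.sub h'.pred).const_mul h⁻¹).const_mul (S.τ l)⟩
  | inr i => exact ⟨_, (h'.dd _).const_mul τ₀⟩

theorem dbar_moll {N : ℕ} {C : ℝ} {φ : E d → ℝ} (h' : BD (N + 1) C φ) (μ : E d ⊕ Fin d) :
    S.dbar τ₀ h μ (moll ν φ) = moll ν (S.dbar τ₀ h μ φ) := by
  funext x
  cases μ with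
  | inl l =>
    have h1 := (((hasAvg_moll (ν := ν) h' (x + h • l)).sub (hasAvg_moll h' x)).const_mul
      h⁻¹).const_mul (S.τ l)
    refine h1.2.symm.trans ?_
    simp only [moll, dbar, fd]
    refine integral_congr_ae (Eventually.of_forall fun y => ?_)
    simp only [sub_add_eq_add_sub]
  | inr i =>
    simp only [dbar, pderiv_eq_dd, dd_moll h']
    simp only [moll]
    rw [integral_const_mul]

theorem hasAvg_dbar {N : ℕ} {C : ℝ} {φ : E d → ℝ} (h' : BD (N + 1) C φ) (μ : E d ⊕ Fin d)
    (x : E d) : HasAvg ν (fun y => S.dbar τ₀ h μ φ (x - y))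
      ((S.average ν).dbar τ₀ h μ (moll ν φ) x) := by
  obtain ⟨C', hC'⟩ := BD.dbar (S := S) (τ₀ := τ₀) (h := h) h' μ
  rw [average_dbar, dbar_moll h']
  exact hasAvg_moll hC' x

theorem hasAvg_dbar_dbar {N : ℕ} {C : ℝ} {φ : E d → ℝ} (h' : BD (N + 2) C φ) (μ μ' : E d ⊕ Fin d)
    (x : E d) : HasAvg ν (fun y => S.dbar τ₀ h μ (S.dbar τ₀ h μ' φ) (x - y))
      ((S.average ν).dbar τ₀ h μ ((S.average ν).dbar τ₀ h μ' (moll ν φ)) x) := by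
  obtain ⟨C', hC'⟩ := BD.dbar (S := S) (τ₀ := τ₀) (h := h) h' μ'
  rw [average_dbar μ', dbar_moll h']
  exact hasAvg_dbar hC' μ x

/-- Translating the test function by `y` and the point by `-y` leaves every quantity of the test
function unchanged. Averaging over `y` therefore affects the coefficients only. -/
theorem fd_shift_translate (φ : E d → ℝ) (l : E d) (μ : E d ⊕ Fin d) (x y : E d) :
    fd h l (shift h μ fun z => φ (z + y)) (x - y) = fd h l (shift h μ φ) x := by
  rw [shift_eq, shift_eq]
  simp only [fd]
  congr 2 <;> congr 1 <;> abel

theorem fd_translate (φ : E d → ℝ) (l x y : E d) :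
    fd h l (fun z => φ (z + y)) (x - y) = fd h l φ x := by
  simp only [fd]
  congr 2 <;> congr 1 <;> abel

theorem fd_shift_shift_translate (φ : E d → ℝ) (l : E d) (μ μ' : E d ⊕ Fin d) (x y : E d) :
    fd h l (shift h μ (shift h μ' fun z => φ (z + y))) (x - y) =
      fd h l (shift h μ (shift h μ' φ)) x := by
  rw [shift_shift_eq, shift_shift_eq]
  simp only [fd]
  congr 2 <;> congr 1 <;> abel

theorem dbar_translate {φ : E d → ℝ} (hφ : SB φ) (μ : E d ⊕ Fin d) (x y : E d) :
    S.dbar τ₀ h μ (fun z => φ (z + y)) (x - y) = S.dbar τ₀ h μ φ x := by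
  rw [dbar_comp_add hφ]
  simp

/-- Regularity of the coefficients needed for averaging the energy conditions. -/
structure BDAt (S : Scheme d) (t : ℝ) : Prop where
  q : ∀ l ∈ S.Λ₁, ∃ C, BD 2 C (S.q l t)
  p : ∀ l ∈ S.Λ₁, ∃ C, BD 2 C (S.p l t)
  c : ∃ C, BD 2 C (S.c t)

theorem hasAvg_A (hS : BDAt S t) {φ : E d → ℝ} (hφ : SB φ) (x : E d) :
    HasAvg ν (fun y => S.A τ₀ h t (fun z => φ (z + y)) (x - y)) ((S.average ν).A τ₀ h t φ x) := by
  simp only [A, opL, opQ, dbar_translate hφ, fd_shift_translate]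
  refine (HasAvg.sum _ fun μ _ => ?_).const_mul 2
  rw [average_dbar]
  refine HasAvg.const_mul (HasAvg.add (HasAvg.const_mul (HasAvg.sum _ fun l hl => ?_) _)
    (HasAvg.sum _ fun l hl => ?_)) _
  · obtain ⟨C, hC⟩ := hS.q l hl
    exact (hasAvg_dbar hC μ x).mul_const _
  · obtain ⟨C, hC⟩ := hS.p l hl
    exact (hasAvg_dbar hC μ x).mul_const _

theorem hasAvg_chi (hS : BDAt S t) {l : E d} (hl : l ∈ S.Λ₁) (x : E d) :
    HasAvg ν (fun y => S.χ h l t (x - y)) ((S.average ν).χ h l t x) := by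
  obtain ⟨C, hC⟩ := hS.q l hl
  obtain ⟨C', hC'⟩ := hS.p l hl
  exact (hasAvg_moll hC x).add ((hasAvg_moll hC' x).const_mul h)

theorem hasAvg_quad (hS : BDAt S t) (φ : E d → ℝ) (x : E d) :
    HasAvg ν (fun y => S.quad h t (fun z => φ (z + y)) (x - y)) ((S.average ν).quad h t φ x) := by
  simp only [quad, fd_translate]
  exact HasAvg.sum _ fun l hl => (hasAvg_chi hS hl x).mul_const _

/-- Both sides are linear in the coefficients. The condition is applied to the functions `φ_i(· +
y)` at the point `x - y` and integrated in `y`. The supremum `C₁` is invariant under translation,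
which an operator `𝒦` in its place need not be. -/
theorem FirstEnergy.average {δ K : ℝ} (hS : BDAt S t) (hE : S.FirstEnergy τ₀ h δ K t) :
    (S.average ν).FirstEnergy τ₀ h δ K t := by
  intro ι s φ hφ C₁ hC₁ x
  obtain ⟨Cc, hCc⟩ := hS.c
  refine HasAvg.le (ν := ν) (HasAvg.sum s fun i hi => hasAvg_A hS (hφ i hi) x)
    (((HasAvg.sum s fun i hi => HasAvg.sum S.Λ fun μ _ =>
      hasAvg_quad hS (S.dbar τ₀ h μ (φ i)) x).const_mul (1 - δ)).add
    ((HasAvg.sum s fun i hi => hasAvg_quad hS (φ i) x).const_mul K) |>.add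
    (((hasAvg_moll hCc x).const_mul (2 * (1 - δ))).mul_const C₁)) fun y => ?_
  refine (hE ι s (fun i z => φ i (z + y)) (fun i hi => (hφ i hi).comp_add y) C₁ (fun z => ?_)
    (x - y)).trans (le_of_eq ?_)
  · refine le_trans (le_of_eq ?_) (hC₁ (z + y))
    refine Finset.sum_congr rfl fun i hi => ?_
    simp only [sq₁, average_dbar]
    refine Finset.sum_congr rfl fun μ _ => ?_
    rw [dbar_comp_add (hφ i hi)]
  · congr 3
    refine Finset.sum_congr rfl fun i hi => Finset.sum_congr rfl fun μ _ => ?_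
    rw [dbar_comp_add (hφ i hi)]

/-- The same averaging as for the first order condition; here also the twice differenced
coefficients of `Q_{h,λ}` are averaged, which uses two bounded derivatives of `q`. -/
theorem SecondEnergy.average {δ K : ℝ} {n : ℕ} (hS : BDAt S t)
    (hE : S.SecondEnergy τ₀ h δ K t n) : (S.average ν).SecondEnergy τ₀ h δ K t n := by
  intro ι s φ hφ C₁ C₂ hC₁ hC₂ x
  obtain ⟨Cc, hCc⟩ := hS.c
  have hd : ∀ i ∈ s, ∀ μ, SB (S.dbar τ₀ h μ (φ i)) := fun i hi μ => sb_dbar (hφ i hi) μ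
  have hd' : ∀ i ∈ s, ∀ μ y, S.dbar τ₀ h μ (fun z => φ i (z + y)) =
      fun z => S.dbar τ₀ h μ (φ i) (z + y) := fun i hi μ y => dbar_comp_add (hφ i hi) y μ
  have hd2 : ∀ i ∈ s, ∀ μ μ' y, S.dbar τ₀ h μ (S.dbar τ₀ h μ' (fun z => φ i (z + y))) =
      fun z => S.dbar τ₀ h μ (S.dbar τ₀ h μ' (φ i)) (z + y) := fun i hi μ μ' y => by
    rw [hd' i hi, dbar_comp_add (hd i hi μ')]
  refine HasAvg.le (ν := ν)
    (F := fun y => ∑ i ∈ s, (n * ∑ μ ∈ S.Λ, S.A τ₀ h t (fun z => S.dbar τ₀ h μ (φ i) (z + y)) (x - y)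
        + n * ((n : ℝ) - 1) * ∑ μ ∈ S.Λ, ∑ μ' ∈ S.Λ,
            S.dbar τ₀ h μ (S.dbar τ₀ h μ' (φ i)) x * (h⁻¹ * ∑ l ∈ S.Λ₁,
              S.dbar τ₀ h μ (S.dbar τ₀ h μ' (S.q l t)) (x - y) *
                fd h l (shift h μ (shift h μ' (φ i))) x)))
    (HasAvg.sum s fun i hi =>
      ((HasAvg.sum S.Λ fun μ _ => hasAvg_A hS (hd i hi μ) x).const_mul n).add
      ((HasAvg.sum S.Λ fun μ _ => HasAvg.sum S.Λ fun μ' _ => HasAvg.const_mul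
        (HasAvg.const_mul (HasAvg.sum S.Λ₁ fun l hl =>
          (hasAvg_dbar_dbar (hS.q l hl).choose_spec μ μ' x).mul_const _) h⁻¹) _).const_mul _))
    (((HasAvg.sum s fun i hi => HasAvg.sum S.Λ fun μ _ => HasAvg.sum S.Λ fun μ' _ =>
      hasAvg_quad hS (S.dbar τ₀ h μ (S.dbar τ₀ h μ' (φ i))) x).const_mul (1 - δ)).add
    ((HasAvg.sum s fun i hi => HasAvg.sum S.Λ fun μ _ =>
      hasAvg_quad hS (S.dbar τ₀ h μ (φ i)) x).const_mul K) |>.add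
    (((hasAvg_moll hCc x).const_mul (2 * (1 - δ))).mul_const C₂) |>.add
    (HasAvg.const (K * C₁))) fun y => ?_
  have := hE ι s (fun i z => φ i (z + y)) (fun i hi => (hφ i hi).comp_add y) C₁ C₂ (fun z => by
    refine le_trans (le_of_eq ?_) (hC₁ (z + y))
    refine Finset.sum_congr rfl fun i hi => ?_
    simp only [sq₁, average_dbar]
    refine Finset.sum_congr rfl fun μ _ => ?_
    rw [hd' i hi]) (fun z => by
    refine le_trans (le_of_eq ?_) (hC₂ (z + y))
    refine Finset.sum_congr rfl fun i hi => ?_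
    simp only [sq₂, average_dbar]
    refine Finset.sum_congr rfl fun μ _ => Finset.sum_congr rfl fun μ' _ => ?_
    rw [hd2 i hi]) (x - y)
  refine (le_of_eq ?_).trans (this.trans (le_of_eq ?_))
  · refine Finset.sum_congr rfl fun i hi => ?_
    congr 2
    · exact Finset.sum_congr rfl fun μ _ => by rw [hd' i hi]
    · refine Finset.sum_congr rfl fun μ _ => Finset.sum_congr rfl fun μ' _ => ?_
      rw [hd2 i hi]
      simp only [opQ, fd_shift_shift_translate, sub_add_cancel]
  · congr 4
    · refine Finset.sum_congr rfl fun i hi => Finset.sum_congr rfl fun μ _ =>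
        Finset.sum_congr rfl fun μ' _ => ?_
      rw [hd2 i hi]
    · refine Finset.sum_congr rfl fun i hi => Finset.sum_congr rfl fun μ _ => ?_
      rw [hd' i hi]

/-! ## Energy conditions for families -/

theorem isBoundedBorel_of_SB {φ : E d → ℝ} (hφ : SB φ) : IsBoundedBorel φ :=
  ⟨hφ.continuous.measurable, (hφ 0).choose, (hφ 0).choose_spec.2⟩

theorem _root_.FDScheme.IsSubMarkov.sum {𝒦 : (E d → ℝ) → E d → ℝ} (h𝒦 : IsSubMarkov 𝒦)
    {ι : Type*} (s : Finset ι) {φ : ι → E d → ℝ} (hφ : ∀ i ∈ s, SB (φ i)) (x : E d) :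
    𝒦 (fun y => ∑ i ∈ s, φ i y) x = ∑ i ∈ s, 𝒦 (φ i) x := by
  classical
  induction s using Finset.induction_on with
  | empty =>
    have := h𝒦.smul 0 (fun _ => 0) (isBoundedBorel_of_SB (SB.const 0))
    simp only [zero_smul] at this
    simp only [Finset.sum_empty]
    exact congrFun this x
  | insert i s hi ih =>
    have h1 : SB (φ i) := hφ i (by simp)
    have h2 : ∀ j ∈ s, SB (φ j) := fun j hj => hφ j (by simp [hj])
    simp only [Finset.sum_insert hi]
    have := h𝒦.add (φ i) (fun y => ∑ j ∈ s, φ j y) (isBoundedBorel_of_SB h1)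
      (isBoundedBorel_of_SB (SB.sum s h2))
    rw [← ih h2]
    exact congrFun this x

/-- Positivity is applied to `C - φ`, and `𝒦 1 ≤ 1` handles the constant because `C ≥ 0`. -/
theorem _root_.FDScheme.IsSubMarkov.le_of_le {𝒦 : (E d → ℝ) → E d → ℝ} (h𝒦 : IsSubMarkov 𝒦)
    {φ : E d → ℝ} (hφ : SB φ) {C : ℝ} (hC : 0 ≤ C) (hle : ∀ y, φ y ≤ C) (x : E d) :
    𝒦 φ x ≤ C := by
  have b1 := isBoundedBorel_of_SB hφ
  have b2 := isBoundedBorel_of_SB (SB.const (F := E d) 1)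
  have b3 : IsBoundedBorel (fun y => C - φ y) := isBoundedBorel_of_SB ((SB.const C).sub hφ)
  have h1 := h𝒦.nonneg _ b3 (fun y => by linarith [hle y]) x
  have h2 := congrFun (h𝒦.add (fun y => C - φ y) φ b3 b1) x
  have h3 := congrFun (h𝒦.smul C (fun _ => 1) b2) x
  have e : ((fun y => C - φ y) + φ) = C • fun _ : E d => (1 : ℝ) := by
    funext y; simp
  rw [e, h3] at h2
  simp only [Pi.add_apply, Pi.smul_apply, smul_eq_mul] at h2
  have h4 := mul_le_mul_of_nonneg_left (h𝒦.one_le x) hC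
  linarith

theorem sb_sq₁ {φ : E d → ℝ} (hφ : SB φ) : SB (S.sq₁ τ₀ h φ) := by
  have : S.sq₁ τ₀ h φ = fun x => ∑ μ ∈ S.Λ, S.dbar τ₀ h μ φ x * S.dbar τ₀ h μ φ x := by
    funext x; simp [sq₁, pow_two]
  rw [this]
  exact SB.sum _ fun μ _ => (sb_dbar hφ μ).mul (sb_dbar hφ μ)

theorem sb_sq₂ {φ : E d → ℝ} (hφ : SB φ) : SB (S.sq₂ τ₀ h φ) := by
  have : S.sq₂ τ₀ h φ = fun x => ∑ μ ∈ S.Λ, ∑ ν ∈ S.Λ,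
      S.dbar τ₀ h μ (S.dbar τ₀ h ν φ) x * S.dbar τ₀ h μ (S.dbar τ₀ h ν φ) x := by
    funext x; simp [sq₂, pow_two]
  rw [this]
  exact SB.sum _ fun μ _ => SB.sum _ fun ν _ =>
    (sb_dbar (sb_dbar hφ ν) μ).mul (sb_dbar (sb_dbar hφ ν) μ)

/-- The condition is summed over the family first, so that `𝒦` acts on the total sum of squares,
bounded by `C₁`. The factor `m ≥ 1` on the left may be dropped because the right side is
nonnegative. -/
theorem firstEnergy_of_condition {m : ℕ} {δ K c₀ : ℝ} (hδ : δ ≤ 1) (hK : 0 ≤ K) (hc₀ : 0 < c₀)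
    (hS : S.FirstOrderCondition m δ τ₀ K) (hχ : S.ChiNonneg) (hkill : S.Killing c₀)
    (hh : h ∈ Ioc 0 S.h₀) (ht : t ∈ Icc 0 S.T) : S.FirstEnergy τ₀ h δ K t := by
  intro ι s φ hφ C₁ hC₁ x
  obtain ⟨hm, h1⟩ := hS
  obtain ⟨𝒦, h𝒦⟩ := h1 h hh
  obtain ⟨h2, h3⟩ := h𝒦 t ht
  have hc : 0 ≤ S.c t x := hc₀.le.trans (hkill t ht x)
  have hq : ∀ ψ, 0 ≤ S.quad h t ψ x := fun ψ =>
    quad_nonneg (fun l hl x => hχ h hh l hl t ht x) ψ x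
  have h4 := Finset.sum_le_sum fun i hi => h3 (φ i) (hφ i hi).isSmoothBounded x
  rw [← Finset.mul_sum, Finset.sum_add_distrib, Finset.sum_add_distrib, ← Finset.mul_sum,
    ← Finset.mul_sum, ← Finset.mul_sum, ← h2.sum s fun i hi => sb_sq₁ (hφ i hi)] at h4
  have hC0 : 0 ≤ C₁ := le_trans (Finset.sum_nonneg fun i _ => Finset.sum_nonneg fun μ _ =>
    _root_.sq_nonneg _) (hC₁ 0)
  have h5 := h2.le_of_le (SB.sum s fun i hi => sb_sq₁ (S := S) (τ₀ := τ₀) (h := h) (hφ i hi))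
    hC0 hC₁ x
  have h6 : 2 * (1 - δ) * S.c t x * 𝒦 t (fun y => ∑ i ∈ s, S.sq₁ τ₀ h (φ i) y) x ≤
      2 * (1 - δ) * S.c t x * C₁ := by
    refine mul_le_mul_of_nonneg_left h5 ?_
    have : 0 ≤ 1 - δ := by linarith
    positivity
  have h7 : 0 ≤ (1 - δ) * ∑ i ∈ s, ∑ μ ∈ S.Λ, S.quad h t (S.dbar τ₀ h μ (φ i)) x
        + K * ∑ i ∈ s, S.quad h t (φ i) x + 2 * (1 - δ) * S.c t x * C₁ := by
    have e1 : 0 ≤ 1 - δ := by linarith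
    have e2 : 0 ≤ ∑ i ∈ s, ∑ μ ∈ S.Λ, S.quad h t (S.dbar τ₀ h μ (φ i)) x :=
      Finset.sum_nonneg fun _ _ => Finset.sum_nonneg fun _ _ => hq _
    have e3 : 0 ≤ ∑ i ∈ s, S.quad h t (φ i) x := Finset.sum_nonneg fun _ _ => hq _
    positivity
  have h8 : (1 : ℝ) ≤ m := by exact_mod_cast hm
  by_contra! hlt
  nlinarith

theorem secondEnergy_of_condition {m : ℕ} {δ K c₀ : ℝ} (hδ : δ ≤ 1) (hK : 0 ≤ K) (hc₀ : 0 < c₀)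
    (hS : S.SecondOrderCondition m δ τ₀ K) (hkill : S.Killing c₀)
    (hh : h ∈ Ioc 0 S.h₀) (ht : t ∈ Icc 0 S.T) {n : ℕ} (hn : 1 ≤ n) (hnm : n ≤ m) :
    S.SecondEnergy τ₀ h δ K t n := by
  intro ι s φ hφ C₁ C₂ hC₁ hC₂ x
  obtain ⟨𝒦, h𝒦⟩ := hS.2 h hh n hn hnm
  obtain ⟨h2, h3⟩ := h𝒦 t ht
  have hc : 0 ≤ S.c t x := hc₀.le.trans (hkill t ht x)
  have h4 := Finset.sum_le_sum fun i hi => h3 (φ i) (hφ i hi).isSmoothBounded x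
  refine h4.trans ?_
  rw [Finset.sum_add_distrib, Finset.sum_add_distrib, Finset.sum_add_distrib, ← Finset.mul_sum,
    ← Finset.mul_sum, ← Finset.mul_sum, ← Finset.mul_sum, ← h2.sum s fun i hi => sb_sq₁ (hφ i hi),
    ← h2.sum s fun i hi => sb_sq₂ (hφ i hi)]
  have hC0 : 0 ≤ C₁ := le_trans (Finset.sum_nonneg fun i _ => Finset.sum_nonneg fun μ _ =>
    _root_.sq_nonneg _) (hC₁ 0)
  have hC20 : 0 ≤ C₂ := le_trans (Finset.sum_nonneg fun i _ => Finset.sum_nonneg fun μ _ =>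
    Finset.sum_nonneg fun μ _ => _root_.sq_nonneg _) (hC₂ 0)
  have h5 := h2.le_of_le (SB.sum s fun i hi => sb_sq₁ (S := S) (τ₀ := τ₀) (h := h) (hφ i hi))
    hC0 hC₁ x
  have h6 := h2.le_of_le (SB.sum s fun i hi => sb_sq₂ (S := S) (τ₀ := τ₀) (h := h) (hφ i hi))
    hC20 hC₂ x
  have e1 : 0 ≤ 1 - δ := by linarith
  gcongr

end Scheme

/-! ## Bounded generalized derivatives -/

theorem hasWeakDeriv_weakDeriv {α : Fin d → ℕ} {φ : E d → ℝ} (h : ∃ w, HasWeakDeriv α φ w) :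
    HasWeakDeriv α φ (weakDeriv α φ) := by
  rw [weakDeriv, dif_pos h]
  exact h.choose_spec

theorem HasWeakDeriv.ae_eq {α : Fin d → ℕ} {φ w w' : E d → ℝ} (h : HasWeakDeriv α φ w)
    (h' : HasWeakDeriv α φ w') : w =ᵐ[volume] w' := by
  refine ae_eq_of_integral_contDiff_smul_eq h.2.1 h'.2.1 fun g hg hc => ?_
  have h1 := (h.2.2 g hg hc).symm.trans (h'.2.2 g hg hc)
  have h2 := mul_left_cancel₀ (pow_ne_zero _ (by norm_num)) h1
  simpa only [smul_eq_mul, mul_comm] using h2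

/-- The generalized derivatives of `φ` of order at most `m` exist and are bounded by `C`. -/
def WeakB (m : ℕ) (C : ℝ) (φ : E d → ℝ) : Prop :=
  ∀ α : Fin d → ℕ, ∑ i, α i ≤ m →
    HasWeakDeriv α φ (weakDeriv α φ) ∧ ∀ᵐ x, |weakDeriv α φ x| ≤ C

theorem MemB.weakB {m : ℕ} {T : ℝ} {ψ : ℝ → E d → ℝ} (h : MemB m T ψ) :
    ∃ C, 0 ≤ C ∧ ∀ t ∈ Icc 0 T, WeakB m C (ψ t) := by
  obtain ⟨C, hC⟩ := h.deriv_bounded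
  refine ⟨max C 0, le_max_right _ _, fun t ht α hα => ?_⟩
  obtain ⟨w, hw, hb⟩ := hC t ht α hα
  have h1 := hasWeakDeriv_weakDeriv ⟨w, hw⟩
  refine ⟨h1, ?_⟩
  filter_upwards [hb, h1.ae_eq hw] with x hx he
  rw [he]
  exact hx.trans (le_max_left _ _)

theorem weakSq_nonneg (k : ℕ) (φ : E d → ℝ) (x : E d) : 0 ≤ weakSq k φ x :=
  Finset.sum_nonneg fun _ _ => sq_nonneg _

theorem WeakB.ae_weakSq_le {m : ℕ} {C : ℝ} {φ : E d → ℝ} (h : WeakB m C φ) {k : ℕ} (hk : k ≤ m) :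
    ∀ᵐ x, weakSq k φ x ≤ (multiIndices d k).card * C ^ 2 := by
  have : ∀ᵐ x, ∀ α ∈ multiIndices d k, |weakDeriv α φ x| ≤ C := by
    rw [Finset.eventually_all]
    exact fun α hα => (h α ((mem_multiIndices.mp hα).trans_le hk)).2
  filter_upwards [this] with x hx
  rw [weakSq, ← nsmul_eq_mul]
  exact Finset.sum_le_card_nsmul _ _ _ fun α hα => sq_le_sq' (abs_le.mp (hx α hα)).1
    (abs_le.mp (hx α hα)).2

theorem normB_nonneg (m : ℕ) (T : ℝ) (ψ : ℝ → E d → ℝ) : 0 ≤ normB m T ψ := Real.sqrt_nonneg _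

/-- The norm passes from extended nonnegative numbers to reals, so it bounds anything only after the
supremum is known to be finite; this follows from the bounds in `MemB`. -/
theorem MemB.ae_sum_weakSq_le {m : ℕ} {T : ℝ} {ψ : ℝ → E d → ℝ} (h : MemB m T ψ) {t : ℝ}
    (ht : t ∈ Icc 0 T) :
    ∀ᵐ x, ∑ k ∈ Finset.range (m + 1), weakSq k (ψ t) x ≤ normB m T ψ ^ 2 := by
  obtain ⟨C, hC0, hC⟩ := h.weakB
  rw [normB, Real.sq_sqrt ENNReal.toReal_nonneg]
  set G : ℝ → E d → ENNReal := fun t x =>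
    ENNReal.ofReal (∑ k ∈ Finset.range (m + 1), weakSq k (ψ t) x) with hG
  have hfin : ⨆ t ∈ Icc (0 : ℝ) T, essSup (G t) volume ≠ ⊤ := by
    refine ne_top_of_le_ne_top (b := ENNReal.ofReal
      (∑ k ∈ Finset.range (m + 1), ((multiIndices d k).card * C ^ 2))) ENNReal.ofReal_ne_top ?_
    refine iSup₂_le fun s hs => essSup_le_of_ae_le _ ?_
    have : ∀ᵐ x, ∀ k ∈ Finset.range (m + 1), weakSq k (ψ s) x ≤ (multiIndices d k).card * C ^ 2 := by
      rw [Finset.eventually_all]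
      exact fun k hk => (hC s hs).ae_weakSq_le (Nat.lt_succ_iff.mp (Finset.mem_range.mp hk))
    filter_upwards [this] with x hx
    exact ENNReal.ofReal_le_ofReal (Finset.sum_le_sum hx)
  filter_upwards [ENNReal.ae_le_essSup (μ := volume) (G t)] with x hx
  have h1 : G t x ≤ ⨆ t ∈ Icc (0 : ℝ) T, essSup (G t) volume :=
    hx.trans (le_iSup₂ (f := fun t (_ : t ∈ Icc (0 : ℝ) T) => essSup (G t) volume) t ht)
  exact (ENNReal.ofReal_le_iff_le_toReal hfin).mp h1

theorem MemB.ae_weakSq_le {m : ℕ} {T : ℝ} {ψ : ℝ → E d → ℝ} (h : MemB m T ψ) {t : ℝ}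
    (ht : t ∈ Icc 0 T) {k : ℕ} (hk : k ≤ m) : ∀ᵐ x, weakSq k (ψ t) x ≤ normB m T ψ ^ 2 := by
  filter_upwards [h.ae_sum_weakSq_le ht] with x hx
  exact (Finset.single_le_sum (f := fun k => weakSq k (ψ t) x)
    (fun j _ => weakSq_nonneg j _ _) (Finset.mem_range.mpr (Nat.lt_succ_of_le hk))).trans hx

/-! ### Derivatives of mollified functions in terms of generalized derivatives. -/

section Bump

variable (b : ContDiffBump (0 : E d))

theorem ae_bumpMeasure_of_ae {P : E d → Prop} (h : ∀ᵐ x, P x) (x : E d) :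
    ∀ᵐ y ∂(bumpMeasure b), P (x - y) :=
  (bumpMeasure_absolutelyContinuous b).ae_le
    ((Measure.measurePreserving_sub_left volume x).quasiMeasurePreserving.ae h)

theorem integrable_bumpMeasure {w : E d → ℝ} {C : ℝ} (hw : LocallyIntegrable w volume)
    (hb : ∀ᵐ x, |w x| ≤ C) (x : E d) : Integrable (fun y => w (x - y)) (bumpMeasure b) := by
  refine Integrable.of_bound ?_ C (ae_bumpMeasure_of_ae b hb x)
  exact (hw.aestronglyMeasurable.comp_quasiMeasurePreserving
    (Measure.measurePreserving_sub_left volume x).quasiMeasurePreserving).mono_ac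
      (bumpMeasure_absolutelyContinuous b)

/-- Passing from words to multi-indices costs `k!`. Then Jensen's inequality is applied to the whole
family of generalized derivatives at once, so only the bound on their joint sum of squares enters.
-/
theorem sum_pword_moll_sq_le {ι : Type*} (s : Finset ι) {φ : ι → E d → ℝ} {k m : ℕ} {C B : ℝ}
    (hk : k ≤ m) (hφ : ∀ i ∈ s, WeakB m C (φ i)) (hsb : ∀ i ∈ s, SB (moll (bumpMeasure b) (φ i)))
    (hB : 0 ≤ B) (h : ∀ᵐ x, ∑ i ∈ s, weakSq k (φ i) x ≤ B ^ 2) (x : E d) :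
    ∑ i ∈ s, ∑ v ∈ words (Finset.univ : Finset (Fin d)) k,
      pword v (moll (bumpMeasure b) (φ i)) x ^ 2 ≤ k.factorial * B ^ 2 := by
  refine (Finset.sum_le_sum fun i hi => sum_pword_sq_le k (hsb i hi) x).trans ?_
  rw [← Finset.mul_sum]
  refine mul_le_mul_of_nonneg_left ?_ (by positivity)
  have hm : ∀ α ∈ multiIndices d k, ∑ i, α i ≤ m := fun α hα =>
    (mem_multiIndices.mp hα).trans_le hk
  have h1 := sum_moll_sq_le (ν := bumpMeasure b) (s ×ˢ multiIndices d k)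
    (F := fun z => weakDeriv z.2 (φ z.1)) hB (x := x)
    (fun z hz => by
      obtain ⟨h1, h2⟩ := Finset.mem_product.mp hz
      obtain ⟨h3, h4⟩ := hφ z.1 h1 z.2 (hm _ h2)
      exact integrable_bumpMeasure b h3.2.1 h4 x)
    ((ae_bumpMeasure_of_ae b h x).mono fun y hy => by
      rw [Finset.sum_product]
      exact hy)
  rw [Finset.sum_product] at h1
  refine (le_of_eq ?_).trans h1
  refine Finset.sum_congr rfl fun i hi => Finset.sum_congr rfl fun α hα => ?_
  rw [mderiv_moll b (hφ i hi α (hm α hα)).1]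

theorem MemB.tb_moll {m : ℕ} {T : ℝ} (hT : 0 ≤ T) {ψ : ℝ → E d → ℝ} (h : MemB m T ψ) :
    TB T (fun t => moll (bumpMeasure b) (ψ t)) := by
  obtain ⟨C, hC⟩ := h.bounded
  exact FDScheme.tb_moll b hT h.measurable h.continuous hC

end Bump

/-- Uniformity in the mollifier is the point. The constant may depend on `d`, since it serves only
convergence and regularity, not the final estimate. -/
theorem MemB.exists_bd_moll {m : ℕ} {T : ℝ} (hT : 0 ≤ T) {ψ : ℝ → E d → ℝ} (h : MemB m T ψ) :
    ∃ C, ∀ t ∈ Icc 0 T, ∀ b : ContDiffBump (0 : E d), BD m C (moll (bumpMeasure b) (ψ t)) := by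
  obtain ⟨C, hC0, hC⟩ := h.weakB
  set D : ℕ → ℝ := fun k => k.factorial * ((multiIndices d k).card * C ^ 2) with hD
  have hD0 : ∀ k, 0 ≤ D k := fun k => by positivity
  refine ⟨√(∑ k ∈ Finset.range (m + 1), D k), fun t ht b => BD_of_sum_pword_sq_le
    (Real.sqrt_nonneg _) ((h.tb_moll b hT).sb ht) fun k hk x => ?_⟩
  obtain ⟨B, hB0, hB⟩ : ∃ B : ℝ, 0 ≤ B ∧ (multiIndices d k).card * C ^ 2 = B ^ 2 :=
    ⟨_, Real.sqrt_nonneg _, (Real.sq_sqrt (by positivity)).symm⟩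
  have h1 := sum_pword_moll_sq_le b (Finset.univ : Finset Unit) (φ := fun _ => ψ t) hk
    (fun _ _ => hC t ht) (fun _ _ => (h.tb_moll b hT).sb ht) hB0 (by
      filter_upwards [(hC t ht).ae_weakSq_le hk] with x hx
      rw [Finset.univ_unique, Finset.sum_singleton]
      exact hx.trans_eq hB) x
  rw [Finset.univ_unique, Finset.sum_singleton, ← hB] at h1
  rw [Real.sq_sqrt (Finset.sum_nonneg fun k _ => hD0 k)]
  exact h1.trans (Finset.single_le_sum (f := D) (fun k _ => hD0 k)
    (Finset.mem_range.mpr (Nat.lt_succ_of_le hk)))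

/-- A sequence of mollifiers. -/
def bumpSeq (n : ℕ) : ContDiffBump (0 : E d) where
  rIn := 1 / (n + 1) / 2
  rOut := 1 / (n + 1)
  rIn_pos := by positivity
  rIn_lt_rOut := half_lt_self (by positivity)

theorem rOut_bumpSeq (n : ℕ) : (bumpSeq n : ContDiffBump (0 : E d)).rOut = 1 / (n + 1) := rfl

theorem tendsto_moll_bumpSeq {φ : E d → ℝ} {C : ℝ} (hφ : Continuous φ) (hb : ∀ x, |φ x| ≤ C)
    (x : E d) : Tendsto (fun n => moll (bumpMeasure (bumpSeq n)) φ x) atTop (𝓝 (φ x)) := by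
  rw [Metric.tendsto_atTop]
  intro ε hε
  obtain ⟨r, hr, h⟩ := Metric.continuous_iff.mp hφ x (ε / 2) (by positivity)
  obtain ⟨n₀, hn₀⟩ := exists_nat_one_div_lt hr
  refine ⟨n₀, fun n hn => ?_⟩
  have hnr : (1 : ℝ) / (n + 1) < r := lt_of_le_of_lt (one_div_le_one_div_of_le (by positivity)
    (by exact_mod_cast Nat.succ_le_succ hn)) hn₀
  refine lt_of_le_of_lt (abs_moll_sub_le (ae_norm_le_bumpMeasure (bumpSeq n))
    (BD.integrable ⟨hφ, hb⟩ x) fun y hy => ?_) (half_lt_self hε)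
  have := h (x - y) (by rw [dist_eq_norm]; simpa using hy.trans_lt hnr)
  exact this.le

/-- Regularity of functions with bounded generalized derivatives, and convergence of their
mollifications. -/
theorem MemB.exists_bd {m : ℕ} {T : ℝ} (hT : 0 ≤ T) {ψ : ℝ → E d → ℝ} (h : MemB (m + 1) T ψ) :
    ∃ C, 0 ≤ C ∧ ∀ t ∈ Icc 0 T,
      (∀ b : ContDiffBump (0 : E d), BD (m + 1) C (moll (bumpMeasure b) (ψ t))) ∧
      BD m C (ψ t) ∧ ∀ n x, |moll (bumpMeasure (bumpSeq n)) (ψ t) x - ψ t x| ≤ C * (1 / (n + 1)) := by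
  obtain ⟨C, hC⟩ := h.exists_bd_moll hT
  obtain ⟨C₀, hC₀⟩ := h.bounded
  refine ⟨C, (hC 0 ⟨le_rfl, hT⟩ (bumpSeq 0)).nonneg, fun t ht => ?_⟩
  -- The mollifications are Lipschitz with a common constant and converge pointwise, so the limit is
  -- Lipschitz; this upgrades the convergence to a uniform rate.
  have hlip : ∀ x y, |ψ t x - ψ t y| ≤ C * ‖x - y‖ := fun x y =>
    le_of_tendsto ((tendsto_moll_bumpSeq (h.continuous t ht) (hC₀ t ht) x).sub
      (tendsto_moll_bumpSeq (h.continuous t ht) (hC₀ t ht) y)).abs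
      (Eventually.of_forall fun n => (hC t ht (bumpSeq n)).abs_sub_le y x)
  have hconv : ∀ n x, |moll (bumpMeasure (bumpSeq n)) (ψ t) x - ψ t x| ≤ C * (1 / (n + 1)) := by
    intro n x
    refine abs_moll_sub_le (ae_norm_le_bumpMeasure (bumpSeq n))
      (BD.integrable ⟨h.continuous t ht, hC₀ t ht⟩ x) fun y hy => ?_
    refine (hlip _ _).trans (mul_le_mul_of_nonneg_left ?_ (hC t ht (bumpSeq 0)).nonneg)
    simpa [rOut_bumpSeq] using hy
  refine ⟨hC t ht, BD.of_tendstoUniformly (fun n => hC t ht (bumpSeq n)) ?_, hconv⟩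
  rw [Metric.tendstoUniformly_iff]
  intro ε hε
  have h0 : Tendsto (fun n : ℕ => C * (1 / ((n : ℝ) + 1))) atTop (𝓝 0) := by
    simpa using (tendsto_one_div_add_atTop_nhds_zero_nat (𝕜 := ℝ)).const_mul C
  filter_upwards [h0.eventually_lt_const hε] with n hn x
  rw [dist_comm]
  exact (hconv n x).trans_lt hn

namespace Scheme

variable {S : Scheme d} {τ₀ h t : ℝ}

/-! ## The mollified scheme -/

section Linear

variable (ν : Measure (E d))

theorem Symmetric.average (h : S.Symmetric) : (S.average ν).Symmetric :=
  ⟨h.1, fun l hl t ht x => integral_congr_ae (Eventually.of_forall fun y => h.2 l hl t ht (x - y))⟩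

theorem Antisymmetric.average (h : S.Antisymmetric) : (S.average ν).Antisymmetric :=
  fun l hl t ht x => by
    refine (integral_congr_ae (Eventually.of_forall fun y => h l hl t ht (x - y))).trans ?_
    exact integral_neg _

variable [IsProbabilityMeasure ν]

theorem ChiNonneg.average (hS : ∀ t ∈ Icc 0 S.T, BDAt S t) (h : S.ChiNonneg) :
    (S.average ν).ChiNonneg := by
  intro h' hh l hl t ht x
  rw [← (hasAvg_chi (h := h') (ν := ν) (hS t ht) hl x).2]
  exact integral_nonneg fun y => h h' hh l hl t ht _

theorem Centered.average (hS : ∀ t ∈ Icc 0 S.T, BDAt S t) (h : S.Centered) :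
    (S.average ν).Centered := by
  intro t ht x
  have hi : ∀ l ∈ S.Λ₁, Integrable (fun y => S.q l t (x - y)) ν := fun l hl => by
    obtain ⟨C, hC⟩ := (hS t ht).q l hl
    exact (hasAvg_moll hC x).1
  have : ∑ l ∈ S.Λ₁, moll ν (S.q l t) x • l = ∫ y, ∑ l ∈ S.Λ₁, S.q l t (x - y) • l ∂ν := by
    rw [integral_finsetSum _ fun l hl => (hi l hl).smul_const l]
    exact Finset.sum_congr rfl fun l _ => (integral_smul_const _ _).symm
  refine this.trans ?_
  simp only [h t ht, integral_zero]

theorem Killing.average {c₀ : ℝ} (hS : ∀ t ∈ Icc 0 S.T, BDAt S t) (h : S.Killing c₀) :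
    (S.average ν).Killing c₀ := by
  intro t ht x
  obtain ⟨C, hC⟩ := (hS t ht).c
  exact (HasAvg.const c₀).le (hasAvg_moll hC x) fun y => h t ht _

end Linear

theorem Regular.bdAt {m : ℕ} {M : ℕ → ℝ} (hm : 3 ≤ m) (hS : S.Regular m M) (ht : t ∈ Icc 0 S.T) :
    BDAt S t := by
  obtain ⟨m, rfl⟩ : ∃ n, m = n + 1 := ⟨m - 1, by omega⟩
  have key : ∀ {ψ : ℝ → E d → ℝ}, MemB (m + 1) S.T ψ → ∃ C, BD 2 C (ψ t) := fun h => by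
    obtain ⟨C, -, hC⟩ := h.exists_bd S.T_pos.le
    exact ⟨C, (hC t ht).2.1.of_le (by omega)⟩
  exact ⟨fun l hl => key (hS.q_mem l hl), fun l hl => key (hS.p_mem l hl), key hS.c_mem⟩

theorem sum_sq_moll_le (S : Scheme d) {ι : Type} (s : Finset ι) (b : ContDiffBump (0 : E d)) {m k : ℕ}
    {ψ : ι → ℝ → E d → ℝ} (hk : k ≤ m) (hh : h ≠ 0) (hψ : ∀ i ∈ s, MemB m S.T (ψ i)) {B : ℝ}
    (ht : t ∈ Icc 0 S.T) (hB : ∀ᵐ x, ∑ i ∈ s, weakSq k (ψ i t) x ≤ B ^ 2) (x : E d) :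
    ∑ i ∈ s, S.sq τ₀ h k (moll (bumpMeasure b) (ψ i t)) x ≤
      (S.weightedSize ^ 2 + τ₀ ^ 2) ^ k * (k.factorial * B ^ 2) := by
  have hsb : ∀ i ∈ s, SB (moll (bumpMeasure b) (ψ i t)) := fun i hi =>
    ((hψ i hi).tb_moll b S.T_pos.le).sb ht
  choose! C hC0 hC using fun i hi => (hψ i hi).weakB
  have hC' : ∀ i ∈ s, WeakB m (∑ i ∈ s, C i) (ψ i t) := fun i hi α hα => by
    obtain ⟨h1, h2⟩ := hC i hi t ht α hα
    exact ⟨h1, h2.mono fun x hx => hx.trans (Finset.single_le_sum hC0 hi)⟩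
  refine sum_sq_le_of_pword hh s _ hsb _ (fun y => ?_) x
  rw [← sq_abs B] at hB ⊢
  exact sum_pword_moll_sq_le b s hk hC' hsb (abs_nonneg B) hB y

/-- A bound for the coefficients of the mollified scheme. -/
def coefBound (κ : ℝ) (M : ℕ → ℝ) (m : ℕ) : ℝ :=
  ∑ j ∈ Finset.range (m + 1), 3 * (κ ^ j * (j.factorial * M j ^ 2)) + 1

/-- A bound for the free terms of the mollified scheme. -/
def dataBound (κ : ℝ) (m : ℕ) : ℝ := ∑ j ∈ Finset.range (m + 1), κ ^ j * j.factorial + 1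

theorem one_le_coefBound {κ : ℝ} (hκ : 0 ≤ κ) (M : ℕ → ℝ) (m : ℕ) : 1 ≤ coefBound κ M m :=
  le_add_of_nonneg_left (Finset.sum_nonneg fun _ _ => by positivity)

theorem one_le_dataBound {κ : ℝ} (hκ : 0 ≤ κ) (m : ℕ) : 1 ≤ dataBound κ m :=
  le_add_of_nonneg_left (Finset.sum_nonneg fun _ _ => by positivity)

/-- The summand `1` makes the bound at least one, hence dominated by its own square. -/
theorem le_coefBound_sq {κ : ℝ} (hκ : 0 ≤ κ) (M : ℕ → ℝ) {j m : ℕ} (hj : j ≤ m) :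
    3 * (κ ^ j * (j.factorial * M j ^ 2)) ≤ coefBound κ M m ^ 2 := by
  have h1 := one_le_coefBound hκ M m
  have h2 := Finset.single_le_sum (f := fun j : ℕ => 3 * (κ ^ j * (j.factorial * M j ^ 2)))
    (fun _ _ => by positivity) (Finset.mem_range.mpr (Nat.lt_succ_of_le hj))
  have h3 : 3 * (κ ^ j * (j.factorial * M j ^ 2)) ≤ coefBound κ M m := by
    unfold coefBound; linarith
  nlinarith

theorem le_dataBound_sq {κ : ℝ} (hκ : 0 ≤ κ) {j m : ℕ} (hj : j ≤ m) :
    κ ^ j * j.factorial ≤ dataBound κ m ^ 2 := by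
  have h1 := one_le_dataBound hκ m
  have h2 := Finset.single_le_sum (f := fun j : ℕ => κ ^ j * (j.factorial : ℝ))
    (fun _ _ => by positivity) (Finset.mem_range.mpr (Nat.lt_succ_of_le hj))
  have h3 : κ ^ j * j.factorial ≤ dataBound κ m := by
    unfold dataBound; linarith
  nlinarith

/-- The mollified scheme satisfies the assumptions with smooth data. -/
theorem smoothData_average {m : ℕ} {M : ℕ → ℝ} {δ K c₀ : ℝ} (hm : 3 ≤ m) (hδ : δ ≤ 1)
    (hK : 0 ≤ K) (hc₀ : 0 < c₀) (hS : S.Regular m M) (hχ : S.ChiNonneg) (hcen : S.Centered)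
    (hkill : S.Killing c₀) (h1 : S.FirstOrderCondition m δ τ₀ K)
    (h2 : S.SecondOrderCondition m δ τ₀ K) (b : ContDiffBump (0 : E d)) :
    (S.average (bumpMeasure b)).SmoothData τ₀ δ K c₀
      (coefBound (S.weightedSize ^ 2 + τ₀ ^ 2) M m) m := by
  have hbd : ∀ t ∈ Icc 0 S.T, BDAt S t := fun t ht => hS.bdAt hm ht
  have hT := S.T_pos.le
  refine ⟨fun l hl => (hS.q_mem l hl).tb_moll b hT, fun l hl => (hS.p_mem l hl).tb_moll b hT,
    hS.c_mem.tb_moll b hT, hχ.average _ hbd, hcen.average _ hbd, hkill.average _ hbd,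
    fun h hh t ht => (firstEnergy_of_condition hδ hK hc₀ h1 hχ hkill hh ht).average (hbd t ht),
    fun h hh t ht n hn hnm => (secondEnergy_of_condition hδ hK hc₀ h2 hkill hh ht
      (by omega) hnm).average (hbd t ht), fun h hh t ht j hj x => ?_⟩
  have hh0 : h ≠ 0 := hh.1.ne'
  have hb := hS.bound j hj t ht
  have hq0 : ∀ x, 0 ≤ ∑ l ∈ S.Λ₁, weakSq j (S.q l t) x := fun x =>
    Finset.sum_nonneg fun _ _ => weakSq_nonneg _ _ _
  have hp0 : ∀ x, 0 ≤ ∑ l ∈ S.Λ₁, weakSq j (S.p l t) x := fun x =>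
    Finset.sum_nonneg fun _ _ => weakSq_nonneg _ _ _
  simp only [Finset.sum_add_distrib] at hb
  -- The families `q`, `p` and the function `c` are each estimated by the full `M j`; this is the
  -- factor 3 in `coefBound`.
  have e1 := sum_sq_moll_le (τ₀ := τ₀) (S.average (bumpMeasure b)) S.Λ₁ b (ψ := S.q) (B := M j)
    hj hh0 hS.q_mem ht (hb.mono fun x hx => by
      linarith [hp0 x, weakSq_nonneg j (S.c t) x]) x
  have e2 := sum_sq_moll_le (τ₀ := τ₀) (S.average (bumpMeasure b)) S.Λ₁ b (ψ := S.p) (B := M j)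
    hj hh0 hS.p_mem ht (hb.mono fun x hx => by
      linarith [hq0 x, weakSq_nonneg j (S.c t) x]) x
  have e3 := sum_sq_moll_le (τ₀ := τ₀) (S.average (bumpMeasure b)) (Finset.univ : Finset Unit) b
    (ψ := fun _ => S.c) (B := M j)
    hj hh0 (fun _ _ => hS.c_mem) ht (hb.mono fun x hx => by
      simp only [Finset.univ_unique, Finset.sum_singleton]
      linarith [hq0 x, hp0 x]) x
  simp only [Finset.univ_unique, Finset.sum_singleton] at e3
  have e4 := le_coefBound_sq (κ := S.weightedSize ^ 2 + τ₀ ^ 2) (by positivity) M hj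
  rw [Finset.sum_add_distrib]
  have ew : (S.average (bumpMeasure b)).weightedSize = S.weightedSize := rfl
  rw [ew] at e1 e2 e3
  refine le_trans (add_le_add (add_le_add e1 e2) e3) ((le_of_eq ?_).trans e4)
  ring

theorem sq_moll_le_dataBound (S : Scheme d) (b : ContDiffBump (0 : E d)) {m k : ℕ}
    {ψ : ℝ → E d → ℝ} (hk : k ≤ m) (hh : h ≠ 0) (hψ : MemB m S.T ψ) (ht : t ∈ Icc 0 S.T)
    {B : ℝ} (hB : normB m S.T ψ ≤ B) (x : E d) :
    S.sq τ₀ h k (moll (bumpMeasure b) (ψ t)) x ≤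
      (dataBound (S.weightedSize ^ 2 + τ₀ ^ 2) m * B) ^ 2 := by
  have e := sum_sq_moll_le (τ₀ := τ₀) S (Finset.univ : Finset Unit) b
    (ψ := fun _ => ψ) (B := normB m S.T ψ) hk hh (fun _ _ => hψ) ht (by
      simpa using hψ.ae_weakSq_le ht hk) x
  simp only [Finset.univ_unique, Finset.sum_singleton] at e
  refine e.trans ?_
  rw [← mul_assoc, mul_pow]
  have h0 := normB_nonneg m S.T ψ
  exact mul_le_mul (le_dataBound_sq (by positivity) hk) (pow_le_pow_left₀ h0 hB 2)
    (by positivity) (by positivity)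

end Scheme

/-! ## Stability of the evolution equation and limits of solutions -/

section Limit

variable {F : Type*} [NormedAddCommGroup F] [NormedSpace ℝ F]
variable {ι : Type*} {J : Finset ι} {A : ι → F →L[ℝ] F} {T : ℝ}

/-- Gronwall's lemma for bounded solutions without any regularity, on a set invariant under the maps
`A j`. The whole space is used for convergence of approximations, a slice of fixed `h` for
uniqueness. -/
theorem evol_sub_le {D : Set F} (hD : ∀ j ∈ J, ∀ z ∈ D, A j z ∈ D) {a a' : ι → ℝ → F → ℝ}
    {f f' : ℝ → F → ℝ} {g g' : F → ℝ} {u u' : ℝ → F → ℝ} {C B η : ℝ} (hη : 0 ≤ η)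
    (hi : ∀ t ∈ Icc 0 T, ∀ z ∈ D, IntervalIntegrable (evolRHS J a A f u · z) volume 0 t)
    (hi' : ∀ t ∈ Icc 0 T, ∀ z ∈ D, IntervalIntegrable (evolRHS J a' A f' u' · z) volume 0 t)
    (he : ∀ t ∈ Icc 0 T, ∀ z ∈ D, u t z = g z + ∫ s in (0 : ℝ)..t, evolRHS J a A f u s z)
    (he' : ∀ t ∈ Icc 0 T, ∀ z ∈ D, u' t z = g' z + ∫ s in (0 : ℝ)..t, evolRHS J a' A f' u' s z)
    (hC : ∀ j ∈ J, ∀ t ∈ Icc 0 T, ∀ z ∈ D, |a j t z| ≤ C)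
    (hB : ∀ t ∈ Icc 0 T, ∀ z ∈ D, |u t z| ≤ B) (hB' : ∀ t ∈ Icc 0 T, ∀ z ∈ D, |u' t z| ≤ B)
    (hda : ∀ j ∈ J, ∀ t ∈ Icc 0 T, ∀ z ∈ D, |a j t z - a' j t z| ≤ η)
    (hdf : ∀ t ∈ Icc 0 T, ∀ z ∈ D, |f t z - f' t z| ≤ η) (hdg : ∀ z ∈ D, |g z - g' z| ≤ η)
    {t : ℝ} (ht : t ∈ Icc 0 T) {z : F} (hz : z ∈ D) :
    |u t z - u' t z| ≤ (1 + T * (J.card * B + 1)) * η * Real.exp (J.card * C * t) := by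
  have hB0 : 0 ≤ B := (abs_nonneg _).trans (hB t ht z hz)
  refine gronwall_family (Z := D) (u := fun t z => u t z - u' t z) (B := B + B) (C := J.card * C)
    (fun t ht z => (abs_sub _ _).trans (add_le_add (hB t ht z z.2) (hB' t ht z z.2))) ?_ ht ⟨z, hz⟩
  rintro b hb hub t ht ⟨z, hz⟩
  have key : ∀ s ∈ Icc 0 T, |evolRHS J a A f u s z - evolRHS J a' A f' u' s z| ≤
      J.card * C * b s + (J.card * B + 1) * η := by
    intro s hs
    have e : evolRHS J a A f u s z - evolRHS J a' A f' u' s z =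
        ∑ j ∈ J, (a j s z * (u s (A j z) - u' s (A j z)) + (a j s z - a' j s z) * u' s (A j z)) +
          (f s z - f' s z) := by
      simp only [evolRHS, Finset.sum_add_distrib, mul_sub, sub_mul, Finset.sum_sub_distrib]
      ring
    rw [e]
    refine (abs_add_le _ _).trans ?_
    have h1 : |∑ j ∈ J, (a j s z * (u s (A j z) - u' s (A j z)) +
        (a j s z - a' j s z) * u' s (A j z))| ≤ J.card * (C * b s + η * B) := by
      refine (Finset.abs_sum_le_sum_abs _ _).trans ?_
      rw [← nsmul_eq_mul]
      refine Finset.sum_le_card_nsmul _ _ _ fun j hj => (abs_add_le _ _).trans ?_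
      rw [abs_mul, abs_mul]
      have hw := hD j hj z hz
      exact add_le_add
        (mul_le_mul (hC j hj s hs z hz) (hub s hs ⟨A j z, hw⟩) (abs_nonneg _)
          ((abs_nonneg _).trans (hC j hj s hs z hz)))
        (mul_le_mul (hda j hj s hs z hz) (hB' s hs _ hw) (abs_nonneg _) hη)
    have h2 := hdf s hs z hz
    linarith
  have e : u t z - u' t z = (g z - g' z) +
      ∫ s in (0 : ℝ)..t, (evolRHS J a A f u s z - evolRHS J a' A f' u' s z) := by
    rw [he t ht z hz, he' t ht z hz, intervalIntegral.integral_sub (hi t ht z hz) (hi' t ht z hz)]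
    ring
  have hbi : IntervalIntegrable (fun s => J.card * C * b s) volume 0 t :=
    (continuous_const.mul hb).intervalIntegrable _ _
  have h3 := intervalIntegral.norm_integral_le_of_norm_le ht.1 (μ := volume)
    (f := fun s => evolRHS J a A f u s z - evolRHS J a' A f' u' s z)
    (g := fun s => J.card * C * b s + (J.card * B + 1) * η)
    (Eventually.of_forall fun s hs => key s ⟨hs.1.le, hs.2.trans ht.2⟩)
    (hbi.add intervalIntegrable_const)
  rw [intervalIntegral.integral_add hbi intervalIntegrable_const,
    intervalIntegral.integral_const, Real.norm_eq_abs, sub_zero, smul_eq_mul] at h3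
  have h4 : t * ((J.card * B + 1) * η) ≤ T * ((J.card * B + 1) * η) :=
    mul_le_mul_of_nonneg_right ht.2 (by positivity)
  dsimp only
  rw [e]
  refine (abs_add_le _ _).trans ?_
  have h5 := hdg z hz
  linarith

/-- Stability makes the approximate solutions uniformly Cauchy, and the bounds of order `N` are
uniform since those of the data are. Dominated convergence carries the equation over to the limit.
-/
theorem exists_evolution_limit [FiniteDimensional ℝ F] (hT : 0 ≤ T) {a : ℕ → ι → ℝ → F → ℝ}
    {f : ℕ → ℝ → F → ℝ} {g : ℕ → F → ℝ} {a' : ι → ℝ → F → ℝ} {f' : ℝ → F → ℝ} {g' : F → ℝ}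
    {N : ℕ} {C : ℝ} {ε : ℕ → ℝ} (hε : Tendsto ε atTop (𝓝 0))
    (ha : ∀ n, ∀ j ∈ J, TB T (a n j)) (hf : ∀ n, TB T (f n)) (hg : ∀ n, SB (g n))
    (hCa : ∀ n, ∀ j ∈ J, ∀ t ∈ Icc 0 T, BD N C (a n j t))
    (hCf : ∀ n, ∀ t ∈ Icc 0 T, BD N C (f n t)) (hCg : ∀ n, BD N C (g n))
    (hda : ∀ n, ∀ j ∈ J, ∀ t ∈ Icc 0 T, ∀ z, |a n j t z - a' j t z| ≤ ε n)
    (hdf : ∀ n, ∀ t ∈ Icc 0 T, ∀ z, |f n t z - f' t z| ≤ ε n)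
    (hdg : ∀ n z, |g n z - g' z| ≤ ε n) :
    ∃ (U : ℝ → F → ℝ) (Un : ℕ → ℝ → F → ℝ) (C' : ℝ), (∀ n, TB T (Un n)) ∧
      (∀ n, ∀ t ∈ Icc 0 T, ∀ z, Un n t z = g n z +
        ∫ s in (0 : ℝ)..t, evolRHS J (a n) A (f n) (Un n) s z) ∧
      (∀ n, ∀ t ∈ Icc 0 T, BD N C' (Un n t)) ∧
      (∀ t ∈ Icc 0 T, TendstoUniformly (fun n => Un n t) (U t) atTop) ∧
      ∀ t ∈ Icc 0 T, ∀ z, IntervalIntegrable (evolRHS J a' A f' U · z) volume 0 t ∧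
        U t z = g' z + ∫ s in (0 : ℝ)..t, evolRHS J a' A f' U s z := by
  have hC0 : 0 ≤ C := (hCg 0).nonneg
  obtain ⟨R, hR, hA⟩ : ∃ R : ℝ, 1 ≤ R ∧ ∀ j ∈ J, ‖A j‖ ≤ R :=
    ⟨1 + ∑ j ∈ J, ‖A j‖, by linarith [Finset.sum_nonneg fun j (_ : j ∈ J) => norm_nonneg (A j)],
      fun j hj => by
        have := Finset.single_le_sum (f := fun j => ‖A j‖) (fun j _ => norm_nonneg _) hj
        linarith⟩
  choose Un hUn heq hbd using fun n => exists_evolution_solution (J := J) (a := a n) (A := A) hT (ha n) (hf n) (hg n)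
  set C' := (C + T * C) * Real.exp (J.card * 2 ^ N * C * R ^ N * T) with hC'
  have hC'0 : 0 ≤ C' := by positivity
  have hbd' : ∀ n, ∀ t ∈ Icc 0 T, BD N C' (Un n t) := fun n t ht =>
    (hbd n N C C C R hR hA (hCa n) (hCf n) (hCg n) t ht).mono (by
      rw [hC']
      gcongr
      exact ht.2)
  have hR' : ∀ n, TB T (evolRHS J (a n) A (f n) (Un n)) := fun n =>
    TB.evolRHS (ha n) (hf n) (hUn n)
  have hε0 : ∀ n, 0 ≤ ε n := fun n => (abs_nonneg _).trans (hdg n 0)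
  have hdist : ∀ {x y z p q : ℝ}, |x - z| ≤ p → |y - z| ≤ q → |x - y| ≤ p + q := by
    intro x y z p q h1 h2
    rw [abs_le] at *
    constructor <;> linarith [h1.1, h1.2, h2.1, h2.2]
  set κ := (1 + T * (J.card * C' + 1)) * Real.exp (J.card * C * T) with hκ
  have hκ0 : 0 ≤ κ := by positivity
  -- Two approximations are compared with each other, their data being within `ε n + ε k` because
  -- both are close to the limit data.
  have hcau : ∀ n k, ∀ t ∈ Icc 0 T, ∀ z, |Un n t z - Un k t z| ≤ κ * (ε n + ε k) := by
    intro n k t ht z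
    have h1 := evol_sub_le (D := univ) (A := A) (fun _ _ _ _ => mem_univ _)
      (add_nonneg (hε0 n) (hε0 k))
      (fun t ht z _ => (hR' n).intervalIntegrable ht z)
      (fun t ht z _ => (hR' k).intervalIntegrable ht z) (fun t ht z _ => heq n t ht z)
      (fun t ht z _ => heq k t ht z) (fun j hj t ht z _ => (hCa n j hj t ht).bound z)
      (fun t ht z _ => (hbd' n t ht).bound z) (fun t ht z _ => (hbd' k t ht).bound z)
      (fun j hj t ht z _ => hdist (hda n j hj t ht z) (hda k j hj t ht z))
      (fun t ht z _ => hdist (hdf n t ht z) (hdf k t ht z))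
      (fun z _ => hdist (hdg n z) (hdg k z)) ht (mem_univ z)
    refine h1.trans ?_
    have h2 : Real.exp (J.card * C * t) ≤ Real.exp (J.card * C * T) :=
      Real.exp_le_exp.mpr (mul_le_mul_of_nonneg_left ht.2 (by positivity))
    have h3 := add_nonneg (hε0 n) (hε0 k)
    calc _ ≤ (1 + T * (J.card * C' + 1)) * (ε n + ε k) * Real.exp (J.card * C * T) :=
          mul_le_mul_of_nonneg_left h2 (by positivity)
      _ = _ := by rw [hκ]; ring
  have hlimex : ∀ t ∈ Icc 0 T, ∀ z, ∃ y, Tendsto (fun n => Un n t z) atTop (𝓝 y) := by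
    intro t ht z
    refine cauchySeq_tendsto_of_complete (Metric.cauchySeq_iff.mpr fun e he => ?_)
    have h0 : Tendsto (fun n => κ * (ε n + ε n)) atTop (𝓝 0) := by
      simpa using (hε.add hε).const_mul κ
    have h1 : Tendsto (fun n => κ * ε n) atTop (𝓝 0) := by simpa using hε.const_mul κ
    obtain ⟨n₀, hn₀⟩ := eventually_atTop.mp (h1.eventually_lt_const (half_pos he))
    refine ⟨n₀, fun n hn k hk => lt_of_le_of_lt (hcau n k t ht z) ?_⟩
    have := hn₀ n hn
    have := hn₀ k hk
    linarith
  choose! U hU using hlimex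
  have hrate : ∀ n, ∀ t ∈ Icc 0 T, ∀ z, |Un n t z - U t z| ≤ κ * ε n := by
    intro n t ht z
    have h1 : Tendsto (fun k => κ * (ε n + ε k)) atTop (𝓝 (κ * (ε n + 0))) :=
      (hε.const_add _).const_mul κ
    rw [add_zero] at h1
    exact le_of_tendsto_of_tendsto' (tendsto_const_nhds.sub (hU t ht z)).abs h1
      fun k => hcau n k t ht z
  have hunif : ∀ t ∈ Icc 0 T, TendstoUniformly (fun n => Un n t) (U t) atTop := by
    intro t ht
    rw [Metric.tendstoUniformly_iff]
    intro e he
    have h1 : Tendsto (fun n => κ * ε n) atTop (𝓝 0) := by simpa using hε.const_mul κ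
    filter_upwards [h1.eventually_lt_const he] with n hn z
    rw [dist_comm]
    exact (hrate n t ht z).trans_lt hn
  have hptw : ∀ s ∈ Icc 0 T, ∀ z, Tendsto (fun n => evolRHS J (a n) A (f n) (Un n) s z) atTop
      (𝓝 (evolRHS J a' A f' U s z)) := by
    intro s hs z
    have h1 : ∀ {φ : ℕ → ℝ} {y : ℝ}, (∀ n, |φ n - y| ≤ ε n) → Tendsto φ atTop (𝓝 y) := by
      intro φ y h
      rw [tendsto_iff_norm_sub_tendsto_zero]
      exact squeeze_zero (fun _ => norm_nonneg _) h hε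
    exact (tendsto_finsetSum _ fun j hj => (h1 fun n => hda n j hj s hs z).mul (hU s hs _)).add
      (h1 fun n => hdf n s hs z)
  set b : ℝ := J.card * 2 ^ 0 * C * R ^ 0 * C' + C with hb
  have hdom : ∀ n, ∀ s ∈ Icc 0 T, ∀ z, |evolRHS J (a n) A (f n) (Un n) s z| ≤ b :=
    fun n s hs z => (BD.evolRHS hR hA (fun j hj => (hCa n j hj s hs).of_le (Nat.zero_le N))
      ((hCf n s hs).of_le (Nat.zero_le N)) ((hbd' n s hs).of_le (Nat.zero_le N))).bound z
  refine ⟨U, Un, C', hUn, heq, hbd', hunif, fun t ht z => ⟨?_, ?_⟩⟩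
  · rw [intervalIntegrable_iff_integrableOn_Ioc_of_le ht.1]
    refine Integrable.of_bound (aestronglyMeasurable_of_tendsto_ae (u := atTop)
      (fun n => ((hR' n).meas z).mono_measure (restrict_Ioc_le ht)) ?_) b ?_
    · filter_upwards [ae_restrict_mem measurableSet_Ioc] with s hs
      exact hptw s ⟨hs.1.le, hs.2.trans ht.2⟩ z
    · filter_upwards [ae_restrict_mem measurableSet_Ioc] with s hs
      have hs' : s ∈ Icc 0 T := ⟨hs.1.le, hs.2.trans ht.2⟩
      exact le_of_tendsto (hptw s hs' z).norm (Eventually.of_forall fun n => hdom n s hs' z)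
  · refine tendsto_nhds_unique (hU t ht z) ?_
    have hgt : Tendsto (fun n => g n z) atTop (𝓝 (g' z)) := by
      rw [tendsto_iff_norm_sub_tendsto_zero]
      exact squeeze_zero (fun _ => norm_nonneg _) (fun n => hdg n z) hε
    have h1 : Tendsto (fun n => ∫ s in (0 : ℝ)..t, evolRHS J (a n) A (f n) (Un n) s z) atTop
        (𝓝 (∫ s in (0 : ℝ)..t, evolRHS J a' A f' U s z)) := by
      refine intervalIntegral.tendsto_integral_filter_of_dominated_convergence (fun _ => b)
        (Eventually.of_forall fun n => ?_) (Eventually.of_forall fun n =>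
          Eventually.of_forall fun s hs => ?_) (by simp) (Eventually.of_forall fun s hs => ?_)
      · rw [uIoc_of_le ht.1]
        exact ((hR' n).meas z).mono_measure (restrict_Ioc_le ht)
      · rw [uIoc_of_le ht.1] at hs
        exact hdom n s ⟨hs.1.le, hs.2.trans ht.2⟩ z
      · rw [uIoc_of_le ht.1] at hs
        exact hptw s ⟨hs.1.le, hs.2.trans ht.2⟩ z
    exact (hgt.add h1).congr fun n => (heq n t ht z).symm

end Limit

/-! ## Derivatives of slices -/

theorem BD.comp_snd {N : ℕ} {C : ℝ} {φ : E d → ℝ} (h : BD N C φ) :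
    BD N C (fun z : ℝ × E d => φ z.2) := by
  have := h.comp_affine (ContinuousLinearMap.snd ℝ ℝ (E d)) 0 (R := 1)
    (ContinuousLinearMap.norm_snd_le ℝ ℝ (E d)) le_rfl
  simpa using this

theorem BD.comp_fst {N : ℕ} {C : ℝ} {φ : ℝ → ℝ} (h : BD N C φ) :
    BD N C (fun z : ℝ × E d => φ z.1) := by
  have := h.comp_affine (ContinuousLinearMap.fst ℝ ℝ (E d)) 0 (R := 1)
    (ContinuousLinearMap.norm_fst_le ℝ ℝ (E d)) le_rfl
  simpa using this

theorem norm_eh : ‖(eh : ℝ × E d)‖ ≤ 1 := by simp [eh, Prod.norm_def]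

theorem BD.iterate_dd_eh {k N : ℕ} {C : ℝ} {φ : ℝ × E d → ℝ} (h : BD (N + k) C φ) :
    BD N C ((FDScheme.dd eh)^[k] φ) := by
  induction k generalizing φ with
  | zero => exact h
  | succ k ih =>
    rw [Function.iterate_succ_apply]
    exact ih (h.2.2 eh norm_eh)

theorem ddList_slice {N : ℕ} {C : ℝ} {φ : ℝ × E d → ℝ} (h : BD N C φ) (l : List (E d))
    (hl : l.length ≤ N) (η : ℝ) : ddList l (fun x => φ (η, x)) =
      fun x => ddList (l.map fun e => ((0 : ℝ), e)) φ (η, x) := by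
  induction l generalizing φ N C with
  | nil => rfl
  | cons e l ih =>
    obtain ⟨N, rfl⟩ : ∃ N', N = N' + 1 := ⟨N - 1, by simp at hl; omega⟩
    have h1 := dd_comp_affine (A := ContinuousLinearMap.inr ℝ ℝ (E d)) (v := (η, 0)) h.1 e
    simp only [ContinuousLinearMap.inr_apply, Prod.mk_add_mk, zero_add, add_zero] at h1
    simp only [ddList, List.map_cons]
    rw [h1, ih (h.dd _) (by simp at hl; omega)]

theorem BD.contDiff_slice_snd {N : ℕ} {C : ℝ} {φ : ℝ × E d → ℝ} (h : BD N C φ) (η : ℝ) :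
    ContDiff ℝ N (fun x => φ (η, x)) :=
  h.contDiff.comp (contDiff_const.prodMk contDiff_id)

theorem BD.contDiff_slice_fst {N : ℕ} {C : ℝ} {φ : ℝ × E d → ℝ} (h : BD N C φ) (x : E d) :
    ContDiff ℝ N (fun η => φ (η, x)) :=
  h.contDiff.comp (contDiff_id.prodMk contDiff_const)

theorem iteratedDeriv_slice {k : ℕ} {C : ℝ} {φ : ℝ × E d → ℝ} (h : BD k C φ) (x : E d) (η : ℝ) :
    iteratedDeriv k (fun η => φ (η, x)) η = ((dd eh)^[k] φ) (η, x) := by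
  induction k generalizing φ with
  | zero => simp
  | succ k ih =>
    rw [iteratedDeriv_succ', Function.iterate_succ_apply, ← ih (h.2.2 eh norm_eh)]
    congr 1
    funext η
    have h1 : HasDerivAt (fun η : ℝ => (η, x)) ((1 : ℝ), (0 : E d)) η :=
      (hasDerivAt_id η).prodMk (hasDerivAt_const η x)
    exact ((h.1 (η, x)).hasFDerivAt.comp_hasDerivAt η h1).deriv

/-! ### Passage to the original data, and uniqueness of bounded solutions. -/

namespace Scheme

variable {S : Scheme d} {τ₀ : ℝ} {β : ℝ → ℝ}

theorem bd_jointCoef {N : ℕ} {B Cc : ℝ} {Cq Cp : E d → ℝ} {s : ℝ} (hβ : BD N B β)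
    (hq : ∀ l ∈ S.Λ₁, BD N (Cq l) (S.q l s)) (hp : ∀ l ∈ S.Λ₁, BD N (Cp l) (S.p l s))
    (hc : BD N Cc (S.c s)) : ∀ o ∈ Finset.insertNone S.Λ₁,
      BD N (∑ l ∈ S.Λ₁, (2 ^ N * B * (2 ^ N * B * Cq l) + 2 ^ N * B * Cp l) + Cc)
        (S.jointCoef β o s) := by
  have h1 : ∀ l ∈ S.Λ₁, BD N (2 ^ N * B * (2 ^ N * B * Cq l) + 2 ^ N * B * Cp l)
      (S.jointCoef β (some l) s) := fun l hl =>
    (hβ.comp_fst.mul (hβ.comp_fst.mul (hq l hl).comp_snd)).add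
      (hβ.comp_fst.mul (hp l hl).comp_snd)
  intro o ho
  cases o with
  | none =>
    have := ((BD.sum S.Λ₁ h1).const_mul (-1)).sub hc.comp_snd
    rw [abs_neg, abs_one, one_mul] at this
    exact this
  | some l =>
    have hl : l ∈ S.Λ₁ := by simpa using ho
    refine (h1 l hl).mono ?_
    have := Finset.single_le_sum (fun l hl => (h1 l hl).nonneg) hl
    linarith [hc.nonneg]

theorem abs_jointCoef_average_sub_le {ν : Measure (E d)} {B ε Cc : ℝ} {Cq Cp : E d → ℝ} {s : ℝ}
    (hβ : ∀ η, |β η| ≤ B)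
    (hq : ∀ l ∈ S.Λ₁, ∀ x, |moll ν (S.q l s) x - S.q l s x| ≤ Cq l * ε)
    (hp : ∀ l ∈ S.Λ₁, ∀ x, |moll ν (S.p l s) x - S.p l s x| ≤ Cp l * ε)
    (hc : ∀ x, |moll ν (S.c s) x - S.c s x| ≤ Cc * ε) : ∀ o ∈ Finset.insertNone S.Λ₁, ∀ z,
      |(S.average ν).jointCoef β o s z - S.jointCoef β o s z| ≤
        (∑ l ∈ S.Λ₁, (B * (B * Cq l) + B * Cp l) + Cc) * ε := by
  have hB : 0 ≤ B := (abs_nonneg _).trans (hβ 0)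
  have h1 : ∀ l ∈ S.Λ₁, ∀ z, |(S.average ν).jointCoef β (some l) s z -
      S.jointCoef β (some l) s z| ≤ (B * (B * Cq l) + B * Cp l) * ε := by
    intro l hl z
    have e : (S.average ν).jointCoef β (some l) s z - S.jointCoef β (some l) s z =
        β z.1 * (β z.1 * (moll ν (S.q l s) z.2 - S.q l s z.2)) +
          β z.1 * (moll ν (S.p l s) z.2 - S.p l s z.2) := by
      simp only [jointCoef, average]; ring
    rw [e]
    refine (abs_add_le _ _).trans ?_
    simp only [abs_mul]
    have h2 := mul_le_mul (hβ z.1) (mul_le_mul (hβ z.1) (hq l hl z.2) (abs_nonneg _) hB)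
      (by positivity) hB
    have h3 := mul_le_mul (hβ z.1) (hp l hl z.2) (abs_nonneg _) hB
    linarith
  have h4 : ∀ z, ∑ l ∈ S.Λ₁, |(S.average ν).jointCoef β (some l) s z -
      S.jointCoef β (some l) s z| ≤ (∑ l ∈ S.Λ₁, (B * (B * Cq l) + B * Cp l)) * ε := fun z => by
    rw [Finset.sum_mul]
    exact Finset.sum_le_sum fun l hl => h1 l hl z
  intro o ho z
  have hcz := hc z.2
  cases o with
  | none =>
    have e : (S.average ν).jointCoef β none s z - S.jointCoef β none s z =
        -(∑ l ∈ S.Λ₁, ((S.average ν).jointCoef β (some l) s z - S.jointCoef β (some l) s z)) -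
          (moll ν (S.c s) z.2 - S.c s z.2) := by
      rw [Finset.sum_sub_distrib]
      simp only [jointCoef, average]; ring
    rw [e, add_mul]
    refine (abs_sub _ _).trans (add_le_add ?_ hcz)
    rw [abs_neg]
    exact (Finset.abs_sum_le_sum_abs _ _).trans (h4 z)
  | some l =>
    have hl : l ∈ S.Λ₁ := by simpa using ho
    have h5 := Finset.single_le_sum (f := fun l => |(S.average ν).jointCoef β (some l) s z -
      S.jointCoef β (some l) s z|) (fun _ _ => abs_nonneg _) hl
    have h6 := (abs_nonneg _).trans hcz
    rw [add_mul]
    linarith [h4 z]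

/-- The limit of the solutions of the mollified joint equations. -/
theorem exists_joint_limit {m : ℕ} {M : ℕ → ℝ} (hS : S.Regular (m + 1) M) (hβ : SB β) :
    ∃ (U : ℝ → ℝ × E d → ℝ) (Un : ℕ → ℝ → ℝ × E d → ℝ) (C : ℝ), (∀ n, TB S.T (Un n)) ∧
      (∀ n, ∀ t ∈ Icc 0 S.T, ∀ z, Un n t z = moll (bumpMeasure (bumpSeq n)) S.g z.2 +
        ∫ s in (0 : ℝ)..t, (S.average (bumpMeasure (bumpSeq n))).jointRHS β (Un n) s z) ∧
      (∀ n, ∀ t ∈ Icc 0 S.T, BD (m + 1) C (Un n t)) ∧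
      (∀ t ∈ Icc 0 S.T, TendstoUniformly (fun n => Un n t) (U t) atTop) ∧
      ∀ t ∈ Icc 0 S.T, ∀ z, IntervalIntegrable (S.jointRHS β U · z) volume 0 t ∧
        U t z = S.g z.2 + ∫ s in (0 : ℝ)..t, S.jointRHS β U s z := by
  have hT := S.T_pos.le
  have h0 : (0 : ℝ) ∈ Icc 0 S.T := ⟨le_rfl, hT⟩
  choose! Cq hq0 hq using fun l hl => (hS.q_mem l hl).exists_bd hT
  choose! Cp hp0 hp using fun l hl => (hS.p_mem l hl).exists_bd hT
  obtain ⟨Cc, hc0, hc⟩ := hS.c_mem.exists_bd hT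
  obtain ⟨Cf, hf0, hf⟩ := hS.f_mem.exists_bd hT
  obtain ⟨Cg, hg0, hg⟩ := hS.g_mem.exists_bd hT
  obtain ⟨B, hB⟩ := hβ (m + 1)
  have hB0 := hB.nonneg
  set D := ∑ l ∈ S.Λ₁, (2 ^ (m + 1) * B * (2 ^ (m + 1) * B * Cq l) + 2 ^ (m + 1) * B * Cp l) + Cc
    with hD
  set D' := ∑ l ∈ S.Λ₁, (B * (B * Cq l) + B * Cp l) + Cc with hD'
  have hD0 : 0 ≤ D := add_nonneg (Finset.sum_nonneg fun l hl => by
    have := hq0 l hl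
    have := hp0 l hl
    positivity) hc0
  have hD'0 : 0 ≤ D' := add_nonneg (Finset.sum_nonneg fun l hl => by
    have := hq0 l hl
    have := hp0 l hl
    positivity) hc0
  have hε : Tendsto (fun n : ℕ => (D' + Cf + Cg) * (1 / ((n : ℝ) + 1))) atTop (𝓝 0) := by
    simpa using (tendsto_one_div_add_atTop_nhds_zero_nat (𝕜 := ℝ)).const_mul (D' + Cf + Cg)
  have hle : ∀ {x y : ℝ} (n : ℕ), x ≤ y * (1 / ((n : ℝ) + 1)) → y ≤ D' + Cf + Cg →
      x ≤ (D' + Cf + Cg) * (1 / ((n : ℝ) + 1)) := fun n h h' =>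
    h.trans (mul_le_mul_of_nonneg_right h' (by positivity))
  exact exists_evolution_limit (J := Finset.insertNone S.Λ₁) (A := jointShear) hT
    (a := fun n => (S.average (bumpMeasure (bumpSeq n))).jointCoef β)
    (a' := S.jointCoef β) (f := fun n s z => moll (bumpMeasure (bumpSeq n)) (S.f s) z.2)
    (f' := fun s z => S.f s z.2) (g := fun n z => moll (bumpMeasure (bumpSeq n)) S.g z.2)
    (g' := fun z => S.g z.2) (N := m + 1) (C := D + Cf + Cg) hε
    (fun n => tb_jointCoef (S := S.average (bumpMeasure (bumpSeq n))) hβ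
      (fun l hl => (hS.q_mem l hl).tb_moll _ hT)
      (fun l hl => (hS.p_mem l hl).tb_moll _ hT) (hS.c_mem.tb_moll _ hT))
    (fun n => (hS.f_mem.tb_moll _ hT).comp_snd) (fun n => ((hS.g_mem.tb_moll _ hT).sb h0).comp_snd)
    (fun n o ho t ht => (bd_jointCoef (S := S.average (bumpMeasure (bumpSeq n))) hB
      (fun l hl => (hq l hl t ht).1 _) (fun l hl => (hp l hl t ht).1 _)
      ((hc t ht).1 _) o ho).mono (show D ≤ _ by linarith))
    (fun n t ht => ((hf t ht).1 _).comp_snd.mono (by linarith))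
    (fun n => ((hg 0 h0).1 _).comp_snd.mono (by linarith))
    (fun n o ho t ht z => hle n (abs_jointCoef_average_sub_le hB.bound
      (fun l hl x => (hq l hl t ht).2.2 n x) (fun l hl x => (hp l hl t ht).2.2 n x)
      ((hc t ht).2.2 n) o ho z) (show D' ≤ _ by linarith))
    (fun n t ht z => hle n ((hf t ht).2.2 n z.2) (by linarith))
    (fun n z => hle n ((hg 0 h0).2.2 n z.2) (by linarith))

/-- Solutions of the joint equation are made of solutions of the scheme. -/
theorem isBoundedSolution_of_joint {U : ℝ → ℝ × E d → ℝ} {h C : ℝ} (hβh : β h = h⁻¹)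
    (hb : ∀ t ∈ Icc 0 S.T, ∀ z, |U t z| ≤ C)
    (hU : ∀ t ∈ Icc 0 S.T, ∀ z, IntervalIntegrable (S.jointRHS β U · z) volume 0 t ∧
        U t z = S.g z.2 + ∫ s in (0 : ℝ)..t, S.jointRHS β U s z) :
    S.IsBoundedSolution h (fun t x => U t (h, x)) := by
  refine ⟨⟨C, fun t ht x => hb t ht _⟩, fun t ht x => ?_, fun t ht x => ?_⟩
  · have := (hU t ht (h, x)).1
    simpa only [jointRHS_eq U _ hβh] using this
  · have := (hU t ht (h, x)).2
    simpa only [jointRHS_eq U _ hβh] using this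

/-- For fixed `h` the scheme is the joint equation with the constant cut-off `h⁻¹`, restricted to
the slice `z.1 = h`, which the shears preserve. Stability with equal data, `η = 0`, gives equality.
-/
theorem IsBoundedSolution.eq {h : ℝ} {v w : ℝ → E d → ℝ} (hv : S.IsBoundedSolution h v)
    (hw : S.IsBoundedSolution h w) {C : ℝ} (hq : ∀ l ∈ S.Λ₁, ∀ t ∈ Icc 0 S.T, ∀ x, |S.q l t x| ≤ C)
    (hp : ∀ l ∈ S.Λ₁, ∀ t ∈ Icc 0 S.T, ∀ x, |S.p l t x| ≤ C)
    (hc : ∀ t ∈ Icc 0 S.T, ∀ x, |S.c t x| ≤ C) {t : ℝ} (ht : t ∈ Icc 0 S.T) (x : E d) :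
    v t x = w t x := by
  obtain ⟨B, hB⟩ := hv.bounded
  obtain ⟨B', hB'⟩ := hw.bounded
  have hjoint : ∀ {v : ℝ → E d → ℝ} {s : ℝ} {z : ℝ × E d}, z.1 = h →
      S.jointRHS (fun _ => h⁻¹) (fun s z => v s z.2) s z = S.L h s (v s) z.2 + S.f s z.2 := by
    rintro v s ⟨η, y⟩ rfl
    exact jointRHS_eq (β := fun _ => η⁻¹) (fun s z => v s z.2) s (h := η) rfl y
  have hcoef : ∀ o ∈ Finset.insertNone S.Λ₁, ∀ t ∈ Icc 0 S.T, ∀ z : ℝ × E d,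
      |S.jointCoef (fun _ => h⁻¹) o t z| ≤
        ∑ l ∈ S.Λ₁, (|h⁻¹| * (|h⁻¹| * C) + |h⁻¹| * C) + C := by
    intro o ho t ht z
    have h1 : ∀ l ∈ S.Λ₁, |S.jointCoef (fun _ => h⁻¹) (some l) t z| ≤
        |h⁻¹| * (|h⁻¹| * C) + |h⁻¹| * C := fun l hl => by
      refine (abs_add_le _ _).trans ?_
      simp only [abs_mul]
      have := hq l hl t ht z.2
      have := hp l hl t ht z.2
      gcongr
    have h2 := hc t ht z.2
    cases o with
    | none =>
      refine (abs_sub _ _).trans (add_le_add ?_ h2)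
      rw [abs_mul, abs_neg, abs_one, one_mul]
      exact (Finset.abs_sum_le_sum_abs _ _).trans (Finset.sum_le_sum h1)
    | some l =>
      have hl : l ∈ S.Λ₁ := by simpa using ho
      have h3 := Finset.single_le_sum (f := fun _ : E d => |h⁻¹| * (|h⁻¹| * C) + |h⁻¹| * C)
        (fun l hl => (abs_nonneg _).trans (h1 l hl)) hl
      have h4 := (abs_nonneg _).trans h2
      linarith [h1 l hl]
  have key := evol_sub_le (F := ℝ × E d) (J := Finset.insertNone S.Λ₁) (A := jointShear)
    (D := {z | z.1 = h}) (a := S.jointCoef fun _ => h⁻¹) (a' := S.jointCoef fun _ => h⁻¹)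
    (f := fun s z => S.f s z.2) (f' := fun s z => S.f s z.2) (g := fun z => S.g z.2)
    (g' := fun z => S.g z.2) (u := fun s z => v s z.2) (u' := fun s z => w s z.2) (T := S.T)
    (B := max B B') (η := 0)
    (by
      intro o _ z hz
      cases o <;> exact hz) le_rfl
    (fun t ht z hz => (hv.integrable t ht z.2).congr fun s _ => (hjoint hz).symm)
    (fun t ht z hz => (hw.integrable t ht z.2).congr fun s _ => (hjoint hz).symm)
    (fun t ht z hz => (hv.equation t ht z.2).trans (by
      congr 1
      exact intervalIntegral.integral_congr fun s _ => (hjoint hz).symm))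
    (fun t ht z hz => (hw.equation t ht z.2).trans (by
      congr 1
      exact intervalIntegral.integral_congr fun s _ => (hjoint hz).symm))
    (fun o ho t ht z _ => hcoef o ho t ht z)
    (fun t ht z _ => (hB t ht z.2).trans (le_max_left _ _))
    (fun t ht z _ => (hB' t ht z.2).trans (le_max_right _ _))
    (fun _ _ _ _ _ _ => by simp) (fun _ _ _ _ => by simp) (fun _ _ => by simp) ht
    (z := (h, x)) rfl
  simp only [mul_zero, zero_mul] at key
  exact sub_eq_zero.mp (abs_nonpos_iff.mp key)

theorem Regular.eq_of_isBoundedSolution {m : ℕ} {M : ℕ → ℝ} (hS : S.Regular m M) {h : ℝ}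
    {v w : ℝ → E d → ℝ} (hv : S.IsBoundedSolution h v) (hw : S.IsBoundedSolution h w) {t : ℝ}
    (ht : t ∈ Icc 0 S.T) (x : E d) : v t x = w t x := by
  choose! Cq hq using fun l hl => (hS.q_mem l hl).bounded
  choose! Cp hp using fun l hl => (hS.p_mem l hl).bounded
  obtain ⟨Cc, hc⟩ := hS.c_mem.bounded
  have hsum : ∀ (c : E d → ℝ) l, l ∈ S.Λ₁ → c l ≤ ∑ l ∈ S.Λ₁, |c l| := fun c l hl =>
    (le_abs_self _).trans (Finset.single_le_sum (f := fun l => |c l|) (fun _ _ => abs_nonneg _) hl)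
  have hnn : ∀ c : E d → ℝ, 0 ≤ ∑ l ∈ S.Λ₁, |c l| := fun c =>
    Finset.sum_nonneg fun _ _ => abs_nonneg _
  refine hv.eq hw (C := ∑ l ∈ S.Λ₁, |Cq l| + ∑ l ∈ S.Λ₁, |Cp l| + |Cc|)
    (fun l hl t ht x => (hq l hl t ht x).trans ?_) (fun l hl t ht x => (hp l hl t ht x).trans ?_)
    (fun t ht x => (hc t ht x).trans ?_) ht x
  · linarith [hsum Cq l hl, hnn Cp, abs_nonneg Cc]
  · linarith [hsum Cp l hl, hnn Cq, abs_nonneg Cc]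
  · linarith [hnn Cq, hnn Cp, le_abs_self Cc]

end Scheme

/-! ### Local regularity in the mesh-size and the estimate for the original data. -/

namespace Scheme

/-- Near every mesh-size the solutions are slices of a regular function of the mesh-size and of
the space variable, whose derivatives of odd order in the mesh-size `η` are of order `η`. -/
theorem exists_joint_estimate (m : ℕ) {δ c₀ τ₀ K : ℝ} (size weightedSize : ℝ) (M : ℕ → ℝ)
    (hδ : δ ∈ Ioc (0 : ℝ) 1) (hc₀ : 0 < c₀) (hτ₀ : 0 < τ₀) (hK : 1 ≤ K) (hm : 3 ≤ m) :
    ∃ N : ℝ, 0 ≤ N ∧ ∀ {d : ℕ} (S : Scheme d), S.size = size → S.weightedSize = weightedSize →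
      S.Regular (m + 1) M → S.ChiNonneg → S.Centered → S.Killing c₀ →
      S.FirstOrderCondition (m + 1) δ τ₀ K → S.SecondOrderCondition (m + 1) δ τ₀ K →
      S.Symmetric → S.Antisymmetric → ∀ h ∈ Ioc 0 S.h₀,
      ∃ (a b C : ℝ) (U : ℝ → ℝ × E d → ℝ), 0 < a ∧ h ∈ Ioo a b ∧
        (∀ t ∈ Icc 0 S.T, BD m C (U t)) ∧
        (∀ η ∈ Ioo a b, S.IsBoundedSolution η (fun t x => U t (η, x))) ∧
        ∀ k r : ℕ, Odd k → 3 * k + r ≤ m → ∀ η ∈ Ioo a b ∩ Ioc 0 S.h₀, ∀ t ∈ Icc 0 S.T, ∀ x,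
          absD r (fun y => ((dd eh)^[k] (U t)) (η, y)) x ≤
            N * (normB (m + 1) S.T S.f + normB (m + 1) S.T (fun _ => S.g)) * η := by
  set κ := weightedSize ^ 2 + τ₀ ^ 2 with hκ
  have hκ0 : 0 ≤ κ := by positivity
  -- Taking `m + 1` as the largest order in `h` gives one constant for all pairs with `3k + r ≤ m`.
  obtain ⟨N, hN1, hN⟩ := deriv_estimate_odd (m + 1) (size := size)
    (A := coefBound κ M (m + 1)) hδ hc₀ hτ₀ hK
    (by linarith [one_le_coefBound hκ0 M (m + 1)]) (m + 1)
  have hD := one_le_dataBound hκ0 (m + 1)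
  have hτ' : 0 ≤ τ₀⁻¹ := by positivity
  refine ⟨max 1 τ₀⁻¹ ^ m * N * dataBound κ (m + 1), by positivity, ?_⟩
  intro d S hs hw hS hχ hcen hkill h1 h2 hsym hanti h hh
  have hT := S.T_pos.le
  have h0T : (0 : ℝ) ∈ Icc 0 S.T := ⟨le_rfl, hT⟩
  have hh0 : 0 < h := hh.1
  -- The interval reaches beyond `h₀`, so it is a neighbourhood of `h` even at the endpoint. The
  -- cut-off depends on `h`, but the constant `N` does not.
  have hab : h / 2 < S.h₀ + 1 := by linarith [hh.2]
  obtain ⟨β, hβ, hβh⟩ := exists_cutoff (half_pos hh0) hab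
  have hβ' : ∀ η ∈ Ioo (h / 2) (S.h₀ + 1), β η = η⁻¹ := fun η hη => hβh η ⟨hη.1.le, hη.2.le⟩
  obtain ⟨U, Un, C, hUn, heq, hbd, hunif, hU⟩ := exists_joint_limit hS hβ
  have hbdU : ∀ t ∈ Icc 0 S.T, BD m C (U t) := fun t ht =>
    BD.of_tendstoUniformly (fun n => hbd n t ht) (hunif t ht)
  refine ⟨h / 2, S.h₀ + 1, C, U, half_pos hh0, ⟨half_lt_self hh0, by linarith [hh.2]⟩, hbdU,
    fun η hη => isBoundedSolution_of_joint (hβ' η hη) (fun t ht z => (hbdU t ht).bound z) hU,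
    fun k r hk hkr η hη t ht x => ?_⟩
  obtain ⟨Y, hY⟩ : ∃ Y, Y = normB (m + 1) S.T S.f + normB (m + 1) S.T (fun _ => S.g) := ⟨_, rfl⟩
  have hf0 := normB_nonneg (m + 1) S.T S.f
  have hg0 := normB_nonneg (m + 1) S.T (fun _ => S.g)
  have hY0 : 0 ≤ Y := hY ▸ add_nonneg hf0 hg0
  have hη0 : 0 < η := hη.2.1
  obtain ⟨B, hB⟩ : ∃ B, B = dataBound κ (m + 1) * Y := ⟨_, rfl⟩
  have hB0 : 0 ≤ B := hB ▸ mul_nonneg (by linarith) hY0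
  -- For each mollification the smooth theory applies; the squares over words in `Λ` are converted
  -- to coordinate derivatives at the cost of `τ₀⁻¹ ^ r`.
  have hest : ∀ n, ∑ v ∈ words (Finset.univ : Finset (Fin d)) r,
      pword v (fun y => ((dd eh)^[k] (Un n t)) (η, y)) x ^ 2 ≤
        (τ₀⁻¹ ^ r * (N * (B * η))) ^ 2 := by
    intro n
    set b : ContDiffBump (0 : E d) := bumpSeq n
    have hsm := smoothData_average (by omega) hδ.2 (by linarith) hc₀ hS hχ hcen hkill h1 h2 b
    rw [hw] at hsm
    have hsys := derivSystem_of_joint (S := S.average (bumpMeasure b)) hβ hsm.q_tb hsm.p_tb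
      hsm.c_tb (hS.f_mem.tb_moll b hT) ((hS.g_mem.tb_moll b hT).sb h0T) hsm.centered
      (half_pos hh0) hβ' (hUn n) (heq n) hη.1
    have h3 := hN (S.average (bumpMeasure b)) hs hsm (hsym.average _) (hanti.average _)
      (hS.f_mem.tb_moll b hT) ((hS.g_mem.tb_moll b hT).sb h0T) η hη.2 _ B hsys hB0
      (fun j hj t ht x => by
        have := sq_moll_le_dataBound (τ₀ := τ₀) (S.average (bumpMeasure b)) b hj hη0.ne' hS.f_mem
          ht (B := Y) (hY ▸ le_add_of_nonneg_right hg0) x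
        rw [show (S.average (bumpMeasure b)).weightedSize = weightedSize from hw,
          ← hκ, ← hB] at this
        exact this)
      (fun j hj x => by
        have := sq_moll_le_dataBound (τ₀ := τ₀) (S.average (bumpMeasure b)) b hj hη0.ne' hS.g_mem
          h0T (B := Y) (hY ▸ le_add_of_nonneg_left hf0) x
        rw [show (S.average (bumpMeasure b)).weightedSize = weightedSize from hw,
          ← hκ, ← hB] at this
        exact this) k (by omega) hk r (by omega) t ht x
    refine (sum_pword_sq_le_sq (S := S.average (bumpMeasure b)) (h := η) hτ₀
      ((((hUn n).sb ht).iterate_dd eh k).slice η) r x).trans ?_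
    rw [mul_pow]
    exact mul_le_mul_of_nonneg_left h3 (by positivity)
  have hword : ∀ (φ : ℝ × E d → ℝ) (C : ℝ), BD m C φ → ∀ v ∈ words (Finset.univ : Finset (Fin d)) r,
      pword v (fun y => ((dd eh)^[k] φ) (η, y)) x =
        ddList (List.replicate k eh ++ (v.map bvec).map fun e => ((0 : ℝ), e)) φ (η, x) := by
    intro φ C hφ v hv
    have hv' : v.length = r := (mem_words.mp hv).1
    have h4 : BD (m - k) C ((dd eh)^[k] φ) :=
      BD.iterate_dd_eh (by rwa [Nat.sub_add_cancel (by omega)])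
    rw [pword, ddList_slice h4 _ (by rw [List.length_map, hv']; omega), ddList_append,
      ddList_replicate]
  -- The bound survives the limit because the `k + r ≤ m` derivatives involved converge, the
  -- approximations being bounded in order `m + 1`.
  have hlim : ∑ v ∈ words (Finset.univ : Finset (Fin d)) r,
      pword v (fun y => ((dd eh)^[k] (U t)) (η, y)) x ^ 2 ≤ (τ₀⁻¹ ^ r * (N * (B * η))) ^ 2 := by
    refine le_of_tendsto (f := fun n =>
      ∑ v ∈ words (Finset.univ : Finset (Fin d)) r,
        pword v (fun y => ((dd eh)^[k] (Un n t)) (η, y)) x ^ 2) (x := atTop)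
      (tendsto_finsetSum _ fun v hv => Tendsto.pow ?_ 2) (Eventually.of_forall hest)
    rw [hword (U t) C (hbdU t ht) v hv]
    have h5 := tendsto_ddList (List.replicate k eh ++ (v.map bvec).map fun e => ((0 : ℝ), e))
      (fun n => hbd n t ht) (hunif t ht) (by
        simp only [List.length_append, List.length_replicate, List.length_map,
          (mem_words.mp hv).1]
        omega) (η, x)
    exact h5.congr fun n => (hword (Un n t) C (hbd n t ht).pred v hv).symm
  have hpow : τ₀⁻¹ ^ r ≤ max 1 τ₀⁻¹ ^ m :=
    (pow_le_pow_left₀ hτ' (le_max_right _ _) r).trans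
      (pow_le_pow_right₀ (le_max_left _ _) (by omega))
  have h6 : 0 ≤ N * (B * η) := mul_nonneg (by linarith) (mul_nonneg hB0 hη0.le)
  have h7 : τ₀⁻¹ ^ r * (N * (B * η)) ≤ max 1 τ₀⁻¹ ^ m * N * dataBound κ (m + 1) * Y * η :=
    (mul_le_mul_of_nonneg_right hpow h6).trans_eq (by rw [hB]; ring)
  have h8 : 0 ≤ τ₀⁻¹ ^ r * (N * (B * η)) := mul_nonneg (pow_nonneg hτ' r) h6
  rw [absD, ← hY]
  exact Real.sqrt_le_iff.mpr ⟨h8.trans h7, (sum_mderiv_sq_le r _ x).trans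
    (hlim.trans (pow_le_pow_left₀ h8 h7 2))⟩

/-- Derivatives in the mesh-size of a function which is locally a slice of a regular function. -/
theorem Dh_eq {S : Scheme d} {u : ℝ → ℝ → E d → ℝ} {h t a b C : ℝ} {k : ℕ} {φ : ℝ × E d → ℝ}
    (hφ : BD k C φ) (hh : h ∈ Ioc 0 S.h₀) (hab : h ∈ Ioo a b)
    (hu : ∀ η ∈ Ioo a b ∩ Ioc 0 S.h₀, ∀ x, u η t x = φ (η, x)) (x : E d) :
    ContDiffWithinAt ℝ k (fun η => u η t x) (Ioc 0 S.h₀) h ∧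
      S.Dh k u h t x = ((dd eh)^[k] φ) (h, x) := by
  have hev : (fun η => u η t x) =ᶠ[𝓝[Ioc 0 S.h₀] h] fun η => φ (η, x) := by
    filter_upwards [self_mem_nhdsWithin, mem_nhdsWithin_of_mem_nhds (Ioo_mem_nhds hab.1 hab.2)]
      with η h1 h2
    exact hu η ⟨h2, h1⟩ x
  have hsm := (hφ.contDiff_slice_fst x).contDiffAt (x := h)
  refine ⟨hsm.contDiffWithinAt.congr_of_eventuallyEq hev (hu h ⟨hab, hh⟩ x), ?_⟩
  rw [Dh, hev.iteratedDerivWithin_eq (hu h ⟨hab, hh⟩ x),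
    iteratedDerivWithin_eq_iteratedDeriv (uniqueDiffOn_Ioc _ _) hsm hh, iteratedDeriv_slice hφ]

end Scheme

end FDScheme
end

theorem theorem08p2p19p1
    (m : ℕ) (δ c₀ τ₀ K size weightedSize : ℝ) (M : ℕ → ℝ)
    (hδ : δ ∈ Set.Ioc (0 : ℝ) 1) (hc₀ : 0 < c₀) (hτ₀ : 0 < τ₀) (hK : 1 ≤ K) :
    ∃ N : ℝ, ∀ (d : ℕ) (S : FDScheme.Scheme d),
      S.size = size → S.weightedSize = weightedSize →
      S.Regular m M → S.ChiNonneg → S.Centered → S.Killing c₀ →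
      S.FirstOrderCondition m δ τ₀ K → S.SecondOrderCondition m δ τ₀ K →
      S.Symmetric → S.Antisymmetric →
      ∀ k : ℕ, Odd k → 3 * k + 1 ≤ m →
      -- existence and uniqueness of the bounded solution `u_h`
      (∀ h ∈ Set.Ioc 0 S.h₀, ∃ v, S.IsBoundedSolution h v ∧
        ∀ w, S.IsBoundedSolution h w → ∀ t ∈ Set.Icc 0 S.T, ∀ x, w t x = v t x) ∧
      ∀ u : ℝ → ℝ → FDScheme.E d → ℝ,
        (∀ h ∈ Set.Ioc 0 S.h₀, S.IsBoundedSolution h (u h)) →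
        -- `u_h` is `k` times continuously differentiable in `h`
        (∀ t ∈ Set.Icc 0 S.T, ∀ x, ContDiffOn ℝ k (fun h => u h t x) (Set.Ioc 0 S.h₀)) ∧
        ∀ r : ℕ, 3 * k + r + 1 ≤ m →
          ∀ h ∈ Set.Ioc 0 S.h₀, ∀ t ∈ Set.Icc 0 S.T,
            -- `D_h^k u_h` is `r` times continuously differentiable in `x`
            ContDiff ℝ r (fun x => S.Dh k u h t x) ∧
            ∀ x, FDScheme.absD r (fun y => S.Dh k u h t y) x ≤
              N * (FDScheme.normB m S.T S.f + FDScheme.normB m S.T (fun _ => S.g)) * h := by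
  -- An odd `k` is at least 1, so `3k + 1 ≤ m` fails and any constant will do.
  by_cases hm : m < 4
  · refine ⟨0, fun d S _ _ _ _ _ _ _ _ _ _ k hk hkm => ?_⟩
    have := hk.pos
    omega
  obtain ⟨m, rfl⟩ : ∃ n, m = n + 1 := ⟨m - 1, by omega⟩
  obtain ⟨N, hN0, hN⟩ := FDScheme.Scheme.exists_joint_estimate m size weightedSize M hδ hc₀ hτ₀ hK
    (by omega)
  refine ⟨N, fun d S hs hw hS hχ hcen hkill h1 h2 hsym hanti k hk hkm => ?_⟩
  have key := hN S hs hw hS hχ hcen hkill h1 h2 hsym hanti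
  refine ⟨fun h hh => ?_, fun u hu => ?_⟩
  · obtain ⟨a, b, C, U, ha, hab, hbd, hsol, -⟩ := key h hh
    exact ⟨_, hsol h hab, fun w hw t ht x => hS.eq_of_isBoundedSolution hw (hsol h hab) ht x⟩
  -- The joint function `U` depends on the chosen `h`, but derivatives in `h` are local. Uniqueness
  -- shows that `u` coincides with its slices near `h`.
  have hloc : ∀ h ∈ Ioc 0 S.h₀, ∃ (a b C : ℝ) (U : ℝ → ℝ × FDScheme.E d → ℝ), h ∈ Ioo a b ∧
      (∀ t ∈ Icc 0 S.T, FDScheme.BD m C (U t)) ∧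
      (∀ t ∈ Icc 0 S.T, ∀ η ∈ Ioo a b ∩ Ioc 0 S.h₀, ∀ x, u η t x = U t (η, x)) ∧
      ∀ r : ℕ, 3 * k + r ≤ m → ∀ t ∈ Icc 0 S.T, ∀ x,
        FDScheme.absD r (fun y => ((FDScheme.dd FDScheme.eh)^[k] (U t)) (h, y)) x ≤
          N * (FDScheme.normB (m + 1) S.T S.f + FDScheme.normB (m + 1) S.T (fun _ => S.g)) * h := by
    intro h hh
    obtain ⟨a, b, C, U, ha, hab, hbd, hsol, hest⟩ := key h hh
    exact ⟨a, b, C, U, hab, hbd, fun t ht η hη x =>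
      hS.eq_of_isBoundedSolution (hu η hη.2) (hsol η hη.1) ht x,
      fun r hr t ht x => hest k r hk hr h ⟨hab, hh⟩ t ht x⟩
  refine ⟨fun t ht x h hh => ?_, fun r hr h hh t ht => ?_⟩
  · obtain ⟨a, b, C, U, hab, hbd, hUu, -⟩ := hloc h hh
    exact (FDScheme.Scheme.Dh_eq ((hbd t ht).of_le (by omega)) hh hab (hUu t ht) x).1
  · obtain ⟨a, b, C, U, hab, hbd, hUu, hest⟩ := hloc h hh
    have e : (fun x => S.Dh k u h t x) =
        fun x => ((FDScheme.dd FDScheme.eh)^[k] (U t)) (h, x) := funext fun x =>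
      (FDScheme.Scheme.Dh_eq ((hbd t ht).of_le (by omega)) hh hab (hUu t ht) x).2
    rw [e]
    refine ⟨?_, fun x => hest r (by omega) t ht x⟩
    -- After `k` derivatives in `h` at least `r` derivatives are left, since `k + r ≤ 3k + r ≤ m`.
    exact (FDScheme.BD.iterate_dd_eh ((hbd t ht).of_le (by omega))).contDiff_slice_snd h
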